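/- **Setting.** Let $n\ge 2$, $p\ge 2$. Let $X=(X_1,\dots,X_p)$ be a (possibly random) $n\times p$ design with $\|X_k\|^2=n$ for all $k$, and let $Y\mid X\sim N(X\gamma,\sigma^2 I_n)$ with $\sigma>0$. Let $\gamma^{\rm tar}$ be a target coefficient vector; $\gamma$ and $\gamma^{\rm tar}$ may be random. Put $\sigma^{\rm ora}=\|Y-X\gamma^{\rm tar}\|/\sqrt n$. With penalty level $\lambda_0>0$ let $$\{\hat\gamma,\hat\sigma\}=\arg\min_{b,\sigma}\Big\{\tfrac{\|Y-Xb\|^2}{2n\sigma}+\tfrac{\sigma}{2}+\lambda_0\|b\|_1\Big\},\qquad \hat S=\mathrm{supp}(\hat\gamma),$$ $$\{\hat\gamma^{\rm lse},\hat\sigma^{\rm lse}\}=\arg\min_{b,\sigma}\Big\{\tfrac{\|Y-Xb\|^2}{2n\sigma}+\tfrac{\sigma}{2}:\ \mathrm{supp}(b)\subseteq\hat S\Big\}.$$ Let $\phi(\alpha,K)=\inf\{|K|^{1/2}\|Xu\|/(n^{1/2}\|u_K\|_1): u\ne0,\ \|u_{K^c}\|_1\le\alpha\|u_K\|_1\}$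 and $\kappa^*(m)=\max\{\|Xu\|^2/n:\|u\|=1,\|u\|_0\le m\}$. Let $L_m(t)=m^{-1/2}\Phi^{-1}(1-t)$, and write $a_n=e^{1/(4n-6)^2}$. **(i)** For every $X$, $Y$ and $\lambda_0>0$ (and any $n\ge1$; here $X$ need not be standardized), if $\hat\sigma>0$, then $$\hat\sigma^2-(\hat\sigma^{\rm lse})^2=\frac{\|X(\hat\gamma^{\rm lse}-\hat\gamma)\|^2}{n}\le\frac{(\hat\sigma\lambda_0)^2|\hat S|}{\phi^2(0,\hat S)},\qquad \|\hat\gamma^{\rm lse}-\hat\gamma\|_1\le\frac{\hat\sigma\lambda_0|\hat S|}{\phi^2(0,\hat S)}.$$ **(ii)** Let $K\subseteq\{1,\dots,p\}$, $\delta\ge1$, $0<\tilde\epsilon_1<1$, $k>0$ with $k/p<1/2$, $\varepsilon>0$, and $$(1+\varepsilon)L_{n-3/2}(k/p)\le\lambda_0\le B\sqrt{\delta(\log p)/n},\qquad L_{n-3/2}(\tilde\epsilon_1/p)\le1,\qquad \delta s(\log p)/n\le c_0 .$$ Consider the events * $\mathrm{Cond}_1$: $|K|+\sum_{j\notin K}|\gamma^{\rm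 tar}_j/\sigma^{\rm ora}|/\sqrt{(2/n)\log p}\le s_1$; * $\mathrm{Cond}_2$: $\phi^{-2}(\alpha,J)\le C_2$ for all $J$ with $|J\setminus K|\le s_2$; * $\mathrm{Cond}_3$: $\kappa^*(s_3)\le C_3$; * $\mathrm{Cond}_4$: $C_4\|X(\gamma^{\rm tar}-\gamma)\|\le\sigma^{\rm ora}\sqrt{\log(p/\tilde\epsilon_1)}$, each of which, where it is assumed, has probability at least $1-\tilde\epsilon_1$. Let $\varepsilon_*$ denote the quantity $$\frac{4a_nk/s_2}{L_1^4(k/p)+2L_1^2(k/p)}+\Big(\frac{L_1(\tilde\epsilon_1/p)}{L_1(k/p)}+\frac{a_n/\sqrt{2\pi}}{L_1(k/p)}\Big)\sqrt{\frac{C_3}{s_2}} .$$ Consider three cases. * *Case 1:* $\gamma^{\rm tar}=\gamma$, $s\ge s_1$, $s_2=0$, $k\le\tilde\epsilon_1$, $\alpha=1+2/\varepsilon$, $4\tilde\epsilon_1\le p^{1-\delta}\tilde\epsilon_0$; $\mathrm{Cond}_1,\mathrm{Cond}_2$ are assumed. * *Case 2:* $\gamma^{\rm tar}=\gamma$, $s\ge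 s_1+s_2$, $1\le s_2\le s_3$, $k\ge1$, $\varepsilon_*\le\varepsilon_1<\varepsilon$, $\alpha\ge\sqrt2(\varepsilon-\varepsilon_1)^{-1}\{1+\varepsilon+L_1(\tilde\epsilon_1/p)/L_1(k/p)\}$, $(5+a_n)\tilde\epsilon_1\le p^{1-\delta}\tilde\epsilon_0$; $\mathrm{Cond}_1$–$\mathrm{Cond}_3$ are assumed. * *Case 3:* $s\ge s_1+s_2$, $1\le s_2\le s_3$, $k\ge1$, $\varepsilon_*\le\varepsilon_1<\varepsilon_2<\varepsilon$, $\alpha\ge2(\varepsilon-\varepsilon_2)^{-1}\{1+\varepsilon+L_1(\tilde\epsilon_1/p)/L_1(k/p)\}$, $(6+a_n)\tilde\epsilon_1\le p^{1-\delta}\tilde\epsilon_0$, $C_4\ge\sqrt{(4/L_1^2(k/p))\log(p/\tilde\epsilon_1)}/\min(\sqrt2-1,\varepsilon_2-\varepsilon_1)$; $\mathrm{Cond}_1$–$\mathrm{Cond}_4$ are assumed. For an estimator $\{\gamma^{\rm est},\sigma^{\rm est}\}$ and a constant $C$, let $(\mathrm E_C)$ say that each of $$\|X(\gamma^{\rm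 est}-\gamma^{\rm tar})\|^2\le Cs(\sigma^{\rm ora})^2\delta\log p,\qquad \|\gamma^{\rm est}-\gamma^{\rm tar}\|_1\le Cs\sigma^{\rm ora}\sqrt{\delta(\log p)/n},$$ $$\Big|\frac{\sigma^{\rm est}}{\sigma^{\rm ora}}-1\Big|\le \frac{Cs\delta\log p}{n}\le\frac12$$ holds with probability at least $1-p^{1-\delta}\tilde\epsilon_0$. In each case there is a constant $C_0>0$, depending only on $\{\alpha,C_2,B\}$ in Case 1, on $\{\alpha,\varepsilon,\varepsilon_1,C_2,B\}$ in Case 2 and on $\{\alpha,\varepsilon,\varepsilon_2,C_2,B\}$ in Case 3, such that, whenever $C_0c_0\le1/2$, the scaled lasso satisfies $(\mathrm E_{C_0})$ and the following holds. Let $\varepsilon_1<\varepsilon_2<\varepsilon_3<\varepsilon$ (in Case 1: $0\le\varepsilon_2<\varepsilon_3<\varepsilon$ and $s_3\ge1$), assume $\mathrm{Cond}_3$ in Case 1 too, and let $$\frac{C_0s\delta\log p}{n}\le\frac{\varepsilon-\varepsilon_3}{1+\varepsilon},\qquad \frac{C_0s\delta\log p}{(\varepsilon_3-\varepsilon_2)^2L_1^2(k/p)}\le\frac{s_3}{C_3}.$$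 Then $$P\{|\hat S|<s_3+s\}\ge1-p^{1-\delta}\tilde\epsilon_0 .$$ If in addition the condition on $\mathrm{Cond}_2$ is strengthened to $$P\Big\{\Big(\max_{|J\setminus K|\le s_2}\phi^{-2}(\alpha,J)\Big)\vee\Big(\max_{|J|\le s_3+s}\phi^{-2}(0,J)\Big)>C_2\Big\}\le\tilde\epsilon_1,$$ then there is a constant $C_0'>0$, depending only on the quantities on which $C_0$ depends and on $\{C_3,\varepsilon_2,\varepsilon_3\}$, such that, whenever $C_0'c_0\le1/2$, the estimator $\{\hat\gamma^{\rm lse},\hat\sigma^{\rm lse}\}$ satisfies $(\mathrm E_{C_0'})$. -/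

import Mathlib

open MeasureTheory ProbabilityTheory

universe u

noncomputable section

namespace ScaledLasso

/-! ### Vectors and index sets -/

/-- The Euclidean norm of a vector. -/
def l2 {ι : Type*} [Fintype ι] (v : ι → ℝ) : ℝ := ‖(WithLp.toLp 2 v : EuclideanSpace ℝ ι)‖

/-- `‖u_K‖₁`, the `ℓ₁` norm of the restriction of `u` to the index set `K`. -/
def l1On {p : ℕ} (K : Finset (Fin p)) (u : Fin p → ℝ) : ℝ := ∑ k ∈ K, |u k|

/-- `‖u‖₁`. -/
def l1 {p : ℕ} (u : Fin p → ℝ) : ℝ := l1On Finset.univ u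

/-- The support of a coefficient vector. -/
def supp {p : ℕ} (u : Fin p → ℝ) : Finset (Fin p) := Finset.univ.filter (fun k => u k ≠ 0)

/-! ### Normal quantiles -/

/-- The standard normal quantile function `Φ⁻¹`, for levels in `(0,1)`. -/
def normalQuantile (q : ℝ) : ℝ := sInf {x : ℝ | q ≤ cdf (gaussianReal 0 1) x}

/-- `L_m(t) = m^{-1/2} Φ⁻¹(1 - t)`; `m` is real, since `m = n - 3/2` is used. -/
def L (m t : ℝ) : ℝ := normalQuantile (1 - t) / √m

/-! ### The two estimators

The loss `‖Y - X b‖² / (2 n σ) + σ / 2` is taken on `σ ≥ 0` with values in `[0, ∞]`. At `σ = 0` the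
division of `ℝ≥0∞` gives `0` if `Y = X b` and `∞` otherwise, which is the lower semicontinuous
extension of the loss from `σ > 0`; so a minimiser always exists, and a minimum that is attained
at some `σ > 0` is the same as the one over `σ > 0`. -/

/-- `‖Y - X b‖² / (2 n σ) + σ / 2`. -/
def scaledLoss {n p : ℕ} (X : Matrix (Fin n) (Fin p) ℝ) (Y : Fin n → ℝ)
    (b : Fin p → ℝ) (σ : ℝ) : ENNReal :=
  ENNReal.ofReal (l2 (Y - X.mulVec b) ^ 2) / ENNReal.ofReal (2 * n * σ) + ENNReal.ofReal (σ / 2)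

/-- `(γhat, σhat)` is a scaled lasso solution with penalty level `lam`. -/
def IsScaledLasso {n p : ℕ} (X : Matrix (Fin n) (Fin p) ℝ) (Y : Fin n → ℝ) (lam : ℝ)
    (γhat : Fin p → ℝ) (σhat : ℝ) : Prop :=
  0 ≤ σhat ∧ ∀ (b : Fin p → ℝ) (σ : ℝ), 0 ≤ σ →
    scaledLoss X Y γhat σhat + ENNReal.ofReal (lam * l1 γhat) ≤
      scaledLoss X Y b σ + ENNReal.ofReal (lam * l1 b)

/-- `(γlse, σlse)` is a least squares fit (with its noise level) in the model `S`. -/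
def IsLSE {n p : ℕ} (X : Matrix (Fin n) (Fin p) ℝ) (Y : Fin n → ℝ) (S : Finset (Fin p))
    (γlse : Fin p → ℝ) (σlse : ℝ) : Prop :=
  supp γlse ⊆ S ∧ 0 ≤ σlse ∧ ∀ (b : Fin p → ℝ) (σ : ℝ), supp b ⊆ S → 0 ≤ σ →
    scaledLoss X Y γlse σlse ≤ scaledLoss X Y b σ

/-! ### Compatibility constant and upper sparse eigenvalue -/

/-- The cone `C(α, K)`. -/
def cone {p : ℕ} (α : ℝ) (K : Finset (Fin p)) : Set (Fin p → ℝ) :=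
  {u | l1On Kᶜ u ≤ α * l1On K u}

/-- The compatibility constant, in `[0, ∞]`; it is `∞` for `K = ∅` (an empty infimum). A nonzero
vector `u` of the cone has `‖u_K‖₁ > 0`, so that no quotient below has a vanishing denominator
when `n > 0`. -/
def phiComp {n p : ℕ} (α : ℝ) (K : Finset (Fin p)) (X : Matrix (Fin n) (Fin p) ℝ) : ENNReal :=
  ⨅ u : {u : Fin p → ℝ // u ∈ cone α K ∧ u ≠ 0},
    ENNReal.ofReal (√(K.card : ℝ) * l2 (X.mulVec u.1) / (√(n : ℝ) * l1On K u.1))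

/-- The upper sparse eigenvalue `κ*(m, X)`. -/
def kappaStar {n p : ℕ} (m : ℕ) (X : Matrix (Fin n) (Fin p) ℝ) : ENNReal :=
  ⨆ u : {u : Fin p → ℝ // l2 u = 1 ∧ (supp u).card ≤ m},
    ENNReal.ofReal (l2 (X.mulVec u.1) ^ 2 / n)

/-! ### Model -/

/-- The Borel structure on matrices, entry by entry. -/
instance {n p : ℕ} : MeasurableSpace (Matrix (Fin n) (Fin p) ℝ) :=
  inferInstanceAs (MeasurableSpace (Fin n → Fin p → ℝ))

/-- `P{E} ≥ 1 - η`, written as `P{not E} ≤ η`. -/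
def HoldsWP {Ω : Type*} [MeasurableSpace Ω] (μ : Measure Ω) (E : Ω → Prop) (η : ℝ) : Prop :=
  μ {ω | ¬ E ω} ≤ ENNReal.ofReal η

/-- The random objects: design, response, regression coefficients, target coefficients, and the two
pairs of estimators; all of them may be random. -/
structure Data (Ω : Type*) (n p : ℕ) where
  X : Ω → Matrix (Fin n) (Fin p) ℝ
  Y : Ω → Fin n → ℝ
  γ : Ω → Fin p → ℝ
  γtar : Ω → Fin p → ℝ
  γhat : Ω → Fin p → ℝ
  σhat : Ω → ℝ
  γlse : Ω → Fin p → ℝ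
  σlse : Ω → ℝ

/-- `σ^ora = ‖Y - X γ^target‖ / √n`. -/
def Data.σora {Ω : Type*} {n p : ℕ} (d : Data Ω n p) (ω : Ω) : ℝ :=
  l2 (d.Y ω - (d.X ω).mulVec (d.γtar ω)) / √(n : ℝ)

/-- The Gaussian linear model with standardised design: `‖X_k‖² = n` and `Y ∣ X ∼ N(X γ, σ² I)`.
As `γ` may be random, the conditional law is given `X` together with `γ`; this is the conditional
law given `X` when `γ` is a function of `X`. The estimators are the scaled lasso with penalty level
`lam` and the least squares fit in the model that it selects. -/
structure IsModel {Ω : Type*} [MeasurableSpace Ω] (μ : Measure Ω) [IsProbabilityMeasure μ]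
    {n p : ℕ} (d : Data Ω n p) (σ lam : ℝ) : Prop where
  measurable_X : Measurable d.X
  measurable_Y : Measurable d.Y
  measurable_γ : Measurable d.γ
  measurable_γtar : Measurable d.γtar
  σ_pos : 0 < σ
  standardized : ∀ᵐ ω ∂μ, ∀ k, l2 (fun i => d.X ω i k) ^ 2 = n
  law : ∀ᵐ a ∂(μ.map (fun ω => (d.X ω, d.γ ω))),
    condDistrib d.Y (fun ω => (d.X ω, d.γ ω)) μ a =
      Measure.pi (fun i => gaussianReal (a.1.mulVec a.2 i) (Real.toNNReal (σ ^ 2)))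
  lasso : ∀ᵐ ω ∂μ, IsScaledLasso (d.X ω) (d.Y ω) lam (d.γhat ω) (d.σhat ω)
  lse : ∀ᵐ ω ∂μ, IsLSE (d.X ω) (d.Y ω) (supp (d.γhat ω)) (d.γlse ω) (d.σlse ω)

/-- The quantities that may change freely with the sample size and the dimension. Here `e₀`, `e₁`
are the levels `ε̃₀`, `ε̃₁`, `lam` is the penalty level, and `s₂`, `s₃` are numbers of variables. -/
structure Params where
  n : ℕ
  p : ℕ
  K : Finset (Fin p)
  s : ℝ
  s₁ : ℝ
  s₂ : ℕ
  s₃ : ℕ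
  δ : ℝ
  c₀ : ℝ
  e₀ : ℝ
  e₁ : ℝ
  k : ℝ
  lam : ℝ

/-! ### The conditions on target and design -/

/-- Capped size of the target vector. -/
def Cond₁ {Ω : Type*} (P : Params) (d : Data Ω P.n P.p) (ω : Ω) : Prop :=
  (P.K.card : ℝ) + ∑ j ∈ P.Kᶜ, |d.γtar ω j / d.σora ω| / √(2 / P.n * Real.log P.p) ≤ P.s₁

/-- Compatibility on all sets with at most `s₂` elements outside `K`. -/
def Cond₂ {Ω : Type*} (P : Params) (α C₂ : ℝ) (d : Data Ω P.n P.p) (ω : Ω) : Prop :=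
  ∀ J : Finset (Fin P.p), (J \ P.K).card ≤ P.s₂ →
    (phiComp α J (d.X ω) ^ 2)⁻¹ ≤ ENNReal.ofReal C₂

/-- The additional part of the strengthened compatibility condition: all sets of size at most
`s₃ + s`, with the cone `C(0, J)`. -/
def Cond₂Add {Ω : Type*} (P : Params) (C₂ : ℝ) (d : Data Ω P.n P.p) (ω : Ω) : Prop :=
  ∀ J : Finset (Fin P.p), (J.card : ℝ) ≤ P.s₃ + P.s →
    (phiComp 0 J (d.X ω) ^ 2)⁻¹ ≤ ENNReal.ofReal C₂

/-- Upper sparse eigenvalue. -/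
def Cond₃ {Ω : Type*} (P : Params) (C₃ : ℝ) (d : Data Ω P.n P.p) (ω : Ω) : Prop :=
  kappaStar P.s₃ (d.X ω) ≤ ENNReal.ofReal C₃

/-- The bias of the target is small. -/
def Cond₄ {Ω : Type*} (P : Params) (C₄ : ℝ) (d : Data Ω P.n P.p) (ω : Ω) : Prop :=
  C₄ * l2 ((d.X ω).mulVec (d.γtar ω - d.γ ω)) ≤ d.σora ω * √(Real.log (P.p / P.e₁))

/-! ### The conditions on the parameters -/

/-- Conditions common to all cases. The penalty level is at least `(1 + ε) L_{n-3/2}(k/p)` and of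
order `√(δ log p / n)`. -/
structure Common (P : Params) (B ε : ℝ) : Prop where
  two_le_n : 2 ≤ P.n
  two_le_p : 2 ≤ P.p
  one_le_δ : 1 ≤ P.δ
  e₁_pos : 0 < P.e₁
  e₁_lt : P.e₁ < 1
  k_pos : 0 < P.k
  k_lt : P.k / P.p < 1 / 2
  lam_ge : (1 + ε) * L (P.n - 3 / 2) (P.k / P.p) ≤ P.lam
  lam_le : P.lam ≤ B * √(P.δ * Real.log P.p / P.n)
  lamStar : L (P.n - 3 / 2) (P.e₁ / P.p) ≤ 1
  rate : P.δ * P.s * Real.log P.p / P.n ≤ P.c₀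

/-- The number `exp(1 / (4 n - 6)²)`. -/
def expN (n : ℕ) : ℝ := Real.exp (1 / (4 * (n : ℝ) - 6) ^ 2)

/-- The lower bound for `ε₁`. -/
def eps₁Bound (P : Params) (C₃ : ℝ) : ℝ :=
  (expN P.n * 4 * P.k / P.s₂) / (L 1 (P.k / P.p) ^ 4 + 2 * L 1 (P.k / P.p) ^ 2) +
    (L 1 (P.e₁ / P.p) / L 1 (P.k / P.p) + (expN P.n / √(2 * Real.pi)) / L 1 (P.k / P.p)) *
      √(C₃ / P.s₂)

/-- First case: large penalty level, unbiased model. -/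
structure CaseI (P : Params) : Prop where
  s_ge : P.s₁ ≤ P.s
  s₂_eq : P.s₂ = 0
  k_le : P.k ≤ P.e₁
  level : 4 * P.e₁ ≤ (P.p : ℝ) ^ (1 - P.δ) * P.e₀

/-- Second case: smaller penalty level, unbiased model. -/
structure CaseII (P : Params) (α ε ε₁ C₃ : ℝ) : Prop where
  s_ge : P.s₁ + P.s₂ ≤ P.s
  one_le_s₂ : 1 ≤ P.s₂
  s₂_le : P.s₂ ≤ P.s₃
  one_le_k : 1 ≤ P.k
  ε₁_lt : ε₁ < ε
  ε₁_ge : eps₁Bound P C₃ ≤ ε₁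
  α_ge : √2 * (ε - ε₁)⁻¹ * (1 + ε + L 1 (P.e₁ / P.p) / L 1 (P.k / P.p)) ≤ α
  level : (5 + expN P.n) * P.e₁ ≤ (P.p : ℝ) ^ (1 - P.δ) * P.e₀

/-- Third case: smaller penalty level, biased model. -/
structure CaseIII (P : Params) (α ε ε₁ ε₂ C₃ C₄ : ℝ) : Prop where
  s_ge : P.s₁ + P.s₂ ≤ P.s
  one_le_s₂ : 1 ≤ P.s₂
  s₂_le : P.s₂ ≤ P.s₃
  one_le_k : 1 ≤ P.k
  ε₁_lt : ε₁ < ε₂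
  ε₂_lt : ε₂ < ε
  ε₁_ge : eps₁Bound P C₃ ≤ ε₁
  α_ge : 2 * (ε - ε₂)⁻¹ * (1 + ε + L 1 (P.e₁ / P.p) / L 1 (P.k / P.p)) ≤ α
  level : (6 + expN P.n) * P.e₁ ≤ (P.p : ℝ) ^ (1 - P.δ) * P.e₀
  C₄_ge : √(4 / L 1 (P.k / P.p) ^ 2 * Real.log (P.p / P.e₁)) / min (√2 - 1) (ε₂ - ε₁) ≤ C₄

/-- The size constraints, for the constant factor `C₀`. -/
structure SizeConstraints (P : Params) (C₀ ε ε₂ ε₃ C₃ : ℝ) : Prop where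
  noise : C₀ * P.s * P.δ * Real.log P.p / P.n ≤ (ε - ε₃) / (1 + ε)
  size : C₀ * P.s * P.δ * Real.log P.p / ((ε₃ - ε₂) ^ 2 * L 1 (P.k / P.p) ^ 2) ≤ P.s₃ / C₃

/-! ### The conclusions -/

/-- The prediction, `ℓ₁` and noise level bounds with constant factor `C₀` for an estimator
`(γest, σest)`, each with probability at least `1 - p^{1-δ} ε̃₀`. -/
structure ErrorBounds {Ω : Type*} [MeasurableSpace Ω] (μ : Measure Ω) (P : Params)
    (d : Data Ω P.n P.p) (γest : Ω → Fin P.p → ℝ) (σest : Ω → ℝ) (C₀ : ℝ) : Prop where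
  prediction : HoldsWP μ
    (fun ω => l2 ((d.X ω).mulVec (γest ω - d.γtar ω)) ^ 2 ≤
      C₀ * P.s * d.σora ω ^ 2 * P.δ * Real.log P.p)
    ((P.p : ℝ) ^ (1 - P.δ) * P.e₀)
  estimation : HoldsWP μ
    (fun ω => l1 (γest ω - d.γtar ω) ≤
      C₀ * P.s * d.σora ω * √(P.δ * Real.log P.p / P.n))
    ((P.p : ℝ) ^ (1 - P.δ) * P.e₀)
  noise : HoldsWP μ
    (fun ω => |σest ω / d.σora ω - 1| ≤ C₀ * P.s * P.δ * Real.log P.p / P.n ∧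
      C₀ * P.s * P.δ * Real.log P.p / P.n ≤ 1 / 2)
    ((P.p : ℝ) ^ (1 - P.δ) * P.e₀)

/-- `|Ŝ| < s₃ + s` with probability at least `1 - p^{1-δ} ε̃₀`. -/
def DimBound {Ω : Type*} [MeasurableSpace Ω] (μ : Measure Ω) (P : Params)
    (d : Data Ω P.n P.p) : Prop :=
  HoldsWP μ (fun ω => ((supp (d.γhat ω)).card : ℝ) < P.s₃ + P.s)
    ((P.p : ℝ) ^ (1 - P.δ) * P.e₀)

end ScaledLasso

end

/-! Minimising the loss over `σ` turns the scaled lasso into the square-root lasso, with `σhat` the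
norm of the residual. Divide the columns by `√n` and everything else by `σora`: the residual `r` at
the target becomes a unit vector, and the error `h` satisfies the scale-free basic inequality `λ (‖γ
+ h‖₁ - ‖γ‖₁) ≤ ⟪X h, r⟫` (`SqrtLasso.basic`). Part (i) follows from the first order conditions of
this problem and from the orthogonality of the least squares residual to the selected columns
(`lse_compare`).

For part (ii), without bias `r` is the direction of a Gaussian vector, so every noise event may be
taken invariant under scaling and `σ` drops out. Two estimates carry the probability. For one
column, the tail of `√(n - 3/2) ⟪a, g⟫ / ‖g‖` lies below the normal tail
(`stdGaussian_inner_gt_le`): the difference of the two tails first increases and then decreases, and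
the constant `3/2` comes from a sharp inequality for the Gamma function. For all columns together,
the sum of the excesses of `|⟪a_j, g⟫|` over `(1 + θ) t` is of order `s₂ t` outside a small event
(`measureReal_sumExcess_gt_le`). Indeed Markov's inequality gives a set of large measure where the
sum is small at a lower level. By Gaussian concentration with a sharp polynomial factor, most points
are within about `t₁` of that set. A displacement of that length changes the sum by little because
of the sparse eigenvalue. The passage from `g` to its direction costs a factor two
(`stdGaussian_cone_le`).

In Cases 2 and 3, let `J` consist of `K` and of the `s₂` largest coordinates of `h` outside `K`.
Outside `J` the coordinates of `h` are at most their average over the added ones, so the total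
excess is paid for by the `ℓ₁` norm of `h` on `J`. Hence `h` lies in the cone of `J`, up to a term
in the small target coefficients, and compatibility bounds `‖h‖₁`. In Case 3 the bias moves `r` by a
small fraction of the penalty level, which is absorbed between `ε₁` and `ε₂`.

In Case 1 the constant `α = 1 + 2 / ε` leaves no room, and the small coefficients may push `h` out
of the cone. If the normal quantile is below a threshold depending on `ε`, then `p` is bounded and
`h` can be shrunk into the cone at a bounded cost (`SqrtLasso.l1_le_of_card_le`). Otherwise some
room is recovered from the noise. If `K` is small, a union bound over `K` alone keeps the noise on
`K` below `0.99` of the level (`SqrtLasso.l1_le_of_noise_on_le`). If `K` is large, a union bound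
over integer combinations of columns shows that `r` is a vector with all correlations at most
`11/20` of the level, plus a vector of length of order `√|K|` times the level, whose effect has the
order of the main term (`inner_le_of_int_comb`, `SqrtLasso.l1_le_of_greedy`).

An `ℓ₁` bound gives the prediction and noise level bounds. For the selected model, every selected
column has correlation exactly `λ` times the residual norm with the residual. Few columns reach
nearly that much from the noise, and the others must receive it from `X h`, which the sparse
eigenvalue allows for few columns only. For the least squares fit the useful quantity is `|Ŝ| λ`,
which is bounded by the complexity times the rate. -/

noncomputable section
namespace ScaledLasso

/-! ### The tail of the standard normal distribution -/

/-- The standard normal density. -/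
def gpdf (x : ℝ) : ℝ := gaussianPDFReal 0 1 x

/-- The upper tail of the standard normal distribution. -/
def gtail (x : ℝ) : ℝ := ∫ y in Set.Ioi x, gpdf y

lemma gpdf_eq (x : ℝ) : gpdf x = (√(2 * Real.pi))⁻¹ * Real.exp (-(x ^ 2) / 2) := by
  simp [gpdf, gaussianPDFReal]

lemma gpdf_pos (x : ℝ) : 0 < gpdf x := gaussianPDFReal_pos 0 1 x one_ne_zero

lemma integrable_gpdf : Integrable gpdf := integrable_gaussianPDFReal 0 1

lemma continuous_gpdf : Continuous gpdf := by
  have : gpdf = fun x => (√(2 * Real.pi))⁻¹ * Real.exp (-(x ^ 2) / 2) := funext gpdf_eq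
  rw [this]; fun_prop

lemma hasDerivAt_gpdf (x : ℝ) : HasDerivAt gpdf (-x * gpdf x) x := by
  have h0 : gpdf = fun x => (√(2 * Real.pi))⁻¹ * Real.exp (-(x ^ 2) / 2) := funext gpdf_eq
  rw [h0]
  have h1 : HasDerivAt (fun x : ℝ => -(x ^ 2) / 2) (-x) x := by
    exact (((hasDerivAt_pow 2 x).neg).div_const 2).congr_deriv (by simp; ring)
  have h2 := (h1.exp).const_mul (√(2 * Real.pi))⁻¹
  exact h2.congr_deriv (by ring)

lemma gpdf_add (x y : ℝ) : gpdf (x + y) = Real.exp (-(x * y) - y ^ 2 / 2) * gpdf x := by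
  rw [gpdf_eq, gpdf_eq, mul_left_comm, ← Real.exp_add]; congr 2; ring

lemma gpdf_neg (x : ℝ) : gpdf (-x) = gpdf x := by simp [gpdf_eq]

lemma integral_gpdf : ∫ x, gpdf x = 1 := integral_gaussianPDFReal_eq_one 0 one_ne_zero

lemma gtail_eq_measureReal (x : ℝ) : gtail x = (gaussianReal 0 1).real (Set.Ioi x) := by
  rw [Measure.real, gaussianReal_apply_eq_integral 0 one_ne_zero, ENNReal.toReal_ofReal]
  · rfl
  · exact setIntegral_nonneg measurableSet_Ioi fun y _ => (gpdf_pos y).le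

lemma gaussianReal_Ioi (x : ℝ) : gaussianReal 0 1 (Set.Ioi x) = ENNReal.ofReal (gtail x) :=
  gaussianReal_apply_eq_integral 0 one_ne_zero _

lemma gtail_add_cdf (x : ℝ) : gtail x + cdf (gaussianReal 0 1) x = 1 := by
  rw [gtail_eq_measureReal, cdf_eq_real, ← Set.compl_Ioi, probReal_compl_eq_one_sub measurableSet_Ioi]
  ring

lemma gtail_zero : gtail 0 = 1 / 2 := by
  have h1 : ∫ y in Set.Iic (0:ℝ), gpdf y = gtail 0 := by
    have := integral_comp_neg_Ioi (0:ℝ) gpdf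
    simp only [gpdf_neg, neg_zero] at this
    exact this.symm
  have h2 := intervalIntegral.integral_Iic_add_Ioi (μ := volume) (f := gpdf) (b := (0:ℝ))
    integrable_gpdf.integrableOn integrable_gpdf.integrableOn
  rw [integral_gpdf, h1] at h2
  unfold gtail at h2 ⊢; linarith

lemma gtail_sub (x y : ℝ) : gtail x - gtail y = ∫ z in x..y, gpdf z := by
  have h := intervalIntegral.integral_Ioi_sub_Ioi' (μ := volume) (f := gpdf) (a := x) (b := y)
    integrable_gpdf.integrableOn integrable_gpdf.integrableOn
  exact h

lemma hasDerivAt_gtail (x : ℝ) : HasDerivAt gtail (-gpdf x) x := by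
  have h : gtail = fun y => gtail 0 - ∫ z in (0:ℝ)..y, gpdf z := by
    ext y; rw [← gtail_sub]; ring
  rw [h]
  have := intervalIntegral.integral_hasDerivAt_right (a := 0) (b := x)
    (integrable_gpdf.intervalIntegrable)
    (continuous_gpdf.stronglyMeasurableAtFilter _ _) continuous_gpdf.continuousAt
  simpa using (this.const_sub (gtail 0))

lemma continuous_gtail : Continuous gtail :=
  continuous_iff_continuousAt.2 fun x => (hasDerivAt_gtail x).continuousAt

lemma strictAnti_gtail : StrictAnti gtail :=
  strictAnti_of_deriv_neg fun x => by rw [(hasDerivAt_gtail x).deriv]; linarith [gpdf_pos x]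

lemma tendsto_gtail_atTop : Filter.Tendsto gtail Filter.atTop (nhds 0) := by
  have h : gtail = fun x => 1 - cdf (gaussianReal 0 1) x := by
    ext x; linarith [gtail_add_cdf x]
  rw [h]; simpa using (tendsto_cdf_atTop (gaussianReal 0 1)).const_sub 1

lemma tendsto_gtail_atBot : Filter.Tendsto gtail Filter.atBot (nhds 1) := by
  have h : gtail = fun x => 1 - cdf (gaussianReal 0 1) x := by
    ext x; linarith [gtail_add_cdf x]
  rw [h]; simpa using (tendsto_cdf_atBot (gaussianReal 0 1)).const_sub 1

lemma gtail_nonneg (x : ℝ) : 0 ≤ gtail x := by rw [gtail_eq_measureReal]; positivity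

lemma gtail_pos (x : ℝ) : 0 < gtail x :=
  lt_of_le_of_lt (gtail_nonneg (x + 1)) (strictAnti_gtail (by linarith))

lemma gtail_neg_le_one (x : ℝ) : gtail x ≤ 1 := by
  rw [gtail_eq_measureReal]; exact measureReal_le_one

lemma gtail_eq_integral_add (x : ℝ) : gtail x = ∫ z in Set.Ioi (0:ℝ), gpdf (x + z) := by
  have h := (measurePreserving_add_left (volume : Measure ℝ) x).setIntegral_preimage_emb
    (measurableEmbedding_addLeft x) gpdf (Set.Ioi x)
  rw [gtail, ← h]; simp

/-- Shifting by `u` multiplies the density at `s + z` by `exp (-(s + z) u - u² / 2)`, and `z u ≥ 0`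
on the range of integration. The sign of `s` plays no role. -/
lemma gtail_add_le (s u : ℝ) (hu : 0 ≤ u) :
    gtail (s + u) ≤ Real.exp (-(s * u) - u ^ 2 / 2) * gtail s := by
  rw [gtail_eq_integral_add, gtail_eq_integral_add, ← integral_const_mul]
  refine setIntegral_mono_on ?_ ?_ measurableSet_Ioi fun z hz => ?_
  · exact (integrable_gpdf.comp_add_left (s + u)).integrableOn
  · exact ((integrable_gpdf.comp_add_left s).const_mul _).integrableOn
  · rw [show s + u + z = s + z + u by ring, gpdf_add]
    refine mul_le_mul_of_nonneg_right (Real.exp_le_exp.2 ?_) (gpdf_pos _).le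
    have : 0 ≤ z * u := mul_nonneg (le_of_lt hz) hu
    linarith

lemma gtail_le_exp (x : ℝ) (hx : 0 ≤ x) : gtail x ≤ Real.exp (-(x ^ 2) / 2) / 2 := by
  have := gtail_add_le 0 x hx
  rw [gtail_zero] at this
  simp only [zero_add, zero_mul, neg_zero, zero_sub] at this
  rw [neg_div]; linarith

/-- The expected overshoot `E (N - x)₊` of a standard normal variable. -/
def hinge (x : ℝ) : ℝ := gpdf x - x * gtail x

lemma hasDerivAt_hinge (x : ℝ) : HasDerivAt hinge (-gtail x) x := by
  have h := (hasDerivAt_gpdf x).sub ((hasDerivAt_id x).mul (hasDerivAt_gtail x))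
  exact h.congr_deriv (by simp)

lemma tendsto_pow_mul_gtail (k : ℕ) :
    Filter.Tendsto (fun x => x ^ k * gtail x) Filter.atTop (nhds 0) := by
  have h1 : Filter.Tendsto (fun x : ℝ => x ^ k * Real.exp (-x)) Filter.atTop (nhds 0) :=
    Real.tendsto_pow_mul_exp_neg_atTop_nhds_zero k
  refine squeeze_zero' ?_ ?_ h1
  · filter_upwards [Filter.eventually_ge_atTop 0] with x hx
    exact mul_nonneg (pow_nonneg hx k) (gtail_nonneg x)
  · filter_upwards [Filter.eventually_ge_atTop 2] with x hx
    refine mul_le_mul_of_nonneg_left ((gtail_le_exp x (by linarith)).trans ?_) (by positivity)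
    have : Real.exp (-(x ^ 2) / 2) ≤ Real.exp (-x) := Real.exp_le_exp.2 (by nlinarith)
    linarith [Real.exp_pos (-(x ^ 2) / 2)]

lemma tendsto_gpdf_atTop : Filter.Tendsto gpdf Filter.atTop (nhds 0) := by
  have h0 : gpdf = fun x => (√(2 * Real.pi))⁻¹ * Real.exp (-(x ^ 2) / 2) := funext gpdf_eq
  rw [h0]
  have h1 : Filter.Tendsto (fun x : ℝ => Real.exp (-(x ^ 2) / 2)) Filter.atTop (nhds 0) := by
    refine Real.tendsto_exp_atBot.comp ?_
    have : Filter.Tendsto (fun x : ℝ => x ^ 2 / 2) Filter.atTop Filter.atTop :=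
      (Filter.tendsto_pow_atTop two_ne_zero).atTop_div_const two_pos
    simp only [neg_div]
    exact Filter.tendsto_neg_atTop_atBot.comp this
  simpa using h1.const_mul _

lemma tendsto_hinge_atTop : Filter.Tendsto hinge Filter.atTop (nhds 0) := by
  have := tendsto_gpdf_atTop.sub (tendsto_pow_mul_gtail 1)
  simp only [pow_one, sub_zero] at this
  exact this

/-- An antitone function lies above its limit. `hinge_nonneg`, `mul_gpdf_le` and `hinge_add_le` are
obtained in this way: the difference of the two sides vanishes at infinity and its derivative has a
sign. -/
lemma nonneg_of_antitone_of_tendsto {f : ℝ → ℝ} (a : ℝ) (hf : AntitoneOn f (Set.Ici a))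
    {l : ℝ} (hl : 0 ≤ l)
    (ht : Filter.Tendsto f Filter.atTop (nhds l)) {x : ℝ} (hx : a ≤ x) : 0 ≤ f x := by
  refine hl.trans (le_of_tendsto ht ?_)
  filter_upwards [Filter.eventually_ge_atTop x] with y hy
  exact hf hx (hx.trans hy) hy

lemma hinge_nonneg (x : ℝ) : 0 ≤ hinge x := by
  refine nonneg_of_antitone_of_tendsto x ?_ le_rfl tendsto_hinge_atTop le_rfl
  refine (antitone_of_deriv_nonpos (fun y => (hasDerivAt_hinge y).differentiableAt)
    fun y => ?_).antitoneOn _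
  rw [(hasDerivAt_hinge y).deriv]; linarith [gtail_nonneg y]

/-- Mills' lower bound for the normal tail. -/
lemma mul_gpdf_le (x : ℝ) : x * gpdf x ≤ (x ^ 2 + 1) * gtail x := by
  -- The difference of the two sides has derivative `-2 * hinge`, so the bound is `hinge_nonneg`
  -- integrated once more.
  have hd : ∀ y, HasDerivAt (fun y => (y ^ 2 + 1) * gtail y - y * gpdf y) (-2 * hinge y) y := by
    intro y
    have h := ((((hasDerivAt_pow 2 y).add_const 1).mul (hasDerivAt_gtail y))).sub
      ((hasDerivAt_id y).mul (hasDerivAt_gpdf y))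
    exact h.congr_deriv (by simp [hinge]; ring)
  have hten : Filter.Tendsto (fun y => (y ^ 2 + 1) * gtail y - y * gpdf y) Filter.atTop (nhds 0) := by
    have h1 : Filter.Tendsto (fun y : ℝ => y * gpdf y) Filter.atTop (nhds 0) := by
      have := ((Real.tendsto_pow_mul_exp_neg_atTop_nhds_zero 1).const_mul (√(2 * Real.pi))⁻¹)
      rw [mul_zero] at this
      refine squeeze_zero' ?_ ?_ this
      · filter_upwards [Filter.eventually_ge_atTop 0] with y hy
        exact mul_nonneg hy (gpdf_pos y).le
      · filter_upwards [Filter.eventually_ge_atTop 2] with y hy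
        rw [gpdf_eq]
        have h3 : Real.exp (-(y ^ 2) / 2) ≤ Real.exp (-y) := Real.exp_le_exp.2 (by nlinarith)
        have h4 : (0:ℝ) ≤ (√(2 * Real.pi))⁻¹ := by positivity
        have h5 := mul_le_mul_of_nonneg_left h3 (mul_nonneg h4 (by linarith : (0:ℝ) ≤ y))
        calc _ = (√(2 * Real.pi))⁻¹ * y * Real.exp (-(y ^ 2) / 2) := by ring
          _ ≤ _ := h5
          _ = _ := by ring
    have := ((tendsto_pow_mul_gtail 2).add (tendsto_gtail_atTop)).sub h1
    simp only [add_zero, sub_zero] at this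
    refine this.congr fun y => by ring
  have := nonneg_of_antitone_of_tendsto x ?_ le_rfl hten le_rfl
  · linarith
  · refine (antitone_of_deriv_nonpos (fun y => (hd y).differentiableAt) fun y => ?_).antitoneOn _
    rw [(hd y).deriv]; linarith [hinge_nonneg y]

/-- A rearrangement of `mul_gpdf_le`. -/
lemma hinge_le_div (x : ℝ) (hx : 0 < x) : hinge x ≤ gtail x / x := by
  rw [le_div_iff₀ hx, hinge]; nlinarith [mul_gpdf_le x]

lemma gpdf_zero_le : gpdf 0 ≤ 2 / 5 := by
  rw [gpdf_eq]
  simp only [ne_eq, OfNat.ofNat_ne_zero, not_false_eq_true, zero_pow, neg_zero, zero_div,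
    Real.exp_zero, mul_one]
  rw [inv_le_comm₀ (by positivity) (by norm_num)]
  refine Real.le_sqrt_of_sq_le ?_
  nlinarith [Real.pi_gt_d2]

/-- Replaces `hinge_le_div` near the origin. The difference of the two sides has second derivative
`(4 y / 5 - 1) gpdf y`, which is nonpositive up to `5/4`; by concavity the endpoints suffice. At `0`
the claim is `gpdf 0 ≤ 2/5`, and at `5/4` it is `hinge_le_div`. -/
lemma hinge_le_mul (x : ℝ) (hx : 0 ≤ x) (hx' : x ≤ 5 / 4) : hinge x ≤ 4 / 5 * gtail x := by
  have hd : ∀ y, HasDerivAt (fun y => 4 / 5 * gtail y - hinge y)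
      (gtail y - 4 / 5 * gpdf y) y := by
    intro y
    exact (((hasDerivAt_gtail y).const_mul (4/5)).sub (hasDerivAt_hinge y)).congr_deriv (by ring)
  have hd2 : ∀ y, HasDerivAt (fun y => gtail y - 4 / 5 * gpdf y)
      (- gpdf y + 4 / 5 * (y * gpdf y)) y := by
    intro y
    exact ((hasDerivAt_gtail y).sub ((hasDerivAt_gpdf y).const_mul (4/5))).congr_deriv (by ring)
  have hconc : ConcaveOn ℝ (Set.Icc (0:ℝ) (5/4)) (fun y => 4 / 5 * gtail y - hinge y) := by
    refine concaveOn_of_hasDerivWithinAt2_nonpos (convex_Icc _ _)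
      (fun y _ => (hd y).continuousAt.continuousWithinAt)
      (fun y _ => (hd y).hasDerivWithinAt) (fun y _ => (hd2 y).hasDerivWithinAt) ?_
    intro y hy
    rw [interior_Icc] at hy
    have := gpdf_pos y
    nlinarith [hy.1, hy.2]
  have h0 : 0 ≤ 4 / 5 * gtail 0 - hinge 0 := by
    rw [gtail_zero, hinge]; linarith [gpdf_zero_le]
  have h1 : 0 ≤ 4 / 5 * gtail (5/4) - hinge (5/4) := by
    have := hinge_le_div (5/4) (by norm_num)
    linarith
  have := hconc.2 (show (0:ℝ) ∈ Set.Icc (0:ℝ) (5/4) from ⟨le_rfl, by norm_num⟩)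
    (show (5/4:ℝ) ∈ Set.Icc (0:ℝ) (5/4) from ⟨by norm_num, le_rfl⟩)
    (show 0 ≤ 1 - x / (5/4) by rw [sub_nonneg, div_le_one (by norm_num)]; exact hx')
    (show 0 ≤ x / (5/4) by positivity) (by ring)
  simp only [smul_eq_mul, mul_zero, zero_add] at this
  rw [div_mul_cancel₀ _ (by norm_num : (5/4:ℝ) ≠ 0)] at this
  have h3 : 0 ≤ (1 - x / (5/4)) * (4 / 5 * gtail 0 - hinge 0) :=
    mul_nonneg (by rw [sub_nonneg, div_le_one (by norm_num)]; exact hx') h0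
  have h4 : 0 ≤ x / (5/4) * (4 / 5 * gtail (5/4) - hinge (5/4)) := mul_nonneg (by positivity) h1
  linarith

/-! ### The normal quantile -/

/-- `gtail` decreases strictly and continuously from `1` to `0`, so the set whose infimum defines
the quantile is a closed half-line that starts where `gtail` equals `x`. -/
lemma gtail_normalQuantile {x : ℝ} (h0 : 0 < x) (h1 : x < 1) :
    gtail (normalQuantile (1 - x)) = x := by
  obtain ⟨y, hy⟩ : ∃ y, gtail y = x := by
    have := mem_range_of_exists_le_of_exists_ge continuous_gtail
      (c := x) ?_ ?_
    · exact this
    · exact (((tendsto_order.1 tendsto_gtail_atTop).2 x h0).exists).imp fun _ h => h.le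
    · exact (((tendsto_order.1 tendsto_gtail_atBot).1 x h1).exists).imp fun _ h => h.le
  have : {z : ℝ | 1 - x ≤ cdf (gaussianReal 0 1) z} = Set.Ici y := by
    ext z
    have h := gtail_add_cdf z
    simp only [Set.mem_ofPred_eq, Set.mem_Ici]
    rw [show y ≤ z ↔ gtail z ≤ gtail y from strictAnti_gtail.le_iff_ge.symm, hy]
    constructor <;> intro h' <;> linarith
  rw [normalQuantile, this, csInf_Ici, hy]

lemma gtail_L_one {x : ℝ} (h0 : 0 < x) (h1 : x < 1) : gtail (L 1 x) = x := by
  rw [L, Real.sqrt_one, div_one, gtail_normalQuantile h0 h1]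

lemma L_one_pos {x : ℝ} (h0 : 0 < x) (h1 : x < 1 / 2) : 0 < L 1 x := by
  rw [← strictAnti_gtail.lt_iff_gt, gtail_zero, gtail_L_one h0 (by linarith)]; exact h1

lemma L_one_antitone {x y : ℝ} (h0 : 0 < x) (hxy : x ≤ y) (h1 : y < 1) : L 1 y ≤ L 1 x := by
  rw [← strictAnti_gtail.le_iff_ge, gtail_L_one h0 (by linarith), gtail_L_one (by linarith) h1]
  exact hxy

lemma L_eq (m x : ℝ) : L m x = L 1 x / √m := by simp [L]

end ScaledLasso
end

/-! ### Density of the standard Gaussian measure and polar coordinates -/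

noncomputable section
namespace ScaledLasso

set_option linter.unusedSectionVars false
section density
variable {E : Type*} [NormedAddCommGroup E] [InnerProductSpace ℝ E] [FiniteDimensional ℝ E]
  [MeasurableSpace E] [BorelSpace E]

variable (E) in
/-- The normalising constant of the standard Gaussian density. -/
def gaussConst : ℝ := (2 * Real.pi) ^ (Module.finrank ℝ E / 2 : ℝ)

lemma gaussConst_pos : 0 < gaussConst E := by unfold gaussConst; positivity

lemma integral_exp_neg_norm_sq : ∫ v : E, Real.exp (-‖v‖ ^ 2 / 2) = gaussConst E := by
  have := GaussianFourier.integral_rexp_neg_mul_sq_norm (V := E) (b := 1 / 2) (by norm_num)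
  rw [gaussConst]
  convert this using 2
  · ext v; congr 1; ring
  · ring

lemma integrable_exp_neg_norm_sq : Integrable fun v : E => Real.exp (-‖v‖ ^ 2 / 2) := by
  by_contra h
  have := integral_undef h
  rw [integral_exp_neg_norm_sq] at this
  exact gaussConst_pos.ne' this

/-- Both sides are finite measures with characteristic function `exp (-‖t‖² / 2)`. -/
lemma stdGaussian_eq_withDensity :
    stdGaussian E = volume.withDensity
      fun v => ENNReal.ofReal ((gaussConst E)⁻¹ * Real.exp (-‖v‖ ^ 2 / 2)) := by
  have hi : Integrable fun v : E => (gaussConst E)⁻¹ * Real.exp (-‖v‖ ^ 2 / 2) :=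
    integrable_exp_neg_norm_sq.const_mul _
  have : IsFiniteMeasure ((volume : Measure E).withDensity
      fun v => ENNReal.ofReal ((gaussConst E)⁻¹ * Real.exp (-‖v‖ ^ 2 / 2))) :=
    isFiniteMeasure_withDensity_ofReal hi.2
  refine Measure.ext_of_charFun ?_
  ext t
  rw [charFun_stdGaussian, charFun_apply, integral_withDensity_eq_integral_toReal_smul
    (by fun_prop) (by simp)]
  have h := GaussianFourier.integral_cexp_neg_mul_sq_norm_add (V := E) (b := 1 / 2) (by norm_num)
    Complex.I t
  have h2 : ∀ v : E, (ENNReal.ofReal ((gaussConst E)⁻¹ * Real.exp (-‖v‖ ^ 2 / 2))).toReal •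
      Complex.exp (inner ℝ v t * Complex.I) = ((gaussConst E)⁻¹ : ℂ) *
        Complex.exp (-(1 / 2) * ‖v‖ ^ 2 + Complex.I * inner ℝ t v) := by
    intro v
    have hp := gaussConst_pos (E := E)
    rw [ENNReal.toReal_ofReal (by positivity), Complex.real_smul, Complex.ofReal_mul, mul_assoc,
      Complex.ofReal_exp, ← Complex.exp_add, real_inner_comm]
    push_cast
    congr 2
    ring
  simp_rw [h2]
  rw [integral_const_mul, h]
  have h3 : ((Real.pi : ℂ) / (1 / 2)) ^ (Module.finrank ℝ E / 2 : ℂ) = (gaussConst E : ℂ) := by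
    rw [gaussConst, Complex.ofReal_cpow (by positivity)]
    push_cast
    congr 1
    ring
  rw [h3, ← mul_assoc, inv_mul_cancel₀ (by exact_mod_cast gaussConst_pos.ne'), one_mul]
  congr 1
  rw [Complex.I_sq]
  ring

lemma integral_stdGaussian (f : E → ℝ) : ∫ x, f x ∂(stdGaussian E) =
    (gaussConst E)⁻¹ * ∫ x, Real.exp (-‖x‖ ^ 2 / 2) * f x := by
  rw [stdGaussian_eq_withDensity, integral_withDensity_eq_integral_toReal_smul
    (by fun_prop) (by simp), ← integral_const_mul]
  congr 1
  ext x
  rw [ENNReal.toReal_ofReal (mul_nonneg (inv_nonneg.2 gaussConst_pos.le) (Real.exp_nonneg _)),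
    smul_eq_mul, mul_assoc]

/-- Integration in polar coordinates of a radial function over a cone. -/
lemma exists_setLIntegral_norm_eq [Nontrivial E] {A : Set E} (hA : MeasurableSet A)
    (hcone : ∀ (r : ℝ) (x : E), 0 < r → x ∈ A → r • x ∈ A) :
    ∃ c : ENNReal, ∀ g : ℝ → ENNReal, Measurable g →
      ∫⁻ x in A, g ‖x‖ = c * ∫⁻ r in Set.Ioi (0 : ℝ),
        ENNReal.ofReal (r ^ (Module.finrank ℝ E - 1)) * g r := by
  -- The constant is the surface measure of the trace of the cone on the unit sphere.
  refine ⟨(volume : Measure E).toSphere (Subtype.val ⁻¹' A), fun g hg => ?_⟩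
  have hcone' : ∀ (x : E), x ≠ 0 → (‖x‖⁻¹ • x ∈ A ↔ x ∈ A) := by
    intro x hx
    have hx' : 0 < ‖x‖ := norm_pos_iff.2 hx
    refine ⟨fun h => ?_, fun h => hcone _ _ (by positivity) h⟩
    have := hcone ‖x‖ _ hx' h
    rwa [smul_smul, mul_inv_cancel₀ hx'.ne', one_smul] at this
  set F : Metric.sphere (0 : E) 1 → ENNReal := (Subtype.val ⁻¹' A).indicator 1 with hF
  set G : Set.Ioi (0 : ℝ) → ENNReal := fun r => g r with hG
  have hFm : Measurable F := measurable_one.indicator (measurable_subtype_coe hA)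
  have hGm : Measurable G := hg.comp measurable_subtype_coe
  calc ∫⁻ x in A, g ‖x‖ = ∫⁻ x, A.indicator (fun x => g ‖x‖) x := (lintegral_indicator hA _).symm
    _ = ∫⁻ x in ({0}ᶜ : Set E), A.indicator (fun x => g ‖x‖) x := by rw [restrict_compl_singleton]
    _ = ∫⁻ x : ({0}ᶜ : Set E), A.indicator (fun x => g ‖x‖) x ∂(Measure.comap Subtype.val volume) :=
        (lintegral_subtype_comap (measurableSet_singleton _).compl _).symm
    _ = ∫⁻ x : ({0}ᶜ : Set E), (fun q : Metric.sphere (0 : E) 1 × Set.Ioi (0 : ℝ) =>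
          F q.1 * G q.2) (homeomorphUnitSphereProd E x) ∂(Measure.comap Subtype.val volume) := by
        refine lintegral_congr fun x => ?_
        have h1 : ((homeomorphUnitSphereProd E x).1 : E) ∈ A ↔ (x : E) ∈ A := by
          rw [homeomorphUnitSphereProd_apply_fst_coe]
          exact hcone' x x.2
        have h2 : G (homeomorphUnitSphereProd E x).2 = g ‖(x : E)‖ := by
          simp [hG]
        simp only [h2]
        by_cases hx : (x : E) ∈ A
        · have h1' := h1.2 hx
          rw [Set.indicator_of_mem hx, hF, Set.indicator_of_mem (Set.mem_preimage.2 h1'),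
            Pi.one_apply, one_mul]
        · have h1' := mt h1.1 hx
          rw [Set.indicator_of_notMem hx, hF,
            Set.indicator_of_notMem (by simpa only [Set.mem_preimage] using h1'), zero_mul]
    _ = ∫⁻ q, F q.1 * G q.2 ∂((volume : Measure E).toSphere.prod
          (Measure.volumeIoiPow (Module.finrank ℝ E - 1))) :=
        (volume : Measure E).measurePreserving_homeomorphUnitSphereProd.lintegral_comp
          ((hFm.comp measurable_fst).mul (hGm.comp measurable_snd))
    _ = (volume : Measure E).toSphere (Subtype.val ⁻¹' A) *
          ∫⁻ r, G r ∂(Measure.volumeIoiPow (Module.finrank ℝ E - 1)) := by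
        rw [lintegral_prod_mul hFm.aemeasurable hGm.aemeasurable, hF,
          lintegral_indicator_one (measurable_subtype_coe hA)]
    _ = _ := by
        congr 1
        rw [Measure.volumeIoiPow, lintegral_withDensity_eq_lintegral_mul _ (by fun_prop) hGm]
        exact lintegral_subtype_comap measurableSet_Ioi
          (fun r => ENNReal.ofReal (r ^ (Module.finrank ℝ E - 1)) * g r)

end density

/-- The first term of the power series of `log ((1 + x) / (1 - x))`, whose terms are all
nonnegative. -/
lemma two_mul_le_log_div {x : ℝ} (hx : 0 ≤ x) (hx1 : x < 1) :
    2 * x ≤ Real.log (1 + x) - Real.log (1 - x) := by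
  have h := Real.hasSum_log_sub_log_of_abs_lt_one (by rw [abs_lt]; constructor <;> linarith)
  have := h.summable.sum_le_tsum (Finset.range 1) (fun i _ => by positivity)
  rw [h.tsum_eq] at this
  simpa using this

/-- The chi density puts at most half of its mass below its mode. -/
lemma lintegral_chi_below_mode_le (d : ℕ) :
    ∫⁻ r in Set.Ioc 0 (√d), ENNReal.ofReal (r ^ d) * ENNReal.ofReal (Real.exp (-r ^ 2 / 2)) ≤
      ∫⁻ r in Set.Ioi (√d), ENNReal.ofReal (r ^ d) * ENNReal.ofReal (Real.exp (-r ^ 2 / 2)) := by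
  set M := √(d : ℝ) with hM
  set f : ℝ → ENNReal := fun r => ENNReal.ofReal (r ^ d) * ENNReal.ofReal (Real.exp (-r ^ 2 / 2))
    with hf
  have hfm : Measurable f := by fun_prop
  -- The density increases under reflection at its mode `M = √d`. With `x = (M - r) / M`, the
  -- logarithm of the ratio is `M² (log (1 + x) - log (1 - x)) - 2 M (M - r)`, which is nonnegative
  -- by `two_mul_le_log_div`.
  have key : ∀ r ∈ Set.Ioo 0 M, f r ≤ f (2 * M - r) := by
    intro r ⟨h0, h1⟩
    have hM0 : 0 < M := h0.trans h1
    have h2 : 0 < 2 * M - r := by linarith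
    have hd : (d : ℝ) = M ^ 2 := (Real.sq_sqrt (Nat.cast_nonneg d)).symm
    simp only [hf]
    rw [← ENNReal.ofReal_mul (by positivity), ← ENNReal.ofReal_mul (by positivity)]
    refine ENNReal.ofReal_le_ofReal ?_
    have hpow : ∀ x : ℝ, 0 < x → x ^ d = Real.exp (d * Real.log x) := fun x hx => by
      rw [Real.exp_nat_mul, Real.exp_log hx]
    rw [hpow _ h0, hpow _ h2, ← Real.exp_add, ← Real.exp_add, Real.exp_le_exp, hd]
    have hx := two_mul_le_log_div (x := (M - r) / M) (div_nonneg (by linarith) hM0.le)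
      (by rw [div_lt_one hM0]; linarith)
    have e1 : 1 + (M - r) / M = (2 * M - r) / M := by field_simp; ring
    have e2 : 1 - (M - r) / M = r / M := by field_simp; ring
    rw [e1, e2, Real.log_div h2.ne' hM0.ne', Real.log_div h0.ne' hM0.ne'] at hx
    have := mul_le_mul_of_nonneg_left hx (sq_nonneg M)
    have e3 : M ^ 2 * (2 * ((M - r) / M)) = 2 * M * (M - r) := by field_simp
    rw [e3] at this
    nlinarith
  have hmp : MeasurePreserving (fun r : ℝ => 2 * M - r) volume volume :=
    Measure.measurePreserving_sub_left volume (2 * M)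
  have hemb : MeasurableEmbedding (fun r : ℝ => 2 * M - r) :=
    (MeasurableEquiv.subLeft (2 * M)).measurableEmbedding
  calc ∫⁻ r in Set.Ioc 0 M, f r = ∫⁻ r in Set.Ioo 0 M, f r :=
        setLIntegral_congr Ioo_ae_eq_Ioc.symm
    _ ≤ ∫⁻ r in Set.Ioo 0 M, f (2 * M - r) := setLIntegral_mono' measurableSet_Ioo key
    _ = ∫⁻ r in (fun r : ℝ => 2 * M - r) ⁻¹' Set.Ioo M (2 * M), f (2 * M - r) := by
        congr 2
        ext r
        simp only [Set.mem_Ioo, Set.mem_preimage]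
        constructor <;> rintro ⟨h1, h2⟩ <;> constructor <;> linarith
    _ = ∫⁻ r in Set.Ioo M (2 * M), f r := hmp.setLIntegral_comp_preimage_emb hemb f _
    _ ≤ ∫⁻ r in Set.Ioi M, f r := lintegral_mono_set (fun r hr => hr.1)


/-- A Gaussian vector has squared norm at least `dim E - 1` with probability at least one half,
independently of its direction. -/
lemma stdGaussian_cone_le {E : Type*} [NormedAddCommGroup E] [InnerProductSpace ℝ E]
    [FiniteDimensional ℝ E] [MeasurableSpace E] [BorelSpace E] [Nontrivial E]
    {A : Set E} (hA : MeasurableSet A)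
    (hcone : ∀ (r : ℝ) (x : E), 0 < r → x ∈ A → r • x ∈ A) :
    stdGaussian E A ≤
      2 * stdGaussian E (A ∩ {x | (Module.finrank ℝ E : ℝ) - 1 ≤ ‖x‖ ^ 2}) := by
  obtain ⟨c, hc⟩ := exists_setLIntegral_norm_eq hA hcone
  set d := Module.finrank ℝ E - 1 with hd
  have hdR : (Module.finrank ℝ E : ℝ) - 1 = d := by
    rw [hd, Nat.cast_sub Module.finrank_pos, Nat.cast_one]
  set D : ENNReal := ENNReal.ofReal (gaussConst E)⁻¹
  set φ : ℝ → ENNReal := fun r => D * ENNReal.ofReal (Real.exp (-r ^ 2 / 2)) with hφ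
  have hφm : Measurable φ := by fun_prop
  set f : ℝ → ENNReal := fun r => ENNReal.ofReal (r ^ d) * ENNReal.ofReal (Real.exp (-r ^ 2 / 2))
    with hf
  have hfm : Measurable f := by fun_prop
  have hdens : ∀ B : Set E, MeasurableSet B → stdGaussian E B = ∫⁻ x in B, φ ‖x‖ := by
    intro B hB
    rw [stdGaussian_eq_withDensity, withDensity_apply _ hB]
    refine lintegral_congr fun x => ?_
    rw [ENNReal.ofReal_mul (inv_nonneg.2 gaussConst_pos.le)]
  have hM : MeasurableSet {x : E | (Module.finrank ℝ E : ℝ) - 1 ≤ ‖x‖ ^ 2} :=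
    measurableSet_le measurable_const (by fun_prop)
  have hI : ∀ s : Set ℝ, ∫⁻ r in s, ENNReal.ofReal (r ^ d) * φ r = D * ∫⁻ r in s, f r := by
    intro s
    rw [← lintegral_const_mul _ hfm]
    refine lintegral_congr fun r => ?_
    simp only [hφ, hf]
    ring
  have h1 : stdGaussian E A = c * (D * ∫⁻ r in Set.Ioi 0, f r) := by
    rw [hdens A hA, hc φ hφm, hI]
  -- The direction contributes the same factor `c` with and without the restriction on the norm;
  -- beyond the mode `√d` one has `‖x‖² ≥ d = dim E - 1`. It remains to compare radial masses by
  -- `lintegral_chi_below_mode_le`.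
  have h2 : c * (D * ∫⁻ r in Set.Ioi (√(d : ℝ)), f r) ≤
      stdGaussian E (A ∩ {x | (Module.finrank ℝ E : ℝ) - 1 ≤ ‖x‖ ^ 2}) := by
    have hφ2 : Measurable ((Set.Ioi (√(d : ℝ))).indicator φ) := hφm.indicator measurableSet_Ioi
    have := hc _ hφ2
    have e : ∫⁻ r in Set.Ioi (0 : ℝ), ENNReal.ofReal (r ^ d) * (Set.Ioi (√(d : ℝ))).indicator φ r =
        D * ∫⁻ r in Set.Ioi (√(d : ℝ)), f r := by
      rw [← hI, ← lintegral_indicator measurableSet_Ioi, ← lintegral_indicator measurableSet_Ioi]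
      refine lintegral_congr fun r => ?_
      by_cases hr : √(d : ℝ) < r
      · have : 0 < r := (Real.sqrt_nonneg _).trans_lt hr
        simp [Set.indicator, hr, this]
      · simp [Set.indicator, hr]
    rw [e] at this
    rw [← this, hdens _ (hA.inter hM), ← lintegral_indicator hA, ← lintegral_indicator (hA.inter hM)]
    refine lintegral_mono fun x => ?_
    by_cases hx : x ∈ A
    · by_cases hr : √(d : ℝ) < ‖x‖
      · have : (Module.finrank ℝ E : ℝ) - 1 ≤ ‖x‖ ^ 2 := by
          rw [hdR]
          exact (Real.sqrt_le_left (norm_nonneg _)).1 hr.le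
        rw [Set.indicator_of_mem hx, Set.indicator_of_mem (show ‖x‖ ∈ Set.Ioi (√(d : ℝ)) from hr),
          Set.indicator_of_mem (show x ∈ A ∩ {x | (Module.finrank ℝ E : ℝ) - 1 ≤ ‖x‖ ^ 2} from ⟨hx, this⟩)]
      · simp [Set.indicator, hx, hr]
    · simp [Set.indicator, hx]
  refine le_trans ?_ (mul_le_mul_right h2 2)
  rw [h1, ← Set.Ioc_union_Ioi_eq_Ioi (Real.sqrt_nonneg (d : ℝ)),
    lintegral_union measurableSet_Ioi (Set.Ioc_disjoint_Ioi le_rfl)]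
  have := lintegral_chi_below_mode_le d
  calc _ ≤ c * (D * ((∫⁻ r in Set.Ioi (√(d : ℝ)), f r) + ∫⁻ r in Set.Ioi (√(d : ℝ)), f r)) := by
        gcongr
    _ = _ := by rw [← two_mul]; ring

end ScaledLasso
end

/-! ### A normal bound for one coordinate of a random direction -/

noncomputable section
namespace ScaledLasso

/-- Logarithmic convexity of the Gamma function at a midpoint. -/
lemma Gamma_add_half_sq_le {y : ℝ} (hy : 0 < y) :
    Real.Gamma (y + 1 / 2) ^ 2 ≤ Real.Gamma y * Real.Gamma (y + 1) := by
  have h := Real.Gamma_mul_add_mul_le_rpow_Gamma_mul_rpow_Gamma hy (by linarith : 0 < y + 1)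
    (by norm_num : (0 : ℝ) < 1 / 2) (by norm_num : (0 : ℝ) < 1 / 2) (by norm_num)
  rw [show 1 / 2 * y + 1 / 2 * (y + 1) = y + 1 / 2 by ring, ← Real.sqrt_eq_rpow,
    ← Real.sqrt_eq_rpow] at h
  have h1 := Real.Gamma_pos_of_pos hy
  have h2 := Real.Gamma_pos_of_pos (by linarith : 0 < y + 1)
  have h3 := Real.Gamma_pos_of_pos (by linarith : 0 < y + 1 / 2)
  calc _ ≤ (√(Real.Gamma y) * √(Real.Gamma (y + 1))) ^ 2 := by gcongr
    _ = _ := by rw [mul_pow, Real.sq_sqrt h1.le, Real.sq_sqrt h2.le]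

/-- A sharp form of Gautschi's inequality at the exponent one half. -/
lemma sub_quarter_mul_Gamma_sq_le {x : ℝ} (hx : 1 / 2 ≤ x) :
    (x - 1 / 4) * Real.Gamma x ^ 2 ≤ Real.Gamma (x + 1 / 2) ^ 2 := by
  -- Log-convexity gives the inequality at a point `z` up to the factor `1 - 1 / (4 z)`. The
  -- functional equation carries it from `x + 1` down to `x` without loss, since `(x + 1/2)² (x -
  -- 1/4) ≤ (x + 3/4) x²`. Starting from `x + m` with `m → ∞` removes the factor.
  have hstep : ∀ m : ℕ, (1 - 1 / (4 * (x + m))) * ((x - 1 / 4) * Real.Gamma x ^ 2) ≤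
      Real.Gamma (x + 1 / 2) ^ 2 := by
    intro m
    induction m generalizing x with
    | zero =>
      have hx0 : 0 < x := by linarith
      have h := Gamma_add_half_sq_le (y := x + 1 / 2) (by linarith)
      rw [show x + 1 / 2 + 1 / 2 = x + 1 by ring, Real.Gamma_add_one hx0.ne',
        Real.Gamma_add_one (by linarith : x + 1 / 2 ≠ 0)] at h
      have hg := sq_nonneg (Real.Gamma x)
      simp only [Nat.cast_zero, add_zero]
      have e : (1 - 1 / (4 * x)) * ((x - 1 / 4) * Real.Gamma x ^ 2) =
          (x - 1 / 4) ^ 2 * Real.Gamma x ^ 2 / x := by field_simp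
      rw [e, div_le_iff₀ hx0]
      have h2 : (x + 1 / 2) * ((x - 1 / 4) ^ 2 * Real.Gamma x ^ 2) ≤
          (x + 1 / 2) * (Real.Gamma (x + 1 / 2) ^ 2 * x) := by
        have : (x + 1 / 2) * (x - 1 / 4) ^ 2 ≤ x * x ^ 2 := by nlinarith
        nlinarith [mul_le_mul_of_nonneg_right this hg, mul_le_mul_of_nonneg_left h hx0.le]
      exact le_of_mul_le_mul_left h2 (by linarith)
    | succ m ih =>
      have hx0 : 0 < x := by linarith
      have h := ih (x := x + 1) (by linarith)
      rw [show x + 1 + 1 / 2 = (x + 1 / 2) + 1 by ring, Real.Gamma_add_one hx0.ne',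
        Real.Gamma_add_one (by linarith : x + 1 / 2 ≠ 0)] at h
      rw [show x + 1 + (m : ℝ) = x + ((m + 1 : ℕ) : ℝ) by push_cast; ring] at h
      set q := 1 - 1 / (4 * (x + ((m + 1 : ℕ) : ℝ)))
      have hq : 0 ≤ q := by
        have : 1 / (4 * (x + ((m + 1 : ℕ) : ℝ))) ≤ 1 := by
          rw [div_le_one (by positivity)]
          push_cast
          have : (0 : ℝ) ≤ m := Nat.cast_nonneg m
          linarith
        simp only [q]; linarith
      have hg := sq_nonneg (Real.Gamma x)
      have hxx : 0 < (x + 1 / 2) ^ 2 := by positivity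
      refine le_of_mul_le_mul_left ?_ hxx
      calc (x + 1 / 2) ^ 2 * (q * ((x - 1 / 4) * Real.Gamma x ^ 2))
          = ((x + 1 / 2) ^ 2 * (x - 1 / 4)) * (q * Real.Gamma x ^ 2) := by ring
        _ ≤ ((x + 3 / 4) * x ^ 2) * (q * Real.Gamma x ^ 2) :=
            mul_le_mul_of_nonneg_right (by nlinarith) (by positivity)
        _ = q * ((x + 1 - 1 / 4) * (x * Real.Gamma x) ^ 2) := by ring
        _ ≤ _ := h
        _ = _ := by ring
  have hlim : Filter.Tendsto (fun m : ℕ => (1 - 1 / (4 * (x + m))) *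
      ((x - 1 / 4) * Real.Gamma x ^ 2)) Filter.atTop
      (nhds ((1 - 0) * ((x - 1 / 4) * Real.Gamma x ^ 2))) := by
    refine Filter.Tendsto.mul_const _ (Filter.Tendsto.sub tendsto_const_nhds ?_)
    refine Filter.Tendsto.div_atTop tendsto_const_nhds ?_
    exact Filter.Tendsto.const_mul_atTop (by norm_num)
      (Filter.tendsto_atTop_add_const_left _ _ tendsto_natCast_atTop_atTop)
  rw [sub_zero, one_mul] at hlim
  exact le_of_tendsto' hlim hstep

/-- The mean of the Euclidean norm of a standard Gaussian vector in dimension `d`. -/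
def chiMean (d : ℕ) : ℝ := √2 * Real.Gamma ((d + 1) / 2) / Real.Gamma (d / 2)

/-- The sharp Gautschi inequality at `d / 2`. With `d = n - 1` this is the origin of `n - 3/2` in
the penalty level: at `y = 0` the true tail `tTail` decreases at least as fast as its normal bound.
-/
lemma sqrt_le_chiMean {d : ℕ} (hd : 1 ≤ d) : √(d - 1 / 2 : ℝ) ≤ chiMean d := by
  have hd' : (1 : ℝ) ≤ d := by exact_mod_cast hd
  have h := sub_quarter_mul_Gamma_sq_le (x := d / 2) (by linarith)
  have h0 : 0 < Real.Gamma (d / 2) := Real.Gamma_pos_of_pos (by linarith)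
  have h1 : 0 < Real.Gamma ((d + 1) / 2) := Real.Gamma_pos_of_pos (by linarith)
  rw [show (d : ℝ) / 2 + 1 / 2 = (d + 1) / 2 by ring] at h
  refine Real.sqrt_le_iff.2 ⟨by unfold chiMean; positivity, ?_⟩
  rw [chiMean, div_pow, mul_pow, Real.sq_sqrt (by norm_num), le_div_iff₀ (by positivity)]
  nlinarith

/-- `∫ ‖x‖ exp(-y² ‖x‖² / 2)` under the standard Gaussian measure. -/
lemma integral_norm_mul_exp (d : ℕ) (hd : 1 ≤ d) (y : ℝ) :
    ∫ x : EuclideanSpace ℝ (Fin d), ‖x‖ * Real.exp (-(y ^ 2 * ‖x‖ ^ 2) / 2) ∂(stdGaussian _) =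
      chiMean d * (1 + y ^ 2) ^ (-((d : ℝ) + 1) / 2) := by
  set E := EuclideanSpace ℝ (Fin d)
  have hdim : Module.finrank ℝ E = d := by simp [E]
  have hd' : (1 : ℝ) ≤ d := by exact_mod_cast hd
  have : Nontrivial E := Module.nontrivial_of_finrank_pos (R := ℝ) (by omega)
  rw [integral_stdGaussian, ← integral_exp_neg_norm_sq (E := E)]
  have h1 := integral_fun_norm_addHaar (volume : Measure E) (fun r => Real.exp (-r ^ 2 / 2))
  have h2 := integral_fun_norm_addHaar (volume : Measure E)
    (fun r => Real.exp (-r ^ 2 / 2) * (r * Real.exp (-(y ^ 2 * r ^ 2) / 2)))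
  rw [h1, h2, hdim]
  have h0 := Real.Gamma_pos_of_pos (by linarith : (0 : ℝ) < d / 2)
  have hb : (0 : ℝ) < 1 + y ^ 2 := by positivity
  have i1 : ∫ r in Set.Ioi (0 : ℝ), r ^ (d - 1) • Real.exp (-r ^ 2 / 2) =
      (1 / 2) ^ (-(d : ℝ) / 2) * (1 / 2) * Real.Gamma (d / 2) := by
    have := integral_rpow_mul_exp_neg_mul_rpow (p := 2) (q := d - 1) (b := 1 / 2) (by norm_num)
      (by linarith) (by norm_num)
    rw [sub_add_cancel] at this
    rw [← this]
    refine setIntegral_congr_fun measurableSet_Ioi fun r hr => ?_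
    have : (r : ℝ) ^ ((d : ℝ) - 1) = r ^ (d - 1) := by
      rw [← Nat.cast_one, ← Nat.cast_sub hd, Real.rpow_natCast]
    simp only [smul_eq_mul, this, Real.rpow_two]
    congr 2
    ring
  have i2 : ∫ r in Set.Ioi (0 : ℝ), r ^ (d - 1) • (Real.exp (-r ^ 2 / 2) *
        (r * Real.exp (-(y ^ 2 * r ^ 2) / 2))) =
      ((1 + y ^ 2) / 2) ^ (-((d : ℝ) + 1) / 2) * (1 / 2) * Real.Gamma ((d + 1) / 2) := by
    have := integral_rpow_mul_exp_neg_mul_rpow (p := 2) (q := d) (b := (1 + y ^ 2) / 2)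
      (by norm_num) (by linarith) (by positivity)
    rw [← this]
    refine setIntegral_congr_fun measurableSet_Ioi fun r hr => ?_
    have e : r ^ d = r ^ (d - 1) * r := by rw [← pow_succ, Nat.sub_add_cancel hd]
    simp only [smul_eq_mul, Real.rpow_two, Real.rpow_natCast]
    rw [e, mul_assoc, mul_left_comm (Real.exp _), ← Real.exp_add]
    congr 3
    ring
  rw [i1, i2]
  set c := (volume : Measure E).real (Metric.ball 0 1)
  have hc : 0 < c := ENNReal.toReal_pos (Metric.measure_ball_pos _ _ one_pos).ne' measure_ball_lt_top.ne
  have e1 : ((1 + y ^ 2) / 2) ^ (-((d : ℝ) + 1) / 2) =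
      (1 + y ^ 2) ^ (-((d : ℝ) + 1) / 2) * (1 / 2) ^ (-((d : ℝ) + 1) / 2) := by
    rw [← Real.mul_rpow hb.le (by norm_num)]; congr 1; ring
  have e2 : ((1 : ℝ) / 2) ^ (-((d : ℝ) + 1) / 2) = (1 / 2) ^ (-(d : ℝ) / 2) * √2 := by
    have : √2 = ((1 : ℝ) / 2) ^ (-(1 / 2) : ℝ) := by
      rw [Real.rpow_neg (by norm_num), one_div, Real.inv_rpow (by norm_num), inv_inv,
        Real.sqrt_eq_rpow, one_div]
    rw [this, ← Real.rpow_add (by norm_num)]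
    congr 1
    ring
  rw [e1, e2, chiMean]
  have : (0 : ℝ) < (1 / 2) ^ (-(d : ℝ) / 2) := by positivity
  simp only [nsmul_eq_mul, smul_eq_mul]
  field_simp


/-- `P(g₀ > y ‖g‖)` for independent standard Gaussian `g₀` in `ℝ` and `g` in `ℝᵈ`. -/
def tTail (d : ℕ) (y : ℝ) : ℝ :=
  ∫ x : EuclideanSpace ℝ (Fin d), gtail (y * ‖x‖) ∂(stdGaussian _)

lemma norm_gtail_le (x : ℝ) : ‖gtail x‖ ≤ 1 := by
  rw [Real.norm_of_nonneg (gtail_nonneg x)]; exact gtail_neg_le_one x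

lemma tTail_zero (d : ℕ) : tTail d 0 = 1 / 2 := by
  simp [tTail, gtail_zero]

lemma tendsto_tTail_atTop {d : ℕ} (hd : 1 ≤ d) :
    Filter.Tendsto (tTail d) Filter.atTop (nhds 0) := by
  have hdim : Module.finrank ℝ (EuclideanSpace ℝ (Fin d)) = d := by simp
  have : Nontrivial (EuclideanSpace ℝ (Fin d)) :=
    Module.nontrivial_of_finrank_pos (R := ℝ) (by omega)
  have h := tendsto_integral_filter_of_dominated_convergence
    (μ := stdGaussian (EuclideanSpace ℝ (Fin d))) (l := Filter.atTop)
    (F := fun (y : ℝ) (x : EuclideanSpace ℝ (Fin d)) => gtail (y * ‖x‖)) (f := fun _ => 0)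
    (fun _ => 1)
    (Filter.Eventually.of_forall fun y =>
      (continuous_gtail.comp (by fun_prop)).aestronglyMeasurable)
    (Filter.Eventually.of_forall fun y => Filter.Eventually.of_forall fun x => norm_gtail_le _)
    (integrable_const _) ?_
  · rw [integral_zero] at h
    exact h
  · have h0 : ∀ᵐ x ∂(stdGaussian (EuclideanSpace ℝ (Fin d))), x ≠ 0 := by
      rw [stdGaussian_eq_withDensity]
      refine withDensity_absolutelyContinuous _ _ ?_
      simp
    filter_upwards [h0] with x hx
    exact tendsto_gtail_atTop.comp
      (Filter.tendsto_id.atTop_mul_const (norm_pos_iff.2 hx))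

/-- Differentiation under the integral, dominated by `2/5 * ‖x‖`, leaves a Gaussian integral that is
explicit in polar coordinates. `tTail` has no closed form, but its derivative has one and can be
compared with that of `tTailBound`. -/
lemma hasDerivAt_tTail {d : ℕ} (hd : 1 ≤ d) (y : ℝ) : HasDerivAt (tTail d)
    (-((√(2 * Real.pi))⁻¹ * (chiMean d * (1 + y ^ 2) ^ (-((d : ℝ) + 1) / 2)))) y := by
  set E := EuclideanSpace ℝ (Fin d)
  have hint : Integrable (fun x : E => ‖x‖) (stdGaussian E) :=
    (IsGaussian.memLp_id (stdGaussian E) 1 (by simp)).integrable le_rfl |>.norm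
  have h := (hasDerivAt_integral_of_dominated_loc_of_deriv_le (μ := stdGaussian E)
    (F := fun (y : ℝ) (x : E) => gtail (y * ‖x‖))
    (F' := fun (y : ℝ) (x : E) => -gpdf (y * ‖x‖) * ‖x‖) (x₀ := y) (s := Set.univ)
    (bound := fun x => 2 / 5 * ‖x‖) Filter.univ_mem
    (Filter.Eventually.of_forall fun y =>
      (continuous_gtail.comp (by fun_prop)).aestronglyMeasurable)
    (Integrable.of_bound (continuous_gtail.comp (by fun_prop)).aestronglyMeasurable 1
      (Filter.Eventually.of_forall fun x => norm_gtail_le _))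
    (((continuous_gpdf.comp (by fun_prop)).neg.mul continuous_norm).aestronglyMeasurable)
    (Filter.Eventually.of_forall fun x z _ => ?_) (hint.const_mul _)
    (Filter.Eventually.of_forall fun x z _ => ?_)).2
  · refine h.congr_deriv ?_
    rw [← integral_norm_mul_exp d hd, ← integral_const_mul, ← integral_neg]
    refine integral_congr_ae (Filter.Eventually.of_forall fun x => ?_)
    simp only
    rw [gpdf_eq, mul_pow, neg_mul, mul_comm ‖x‖, mul_assoc]
  · rw [norm_mul, norm_neg, norm_norm, Real.norm_of_nonneg (gpdf_pos _).le]
    gcongr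
    refine le_trans ?_ gpdf_zero_le
    rw [gpdf_eq, gpdf_eq]
    refine mul_le_mul_of_nonneg_left (Real.exp_le_exp.2 ?_) (by positivity)
    have := sq_nonneg (z * ‖x‖)
    linarith
  · refine ((hasDerivAt_gtail (z * ‖x‖)).comp z ((hasDerivAt_id z).mul_const ‖x‖)).congr_deriv ?_
    simp

/-- The comparison function for `tTail`. -/
def tTailBound (d : ℕ) (y : ℝ) : ℝ := gtail (√(d - 1 / 2 : ℝ) * y / √(1 + y ^ 2))

lemma hasDerivAt_tTailBound {d : ℕ} (hd : 1 ≤ d) (y : ℝ) : HasDerivAt (tTailBound d)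
    (-((√(2 * Real.pi))⁻¹ * (√(d - 1 / 2 : ℝ) * (1 + y ^ 2) ^ (-(3 : ℝ) / 2) *
      Real.exp (-((d - 1 / 2 : ℝ) / 2 * (1 - (1 + y ^ 2)⁻¹)))))) y := by
  have hd' : (1 : ℝ) ≤ d := by exact_mod_cast hd
  have hb : (0 : ℝ) < 1 + y ^ 2 := by positivity
  have hs : √(1 + y ^ 2) ≠ 0 := (Real.sqrt_pos.2 hb).ne'
  have h1 : HasDerivAt (fun y : ℝ => √(1 + y ^ 2)) (1 / (2 * √(1 + y ^ 2)) * (2 * y)) y := by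
    refine ((Real.hasDerivAt_sqrt hb.ne').comp y
      ((hasDerivAt_const y (1 : ℝ)).add (hasDerivAt_pow 2 y))).congr_deriv ?_
    simp
  have h2 := ((hasDerivAt_id y).const_mul (√(d - 1 / 2 : ℝ))).div h1 hs
  refine ((hasDerivAt_gtail _).comp y h2).congr_deriv ?_
  simp only [id, Pi.div_apply, mul_one]
  rw [gpdf_eq]
  have hsq : √(1 + y ^ 2) ^ 2 = 1 + y ^ 2 := Real.sq_sqrt hb.le
  have e1 : (1 + y ^ 2) ^ (-(3 : ℝ) / 2) = (√(1 + y ^ 2) ^ 3)⁻¹ := by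
    rw [Real.sqrt_eq_rpow, ← Real.rpow_natCast ((1 + y ^ 2) ^ (1 / 2 : ℝ)),
      ← Real.rpow_mul hb.le, ← Real.rpow_neg hb.le]
    norm_num
  have e2 : -(√(d - 1 / 2 : ℝ) * y / √(1 + y ^ 2)) ^ 2 / 2 =
      -((d - 1 / 2 : ℝ) / 2 * (1 - (1 + y ^ 2)⁻¹)) := by
    rw [div_pow, mul_pow, hsq, Real.sq_sqrt (by linarith)]
    field_simp
    ring
  rw [e1, e2]
  have e3 : (√(d - 1 / 2 : ℝ) * √(1 + y ^ 2) - √(d - 1 / 2 : ℝ) * y * (1 / (2 * √(1 + y ^ 2)) *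
      (2 * y))) / √(1 + y ^ 2) ^ 2 = √(d - 1 / 2 : ℝ) * (√(1 + y ^ 2) ^ 3)⁻¹ := by
    field_simp
    rw [hsq]
    ring
  rw [e3]
  ring

/-- The logarithm of the ratio of the derivatives of `tTail` and `tTailBound`, as a function of
`v = 1 / (1 + y²)`. -/
def tLogRatio (d : ℕ) (v : ℝ) : ℝ :=
  ((d : ℝ) - 2) / 2 * Real.log v + (d - 1 / 2 : ℝ) / 2 * (1 - v) +
    Real.log (chiMean d / √(d - 1 / 2 : ℝ))

lemma tLogRatio_nonneg_iff {d : ℕ} (hd : 1 ≤ d) (y : ℝ) : 0 ≤ tLogRatio d (1 + y ^ 2)⁻¹ ↔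
    √(d - 1 / 2 : ℝ) * (1 + y ^ 2) ^ (-(3 : ℝ) / 2) *
      Real.exp (-((d - 1 / 2 : ℝ) / 2 * (1 - (1 + y ^ 2)⁻¹))) ≤
    chiMean d * (1 + y ^ 2) ^ (-((d : ℝ) + 1) / 2) := by
  have hd' : (1 : ℝ) ≤ d := by exact_mod_cast hd
  have hb : (0 : ℝ) < 1 + y ^ 2 := by positivity
  have hν : 0 < √(d - 1 / 2 : ℝ) := Real.sqrt_pos.2 (by linarith)
  have hM : 0 < chiMean d := hν.trans_le (sqrt_le_chiMean hd)
  rw [← Real.log_le_log_iff (x := √(d - 1 / 2 : ℝ) * _ * _) (by positivity) (by positivity),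
    Real.log_mul (by positivity) (Real.exp_ne_zero _), Real.log_mul (by positivity) (by positivity),
    Real.log_mul (by positivity) (by positivity), Real.log_exp, Real.log_rpow hb, Real.log_rpow hb,
    tLogRatio, Real.log_inv, Real.log_div hM.ne' hν.ne']
  constructor <;> intro h <;> nlinarith

lemma tLogRatio_one {d : ℕ} (hd : 1 ≤ d) : 0 ≤ tLogRatio d 1 := by
  have hd' : (1 : ℝ) ≤ d := by exact_mod_cast hd
  have hν : 0 < √(d - 1 / 2 : ℝ) := Real.sqrt_pos.2 (by linarith)
  simp only [tLogRatio, Real.log_one, sub_self, mul_zero, zero_add]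
  exact Real.log_nonneg (by rw [le_div_iff₀ hν, one_mul]; exact sqrt_le_chiMean hd)

/-- Nonnegativity of `tLogRatio` propagates towards `1`. -/
lemma tLogRatio_nonneg_of_le {d : ℕ} (hd : 1 ≤ d) {v w : ℝ} (hv : 0 < v) (hvw : v ≤ w)
    (hw : w ≤ 1) (h : 0 ≤ tLogRatio d v) : 0 ≤ tLogRatio d w := by
  have hw0 : 0 < w := hv.trans_le hvw
  have h1 := tLogRatio_one hd
  have hd' : (1 : ℝ) ≤ d := by exact_mod_cast hd
  -- For `d = 1` the coefficient of the logarithm is negative and every term is nonnegative on `(0,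
  -- 1]`. For `d ≥ 2` the function is concave in `v`, so nonnegativity at `v` and at `1` extends to
  -- the points between them.
  rcases Nat.lt_or_ge d 2 with hd2 | hd2
  · have hd1 : (d : ℝ) = 1 := by exact_mod_cast (by omega : d = 1)
    simp only [tLogRatio, Real.log_one, sub_self, mul_zero, zero_add] at h1
    simp only [tLogRatio]
    have := Real.log_nonpos hw0.le hw
    rw [hd1] at h1 ⊢
    nlinarith
  · have hd2' : (2 : ℝ) ≤ d := by exact_mod_cast hd2
    rcases eq_or_lt_of_le (hvw.trans hw) with he | hlt
    · have : w = v := le_antisymm (by linarith) hvw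
      rwa [this]
    set θ := (w - v) / (1 - v) with hθ
    have hθ0 : 0 ≤ θ := div_nonneg (by linarith) (by linarith)
    have hθ1 : 0 ≤ 1 - θ := by
      have : θ ≤ 1 := by rw [hθ, div_le_one (by linarith)]; linarith
      linarith
    have hwe : (1 - θ) * v + θ * 1 = w := by
      have : (1 - v) ≠ 0 := by linarith
      rw [hθ]; field_simp; ring
    have hlog := strictConcaveOn_log_Ioi.concaveOn.2 (show v ∈ Set.Ioi (0 : ℝ) from hv)
      (show (1 : ℝ) ∈ Set.Ioi (0 : ℝ) from Set.mem_Ioi.2 one_pos) hθ1 hθ0 (by ring)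
    simp only [smul_eq_mul, Real.log_one, mul_zero, add_zero, hwe] at hlog
    simp only [mul_one] at hwe
    rw [tLogRatio] at h h1 ⊢
    rw [Real.log_one] at h1
    have h3 := mul_le_mul_of_nonneg_left hlog (by linarith : 0 ≤ ((d : ℝ) - 2) / 2)
    have h4 := mul_nonneg hθ1 h
    have h5 := mul_nonneg hθ0 h1
    have h6 : (d - 1 / 2 : ℝ) / 2 * (1 - w) = (1 - θ) * ((d - 1 / 2 : ℝ) / 2 * (1 - v)) := by
      rw [← hwe]; ring
    rw [h6]
    nlinarith

/-- The difference `D` of the two sides vanishes at `0` and is asymptotically nonnegative, because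
`tTail` tends to `0`. The sign of its derivative is that of `tLogRatio` at `1 / (1 + y²)`, which
changes at most once, from plus to minus. At each `y`, either `D` increases on `[0, y]` and
dominates `D 0`, or it decreases on `[y, ∞)` and dominates its values far out. -/
lemma tTail_le_tTailBound {d : ℕ} (hd : 1 ≤ d) {y : ℝ} (hy : 0 ≤ y) :
    tTail d y ≤ tTailBound d y := by
  have hd' : (1 : ℝ) ≤ d := by exact_mod_cast hd
  set D : ℝ → ℝ := fun y => tTailBound d y - tTail d y with hD
  have hder : ∀ y, HasDerivAt D _ y :=
    fun y => (hasDerivAt_tTailBound hd y).sub (hasDerivAt_tTail hd y)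
  have hcont : Continuous D := continuous_iff_continuousAt.2 fun y => (hder y).continuousAt
  have hc0 : (0 : ℝ) ≤ (√(2 * Real.pi))⁻¹ := by positivity
  have hmono : ∀ a b : ℝ, 0 ≤ a → a ≤ b → (1 + b ^ 2)⁻¹ ≤ (1 + a ^ 2)⁻¹ := fun a b ha hab => by
    gcongr
  suffices 0 ≤ D y by simp only [hD] at this; linarith
  by_cases hs : 0 ≤ tLogRatio d (1 + y ^ 2)⁻¹
  · have hm : MonotoneOn D (Set.Icc 0 y) := by
      refine monotoneOn_of_deriv_nonneg (convex_Icc 0 y) hcont.continuousOn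
        (fun z _ => (hder z).differentiableAt.differentiableWithinAt) fun z hz => ?_
      rw [interior_Icc] at hz
      rw [(hder z).deriv]
      have := (tLogRatio_nonneg_iff hd z).1 (tLogRatio_nonneg_of_le hd (by positivity)
        (hmono z y hz.1.le hz.2.le) (inv_le_one_of_one_le₀ (by nlinarith [sq_nonneg z])) hs)
      have := mul_le_mul_of_nonneg_left this hc0
      linarith
    have h0 : D 0 = 0 := by simp [hD, tTail_zero, tTailBound, gtail_zero]
    rw [← h0]
    exact hm ⟨le_rfl, hy⟩ ⟨hy, le_rfl⟩ hy
  · have hm : AntitoneOn D (Set.Ici y) := by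
      refine antitoneOn_of_deriv_nonpos (convex_Ici y) hcont.continuousOn
        (fun z _ => (hder z).differentiableAt.differentiableWithinAt) fun z hz => ?_
      rw [interior_Ici] at hz
      rw [(hder z).deriv]
      have h1 : ¬ 0 ≤ tLogRatio d (1 + z ^ 2)⁻¹ := fun h => hs (tLogRatio_nonneg_of_le hd
        (by positivity) (hmono y z hy (le_of_lt hz))
        (inv_le_one_of_one_le₀ (by nlinarith [sq_nonneg y])) h)
      rw [tLogRatio_nonneg_iff hd, not_le] at h1
      have := mul_le_mul_of_nonneg_left h1.le hc0
      linarith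
    by_contra hneg
    rw [not_le] at hneg
    have h2 : ∀ z ∈ Set.Ici y, -tTail d z ≤ D y := fun z hz =>
      le_trans (by simp only [hD]; linarith [gtail_nonneg (√(d - 1 / 2 : ℝ) * z / √(1 + z ^ 2)),
        show tTailBound d z = gtail (√(d - 1 / 2 : ℝ) * z / √(1 + z ^ 2)) from rfl])
        (hm (Set.mem_Ici.2 le_rfl) hz hz)
    have h3 := le_of_tendsto (tendsto_tTail_atTop hd).neg
      ((Filter.eventually_ge_atTop y).mono fun z hz => h2 z hz)
    linarith


open WithLp in
lemma stdGaussian_cone_zero {d : ℕ} (y : ℝ) :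
    stdGaussian (EuclideanSpace ℝ (Fin (d + 1)))
      {g | y * ‖(toLp 2 (fun i : Fin d => g i.succ) : EuclideanSpace ℝ (Fin d))‖ < g 0} =
    ENNReal.ofReal (tTail d y) := by
  have hm : MeasurableSet {g : EuclideanSpace ℝ (Fin (d + 1)) |
      y * ‖(toLp 2 (fun i : Fin d => g i.succ) : EuclideanSpace ℝ (Fin d))‖ < g 0} := by
    refine measurableSet_lt ?_ ?_
    · exact (Continuous.measurable (by fun_prop))
    · exact (Continuous.measurable (by fun_prop))
  have hmp := measurePreserving_piFinSuccAbove (fun _ : Fin (d + 1) => gaussianReal 0 1) 0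
  set B : Set (ℝ × (Fin d → ℝ)) :=
    {q | y * ‖(toLp 2 q.2 : EuclideanSpace ℝ (Fin d))‖ < q.1} with hB
  have hBm : MeasurableSet B :=
    measurableSet_lt (Continuous.measurable (by fun_prop)) (Continuous.measurable (by fun_prop))
  rw [← map_pi_eq_stdGaussian, Measure.map_apply (by fun_prop) hm]
  have e : toLp 2 ⁻¹' {g : EuclideanSpace ℝ (Fin (d + 1)) |
      y * ‖(toLp 2 (fun i : Fin d => g i.succ) : EuclideanSpace ℝ (Fin d))‖ < g 0} =
      MeasurableEquiv.piFinSuccAbove (fun _ : Fin (d + 1) => ℝ) 0 ⁻¹' B := by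
    ext g
    rfl
  rw [e, hmp.measure_preimage hBm.nullMeasurableSet, Measure.prod_apply_symm hBm]
  have e2 : ∀ x : Fin d → ℝ, gaussianReal 0 1 ((fun z => (z, x)) ⁻¹' B) =
      ENNReal.ofReal (gtail (y * ‖(toLp 2 x : EuclideanSpace ℝ (Fin d))‖)) := by
    intro x
    rw [← gaussianReal_Ioi]
    rfl
  simp_rw [e2]
  rw [tTail, ← map_pi_eq_stdGaussian, integral_map (f := fun x : EuclideanSpace ℝ (Fin d) => gtail (y * ‖x‖))
      (by fun_prop) (continuous_gtail.comp (by fun_prop)).aestronglyMeasurable,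
    ofReal_integral_eq_lintegral_ofReal]
  · exact Integrable.of_bound (continuous_gtail.comp (by fun_prop)).aestronglyMeasurable 1
      (Filter.Eventually.of_forall fun x => norm_gtail_le _)
  · exact Filter.Eventually.of_forall fun x => gtail_nonneg _

/-- The exact normal bound for the tail of one coordinate of a uniform random direction. -/
lemma stdGaussian_inner_gt_le {n : ℕ} (hn : 2 ≤ n) (a : EuclideanSpace ℝ (Fin n)) (ha : ‖a‖ = 1)
    {y : ℝ} (hy : 0 ≤ y) :
    stdGaussian (EuclideanSpace ℝ (Fin n)) {g | y * ‖g‖ < inner ℝ a g} ≤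
      ENNReal.ofReal (gtail (√(n - 3 / 2 : ℝ) * y)) := by
  obtain ⟨d, rfl⟩ : ∃ d, n = d + 1 := ⟨n - 1, by omega⟩
  have hd : 1 ≤ d := by omega
  rcases le_or_gt 1 y with hy1 | hy1
  · have : {g : EuclideanSpace ℝ (Fin (d + 1)) | y * ‖g‖ < inner ℝ a g} = ∅ := by
      ext g
      simp only [Set.mem_ofPred_eq, Set.mem_empty_iff_false, iff_false, not_lt]
      have := real_inner_le_norm a g
      rw [ha, one_mul] at this
      nlinarith [norm_nonneg g]
    rw [this, measure_empty]
    exact zero_le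
  set e : EuclideanSpace ℝ (Fin (d + 1)) := EuclideanSpace.single 0 1
  have hae : ‖e‖ = ‖a‖ := by rw [ha]; simp [e]
  -- A reflection takes the first basis vector to `a` and preserves the Gaussian measure, so `a` may
  -- be taken to be that vector.
  set T : EuclideanSpace ℝ (Fin (d + 1)) ≃ₗᵢ[ℝ] EuclideanSpace ℝ (Fin (d + 1)) := (ℝ ∙ (e - a))ᗮ.reflection
  have hT : T e = a := Submodule.reflection_sub hae
  -- With `g'` the remaining coordinates, `y ‖g‖ < g₀` implies `w ‖g'‖ < g₀`. The comparison
  -- function then returns to `y`, because `w / √(1 + w²) = y`.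
  set w := y / √(1 - y ^ 2)
  have h1y : 0 < 1 - y ^ 2 := by nlinarith
  have hw0 : 0 ≤ w := by positivity
  have hw2 : w ^ 2 * (1 - y ^ 2) = y ^ 2 := by
    simp only [w]
    rw [div_pow, Real.sq_sqrt h1y.le]
    field_simp
  rw [← stdGaussian_map T, Measure.map_apply (by fun_prop)
    (measurableSet_lt (Continuous.measurable (by fun_prop)) (Continuous.measurable (by fun_prop)))]
  have hsub : T ⁻¹' {g : EuclideanSpace ℝ (Fin (d + 1)) | y * ‖g‖ < inner ℝ a g} ⊆
      {g | w * ‖(WithLp.toLp 2 (fun i : Fin d => g i.succ) : EuclideanSpace ℝ (Fin d))‖ < g 0} := by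
    intro g hg
    simp only [Set.mem_preimage, Set.mem_ofPred_eq] at hg ⊢
    rw [← hT, LinearIsometryEquiv.inner_map_map, LinearIsometryEquiv.norm_map] at hg
    have hi : inner ℝ e g = g 0 := by
      simp only [e, EuclideanSpace.inner_single_left]; simp
    rw [hi] at hg
    have hn2 : ‖g‖ ^ 2 = g 0 ^ 2 +
        ‖(WithLp.toLp 2 (fun i : Fin d => g i.succ) : EuclideanSpace ℝ (Fin d))‖ ^ 2 := by
      simp [EuclideanSpace.real_norm_sq_eq, Fin.sum_univ_succ]
    set ρ := ‖(WithLp.toLp 2 (fun i : Fin d => g i.succ) : EuclideanSpace ℝ (Fin d))‖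
    have hg0 : 0 < g 0 := lt_of_le_of_lt (by positivity) hg
    have hsq : y ^ 2 * ‖g‖ ^ 2 < g 0 ^ 2 := by
      rw [← mul_pow]; gcongr
    rw [hn2] at hsq
    refine lt_of_pow_lt_pow_left₀ 2 hg0.le ?_
    rw [mul_pow]
    refine lt_of_mul_lt_mul_right ?_ h1y.le
    calc w ^ 2 * ρ ^ 2 * (1 - y ^ 2) = y ^ 2 * ρ ^ 2 := by linear_combination ρ ^ 2 * hw2
      _ < _ := by linarith
  refine (measure_mono hsub).trans ?_
  rw [stdGaussian_cone_zero]
  refine ENNReal.ofReal_le_ofReal ((tTail_le_tTailBound hd hw0).trans (le_of_eq ?_))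
  rw [tTailBound]
  congr 1
  have h1 : √(1 + w ^ 2) * √(1 - y ^ 2) = 1 := by
    rw [← Real.sqrt_mul (by positivity), Real.sqrt_eq_one]
    nlinarith
  have h2 : w / √(1 + w ^ 2) = y := by
    have h3 : √(1 + w ^ 2) ≠ 0 := by positivity
    have h4 : √(1 - y ^ 2) ≠ 0 := by positivity
    rw [div_eq_iff h3]
    simp only [w] at h1 h3 ⊢
    rw [div_eq_iff h4, mul_assoc, h1, mul_one]
  rw [mul_div_assoc, h2]
  congr 2
  push_cast
  ring

end ScaledLasso
end

/-! ### Stein's identity and the Gaussian covariance inequality -/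

noncomputable section
namespace ScaledLasso

set_option linter.unusedSectionVars false
section concentration
variable {E : Type*} [NormedAddCommGroup E] [InnerProductSpace ℝ E] [FiniteDimensional ℝ E]
  [MeasurableSpace E] [BorelSpace E]

lemma integrable_stdGaussian_iff {h : E → ℝ} : Integrable h (stdGaussian E) ↔
    Integrable fun x => h x * Real.exp (-‖x‖ ^ 2 / 2) := by
  rw [stdGaussian_eq_withDensity, integrable_withDensity_iff_integrable_smul' (by fun_prop)
    (by simp)]
  have hp := gaussConst_pos (E := E)
  have e : (fun x : E => (ENNReal.ofReal ((gaussConst E)⁻¹ * Real.exp (-‖x‖ ^ 2 / 2))).toReal • h x)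
      = fun x => (gaussConst E)⁻¹ * (h x * Real.exp (-‖x‖ ^ 2 / 2)) := by
    ext x
    rw [ENNReal.toReal_ofReal (by positivity), smul_eq_mul]
    ring
  rw [e]
  exact integrable_const_mul_iff (IsUnit.mk0 _ (inv_ne_zero hp.ne')) _

lemma memLp_stdGaussian_of_le {h : E → ℝ} (hc : Continuous h) {a M : ℝ}
    (hb : ∀ x, |h x| ≤ a + M * ‖x‖) (p : ENNReal) (hp : p ≠ ⊤) : MemLp h p (stdGaussian E) := by
  have h1 : MemLp (fun x : E => ‖x‖) p (stdGaussian E) :=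
    (IsGaussian.memLp_id (stdGaussian E) p hp).norm
  refine ((memLp_const a).add (h1.const_mul M)).mono hc.aestronglyMeasurable
    (Filter.Eventually.of_forall fun x => ?_)
  simp only [Pi.add_apply, Real.norm_eq_abs]
  exact (hb x).trans (le_abs_self _)

lemma memLp_inner_stdGaussian (v : E) (p : ENNReal) (hp : p ≠ ⊤) :
    MemLp (fun w => inner ℝ v w) p (stdGaussian E) :=
  memLp_stdGaussian_of_le (by fun_prop) (a := 0) (M := ‖v‖)
    (fun x => by simpa using abs_real_inner_le_norm v x) p hp

lemma abs_le_of_fderiv_bound {G : E → ℝ} (hG : Differentiable ℝ G) {M : ℝ}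
    (hb : ∀ w, ‖fderiv ℝ G w‖ ≤ M) (x : E) : |G x| ≤ |G 0| + M * ‖x‖ := by
  have := Convex.norm_image_sub_le_of_norm_fderiv_le (𝕜 := ℝ) (f := G) (C := M) (s := Set.univ)
    (fun x _ => hG x) (fun x _ => hb x) convex_univ (Set.mem_univ 0) (Set.mem_univ x)
  rw [sub_zero, Real.norm_eq_abs] at this
  have h2 := abs_sub_abs_le_abs_sub (G x) (G 0)
  linarith

/-- Stein's identity for the standard Gaussian measure. -/
lemma stein_identity {G : E → ℝ} (hG : Differentiable ℝ G) (hc : Continuous (fderiv ℝ G)) {M : ℝ}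
    (hb : ∀ w, ‖fderiv ℝ G w‖ ≤ M) (v : E) :
    ∫ w, inner ℝ v w * G w ∂(stdGaussian E) = ∫ w, fderiv ℝ G w v ∂(stdGaussian E) := by
  set ρ : E → ℝ := fun w => Real.exp (-‖w‖ ^ 2 / 2) with hρ
  have hρd : ∀ w, HasFDerivAt ρ ((ρ w) • (-(innerSL ℝ w))) w := by
    intro w
    have h1 := (((hasStrictFDerivAt_norm_sq w).hasFDerivAt).neg.mul_const (2⁻¹ : ℝ)).exp
    have e : ρ = fun x => Real.exp ((-fun x : E => ‖x‖ ^ 2) x * 2⁻¹) := by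
      ext x; simp only [hρ, Pi.neg_apply, div_eq_mul_inv]
    rw [e]
    refine h1.congr_fderiv ?_
    ext x
    simp
  have hρf : ∀ w, fderiv ℝ ρ w v = -(inner ℝ v w * ρ w) := by
    intro w
    rw [(hρd w).fderiv]
    simp [real_inner_comm v w, mul_comm]
  have hGc : Continuous G := hG.continuous
  have hg := abs_le_of_fderiv_bound hG hb
  have hfv : Continuous fun w => fderiv ℝ G w v := hc.clm_apply continuous_const
  have hGi : MemLp G 2 (stdGaussian E) := memLp_stdGaussian_of_le hGc hg 2 (by simp)
  have i1 : Integrable (fun w => fderiv ℝ G w v * ρ w) := by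
    refine integrable_stdGaussian_iff.1 (Integrable.of_bound hfv.aestronglyMeasurable (M * ‖v‖)
      (Filter.Eventually.of_forall fun w => ?_))
    exact (ContinuousLinearMap.le_opNorm _ _).trans (by gcongr; exact hb w)
  have i2 : Integrable (fun w => G w * ρ w) :=
    integrable_stdGaussian_iff.1 (hGi.integrable one_le_two)
  have i3' : Integrable (fun w => G w * inner ℝ v w) (stdGaussian E) :=
    hGi.integrable_mul (memLp_inner_stdGaussian v 2 (by simp))
  have i3 : Integrable (fun w => G w * fderiv ℝ ρ w v) := by
    refine (integrable_stdGaussian_iff.1 i3').neg.congr (Filter.Eventually.of_forall fun w => ?_)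
    simp only [Pi.neg_apply, hρf]
    ring
  -- Integration by parts against the density `ρ`, whose derivative along `v` is `-⟪v, w⟫ ρ w`.
  have h := integral_mul_fderiv_eq_neg_fderiv_mul_of_integrable i1 i3 i2 (fun x _ => hG x)
    (fun x _ => (hρd x).differentiableAt)
  rw [integral_stdGaussian, integral_stdGaussian]
  congr 1
  simp_rw [hρf] at h
  have e1 : ∫ x, G x * -(inner ℝ v x * ρ x) = -∫ x, Real.exp (-‖x‖ ^ 2 / 2) * (inner ℝ v x * G x) := by
    rw [← integral_neg]
    congr 1; ext x; simp only [hρ]; ring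
  rw [e1, neg_inj] at h
  rw [h]
  congr 1; ext x; simp only [hρ]; ring

lemma map_rotation_stdGaussian (θ : ℝ) :
    ((stdGaussian E).prod (stdGaussian E)).map (ContinuousLinearMap.rotation θ) =
      (stdGaussian E).prod (stdGaussian E) :=
  IsGaussian.map_rotation_eq_self (by simp) θ

/-- The Gaussian covariance inequality `E (f - E f) ψ(f) ≤ E ψ'(f)` for smooth functions. -/
lemma gaussian_covariance_le {f : E → ℝ} (hf : Differentiable ℝ f) (hfc : Continuous (fderiv ℝ f))
    (hb : ∀ w, ‖fderiv ℝ f w‖ ≤ 1) {ψ ψ' : ℝ → ℝ} (hψ : ∀ x, HasDerivAt ψ (ψ' x) x)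
    (hψc : Continuous ψ') (h0 : ∀ x, 0 ≤ ψ' x) {M : ℝ} (hM : ∀ x, ψ' x ≤ M) :
    ∫ x, f x * ψ (f x) ∂(stdGaussian E) -
      (∫ x, f x ∂(stdGaussian E)) * ∫ x, ψ (f x) ∂(stdGaussian E) ≤
      ∫ x, ψ' (f x) ∂(stdGaussian E) := by
  set γ := stdGaussian E
  have hψcont : Continuous ψ := continuous_iff_continuousAt.2 fun x => (hψ x).continuousAt
  have hfcont := hf.continuous
  have hfg := abs_le_of_fderiv_bound hf hb
  have hH : ∀ x, HasFDerivAt (fun x => ψ (f x)) (ψ' (f x) • fderiv ℝ f x) x := fun x =>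
    (hψ (f x)).comp_hasFDerivAt x (hf x).hasFDerivAt
  have hHd : Differentiable ℝ fun x => ψ (f x) := fun x => (hH x).differentiableAt
  have hM0 : 0 ≤ M := (h0 0).trans (hM 0)
  have hHb : ∀ x, ‖fderiv ℝ (fun x => ψ (f x)) x‖ ≤ M := fun x => by
    rw [(hH x).fderiv, norm_smul, Real.norm_of_nonneg (h0 _)]
    calc _ ≤ M * 1 := mul_le_mul (hM _) (hb x) (norm_nonneg _) hM0
      _ = M := mul_one M
  have hHc : Continuous (fderiv ℝ fun x => ψ (f x)) := by
    have : (fderiv ℝ fun x => ψ (f x)) = fun x => ψ' (f x) • fderiv ℝ f x :=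
      funext fun x => (hH x).fderiv
    rw [this]
    exact (hψc.comp hfcont).smul hfc
  have hHg := abs_le_of_fderiv_bound hHd hHb
  have hn2 : MemLp (fun x : E => ‖x‖) 2 γ := (IsGaussian.memLp_id γ 2 (by simp)).norm
  have hf2 : MemLp f 2 γ := memLp_stdGaussian_of_le hfcont hfg 2 (by simp)
  have hH2 : MemLp (fun x => ψ (f x)) 2 γ :=
    memLp_stdGaussian_of_le (hψcont.comp hfcont) hHg 2 (by simp)
  -- Interpolation by rotation between two independent copies: the expectation of `k θ` is the
  -- product of the means at `θ = 0` and the mean of the product at `θ = π / 2`.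
  set k : ℝ → E × E → ℝ := fun θ p => f (Real.cos θ • p.1 + Real.sin θ • p.2) * ψ (f p.2) with hk
  set k' : ℝ → E × E → ℝ := fun θ p => fderiv ℝ f (Real.cos θ • p.1 + Real.sin θ • p.2)
    (-Real.sin θ • p.1 + Real.cos θ • p.2) * ψ (f p.2) with hk'
  have hkc : ∀ θ, Continuous (k θ) := fun θ => by
    simp only [hk]
    exact (hfcont.comp (by fun_prop)).mul (hψcont.comp (hfcont.comp continuous_snd))
  have hk'c : ∀ θ, Continuous (k' θ) := fun θ => by
    simp only [hk']
    exact ((hfc.comp (by fun_prop)).clm_apply (by fun_prop)).mul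
      (hψcont.comp (hfcont.comp continuous_snd))
  have hA2 : MemLp (fun p : E × E => ‖p.1‖ + ‖p.2‖) 2 (γ.prod γ) :=
    (hn2.comp_fst γ).add (hn2.comp_snd γ)
  have hB2 : MemLp (fun p : E × E => |ψ (f p.2)|) 2 (γ.prod γ) := (hH2.comp_snd γ).norm
  have hbd : Integrable (fun p : E × E => (‖p.1‖ + ‖p.2‖) * |ψ (f p.2)|) (γ.prod γ) :=
    hA2.integrable_mul hB2
  have hcs : ∀ θ (p : E × E), ‖Real.cos θ • p.1 + Real.sin θ • p.2‖ ≤ ‖p.1‖ + ‖p.2‖ := by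
    intro θ p
    refine (norm_add_le _ _).trans ?_
    rw [norm_smul, norm_smul]
    have h1 : ‖Real.cos θ‖ ≤ 1 := Real.abs_cos_le_one θ
    have h2 : ‖Real.sin θ‖ ≤ 1 := Real.abs_sin_le_one θ
    nlinarith [norm_nonneg p.1, norm_nonneg p.2]
  have hcs' : ∀ θ (p : E × E), ‖-Real.sin θ • p.1 + Real.cos θ • p.2‖ ≤ ‖p.1‖ + ‖p.2‖ := by
    intro θ p
    refine (norm_add_le _ _).trans ?_
    rw [norm_smul, norm_smul, norm_neg]
    have h1 : ‖Real.cos θ‖ ≤ 1 := Real.abs_cos_le_one θ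
    have h2 : ‖Real.sin θ‖ ≤ 1 := Real.abs_sin_le_one θ
    nlinarith [norm_nonneg p.1, norm_nonneg p.2]
  have hk'b : ∀ θ p, ‖k' θ p‖ ≤ (‖p.1‖ + ‖p.2‖) * |ψ (f p.2)| := by
    intro θ p
    simp only [hk', norm_mul, Real.norm_eq_abs]
    refine mul_le_mul_of_nonneg_right ?_ (abs_nonneg _)
    refine ((fderiv ℝ f (Real.cos θ • p.1 + Real.sin θ • p.2)).le_opNorm _).trans ?_
    calc _ ≤ 1 * (‖p.1‖ + ‖p.2‖) := mul_le_mul (hb _) (hcs' θ p) (norm_nonneg _) zero_le_one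
      _ = _ := one_mul _
  have hki : ∀ θ, Integrable (k θ) (γ.prod γ) := by
    intro θ
    refine ((hB2.integrable one_le_two).const_mul |f 0| |>.add hbd).mono'
      (hkc θ).aestronglyMeasurable (Filter.Eventually.of_forall fun p => ?_)
    simp only [hk, Pi.add_apply, Real.norm_eq_abs, abs_mul]
    rw [← add_mul]
    refine mul_le_mul_of_nonneg_right ((hfg _).trans ?_) (abs_nonneg _)
    linarith [hcs θ p]
  have hderiv : ∀ θ, HasDerivAt (fun θ => ∫ p, k θ p ∂(γ.prod γ)) (∫ p, k' θ p ∂(γ.prod γ)) θ := by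
    intro θ
    refine (hasDerivAt_integral_of_dominated_loc_of_deriv_le (s := Set.univ) Filter.univ_mem
      (Filter.Eventually.of_forall fun θ => (hkc θ).aestronglyMeasurable) (hki θ)
      (hk'c θ).aestronglyMeasurable (Filter.Eventually.of_forall fun p θ _ => hk'b θ p) hbd
      (Filter.Eventually.of_forall fun p θ _ => ?_)).2
    have h1 : HasDerivAt (fun θ => Real.cos θ • p.1 + Real.sin θ • p.2)
        (-Real.sin θ • p.1 + Real.cos θ • p.2) θ :=
      ((Real.hasDerivAt_cos θ).smul_const p.1).add ((Real.hasDerivAt_sin θ).smul_const p.2)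
    exact ((hf _).hasFDerivAt.comp_hasDerivAt θ h1).mul_const _
  -- The pair `z = cos θ • p.1 + sin θ • p.2`, `w = -sin θ • p.1 + cos θ • p.2` is again independent
  -- standard Gaussian, and `p.2 = sin θ • z + cos θ • w`. For fixed `z`, Stein's identity in `w`
  -- turns the linear factor `fderiv ℝ f z w` into a derivative of `ψ (f p.2)`. This produces `cos θ
  -- ψ'` times a product of two gradients of norm at most one.
  have hle : ∀ θ, 0 ≤ Real.cos θ → ∫ p, k' θ p ∂(γ.prod γ) ≤ Real.cos θ * ∫ x, ψ' (f x) ∂γ := by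
    intro θ hθ
    set q : E × E → ℝ := fun p => fderiv ℝ f p.1 p.2 *
      ψ (f (Real.sin θ • p.1 + Real.cos θ • p.2)) with hq
    have hqc : Continuous q := by
      simp only [hq]
      exact ((hfc.comp continuous_fst).clm_apply continuous_snd).mul
        (hψcont.comp (hfcont.comp (by fun_prop)))
    have hrot : ∀ p : E × E, Real.sin θ • (Real.cos θ • p.1 + Real.sin θ • p.2) +
        Real.cos θ • (-Real.sin θ • p.1 + Real.cos θ • p.2) = p.2 := by
      intro p
      have := Real.sin_sq_add_cos_sq θ
      calc _ = (Real.sin θ ^ 2 + Real.cos θ ^ 2) • p.2 := by module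
        _ = p.2 := by rw [this, one_smul]
    have hqk : ∀ p, k' θ p = q (ContinuousLinearMap.rotation θ p) := by
      intro p
      simp only [hk', hq, ContinuousLinearMap.rotation_apply, hrot]
    have hmap : ∀ g : E × E → ℝ, Continuous g → ∫ p, g (ContinuousLinearMap.rotation θ p) ∂(γ.prod γ)
        = ∫ p, g p ∂(γ.prod γ) := by
      intro g hg
      have h := integral_map (μ := γ.prod γ) (φ := ContinuousLinearMap.rotation θ) (f := g)
        (by fun_prop) hg.aestronglyMeasurable
      rw [map_rotation_stdGaussian] at h
      exact h.symm
    have hqi : Integrable q (γ.prod γ) := by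
      have h1 : Integrable (fun p => q (ContinuousLinearMap.rotation θ p)) (γ.prod γ) :=
        hbd.mono' (by
          exact (hqc.comp (ContinuousLinearMap.rotation θ).continuous).aestronglyMeasurable)
          (Filter.Eventually.of_forall fun p => by rw [← hqk]; exact hk'b θ p)
      rw [← map_rotation_stdGaussian θ]
      exact (integrable_map_measure hqc.aestronglyMeasurable (by fun_prop)).2 h1
    set r : E × E → ℝ := fun p => Real.cos θ * ψ' (f (Real.sin θ • p.1 + Real.cos θ • p.2)) with hr
    have hrc : Continuous r := by
      simp only [hr]
      exact continuous_const.mul (hψc.comp (hfcont.comp (by fun_prop)))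
    have hri : Integrable r (γ.prod γ) := by
      refine Integrable.of_bound hrc.aestronglyMeasurable (Real.cos θ * M)
        (Filter.Eventually.of_forall fun p => ?_)
      rw [Real.norm_of_nonneg (mul_nonneg hθ (h0 _))]
      exact mul_le_mul_of_nonneg_left (hM _) hθ
    have hinner : ∀ z, ∫ w, q (z, w) ∂γ ≤ ∫ w, r (z, w) ∂γ := by
      intro z
      set v := (InnerProductSpace.toDual ℝ E).symm (fderiv ℝ f z) with hv
      have hvin : ∀ w, fderiv ℝ f z w = inner ℝ v w := fun w => by
        rw [hv, InnerProductSpace.toDual_symm_apply]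
      have hvn : ‖v‖ ≤ 1 := by rw [hv, LinearIsometryEquiv.norm_map]; exact hb z
      set G : E → ℝ := fun w => ψ (f (Real.sin θ • z + Real.cos θ • w)) with hGdef
      have hGd : ∀ w, HasFDerivAt G (Real.cos θ •
          fderiv ℝ (fun x => ψ (f x)) (Real.sin θ • z + Real.cos θ • w)) w := by
        intro w
        have h1 : HasFDerivAt (fun w : E => Real.sin θ • z + Real.cos θ • w)
            (Real.cos θ • ContinuousLinearMap.id ℝ E) w :=
          ((hasFDerivAt_id w).const_smul (Real.cos θ)).const_add _
        refine ((hHd _).hasFDerivAt.comp w h1).congr_fderiv ?_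
        ext x
        simp
      have hGf : ∀ w, fderiv ℝ G w = Real.cos θ •
          fderiv ℝ (fun x => ψ (f x)) (Real.sin θ • z + Real.cos θ • w) := fun w => (hGd w).fderiv
      have hGc : Continuous (fderiv ℝ G) := by
        rw [show fderiv ℝ G = _ from funext hGf]
        exact (continuous_const (y := Real.cos θ)).smul
          (hHc.comp (by fun_prop : Continuous fun w : E => Real.sin θ • z + Real.cos θ • w))
      have hGb : ∀ w, ‖fderiv ℝ G w‖ ≤ Real.cos θ * M := fun w => by
        rw [hGf, norm_smul, Real.norm_of_nonneg hθ]
        exact mul_le_mul_of_nonneg_left (hHb _) hθ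
      have hst := stein_identity (fun w => (hGd w).differentiableAt) hGc hGb v
      have e1 : ∫ w, q (z, w) ∂γ = ∫ w, inner ℝ v w * G w ∂γ := by
        refine integral_congr_ae (Filter.Eventually.of_forall fun w => ?_)
        simp only [hq, hvin, hGdef]
      rw [e1, hst]
      refine integral_mono ?_ ?_ fun w => ?_
      · refine Integrable.of_bound (hGc.clm_apply continuous_const).aestronglyMeasurable
          (Real.cos θ * M * ‖v‖) (Filter.Eventually.of_forall fun w => ?_)
        exact (ContinuousLinearMap.le_opNorm _ _).trans (by gcongr; exact hGb w)
      · refine Integrable.of_bound (by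
          exact (hrc.comp (by fun_prop : Continuous fun w : E => (z, w))).aestronglyMeasurable)
          (Real.cos θ * M) (Filter.Eventually.of_forall fun p => ?_)
        rw [Real.norm_of_nonneg (mul_nonneg hθ (h0 _))]
        exact mul_le_mul_of_nonneg_left (hM _) hθ
      · rw [hGf, (hH _).fderiv]
        simp only [smul_apply, smul_eq_mul, hr]
        refine mul_le_mul_of_nonneg_left ?_ hθ
        have h1 : fderiv ℝ f (Real.sin θ • z + Real.cos θ • w) v ≤ 1 := by
          refine (Real.le_norm_self _).trans ((ContinuousLinearMap.le_opNorm _ _).trans ?_)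
          calc _ ≤ 1 * 1 := mul_le_mul (hb _) hvn (norm_nonneg _) zero_le_one
            _ = 1 := one_mul 1
        calc _ ≤ ψ' (f (Real.sin θ • z + Real.cos θ • w)) * 1 :=
              mul_le_mul_of_nonneg_left h1 (h0 _)
          _ = _ := mul_one _
    calc ∫ p, k' θ p ∂(γ.prod γ) = ∫ p, q (ContinuousLinearMap.rotation θ p) ∂(γ.prod γ) := by
          simp_rw [hqk]
      _ = ∫ p, q p ∂(γ.prod γ) := hmap q hqc
      _ = ∫ z, ∫ w, q (z, w) ∂γ ∂γ := integral_prod _ hqi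
      _ ≤ ∫ z, ∫ w, r (z, w) ∂γ ∂γ :=
          integral_mono hqi.integral_prod_left hri.integral_prod_left hinner
      _ = ∫ p, r p ∂(γ.prod γ) := (integral_prod _ hri).symm
      _ = ∫ p, r (ContinuousLinearMap.rotation θ p) ∂(γ.prod γ) := (hmap r hrc).symm
      _ = ∫ p, Real.cos θ * ψ' (f p.2) ∂(γ.prod γ) := by
          refine integral_congr_ae (Filter.Eventually.of_forall fun p => ?_)
          simp only [hr, ContinuousLinearMap.rotation_apply, hrot]
      _ = Real.cos θ * ∫ x, ψ' (f x) ∂γ := by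
          rw [integral_const_mul]
          congr 1
          have := integral_fun_snd (μ := γ) (ν := γ) (fun x : E => ψ' (f x))
          simpa using this
  -- Integrating `cos θ` over `[0, π / 2]` gives the total factor one.
  have hanti : AntitoneOn (fun θ => ∫ p, k θ p ∂(γ.prod γ) - Real.sin θ * ∫ x, ψ' (f x) ∂γ)
      (Set.Icc 0 (Real.pi / 2)) := by
    have hd := fun θ => (hderiv θ).sub ((Real.hasDerivAt_sin θ).mul_const (∫ x, ψ' (f x) ∂γ))
    refine antitoneOn_of_deriv_nonpos (convex_Icc _ _)
      (fun θ _ => (hd θ).continuousAt.continuousWithinAt)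
      (fun θ _ => (hd θ).differentiableAt.differentiableWithinAt) fun θ hθ => ?_
    rw [interior_Icc] at hθ
    have e : deriv (fun θ => ∫ p, k θ p ∂(γ.prod γ) - Real.sin θ * ∫ x, ψ' (f x) ∂γ) θ = _ :=
      (hd θ).deriv
    rw [e]
    have := hle θ (Real.cos_nonneg_of_mem_Icc ⟨by linarith [hθ.1, Real.pi_pos], hθ.2.le⟩)
    linarith
  have hpi : (0 : ℝ) ≤ Real.pi / 2 := by positivity
  have h := hanti ⟨le_rfl, hpi⟩ ⟨hpi, le_rfl⟩ hpi
  simp only [Real.sin_pi_div_two, one_mul, Real.sin_zero, zero_mul, sub_zero] at h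
  have e1 : ∫ p, k (Real.pi / 2) p ∂(γ.prod γ) = ∫ x, f x * ψ (f x) ∂γ := by
    simp only [hk, Real.sin_pi_div_two, Real.cos_pi_div_two, zero_smul, one_smul, zero_add]
    have := integral_fun_snd (μ := γ) (ν := γ) (fun x : E => f x * ψ (f x))
    simpa using this
  have e2 : ∫ p, k 0 p ∂(γ.prod γ) = (∫ x, f x ∂γ) * ∫ x, ψ (f x) ∂γ := by
    simp only [hk, Real.sin_zero, Real.cos_zero, zero_smul, one_smul, add_zero]
    exact integral_prod_mul f (fun x => ψ (f x))
  rw [e1, e2] at h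
  linarith

end concentration
end ScaledLasso
end

/-! ### Gaussian concentration with a sharp polynomial factor -/

noncomputable section
namespace ScaledLasso

/-- A truncation of `x₊ exp(x² / 2)`. -/
def truncExp (t δ x : ℝ) : ℝ :=
  max x 0 * Real.exp (x ^ 2 / 2) * max 0 (min 1 ((t - x) / δ))

/-- The primitive of `truncExp`. -/
def truncExpInt (t δ x : ℝ) : ℝ := ∫ y in (0 : ℝ)..x, truncExp t δ y

lemma continuous_truncExp (t δ : ℝ) : Continuous (truncExp t δ) := by
  unfold truncExp; fun_prop

lemma truncExp_nonneg (t δ x : ℝ) : 0 ≤ truncExp t δ x := by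
  unfold truncExp; positivity

lemma truncExp_le {t δ : ℝ} (hδ : 0 < δ) (ht : 0 ≤ t) (x : ℝ) :
    truncExp t δ x ≤ t * Real.exp (t ^ 2 / 2) := by
  have h1 : max 0 (min 1 ((t - x) / δ)) ≤ 1 := max_le zero_le_one (min_le_left _ _)
  rcases le_or_gt x 0 with hx | hx
  · rw [truncExp, max_eq_right hx]; simp; positivity
  rcases le_or_gt t x with hxt | hxt
  · have : (t - x) / δ ≤ 0 := div_nonpos_of_nonpos_of_nonneg (by linarith) hδ.le
    rw [truncExp, max_eq_left (a := 0) ((min_le_right _ _).trans this), mul_zero]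
    positivity
  · rw [truncExp, max_eq_left hx.le]
    calc _ ≤ x * Real.exp (x ^ 2 / 2) * 1 := by gcongr
      _ ≤ t * Real.exp (t ^ 2 / 2) := by rw [mul_one]; gcongr

lemma hasDerivAt_truncExpInt (t δ x : ℝ) : HasDerivAt (truncExpInt t δ) (truncExp t δ x) x :=
  intervalIntegral.integral_hasDerivAt_right ((continuous_truncExp t δ).intervalIntegrable _ _)
    (continuous_truncExp t δ).stronglyMeasurable.stronglyMeasurableAtFilter
    (continuous_truncExp t δ).continuousAt

lemma monotone_truncExpInt (t δ : ℝ) : Monotone (truncExpInt t δ) :=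
  monotone_of_deriv_nonneg (fun x => (hasDerivAt_truncExpInt t δ x).differentiableAt)
    fun x => by rw [(hasDerivAt_truncExpInt t δ x).deriv]; exact truncExp_nonneg t δ x

lemma truncExpInt_zero (t δ : ℝ) : truncExpInt t δ 0 = 0 := intervalIntegral.integral_same

lemma truncExpInt_eq {t δ x : ℝ} (hδ : 0 < δ) (h0 : 0 ≤ x) (hx : x ≤ t - δ) :
    truncExpInt t δ x = Real.exp (x ^ 2 / 2) - 1 := by
  have h : truncExpInt t δ x = ∫ y in (0 : ℝ)..x, y * Real.exp (y ^ 2 / 2) := by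
    refine intervalIntegral.integral_congr fun y hy => ?_
    rw [Set.uIcc_of_le h0] at hy
    have h1 : 1 ≤ (t - y) / δ := by rw [le_div_iff₀ hδ]; linarith [hy.2]
    simp only [truncExp]
    rw [max_eq_left hy.1, min_eq_left h1, max_eq_right zero_le_one, mul_one]
  rw [h, intervalIntegral.integral_eq_sub_of_hasDerivAt (f := fun y => Real.exp (y ^ 2 / 2))]
  · simp
  · intro y _
    refine ((hasDerivAt_pow 2 y).div_const 2).exp.congr_deriv ?_
    simp; ring
  · exact (by fun_prop : Continuous fun y : ℝ => y * Real.exp (y ^ 2 / 2)).intervalIntegrable _ _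

/-- For `ψ = exp (x² / 2) - 1` one has `x ψ - ψ' = -x`. The truncation keeps this up to `t - δ` and
stops `ψ` from growing beyond `t`, so that past `t` the left side gains `t exp ((t - δ)² / 2)`; the
transition costs the increment of the exponential over `[t - δ, t]`. The quadratic equals `(x + 1)²
/ 4`, an upper bound for `x` and for `0` whose mean is at most `1/2` when `x` is centred with
variance at most one. -/
lemma truncExp_key {t δ : ℝ} (hδ : 0 < δ) (hδt : δ ≤ t) (x : ℝ) :
    (Set.Ici t).indicator (fun _ => t * Real.exp ((t - δ) ^ 2 / 2)) x -
      (1 + (Real.exp (t ^ 2 / 2) - Real.exp ((t - δ) ^ 2 / 2))) * ((x + (x ^ 2 + 1) / 2) / 2) ≤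
    x * truncExpInt t δ x - truncExp t δ x := by
  set κ := Real.exp (t ^ 2 / 2) - Real.exp ((t - δ) ^ 2 / 2) with hκ
  have hκ0 : 0 ≤ κ := by
    rw [hκ, sub_nonneg]; gcongr; linarith
  have hq : 0 ≤ (x + (x ^ 2 + 1) / 2) / 2 := by nlinarith [sq_nonneg (x + 1)]
  have hqx : x ≤ (x + (x ^ 2 + 1) / 2) / 2 := by nlinarith [sq_nonneg (x - 1)]
  rcases le_or_gt x 0 with hx | hx
  · have h1 : truncExp t δ x = 0 := by rw [truncExp, max_eq_right hx]; simp
    have h2 := monotone_truncExpInt t δ hx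
    rw [truncExpInt_zero] at h2
    rw [h1, Set.indicator_of_notMem (by rw [Set.mem_Ici]; linarith)]
    nlinarith [mul_nonneg_of_nonpos_of_nonpos hx h2]
  · have hB : (1 + κ) * x ≤ (1 + κ) * ((x + (x ^ 2 + 1) / 2) / 2) :=
      mul_le_mul_of_nonneg_left hqx (by linarith)
    have hle : truncExp t δ x ≤ x * Real.exp (x ^ 2 / 2) := by
      rw [truncExp, max_eq_left hx.le]
      have : max 0 (min 1 ((t - x) / δ)) ≤ 1 := max_le zero_le_one (min_le_left _ _)
      calc _ ≤ x * Real.exp (x ^ 2 / 2) * 1 := by gcongr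
        _ = _ := mul_one _
    rcases le_or_gt x (t - δ) with hxt | hxt
    · rw [truncExpInt_eq hδ hx.le hxt, Set.indicator_of_notMem (by rw [Set.mem_Ici]; linarith)]
      nlinarith
    · have h1 := monotone_truncExpInt t δ hxt.le
      rw [truncExpInt_eq hδ (by linarith) le_rfl] at h1
      have h2 := mul_le_mul_of_nonneg_left h1 hx.le
      rcases le_or_gt t x with hxt' | hxt'
      · have h3 : truncExp t δ x = 0 := by
          have : (t - x) / δ ≤ 0 := div_nonpos_of_nonpos_of_nonneg (by linarith) hδ.le
          rw [truncExp, max_eq_left (a := 0) ((min_le_right _ _).trans this), mul_zero]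
        rw [h3, Set.indicator_of_mem (Set.mem_Ici.2 hxt')]
        have := Real.exp_pos ((t - δ) ^ 2 / 2)
        nlinarith
      · rw [Set.indicator_of_notMem (by rw [Set.mem_Ici]; linarith)]
        have h4 : Real.exp (x ^ 2 / 2) ≤ Real.exp (t ^ 2 / 2) := by gcongr
        have h5 := mul_le_mul_of_nonneg_left h4 hx.le
        nlinarith

set_option linter.unusedSectionVars false
section concentration
variable {E : Type*} [NormedAddCommGroup E] [InnerProductSpace ℝ E] [FiniteDimensional ℝ E]
  [MeasurableSpace E] [BorelSpace E]

/-- The covariance inequality with `ψ = id`. -/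
lemma integral_sub_mean_sq_le_of_smooth {f : E → ℝ} (hf : Differentiable ℝ f)
    (hfc : Continuous (fderiv ℝ f)) (hb : ∀ w, ‖fderiv ℝ f w‖ ≤ 1) :
    ∫ x, (f x - ∫ y, f y ∂(stdGaussian E)) ^ 2 ∂(stdGaussian E) ≤ 1 := by
  set m := ∫ y, f y ∂(stdGaussian E) with hm
  have hfg := abs_le_of_fderiv_bound hf hb
  have hf2 : MemLp f 2 (stdGaussian E) := memLp_stdGaussian_of_le hf.continuous hfg 2 (by simp)
  have h := gaussian_covariance_le hf hfc hb (ψ := id) (ψ' := fun _ => 1) (M := 1)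
    (fun x => hasDerivAt_id x) continuous_const (fun _ => zero_le_one) (fun _ => le_rfl)
  simp only [id] at h
  have e : ∀ x, (f x - m) ^ 2 = f x * f x - 2 * m * f x + m ^ 2 := fun x => by ring
  have i1 : Integrable (fun x => f x * f x) (stdGaussian E) := hf2.integrable_mul hf2
  have i2 : Integrable (fun x => 2 * m * f x) (stdGaussian E) :=
    (hf2.integrable one_le_two).const_mul _
  simp_rw [e]
  rw [integral_add (by exact i1.sub i2) (integrable_const _), integral_sub i1 i2,
    integral_const_mul, ← hm]
  simp only [integral_const, probReal_univ, smul_eq_mul, one_mul] at h ⊢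
  rw [← hm] at h
  nlinarith

/-- The covariance inequality for the centred function `g` and `ψ = truncExpInt t δ` says that the
mean of `g ψ(g) - ψ'(g)` is at most `0`. `truncExp_key` bounds it from below by the deviation
probability minus a quadratic whose mean is controlled by the Poincaré inequality. -/
lemma measureReal_ge_le_of_smooth {f : E → ℝ} (hf : Differentiable ℝ f)
    (hfc : Continuous (fderiv ℝ f)) (hb : ∀ w, ‖fderiv ℝ f w‖ ≤ 1) {t : ℝ} (ht : 0 < t) :
    t * Real.exp (t ^ 2 / 2) *
      (stdGaussian E).real {x | ∫ y, f y ∂(stdGaussian E) + t ≤ f x} ≤ 1 / 2 := by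
  set m := ∫ y, f y ∂(stdGaussian E) with hm
  have hfg := abs_le_of_fderiv_bound hf hb
  have hf2 : MemLp f 2 (stdGaussian E) := memLp_stdGaussian_of_le hf.continuous hfg 2 (by simp)
  have hfi := hf2.integrable one_le_two
  set g : E → ℝ := fun x => f x - m with hg
  have hgd : Differentiable ℝ g := hf.sub_const m
  have hgf : fderiv ℝ g = fderiv ℝ f := by ext1 x; simp [hg, fderiv_sub_const]
  have hg2 : MemLp g 2 (stdGaussian E) := hf2.sub (memLp_const m)
  have hgi := hg2.integrable one_le_two
  have hgm : ∫ x, g x ∂(stdGaussian E) = 0 := by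
    simp only [hg]
    rw [integral_sub hfi (integrable_const m)]
    simp [hm]
  have hvar : ∫ x, g x ^ 2 ∂(stdGaussian E) ≤ 1 := integral_sub_mean_sq_le_of_smooth hf hfc hb
  have hset : {x | m + t ≤ f x} = g ⁻¹' Set.Ici t := by
    ext x; simp only [hg, Set.mem_ofPred_eq, Set.mem_preimage, Set.mem_Ici]
    constructor <;> intro h <;> linarith
  have hsm : MeasurableSet (g ⁻¹' Set.Ici t) := hgd.continuous.measurable measurableSet_Ici
  rw [hset]
  set p := (stdGaussian E).real (g ⁻¹' Set.Ici t)
  have key : ∀ δ, 0 < δ → δ ≤ t → t * Real.exp ((t - δ) ^ 2 / 2) * p ≤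
      (1 + (Real.exp (t ^ 2 / 2) - Real.exp ((t - δ) ^ 2 / 2))) * (1 / 2) := by
    intro δ hδ hδt
    set κ := Real.exp (t ^ 2 / 2) - Real.exp ((t - δ) ^ 2 / 2) with hκ
    have hκ0 : 0 ≤ κ := by rw [hκ, sub_nonneg]; gcongr; linarith
    have h := gaussian_covariance_le hgd (by rw [hgf]; exact hfc) (by rw [hgf]; exact hb)
      (hasDerivAt_truncExpInt t δ) (continuous_truncExp t δ) (truncExp_nonneg t δ)
      (truncExp_le hδ ht.le)
    rw [hgm, zero_mul, sub_zero] at h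
    have hψd : ∀ x, HasFDerivAt (fun x => truncExpInt t δ (g x))
        (truncExp t δ (g x) • fderiv ℝ g x) x := fun x =>
      (hasDerivAt_truncExpInt t δ (g x)).comp_hasFDerivAt x (hgd x).hasFDerivAt
    have hM : 0 ≤ t * Real.exp (t ^ 2 / 2) := by positivity
    have hψ2 : MemLp (fun x => truncExpInt t δ (g x)) 2 (stdGaussian E) := by
      refine memLp_stdGaussian_of_le
        (Differentiable.continuous (𝕜 := ℝ) fun x => (hψd x).differentiableAt)
        (abs_le_of_fderiv_bound (M := t * Real.exp (t ^ 2 / 2))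
          (fun x => (hψd x).differentiableAt) fun x => ?_) 2 (by simp)
      rw [(hψd x).fderiv, norm_smul, Real.norm_of_nonneg (truncExp_nonneg _ _ _), hgf]
      calc _ ≤ t * Real.exp (t ^ 2 / 2) * 1 :=
            mul_le_mul (truncExp_le hδ ht.le _) (hb x) (norm_nonneg _) hM
        _ = _ := mul_one _
    have i1 : Integrable (fun x => g x * truncExpInt t δ (g x)) (stdGaussian E) :=
      hg2.integrable_mul hψ2
    have i2 : Integrable (fun x => truncExp t δ (g x)) (stdGaussian E) :=
      Integrable.of_bound ((continuous_truncExp t δ).comp hgd.continuous).aestronglyMeasurable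
        (t * Real.exp (t ^ 2 / 2)) (Filter.Eventually.of_forall fun x => by
          rw [Real.norm_of_nonneg (truncExp_nonneg _ _ _)]; exact truncExp_le hδ ht.le _)
    have i3 : Integrable (fun x => (Set.Ici t).indicator
        (fun _ => t * Real.exp ((t - δ) ^ 2 / 2)) (g x)) (stdGaussian E) := by
      have : (fun x => (Set.Ici t).indicator (fun _ => t * Real.exp ((t - δ) ^ 2 / 2)) (g x)) =
          (g ⁻¹' Set.Ici t).indicator (fun _ => t * Real.exp ((t - δ) ^ 2 / 2)) := rfl
      rw [this]
      exact (integrable_const _).indicator hsm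
    have i4 : Integrable (fun x => (g x + (g x ^ 2 + 1) / 2) / 2) (stdGaussian E) :=
      (hgi.add ((hg2.integrable_sq.add (integrable_const 1)).div_const 2)).div_const 2
    have hmono := integral_mono (i3.sub (i4.const_mul (1 + κ))) (i1.sub i2)
      fun x => truncExp_key hδ hδt (g x)
    simp only [Pi.sub_apply] at hmono
    rw [integral_sub i3 (i4.const_mul _), integral_sub i1 i2, integral_const_mul] at hmono
    have e3 : ∫ x, (Set.Ici t).indicator (fun _ => t * Real.exp ((t - δ) ^ 2 / 2)) (g x)
        ∂(stdGaussian E) = t * Real.exp ((t - δ) ^ 2 / 2) * p := by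
      have : (fun x => (Set.Ici t).indicator (fun _ => t * Real.exp ((t - δ) ^ 2 / 2)) (g x)) =
          (g ⁻¹' Set.Ici t).indicator (fun _ => t * Real.exp ((t - δ) ^ 2 / 2)) := rfl
      rw [this, integral_indicator_const _ hsm, smul_eq_mul, mul_comm]
    have e4 : ∫ x, (g x + (g x ^ 2 + 1) / 2) / 2 ∂(stdGaussian E) ≤ 1 / 2 := by
      have i5 : Integrable (fun x => (g x ^ 2 + 1) / 2) (stdGaussian E) :=
        (hg2.integrable_sq.add (integrable_const 1)).div_const 2
      rw [integral_div, integral_add hgi i5, hgm, integral_div, integral_add hg2.integrable_sq (integrable_const 1)]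
      simp only [integral_const, probReal_univ, smul_eq_mul, one_mul]
      linarith
    rw [e3] at hmono
    have := mul_le_mul_of_nonneg_left e4 (by linarith : 0 ≤ 1 + κ)
    linarith
  -- The width of the truncation now tends to zero and takes the transition cost with it.
  have hlim1 : Filter.Tendsto (fun δ : ℝ => t * Real.exp ((t - δ) ^ 2 / 2) * p)
      (nhdsWithin 0 (Set.Ioi 0)) (nhds (t * Real.exp ((t - 0) ^ 2 / 2) * p)) :=
    ((by fun_prop : Continuous fun δ : ℝ => t * Real.exp ((t - δ) ^ 2 / 2) * p).tendsto 0).mono_left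
      nhdsWithin_le_nhds
  have hlim2 : Filter.Tendsto (fun δ : ℝ =>
      (1 + (Real.exp (t ^ 2 / 2) - Real.exp ((t - δ) ^ 2 / 2))) * (1 / 2))
      (nhdsWithin 0 (Set.Ioi 0))
      (nhds ((1 + (Real.exp (t ^ 2 / 2) - Real.exp ((t - 0) ^ 2 / 2))) * (1 / 2))) :=
    ((by fun_prop : Continuous fun δ : ℝ =>
      (1 + (Real.exp (t ^ 2 / 2) - Real.exp ((t - δ) ^ 2 / 2))) * (1 / 2)).tendsto 0).mono_left
      nhdsWithin_le_nhds
  have := le_of_tendsto_of_tendsto hlim1 hlim2 (by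
    filter_upwards [Ioc_mem_nhdsGT ht] with δ hδ
    exact key δ hδ.1 hδ.2)
  simpa using this

open Convolution in
/-- Smooth approximation of a `1`-Lipschitz function by `1`-Lipschitz functions. -/
lemma exists_smooth_approx {f : E → ℝ} (hf : LipschitzWith 1 f) {η : ℝ} (hη : 0 < η) :
    ∃ g : E → ℝ, Differentiable ℝ g ∧ Continuous (fderiv ℝ g) ∧ (∀ w, ‖fderiv ℝ g w‖ ≤ 1) ∧
      ∀ x, |g x - f x| ≤ η := by
  set φ : ContDiffBump (0 : E) := ⟨η / 2, η, half_pos hη, half_lt_self hη⟩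
  set g : E → ℝ := (φ.normed volume ⋆[ContinuousLinearMap.lsmul ℝ ℝ, volume] f : E → ℝ) with hg
  have hgc : ContDiff ℝ 1 g :=
    φ.hasCompactSupport_normed.contDiff_convolution_left (n := 1) _ φ.contDiff_normed
      hf.continuous.locallyIntegrable
  have hint : ∀ x, Integrable fun t => φ.normed volume t * f (x - t) := fun x =>
    (φ.continuous_normed.mul (hf.continuous.comp (by fun_prop))).integrable_of_hasCompactSupport
      φ.hasCompactSupport_normed.mul_right
  have hgl : LipschitzWith 1 g := by
    refine LipschitzWith.of_dist_le_mul fun x y => ?_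
    have e : ∀ x, g x = ∫ t, φ.normed volume t * f (x - t) := fun x => rfl
    rw [dist_eq_norm, e, e, ← integral_sub (hint x) (hint y)]
    calc _ ≤ ∫ t, φ.normed volume t * dist x y := by
          refine norm_integral_le_of_norm_le (φ.integrable_normed.mul_const _)
            (Filter.Eventually.of_forall fun t => ?_)
          rw [← mul_sub, norm_mul, Real.norm_of_nonneg (φ.nonneg_normed t)]
          refine mul_le_mul_of_nonneg_left ?_ (φ.nonneg_normed t)
          have := hf.dist_le_mul (x - t) (y - t)
          rwa [NNReal.coe_one, one_mul, dist_sub_right, dist_eq_norm (f _)] at this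
      _ = _ := by rw [integral_mul_const, φ.integral_normed, NNReal.coe_one]
  refine ⟨g, hgc.differentiable (by simp), hgc.continuous_fderiv (by simp), fun w => ?_, fun x => ?_⟩
  · simpa using norm_fderiv_le_of_lipschitz ℝ hgl (x₀ := w)
  · refine φ.dist_normed_convolution_le hf.continuous.aestronglyMeasurable fun y hy => ?_
    have := hf.dist_le_mul y x
    rw [NNReal.coe_one, one_mul] at this
    exact this.trans (le_of_lt hy)

lemma memLp_of_lipschitz {f : E → ℝ} (hf : LipschitzWith 1 f) : MemLp f 2 (stdGaussian E) := by
  refine memLp_stdGaussian_of_le hf.continuous (a := |f 0|) (M := 1) (fun x => ?_) 2 (by simp)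
  have := hf.dist_le_mul x 0
  rw [NNReal.coe_one, one_mul, Real.dist_eq, dist_zero_right] at this
  have h2 := abs_sub_abs_le_abs_sub (f x) (f 0)
  linarith

lemma abs_integral_sub_le {f g : E → ℝ} (hf : Integrable f (stdGaussian E))
    (hg : Integrable g (stdGaussian E)) {η : ℝ} (h : ∀ x, |g x - f x| ≤ η) :
    |∫ x, g x ∂(stdGaussian E) - ∫ x, f x ∂(stdGaussian E)| ≤ η := by
  rw [← integral_sub hg hf, ← Real.norm_eq_abs]
  have := norm_integral_le_of_norm_le_const (μ := stdGaussian E) (f := fun x => g x - f x)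
    (Filter.Eventually.of_forall h)
  simpa using this

/-- Gaussian concentration with the sharp polynomial factor. -/
lemma measureReal_mean_add_le {f : E → ℝ} (hf : LipschitzWith 1 f) {t : ℝ} (ht : 0 < t) :
    (stdGaussian E).real {x | ∫ y, f y ∂(stdGaussian E) + t ≤ f x} ≤
      Real.exp (-t ^ 2 / 2) / (2 * t) := by
  set p := (stdGaussian E).real {x | ∫ y, f y ∂(stdGaussian E) + t ≤ f x}
  have hfi := (memLp_of_lipschitz hf).integrable one_le_two
  -- One `η` is lost in the values of the function and one in its mean.
  have key : ∀ η, 0 < η → 2 * η < t → (t - 2 * η) * Real.exp ((t - 2 * η) ^ 2 / 2) * p ≤ 1 / 2 := by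
    intro η hη hηt
    obtain ⟨g, hgd, hgc, hgb, hgf⟩ := exists_smooth_approx hf hη
    have hgi : Integrable g (stdGaussian E) := (memLp_stdGaussian_of_le hgd.continuous
      (abs_le_of_fderiv_bound hgd hgb) 2 (by simp)).integrable one_le_two
    have h := measureReal_ge_le_of_smooth hgd hgc hgb (t := t - 2 * η) (by linarith)
    refine le_trans (mul_le_mul_of_nonneg_left ?_ ?_) h
    · refine measureReal_mono (fun x hx => ?_)
      simp only [Set.mem_ofPred_eq] at hx ⊢
      have h1 := abs_le.1 (abs_integral_sub_le hfi hgi hgf)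
      have h2 := abs_le.1 (hgf x)
      linarith [h1.1, h1.2, h2.1, h2.2]
    · have : 0 < t - 2 * η := by linarith
      positivity
  have hlim : Filter.Tendsto (fun η : ℝ => (t - 2 * η) * Real.exp ((t - 2 * η) ^ 2 / 2) * p)
      (nhdsWithin 0 (Set.Ioi 0)) (nhds ((t - 2 * 0) * Real.exp ((t - 2 * 0) ^ 2 / 2) * p)) :=
    ((by fun_prop : Continuous fun η : ℝ =>
      (t - 2 * η) * Real.exp ((t - 2 * η) ^ 2 / 2) * p).tendsto 0).mono_left nhdsWithin_le_nhds
  have := le_of_tendsto hlim (by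
    filter_upwards [Ioo_mem_nhdsGT (by linarith : 0 < t / 2)] with η hη
    exact key η hη.1 (by linarith [hη.2]))
  rw [mul_zero, sub_zero] at this
  rw [le_div_iff₀ (by positivity), show -t ^ 2 / 2 = -(t ^ 2 / 2) by ring, Real.exp_neg]
  have he := Real.exp_pos (t ^ 2 / 2)
  rw [← one_div, le_div_iff₀ he]
  linarith

/-- The Gaussian Poincaré inequality for Lipschitz functions. -/
lemma integral_sub_mean_sq_le {f : E → ℝ} (hf : LipschitzWith 1 f) :
    ∫ x, (f x - ∫ y, f y ∂(stdGaussian E)) ^ 2 ∂(stdGaussian E) ≤ 1 := by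
  have hf2 := memLp_of_lipschitz hf
  have hfi := hf2.integrable one_le_two
  set m := ∫ y, f y ∂(stdGaussian E) with hm
  have key : ∀ η, 0 < η →
      ∫ x, (f x - m) ^ 2 ∂(stdGaussian E) ≤ (1 + 2 * η) * 1 + (2 * η + 4 * η ^ 2) := by
    intro η hη
    obtain ⟨g, hgd, hgc, hgb, hgf⟩ := exists_smooth_approx hf hη
    have hg2 : MemLp g 2 (stdGaussian E) := memLp_stdGaussian_of_le hgd.continuous
      (abs_le_of_fderiv_bound hgd hgb) 2 (by simp)
    have hgi := hg2.integrable one_le_two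
    have h := integral_sub_mean_sq_le_of_smooth hgd hgc hgb
    set m' := ∫ y, g y ∂(stdGaussian E) with hm'
    have h1 := abs_le.1 (abs_integral_sub_le hfi hgi hgf)
    rw [← hm, ← hm'] at h1
    have i1 : Integrable (fun x => (g x - m') ^ 2) (stdGaussian E) :=
      (hg2.sub (memLp_const m')).integrable_sq
    have i2 : Integrable (fun x => (f x - m) ^ 2) (stdGaussian E) :=
      (hf2.sub (memLp_const m)).integrable_sq
    have hmono : ∫ x, (f x - m) ^ 2 ∂(stdGaussian E) ≤
        ∫ x, ((1 + 2 * η) * (g x - m') ^ 2 + (2 * η + 4 * η ^ 2)) ∂(stdGaussian E) := by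
      refine integral_mono i2 ((i1.const_mul _).add (integrable_const _)) fun x => ?_
      have h2 := abs_le.1 (hgf x)
      have h3 : |(f x - m) - (g x - m')| ≤ 2 * η := by
        rw [abs_le]; constructor <;> linarith [h1.1, h1.2, h2.1, h2.2]
      set a := f x - m
      set b := g x - m'
      have h4 : |a| ≤ |b| + 2 * η := by
        have := abs_sub_abs_le_abs_sub a b; linarith
      have h5 : |a| ^ 2 ≤ (|b| + 2 * η) ^ 2 := by gcongr
      rw [sq_abs] at h5
      have h6 := sq_abs b
      show a ^ 2 ≤ _
      nlinarith [sq_nonneg (|b| - 1)]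
    rw [integral_add (i1.const_mul _) (integrable_const _), integral_const_mul] at hmono
    simp only [integral_const, probReal_univ, smul_eq_mul, one_mul] at hmono
    have := mul_le_mul_of_nonneg_left h (by linarith : 0 ≤ 1 + 2 * η)
    linarith
  have hlim : Filter.Tendsto (fun η : ℝ => (1 + 2 * η) * 1 + (2 * η + 4 * η ^ 2))
      (nhdsWithin 0 (Set.Ioi 0)) (nhds ((1 + 2 * 0) * 1 + (2 * 0 + 4 * 0 ^ 2))) :=
    ((by fun_prop : Continuous fun η : ℝ =>
      (1 + 2 * η) * 1 + (2 * η + 4 * η ^ 2)).tendsto 0).mono_left nhdsWithin_le_nhds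
  have := ge_of_tendsto hlim (by
    filter_upwards [self_mem_nhdsWithin] with η hη
    exact key η hη)
  simpa using this

end concentration
end ScaledLasso
end

/-! ### Expected overshoot and mean distance to a set -/

noncomputable section
namespace ScaledLasso

/-- The tail inequality `gtail_add_le`, integrated from `s` to infinity: as a function of `x`, the
difference `c * hinge x - hinge (x + u)` decreases on `[s, ∞)` and tends to zero. -/
lemma hinge_add_le {s u : ℝ} (hu : 0 ≤ u) : hinge (s + u) ≤ Real.exp (-(s * u)) * hinge s := by
  set c := Real.exp (-(s * u)) with hc
  have hd : ∀ x, HasDerivAt (fun x => c * hinge x - hinge (x + u))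
      (c * -gtail x - -gtail (x + u)) x := fun x =>
    ((hasDerivAt_hinge x).const_mul c).sub ((hasDerivAt_hinge (x + u)).comp_add_const x u)
  have hanti : AntitoneOn (fun x => c * hinge x - hinge (x + u)) (Set.Ici s) := by
    refine antitoneOn_of_deriv_nonpos (convex_Ici s)
      (fun x _ => (hd x).continuousAt.continuousWithinAt)
      (fun x _ => (hd x).differentiableAt.differentiableWithinAt) fun x hx => ?_
    rw [interior_Ici] at hx
    rw [(hd x).deriv]
    have h1 := gtail_add_le x u hu
    have h2 : Real.exp (-(x * u) - u ^ 2 / 2) ≤ c := by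
      rw [hc, Real.exp_le_exp]
      nlinarith [mul_le_mul_of_nonneg_right (le_of_lt hx) hu, sq_nonneg u]
    have h3 := mul_le_mul_of_nonneg_right h2 (gtail_nonneg x)
    linarith
  have ht : Filter.Tendsto (fun x => c * hinge x - hinge (x + u)) Filter.atTop (nhds 0) := by
    have h1 := (tendsto_hinge_atTop.const_mul c).sub
      (tendsto_hinge_atTop.comp (Filter.tendsto_atTop_add_const_right _ u Filter.tendsto_id))
    simpa using h1
  have := nonneg_of_antitone_of_tendsto s hanti le_rfl ht le_rfl
  linarith

lemma gaussianReal_eq_withDensity_gpdf :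
    gaussianReal 0 1 = volume.withDensity (fun x => ENNReal.ofReal (gpdf x)) := by
  rw [gaussianReal_of_var_ne_zero 0 one_ne_zero]; rfl

lemma integral_gaussianReal_gpdf (f : ℝ → ℝ) :
    ∫ x, f x ∂(gaussianReal 0 1) = ∫ x, gpdf x * f x := by
  rw [integral_gaussianReal_eq_integral_smul one_ne_zero]
  rfl

lemma integrable_mul_gpdf : Integrable fun x => x * gpdf x := by
  have h : MemLp (fun x : ℝ => x) 1 (gaussianReal 0 1) := IsGaussian.memLp_id _ 1 (by simp)
  have h1 := memLp_one_iff_integrable.1 h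
  rw [gaussianReal_eq_withDensity_gpdf, integrable_withDensity_iff_integrable_smul'
    (by exact continuous_gpdf.measurable.ennreal_ofReal) (by simp)] at h1
  refine h1.congr (Filter.Eventually.of_forall fun x => ?_)
  simp only [ENNReal.toReal_ofReal (gpdf_pos x).le, smul_eq_mul]
  ring

lemma integral_Ioi_mul_gpdf (a : ℝ) : ∫ x in Set.Ioi a, x * gpdf x = gpdf a := by
  have h := integral_Ioi_of_hasDerivAt_of_tendsto (a := a) (f := fun x => -gpdf x)
    (f' := fun x => x * gpdf x) (m := 0)
    (continuous_gpdf.neg.continuousWithinAt)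
    (fun x _ => (hasDerivAt_gpdf x).neg.congr_deriv (by ring))
    integrable_mul_gpdf.integrableOn (by simpa using tendsto_gpdf_atTop.neg)
  rw [h]; ring

/-- The part of `|x|` above the level `a`. -/
def excess (a x : ℝ) : ℝ := max (|x| - a) 0

lemma excess_nonneg (a x : ℝ) : 0 ≤ excess a x := le_max_right _ _

lemma sub_le_excess (a x : ℝ) : |x| - a ≤ excess a x := le_max_left _ _

lemma continuous_excess (a : ℝ) : Continuous (excess a) := by unfold excess; fun_prop

lemma excess_add_le (a b x y : ℝ) : excess (a + b) (x + y) ≤ excess a x + excess b y := by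
  refine max_le ?_ (add_nonneg (excess_nonneg _ _) (excess_nonneg _ _))
  have := abs_add_le x y
  have h1 := sub_le_excess a x
  have h2 := sub_le_excess b y
  linarith

lemma excess_anti {a b : ℝ} (h : a ≤ b) (x : ℝ) : excess b x ≤ excess a x :=
  max_le_max (by linarith) le_rfl

lemma excess_mono {a x y : ℝ} (h : |x| ≤ |y|) : excess a x ≤ excess a y :=
  max_le_max (by linarith) le_rfl

lemma integral_Ioi_sub_mul_gpdf (a : ℝ) : ∫ x in Set.Ioi a, (x - a) * gpdf x = hinge a := by
  have e : ∀ x, (x - a) * gpdf x = x * gpdf x - a * gpdf x := fun x => by ring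
  simp_rw [e]
  rw [integral_sub integrable_mul_gpdf.integrableOn (integrable_gpdf.const_mul a).integrableOn,
    integral_Ioi_mul_gpdf, integral_const_mul]
  rfl

lemma integrable_excess_gaussianReal {a : ℝ} (ha : 0 ≤ a) :
    Integrable (excess a) (gaussianReal 0 1) := by
  have h : MemLp (fun x : ℝ => x) 1 (gaussianReal 0 1) := IsGaussian.memLp_id _ 1 (by simp)
  refine (memLp_one_iff_integrable.1 h).abs.mono' (continuous_excess a).aestronglyMeasurable
    (Filter.Eventually.of_forall fun x => ?_)
  rw [Real.norm_of_nonneg (excess_nonneg _ _)]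
  exact max_le (by linarith) (abs_nonneg x)

lemma integral_excess_gaussianReal {a : ℝ} (ha : 0 ≤ a) :
    ∫ x, excess a x ∂(gaussianReal 0 1) = 2 * hinge a := by
  rw [integral_gaussianReal_gpdf]
  set F : ℝ → ℝ := fun x => (Set.Ioi a).indicator (fun x => (x - a) * gpdf x) x with hF
  have e : ∀ x, gpdf x * excess a x = F x + F (-x) := by
    intro x
    simp only [hF, Set.indicator_apply, Set.mem_Ioi, excess, gpdf_neg]
    rcases le_total 0 x with hx | hx
    · rw [abs_of_nonneg hx, if_neg (by linarith : ¬ a < -x)]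
      split_ifs with h
      · rw [max_eq_left (by linarith)]; ring
      · rw [max_eq_right (by linarith)]; ring
    · rw [abs_of_nonpos hx, if_neg (by linarith : ¬ a < x)]
      split_ifs with h
      · rw [max_eq_left (by linarith)]; ring
      · rw [max_eq_right (by linarith)]; ring
  have hFi : Integrable F := by
    refine Integrable.indicator ?_ measurableSet_Ioi
    exact (integrable_mul_gpdf.sub (integrable_gpdf.const_mul a)).congr
      (Filter.Eventually.of_forall fun x => by simp only [Pi.sub_apply]; ring)
  have hFI : ∫ x, F x = hinge a := by
    rw [hF, integral_indicator measurableSet_Ioi, integral_Ioi_sub_mul_gpdf]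
  simp_rw [e]
  rw [integral_add hFi hFi.comp_neg, integral_neg_eq_self F volume, hFI]
  ring

set_option linter.unusedSectionVars false
section noise
variable {E : Type*} [NormedAddCommGroup E] [InnerProductSpace ℝ E] [FiniteDimensional ℝ E]
  [MeasurableSpace E] [BorelSpace E]

lemma map_inner_stdGaussian {a : E} (ha : ‖a‖ = 1) :
    (stdGaussian E).map (fun g => inner ℝ a g) = gaussianReal 0 1 := by
  have h := IsGaussian.map_eq_gaussianReal (μ := stdGaussian E) (innerSL ℝ a)
  rw [variance_dual_stdGaussian, innerSL_apply_norm, ha, integral_strongDual_stdGaussian] at h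
  simpa using h

lemma integral_comp_inner {a : E} (ha : ‖a‖ = 1) {f : ℝ → ℝ} (hf : Continuous f) :
    ∫ g, f (inner ℝ a g) ∂(stdGaussian E) = ∫ x, f x ∂(gaussianReal 0 1) := by
  rw [← map_inner_stdGaussian ha, integral_map (by fun_prop) hf.aestronglyMeasurable]

lemma integrable_comp_inner {a : E} (ha : ‖a‖ = 1) {f : ℝ → ℝ} (hf : Continuous f)
    (hi : Integrable f (gaussianReal 0 1)) : Integrable (fun g => f (inner ℝ a g)) (stdGaussian E) := by
  rw [← map_inner_stdGaussian ha] at hi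
  exact (integrable_map_measure hf.aestronglyMeasurable (by fun_prop)).1 hi

/-- If a closed set has large Gaussian measure, then the mean distance to it is small. -/
lemma integral_infDist_sq_le {S : Set E} (hS : MeasurableSet S) {q : ℝ}
    (hq : (stdGaussian E).real Sᶜ ≤ q) :
    (∫ g, Metric.infDist g S ∂(stdGaussian E)) ^ 2 ≤
      q * (1 + (∫ g, Metric.infDist g S ∂(stdGaussian E)) ^ 2) := by
  set d : E → ℝ := fun g => Metric.infDist g S with hd
  have hl : LipschitzWith 1 d := Metric.lipschitz_infDist_pt S
  set m := ∫ g, d g ∂(stdGaussian E) with hm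
  have hd2 := memLp_of_lipschitz hl
  have hdi := hd2.integrable one_le_two
  have hm0 : 0 ≤ m := integral_nonneg fun g => Metric.infDist_nonneg
  have hvar := integral_sub_mean_sq_le hl
  rw [← hm] at hvar
  have e : ∀ g, (d g - m) ^ 2 = d g ^ 2 - 2 * m * d g + m ^ 2 := fun x => by ring
  simp_rw [e] at hvar
  rw [integral_add (by exact hd2.integrable_sq.sub (hdi.const_mul _)) (integrable_const _),
    integral_sub hd2.integrable_sq (hdi.const_mul _), integral_const_mul, ← hm] at hvar
  simp only [integral_const, probReal_univ, smul_eq_mul, one_mul] at hvar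
  have hsq : ∫ g, d g ^ 2 ∂(stdGaussian E) ≤ 1 + m ^ 2 := by nlinarith
  have hq0 : 0 ≤ q := measureReal_nonneg.trans hq
  rcases hm0.eq_or_lt with h0 | h0
  · rw [← h0]; simpa using hq0
  -- The distance vanishes on `S`, so this is the Cauchy–Schwarz inequality for the distance and the
  -- indicator of `Sᶜ`, written as `d ≤ (lam * d² + lam⁻¹) / 2` off `S`. The weight is chosen so
  -- that `lam * (1 + m²) = m`, where `1 + m²` bounds the second moment by the Poincaré inequality.
  set lam := m / (1 + m ^ 2) with hlam
  have hlam0 : 0 < lam := by positivity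
  have hbound : m ≤ (lam * ∫ g, d g ^ 2 ∂(stdGaussian E)) / 2 +
      (lam⁻¹ * (stdGaussian E).real Sᶜ) / 2 := by
    have i1 : Integrable (fun g => (lam * d g ^ 2) / 2) (stdGaussian E) :=
      (hd2.integrable_sq.const_mul _).div_const _
    have i2 : Integrable (fun g => (Sᶜ).indicator (fun _ => lam⁻¹ / 2) g) (stdGaussian E) :=
      (integrable_const _).indicator hS.compl
    calc m ≤ ∫ g, ((lam * d g ^ 2) / 2 + (Sᶜ).indicator (fun _ => lam⁻¹ / 2) g)
          ∂(stdGaussian E) := by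
          refine integral_mono hdi (i1.add i2) fun g => ?_
          by_cases hg : g ∈ S
          · have : d g = 0 := Metric.infDist_zero_of_mem hg
            rw [this, Set.indicator_of_notMem (by simpa using hg)]; simp
          · rw [Set.indicator_of_mem (by simpa using hg)]
            have h1 : lam * lam⁻¹ = 1 := mul_inv_cancel₀ hlam0.ne'
            have h2 : 0 ≤ lam⁻¹ * (lam * d g - 1) ^ 2 := by positivity
            have h3 : lam⁻¹ * (lam * d g - 1) ^ 2 = lam * d g ^ 2 - 2 * d g + lam⁻¹ := by
              linear_combination (lam * d g ^ 2 - 2 * d g) * h1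
            linarith
      _ = _ := by
          rw [integral_add i1 i2, integral_div, integral_const_mul,
            integral_indicator_const _ hS.compl, smul_eq_mul]
          ring
  have h1 : lam * ∫ g, d g ^ 2 ∂(stdGaussian E) ≤ m := by
    calc _ ≤ lam * (1 + m ^ 2) := by gcongr
      _ = m := by rw [hlam]; field_simp
  have h2 : lam⁻¹ * (stdGaussian E).real Sᶜ ≤ (1 + m ^ 2) / m * q := by
    rw [hlam, inv_div]; gcongr
  have h3 : m ≤ (1 + m ^ 2) / m * q := by linarith
  calc m ^ 2 = m * m := sq m
    _ ≤ m * ((1 + m ^ 2) / m * q) := by gcongr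
    _ = _ := by field_simp

end noise

/-- The numerical inequality behind the choice of the radius in `measureReal_sum_excess_compl_le`. -/
lemma mul_hinge_le {t A : ℝ} (ht : 0 < t) (hA : 0 ≤ A) :
    A * (t ^ 4 + 2 * t ^ 2) / 2 * hinge ((1 + A) * t) ≤
      17 / 125 * ((13 / 5 + 2 * A) * t) * gtail t := by
  have h1 := hinge_add_le (s := t) (u := A * t) (by positivity)
  rw [show t + A * t = (1 + A) * t by ring] at h1
  set y := A * t ^ 2 with hy
  have hy0 : 0 ≤ y := by positivity
  have hexp : 1 + y + y ^ 2 / 2 ≤ Real.exp y := Real.quadratic_le_exp_of_nonneg hy0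
  have hexpn : Real.exp (-(t * (A * t))) * Real.exp y = 1 := by
    rw [← Real.exp_add, hy, Real.exp_eq_one_iff]; ring
  set c := Real.exp (-(t * (A * t))) with hc
  have hc0 : 0 < c := Real.exp_pos _
  have hg := gtail_pos t
  -- Since `1 + y + y² / 2 ≤ exp y`, the exponential decay of `hinge` is traded for a polynomial.
  -- What remains is a polynomial inequality for each bound `r` of `hinge t / gtail t`: here `4/5`
  -- for `t ≤ 5/4` and `1 / t` beyond.
  have hfin : ∀ r : ℝ, hinge t ≤ r * gtail t →
      A * (t ^ 4 + 2 * t ^ 2) / 2 * r ≤ (17 / 125 * ((13 / 5 + 2 * A) * t)) * (1 + y + y ^ 2 / 2) →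
      A * (t ^ 4 + 2 * t ^ 2) / 2 * hinge ((1 + A) * t) ≤
        17 / 125 * ((13 / 5 + 2 * A) * t) * gtail t := by
    intro r hr hrr
    set W := 17 / 125 * ((13 / 5 + 2 * A) * t) with hW
    have hW0 : 0 ≤ W := by positivity
    have hQ : 0 ≤ A * (t ^ 4 + 2 * t ^ 2) / 2 := by positivity
    calc A * (t ^ 4 + 2 * t ^ 2) / 2 * hinge ((1 + A) * t)
        ≤ A * (t ^ 4 + 2 * t ^ 2) / 2 * (c * (r * gtail t)) :=
          mul_le_mul_of_nonneg_left (h1.trans (mul_le_mul_of_nonneg_left hr hc0.le)) hQ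
      _ = (A * (t ^ 4 + 2 * t ^ 2) / 2 * r) * (c * gtail t) := by ring
      _ ≤ (W * Real.exp y) * (c * gtail t) :=
          mul_le_mul_of_nonneg_right (hrr.trans (mul_le_mul_of_nonneg_left hexp hW0)) (by positivity)
      _ = W * gtail t * (c * Real.exp y) := by ring
      _ = _ := by rw [hexpn, mul_one]
  rcases le_or_gt t (5 / 4) with ht' | ht'
  · refine hfin (4 / 5) (hinge_le_mul t ht.le ht') ?_
    have hpoly : A * (2 / 5 * t ^ 3 + 4 / 5 * t) ≤
        (17 / 125 * (13 / 5 + 2 * A)) * (1 + y + y ^ 2 / 2) := by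
      -- The critical part of the difference is a quadratic in `s` with coefficients depending on
      -- `t`; its discriminant is nonpositive by `h3`.
      set s := A * t with hs
      have hs0 : 0 ≤ s := by positivity
      set κ := 5824 / 10000 + 1464 / 10000 * t with hκ
      set η := 272 / 1000 + 1768 / 10000 * t ^ 2 with hη
      have hη0 : 0 < η := by positivity
      have h2 : 2 / 5 * t ^ 2 + 4 / 5 - 3536 / 10000 * t - 2176 / 10000 ≤ κ := by
        rw [hκ]; nlinarith
      have h3 : κ ^ 2 ≤ 4 * (3536 / 10000) * η := by
        rw [hκ, hη]; nlinarith [sq_nonneg (t - 3729 / 10000)]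
      have h4 : 0 ≤ 3536 / 10000 - s * κ + s ^ 2 * η := by
        have : 0 ≤ 4 * η * (3536 / 10000 - s * κ + s ^ 2 * η) := by
          have : 4 * η * (3536 / 10000 - s * κ + s ^ 2 * η) =
            (2 * η * s - κ) ^ 2 + (4 * (3536 / 10000) * η - κ ^ 2) := by ring
          rw [this]
          linarith [sq_nonneg (2 * η * s - κ)]
        exact nonneg_of_mul_nonneg_right this (by positivity)
      have h5 := mul_le_mul_of_nonneg_left h2 hs0
      have h6 : 2176 / 10000 * s ≤ 272 / 1000 * A := by rw [hs]; nlinarith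
      have h7 : 0 ≤ A ^ 3 * t ^ 4 := by positivity
      have e : (17 / 125 * (13 / 5 + 2 * A)) * (1 + y + y ^ 2 / 2) - A * (2 / 5 * t ^ 3 + 4 / 5 * t) =
          (3536 / 10000 - s * κ + s ^ 2 * η) +
          (s * κ - s * (2 / 5 * t ^ 2 + 4 / 5 - 3536 / 10000 * t - 2176 / 10000)) +
          (272 / 1000 * A - 2176 / 10000 * s) + 17 / 125 * (A ^ 3 * t ^ 4) := by
        rw [hη, hs, hy]; ring
      linarith
    nlinarith
  · refine hfin (1 / t) (by rw [one_div_mul_eq_div]; exact hinge_le_div t ht) ?_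
    have hpoly : y / 2 + A ≤ (17 / 125 * (13 / 5 + 2 * A)) * (1 + y + y ^ 2 / 2) := by
      have hAy : A ≤ 16 / 25 * y := by
        have ht2 : 25 / 16 ≤ t ^ 2 := by nlinarith
        rw [hy]; nlinarith [mul_le_mul_of_nonneg_left ht2 hA]
      rcases le_total (728 / 1000 - 272 / 1000 * y - 136 / 1000 * y ^ 2) 0 with h | h
      · nlinarith [mul_nonneg_of_nonpos_of_nonpos h (neg_nonpos.2 hA), sq_nonneg (y - 2 / 5)]
      · have := mul_le_mul_of_nonneg_left hAy h
        nlinarith [pow_nonneg hy0 3, sq_nonneg (y - 87 / 100)]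
    have : A * (t ^ 4 + 2 * t ^ 2) / 2 * (1 / t) = t * (y / 2 + A) := by
      rw [hy]; field_simp
    rw [this]
    nlinarith

end ScaledLasso
end

/-! ### The total excess of the noise over a level -/

noncomputable section
namespace ScaledLasso

/-- The total excess of the coordinates `⟪A j, g⟫` over the level `a`. -/
def sumExcess {E : Type*} [NormedAddCommGroup E] [InnerProductSpace ℝ E] {p : ℕ}
    (A : Fin p → E) (a : ℝ) (g : E) : ℝ := ∑ j, excess a (inner ℝ (A j) g)

/-- The family `A` has upper sparse eigenvalue at most `C` at order `m`. -/
def SparseBound {E : Type*} [NormedAddCommGroup E] [InnerProductSpace ℝ E] {p : ℕ}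
    (A : Fin p → E) (m : ℕ) (C : ℝ) : Prop :=
  ∀ (v : E) (T : Finset (Fin p)), T.card ≤ m → ∑ j ∈ T, inner ℝ (A j) v ^ 2 ≤ C * ‖v‖ ^ 2

section noise
variable {E : Type*} [NormedAddCommGroup E] [InnerProductSpace ℝ E]

lemma continuous_sumExcess {p : ℕ} (A : Fin p → E) (a : ℝ) : Continuous (sumExcess A a) := by
  unfold sumExcess
  exact continuous_finsetSum _ fun j _ => (continuous_excess a).comp (by fun_prop)

lemma sumExcess_nonneg {p : ℕ} (A : Fin p → E) (a : ℝ) (g : E) : 0 ≤ sumExcess A a g :=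
  Finset.sum_nonneg fun _ _ => excess_nonneg _ _

/-- A small perturbation changes the total excess by little, by the sparse eigenvalue bound. -/
lemma sumExcess_le_of_sparseBound {p m : ℕ} {A : Fin p → E} {C : ℝ} (hC : SparseBound A m C)
    {v : E} {c : ℝ} (hc : 0 < c) (hv : C * ‖v‖ ^ 2 < m * c ^ 2) :
    sumExcess A c v ≤ m * c / 4 := by
  set V := Finset.univ.filter fun j => c < |inner ℝ (A j) v| with hV
  -- If `m` coordinates exceeded `c`, their squares alone would violate the sparse eigenvalue bound.
  have hcard : V.card < m := by
    by_contra hcon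
    rw [not_lt] at hcon
    obtain ⟨T, hTV, hTm⟩ := Finset.exists_subset_card_eq hcon
    have h1 := hC v T hTm.le
    have h2 : ∑ j ∈ T, c ^ 2 ≤ ∑ j ∈ T, inner ℝ (A j) v ^ 2 := by
      refine Finset.sum_le_sum fun j hj => ?_
      have := (Finset.mem_filter.1 (hTV hj)).2
      rw [← sq_abs (inner ℝ (A j) v)]
      gcongr
    rw [Finset.sum_const, hTm, nsmul_eq_mul] at h2
    linarith
  have hsum : sumExcess A c v = ∑ j ∈ V, excess c (inner ℝ (A j) v) := by
    rw [sumExcess, hV, Finset.sum_filter_of_ne]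
    intro j _ hj
    by_contra hcon
    exact hj (max_eq_right (by linarith))
  rw [hsum]
  -- `|x| - c ≤ x² / (4 c)` is `(|x| - 2 c)² ≥ 0`; this is where the factor `1/4` of the conclusion
  -- arises.
  have h3 : ∀ j ∈ V, excess c (inner ℝ (A j) v) ≤ inner ℝ (A j) v ^ 2 / (4 * c) := by
    intro j hj
    have := (Finset.mem_filter.1 hj).2
    rw [excess, max_eq_left (by linarith), le_div_iff₀ (by positivity),
      ← sq_abs (inner ℝ (A j) v)]
    nlinarith [sq_nonneg (|inner ℝ (A j) v| - 2 * c)]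
  calc ∑ j ∈ V, excess c (inner ℝ (A j) v) ≤ ∑ j ∈ V, inner ℝ (A j) v ^ 2 / (4 * c) :=
        Finset.sum_le_sum h3
    _ = (∑ j ∈ V, inner ℝ (A j) v ^ 2) / (4 * c) := by rw [Finset.sum_div]
    _ ≤ (m * c ^ 2) / (4 * c) := by
        gcongr
        exact (hC v V hcard.le).trans hv.le
    _ = _ := by field_simp

variable [FiniteDimensional ℝ E] [MeasurableSpace E] [BorelSpace E]

lemma integrable_sumExcess {p : ℕ} {A : Fin p → E} (hA : ∀ j, ‖A j‖ = 1) {a : ℝ} (ha : 0 ≤ a) :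
    Integrable (sumExcess A a) (stdGaussian E) :=
  integrable_finsetSum _ fun j _ => integrable_comp_inner (hA j) (continuous_excess a)
    (integrable_excess_gaussianReal ha)

lemma integral_sumExcess {p : ℕ} {A : Fin p → E} (hA : ∀ j, ‖A j‖ = 1) {a : ℝ} (ha : 0 ≤ a) :
    ∫ g, sumExcess A a g ∂(stdGaussian E) = p * (2 * hinge a) := by
  unfold sumExcess
  rw [integral_finsetSum _ fun j _ => integrable_comp_inner (hA j) (continuous_excess a)
    (integrable_excess_gaussianReal ha)]
  simp_rw [integral_comp_inner (hA _) (continuous_excess a), integral_excess_gaussianReal ha]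
  simp

lemma sqrt_two_pi_bounds : 5 / 2 < √(2 * Real.pi) ∧ √(2 * Real.pi) < 2507 / 1000 := by
  have h1 := Real.pi_gt_d4
  have h2 := Real.pi_lt_d4
  constructor
  · exact Real.lt_sqrt_of_sq_lt (by norm_num; linarith)
  · rw [Real.sqrt_lt' (by norm_num)]; norm_num; linarith

/-- By Mills' lower bound the tail at `13/10` exceeds `1/18`. The level `e / p` with `e < 1/6` and
`p ≥ 3` is below `1/18`. -/
lemma lt_of_gtail_le {x t : ℝ} (hx : gtail t ≤ x) (hx' : x < 1 / 18) : 13 / 10 < t := by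
  by_contra hcon
  rw [not_lt] at hcon
  have h1 := strictAnti_gtail.antitone hcon
  have h2 := mul_gpdf_le (13 / 10)
  have h3 : 33 / 100 ≤ gpdf (13 / 10) * (5 / 2) := by
    rw [gpdf_eq]
    have hs := sqrt_two_pi_bounds
    have he : 1 / 3 ≤ Real.exp (-((13 / 10) ^ 2) / 2) := by
      have : Real.exp (-1) ≤ Real.exp (-((13 / 10 : ℝ) ^ 2) / 2) := by
        rw [Real.exp_le_exp]; norm_num
      have h4 := Real.exp_neg_one_gt_d9
      linarith
    have hi : (99 : ℝ) / 250 ≤ (√(2 * Real.pi))⁻¹ := by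
      rw [le_inv_comm₀ (by norm_num) (by linarith)]
      exact hs.2.le.trans (by norm_num)
    nlinarith
  norm_num at h2
  nlinarith

/-- For independent Gaussian noise: a bound for the total excess outside an event of
exponentially small probability. -/
lemma measureReal_sumExcess_gt_le {p m : ℕ} (hp : 3 ≤ p) (hm : 1 ≤ m) {A : Fin p → E}
    (hA : ∀ j, ‖A j‖ = 1) {C : ℝ} (hC0 : 0 < C) (hC : SparseBound A m C) {k e t t₁ A₀ θ : ℝ}
    (he0 : 0 < e) (he : e < 1 / 6) (ht : 0 < t) (hgt : gtail t = k / p) (hgt₁ : gtail t₁ = e / p)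
    (hA₀ : A₀ = 4 * (k / m) / (t ^ 4 + 2 * t ^ 2))
    (hθ : A₀ + (t₁ + (√(2 * Real.pi))⁻¹) / t * √(C / m) ≤ θ) :
    (stdGaussian E).real {g | (13 / 5 + 2 * A₀ + θ / 4) * m * t < sumExcess A ((1 + θ) * t) g} ≤
      2 / 3 * e := by
  have hp' : (3 : ℝ) ≤ p := by exact_mod_cast hp
  have hm' : (1 : ℝ) ≤ m := by exact_mod_cast hm
  have hkp : k = p * gtail t := by rw [hgt]; field_simp
  have hk0 : 0 < k := by rw [hkp]; have := gtail_pos t; positivity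
  have hA₀0 : 0 < A₀ := by rw [hA₀]; positivity
  have ht₁ : 13 / 10 < t₁ := lt_of_gtail_le hgt₁.le (by
    rw [div_lt_iff₀ (by linarith)]; linarith)
  set w₀ := 13 / 5 + 2 * A₀ with hw₀
  -- The set of good points, at the intermediate level `(1 + A₀) t`. Markov's inequality at this
  -- level makes it large; the step up to `(1 + θ) t` pays for the distance to it.
  set S : Set E := {x | sumExcess A ((1 + A₀) * t) x ≤ w₀ * m * t} with hS
  have hSm : MeasurableSet S :=
    measurableSet_le (continuous_sumExcess A _).measurable measurable_const
  have ha0 : 0 ≤ (1 + A₀) * t := by positivity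
  have hw0 : 0 < w₀ * m * t := by positivity
  have hSne : S.Nonempty := ⟨0, by
    simp only [hS, Set.mem_ofPred_eq, sumExcess, inner_zero_right, excess, abs_zero, zero_sub]
    rw [max_eq_right (by linarith)]
    simpa using hw0.le⟩
  have hq : (stdGaussian E).real Sᶜ ≤ 17 / 125 := by
    have h1 := mul_meas_ge_le_integral_of_nonneg
      (Filter.Eventually.of_forall fun g => sumExcess_nonneg A ((1 + A₀) * t) g)
      (integrable_sumExcess hA ha0) (w₀ * m * t) (μ := stdGaussian E)
    rw [integral_sumExcess hA ha0] at h1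
    have h2 : (stdGaussian E).real Sᶜ ≤
        (stdGaussian E).real {g | w₀ * m * t ≤ sumExcess A ((1 + A₀) * t) g} := by
      refine measureReal_mono fun g hg => ?_
      simp only [hS, Set.mem_compl_iff, Set.mem_ofPred_eq, not_le] at hg ⊢
      exact hg.le
    have h3 := mul_hinge_le (t := t) ht hA₀0.le
    -- The defining equation of `A₀`, arranged to eliminate `p` in favour of `m` in the mean total
    -- excess `2 p hinge ((1 + A₀) t)`.
    have h4 : p * gtail t * 4 = m * A₀ * (t ^ 4 + 2 * t ^ 2) := by
      rw [← hkp, hA₀]; field_simp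
    have h5 : p * (2 * hinge ((1 + A₀) * t)) ≤ 17 / 125 * (w₀ * m * t) := by
      have hg := gtail_pos t
      refine le_of_mul_le_mul_right ?_ hg
      calc p * (2 * hinge ((1 + A₀) * t)) * gtail t
          = m * (A₀ * (t ^ 4 + 2 * t ^ 2) / 2 * hinge ((1 + A₀) * t)) := by
            linear_combination (hinge ((1 + A₀) * t) / 2) * h4
        _ ≤ m * (17 / 125 * (w₀ * t) * gtail t) := by
            refine mul_le_mul_of_nonneg_left ?_ (by linarith)
            rw [hw₀]; exact h3
        _ = _ := by ring
    have h6 := mul_le_mul_of_nonneg_left h2 hw0.le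
    have h7 : w₀ * m * t * (stdGaussian E).real Sᶜ ≤ w₀ * m * t * (17 / 125) := by linarith
    exact le_of_mul_le_mul_left h7 hw0
  -- From `M² ≤ q (1 + M²)` with `q = 17/125` follows `M² ≤ 17/108 < 1 / (2 π)`. So `17/125` is what
  -- makes the mean distance at most `1 / √(2 π)`, the term that appears in the condition on `θ`.
  set M := ∫ g, Metric.infDist g S ∂(stdGaussian E) with hM
  have hM1 : M ≤ (√(2 * Real.pi))⁻¹ := by
    have h1 := integral_infDist_sq_le hSm hq
    rw [← hM] at h1
    have h2 : M ^ 2 ≤ 17 / 108 := by linarith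
    have hpi := Real.pi_lt_d4
    refine le_of_abs_le (abs_le_of_sq_le_sq ?_ (by positivity))
    rw [inv_pow, Real.sq_sqrt (by positivity)]
    refine h2.trans ?_
    rw [le_inv_comm₀ (by norm_num) (by positivity)]
    norm_num; linarith
  set t₂ := t₁ + (√(2 * Real.pi))⁻¹ with ht₂
  have hs0 : 0 < (√(2 * Real.pi))⁻¹ := by positivity
  have ht₂0 : 0 < t₂ := by linarith
  set b := √(C / m) * t₂ / t with hb
  have hb0 : 0 < b := by positivity
  have hθ' : A₀ + b ≤ θ := by
    refine le_trans (le_of_eq ?_) hθ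
    rw [hb]; ring
  -- A point within `t₂` of `S` is `x + v` with `x ∈ S` and `‖v‖ < t₂`. The level splits as `(1 +
  -- A₀) t + b t`, and `b` is chosen so that `v` satisfies the smallness condition of
  -- `sumExcess_le_of_sparseBound`; its share is at most `m b t / 4`.
  have hsub : {g | (13 / 5 + 2 * A₀ + θ / 4) * m * t < sumExcess A ((1 + θ) * t) g} ⊆
      {g | M + t₁ ≤ Metric.infDist g S} := by
    intro g hg
    simp only [Set.mem_ofPred_eq] at hg ⊢
    by_contra hcon
    rw [not_le] at hcon
    have hlt : Metric.infDist g S < t₂ := by linarith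
    obtain ⟨x, hxS, hx⟩ := (Metric.infDist_lt_iff hSne).1 hlt
    set v := g - x with hv
    have hvn : ‖v‖ < t₂ := by rw [hv, ← dist_eq_norm]; exact hx
    have h1 : sumExcess A (b * t) v ≤ m * (b * t) / 4 := by
      refine sumExcess_le_of_sparseBound hC (by positivity) ?_
      have e : (m : ℝ) * (b * t) ^ 2 = C * t₂ ^ 2 := by
        rw [hb, div_mul_cancel₀ _ ht.ne', mul_pow, Real.sq_sqrt (by positivity)]
        field_simp
      rw [e]
      gcongr
    have h2 : sumExcess A ((1 + θ) * t) g ≤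
        sumExcess A ((1 + A₀) * t) x + sumExcess A (b * t) v := by
      unfold sumExcess
      rw [← Finset.sum_add_distrib]
      refine Finset.sum_le_sum fun j _ => ?_
      have hg' : inner ℝ (A j) g = inner ℝ (A j) x + inner ℝ (A j) v := by
        rw [← inner_add_right, hv]; congr 1; abel
      rw [hg']
      refine le_trans (excess_anti ?_ _) (excess_add_le _ _ _ _)
      nlinarith
    have h3 : sumExcess A ((1 + A₀) * t) x ≤ w₀ * m * t := hxS
    rw [hw₀] at h3
    have h4 : (m : ℝ) * (b * t) / 4 ≤ θ / 4 * m * t := by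
      have : b * (m * t) ≤ θ * (m * t) := by
        apply mul_le_mul_of_nonneg_right _ (by positivity); linarith
      linarith
    linarith
  have ht₁0 : 0 < t₁ := by linarith
  have hcon := measureReal_mean_add_le (Metric.lipschitz_infDist_pt S) ht₁0
  refine (measureReal_mono hsub).trans (hcon.trans ?_)
  -- The concentration bound is converted into the tail at `t₁` by Mills' inequality; with `p ≥ 3`
  -- and `t₁ > 13/10` the constant comes out just below `2/3`.
  have hexp : Real.exp (-t₁ ^ 2 / 2) = √(2 * Real.pi) * gpdf t₁ := by
    rw [gpdf_eq, ← mul_assoc, mul_inv_cancel₀ (by positivity), one_mul]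
  have hmills := mul_gpdf_le t₁
  rw [hgt₁] at hmills
  have hs := sqrt_two_pi_bounds
  rw [hexp, div_le_iff₀ (by positivity)]
  have h1 : t₁ * gpdf t₁ * 3 ≤ (t₁ ^ 2 + 1) * e := by
    have : e / p ≤ e / 3 := by gcongr
    have := mul_le_mul_of_nonneg_left this (by positivity : 0 ≤ t₁ ^ 2 + 1)
    linarith
  have hg := gpdf_pos t₁
  have h2 : √(2 * Real.pi) * gpdf t₁ * t₁ ≤ 2507 / 1000 * (gpdf t₁ * t₁) := by
    rw [mul_assoc]; exact mul_le_mul_of_nonneg_right hs.2.le (by positivity)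
  refine le_of_mul_le_mul_right ?_ ht₁0
  have h3 : 169 / 100 ≤ t₁ ^ 2 := by nlinarith
  nlinarith

/-- Scaling to the sphere: the corresponding bound for the direction of a Gaussian vector. -/
lemma measure_sphere_sumExcess_le [Nontrivial E] {p : ℕ} {A : Fin p → E} {ν w a η : ℝ}
    (hν : ν ≤ (Module.finrank ℝ E : ℝ) - 1)
    (h : (stdGaussian E).real {g | w < sumExcess A a g} ≤ η) :
    stdGaussian E {g | w * ‖g‖ < ∑ j, excess (a * ‖g‖) (√ν * inner ℝ (A j) g)} ≤
      ENNReal.ofReal (2 * η) := by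
  have hm : MeasurableSet {g : E | w * ‖g‖ < ∑ j, excess (a * ‖g‖) (√ν * inner ℝ (A j) g)} := by
    refine measurableSet_lt (by fun_prop) (Finset.measurable_sum _ fun j _ => ?_)
    unfold excess
    fun_prop
  have hη0 : 0 ≤ η := measureReal_nonneg.trans h
  -- The event is a cone, and at least half of its measure lies where `‖g‖ ≥ √ν`. There, replacing
  -- the factor `√ν` by `‖g‖` only increases the excesses, after which `‖g‖` cancels and the event
  -- for `g` itself remains.
  refine (stdGaussian_cone_le hm ?_).trans ?_
  · intro r x hr hx
    simp only [Set.mem_ofPred_eq] at hx ⊢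
    rw [norm_smul, Real.norm_of_nonneg hr.le]
    have e : ∀ j, excess (a * (r * ‖x‖)) (√ν * inner ℝ (A j) (r • x)) =
        r * excess (a * ‖x‖) (√ν * inner ℝ (A j) x) := by
      intro j
      rw [real_inner_smul_right, excess, excess, mul_max_of_nonneg _ _ hr.le, mul_zero,
        mul_left_comm, abs_mul, abs_of_pos hr]
      congr 1
      ring
    simp_rw [e, ← Finset.mul_sum]
    nlinarith
  · rw [ENNReal.ofReal_mul (by norm_num), ENNReal.ofReal_ofNat]
    refine mul_le_mul_right ?_ 2
    rw [← ENNReal.ofReal_toReal (measure_ne_top (stdGaussian E) _)]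
    refine ENNReal.ofReal_le_ofReal (le_trans (measureReal_mono fun g hg => ?_) h)
    obtain ⟨hg1, hg2⟩ := hg
    simp only [Set.mem_ofPred_eq] at hg1 hg2 ⊢
    rcases (norm_nonneg g).eq_or_lt with h0 | h0
    · rw [← h0] at hg1
      have hg0 : g = 0 := norm_eq_zero.1 h0.symm
      simp [hg0, excess] at hg1
    · have hle : √ν ≤ ‖g‖ := by
        rw [Real.sqrt_le_left h0.le]; linarith
      have e : ∑ j, excess (a * ‖g‖) (√ν * inner ℝ (A j) g) ≤ ‖g‖ * sumExcess A a g := by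
        rw [sumExcess, Finset.mul_sum]
        refine Finset.sum_le_sum fun j _ => ?_
        have e1 : ‖g‖ * excess a (inner ℝ (A j) g) = excess (a * ‖g‖) (‖g‖ * inner ℝ (A j) g) := by
          rw [excess, excess, mul_max_of_nonneg _ _ h0.le, mul_zero, abs_mul, abs_of_pos h0]
          congr 1
          ring
        rw [e1]
        refine excess_mono ?_
        rw [abs_mul, abs_mul, abs_of_nonneg (Real.sqrt_nonneg ν), abs_of_pos h0]
        gcongr
      have := hg1.trans_le e
      rw [mul_comm w] at this
      exact lt_of_mul_lt_mul_left this h0.le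

end noise

/-- The normal bound for one coordinate of a random direction, with the scaling `√(n - 3/2)`. -/
lemma measure_sphere_inner_gt_le {n : ℕ} (hn : 2 ≤ n) {a : EuclideanSpace ℝ (Fin n)}
    (ha : ‖a‖ = 1) {x : ℝ} (hx : 0 ≤ x) :
    stdGaussian (EuclideanSpace ℝ (Fin n)) {g | x * ‖g‖ < √(n - 3 / 2 : ℝ) * inner ℝ a g} ≤
      ENNReal.ofReal (gtail x) := by
  have hn' : (2 : ℝ) ≤ n := by exact_mod_cast hn
  set ν := √(n - 3 / 2 : ℝ) with hν
  have hν0 : 0 < ν := Real.sqrt_pos.2 (by linarith)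
  have h := stdGaussian_inner_gt_le hn a ha (y := x / ν) (by positivity)
  rw [mul_div_cancel₀ _ hν0.ne'] at h
  refine le_trans (le_of_eq ?_) h
  congr 1
  ext g
  simp only [Set.mem_ofPred_eq]
  rw [div_mul_eq_mul_div, div_lt_iff₀ hν0, mul_comm ν]

lemma measure_sphere_abs_inner_gt_le {n : ℕ} (hn : 2 ≤ n) {a : EuclideanSpace ℝ (Fin n)}
    (ha : ‖a‖ = 1) {x : ℝ} (hx : 0 ≤ x) :
    stdGaussian (EuclideanSpace ℝ (Fin n)) {g | x * ‖g‖ < |√(n - 3 / 2 : ℝ) * inner ℝ a g|} ≤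
      ENNReal.ofReal (2 * gtail x) := by
  have hsub : {g | x * ‖g‖ < |√(n - 3 / 2 : ℝ) * inner ℝ a g|} ⊆
      {g | x * ‖g‖ < √(n - 3 / 2 : ℝ) * inner ℝ a g} ∪
      {g | x * ‖g‖ < √(n - 3 / 2 : ℝ) * inner ℝ (-a) g} := by
    intro g hj
    rw [Set.mem_ofPred_eq] at hj
    rcases lt_abs.1 hj with h | h
    · exact Or.inl h
    · right
      simp only [Set.mem_ofPred_eq, inner_neg_left]
      linarith
  refine (measure_mono hsub).trans ((measure_union_le _ _).trans ?_)
  refine (add_le_add (measure_sphere_inner_gt_le hn ha hx)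
    (measure_sphere_inner_gt_le hn (by rwa [norm_neg]) hx)).trans (le_of_eq ?_)
  rw [← ENNReal.ofReal_add (gtail_nonneg x) (gtail_nonneg x), two_mul]

/-- The union bound for the largest coordinates of a random direction. -/
lemma measure_sphere_sup_le {n p : ℕ} (hn : 2 ≤ n) {A : Fin p → EuclideanSpace ℝ (Fin n)}
    (hA : ∀ j, ‖A j‖ = 1) (T : Finset (Fin p)) {x : ℝ} (hx : 0 ≤ x) :
    stdGaussian (EuclideanSpace ℝ (Fin n))
      {g | ∃ j ∈ T, x * ‖g‖ < |√(n - 3 / 2 : ℝ) * inner ℝ (A j) g|} ≤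
      ENNReal.ofReal (2 * T.card * gtail x) := by
  have hsub : {g | ∃ j ∈ T, x * ‖g‖ < |√(n - 3 / 2 : ℝ) * inner ℝ (A j) g|} ⊆
      ⋃ j ∈ T, {g | x * ‖g‖ < |√(n - 3 / 2 : ℝ) * inner ℝ (A j) g|} := by
    rintro g ⟨j, hjT, hj⟩
    exact Set.mem_biUnion hjT hj
  refine (measure_mono hsub).trans ((measure_biUnion_finset_le _ _).trans ?_)
  calc _ ≤ ∑ j ∈ T, ENNReal.ofReal (2 * gtail x) :=
        Finset.sum_le_sum fun j _ => measure_sphere_abs_inner_gt_le hn (hA j) hx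
    _ = _ := by
        rw [Finset.sum_const, ← ENNReal.ofReal_nsmul]
        congr 1
        rw [nsmul_eq_mul]; ring

open scoped Classical in
/-- Markov's inequality for the number of large coordinates of a random direction. -/
lemma measure_sphere_card_le {n p : ℕ} (hn : 2 ≤ n) {A : Fin p → EuclideanSpace ℝ (Fin n)}
    (hA : ∀ j, ‖A j‖ = 1) {x : ℝ} (hx : 0 ≤ x) (N : ℕ) (hN : 0 < N) :
    stdGaussian (EuclideanSpace ℝ (Fin n))
      {g | N ≤ (Finset.univ.filter fun j =>
        x * ‖g‖ < |√(n - 3 / 2 : ℝ) * inner ℝ (A j) g|).card} ≤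
      ENNReal.ofReal (2 * p * gtail x / N) := by
  set B : Fin p → Set (EuclideanSpace ℝ (Fin n)) := fun j =>
    {g | x * ‖g‖ < |√(n - 3 / 2 : ℝ) * inner ℝ (A j) g|} with hB
  have hBm : ∀ j, MeasurableSet (B j) := fun j =>
    measurableSet_lt (by fun_prop) (Continuous.measurable (by fun_prop))
  set f : EuclideanSpace ℝ (Fin n) → ENNReal := fun g => ∑ j, (B j).indicator 1 g with hf
  have hfm : Measurable f :=
    Finset.measurable_sum _ fun j _ => measurable_one.indicator (hBm j)
  have hfe : ∀ g, f g = ((Finset.univ.filter fun j =>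
        x * ‖g‖ < |√(n - 3 / 2 : ℝ) * inner ℝ (A j) g|).card : ENNReal) := by
    intro g
    simp only [hf, hB, Set.indicator_apply, Set.mem_ofPred_eq, Pi.one_apply]
    rw [Finset.sum_boole]
  have h1 := mul_meas_ge_le_lintegral (μ := stdGaussian (EuclideanSpace ℝ (Fin n))) hfm (N : ENNReal)
  have h2 : ∫⁻ g, f g ∂(stdGaussian (EuclideanSpace ℝ (Fin n))) ≤ ENNReal.ofReal (2 * p * gtail x) := by
    rw [hf, lintegral_finsetSum _ fun j _ => measurable_one.indicator (hBm j)]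
    calc _ ≤ ∑ j : Fin p, ENNReal.ofReal (2 * gtail x) := by
          refine Finset.sum_le_sum fun j _ => ?_
          rw [lintegral_indicator_one (hBm j)]
          exact measure_sphere_abs_inner_gt_le hn (hA j) hx
      _ = _ := by
          rw [Finset.sum_const, ← ENNReal.ofReal_nsmul, Finset.card_univ, Fintype.card_fin]
          congr 1
          rw [nsmul_eq_mul]; ring
  have hN' : (0 : ℝ) < N := by exact_mod_cast hN
  rw [ENNReal.ofReal_div_of_pos hN', ENNReal.le_div_iff_mul_le (by simp [hN.ne']) (by simp)]
  refine le_trans (le_of_eq ?_) (h1.trans h2)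
  rw [mul_comm, ENNReal.ofReal_natCast]
  congr 2
  ext g
  simp only [Set.mem_ofPred_eq, hfe]
  exact_mod_cast Iff.rfl

end ScaledLasso
end

/-! ### Integer combinations of columns and the greedy decomposition -/

noncomputable section
namespace ScaledLasso

/-- The linear combination `∑ j, b j • a j`. -/
def lin {E : Type*} [NormedAddCommGroup E] [InnerProductSpace ℝ E] {p : ℕ} (a : Fin p → E)
    (b : Fin p → ℝ) : E := ∑ j, b j • a j

/-- A two-sided geometric sum; the subtracted last term makes the induction close. -/
lemma sum_Icc_pow_natAbs_le {θ : ℝ} (h0 : 0 ≤ θ) (h1 : θ ≤ 1 / 2) (N : ℕ) :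
    ∑ c ∈ Finset.Icc (-(N : ℤ)) N, θ ^ c.natAbs ≤ 1 + 4 * θ - 4 * θ ^ (N + 1) := by
  induction N with
  | zero => simp
  | succ N ih =>
    have e : Finset.Icc (-((N + 1 : ℕ) : ℤ)) ((N + 1 : ℕ) : ℤ) =
        insert (-((N + 1 : ℕ) : ℤ)) (insert ((N + 1 : ℕ) : ℤ) (Finset.Icc (-(N : ℤ)) N)) := by
      ext x; simp only [Finset.mem_Icc, Finset.mem_insert]; omega
    rw [e, Finset.sum_insert (by simp only [Finset.mem_insert, Finset.mem_Icc]; omega),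
      Finset.sum_insert (by simp only [Finset.mem_Icc]; omega), Int.natAbs_neg, Int.natAbs_natCast]
    have := pow_nonneg h0 (N + 1)
    have h2 : θ ^ (N + 1 + 1) = θ ^ (N + 1) * θ := pow_succ _ _
    nlinarith

/-- A union bound over the integer combinations of the columns with small coefficients. -/
lemma measure_sphere_int_comb_le {n p : ℕ} (hn : 2 ≤ n) (A : Fin p → EuclideanSpace ℝ (Fin n))
    {θ x : ℝ} (hθ0 : 0 < θ) (hθ : θ ≤ 1 / 2) (hx : 0 ≤ x) (N : ℕ) :
    stdGaussian (EuclideanSpace ℝ (Fin n))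
      {g | ∃ c : Fin p → ℤ, ∑ j, (c j).natAbs ≤ N ∧ x * ‖lin A (fun j => (c j : ℝ))‖ * ‖g‖ <
        √(n - 3 / 2 : ℝ) * inner ℝ (lin A (fun j => (c j : ℝ))) g} ≤
      ENNReal.ofReal (gtail x * (θ ^ N)⁻¹ * Real.exp (4 * θ * p)) := by
  classical
  set I : Finset (Fin p → ℤ) := Fintype.piFinset fun _ => Finset.Icc (-(N : ℤ)) N with hI
  set W : (Fin p → ℤ) → EuclideanSpace ℝ (Fin n) := fun c => lin A (fun j => (c j : ℝ)) with hW
  set B : (Fin p → ℤ) → Set (EuclideanSpace ℝ (Fin n)) := fun c =>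
    {g | x * ‖W c‖ * ‖g‖ < √(n - 3 / 2 : ℝ) * inner ℝ (W c) g} with hB
  set I' := I.filter fun c => ∑ j, (c j).natAbs ≤ N with hI'
  have hsub : {g | ∃ c : Fin p → ℤ, ∑ j, (c j).natAbs ≤ N ∧ x * ‖W c‖ * ‖g‖ <
        √(n - 3 / 2 : ℝ) * inner ℝ (W c) g} ⊆ ⋃ c ∈ I', B c := by
    rintro g ⟨c, hc, hg⟩
    refine Set.mem_biUnion (x := c) ?_ hg
    simp only [hI', hI, Finset.coe_filter, Set.mem_ofPred_eq, Fintype.mem_piFinset, Finset.mem_Icc]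
    refine ⟨fun j => ?_, hc⟩
    have : (c j).natAbs ≤ ∑ j, (c j).natAbs :=
      Finset.single_le_sum (f := fun j => (c j).natAbs) (fun _ _ => Nat.zero_le _) (Finset.mem_univ j)
    omega
  have hBle : ∀ c, stdGaussian (EuclideanSpace ℝ (Fin n)) (B c) ≤ ENNReal.ofReal (gtail x) := by
    intro c
    rcases eq_or_ne (W c) 0 with h0 | h0
    · have : B c = ∅ := by
        ext g; simp [hB, h0]
      rw [this, measure_empty]; exact zero_le
    · have hn0 : 0 < ‖W c‖ := norm_pos_iff.2 h0
      have h := measure_sphere_inner_gt_le hn (a := ‖W c‖⁻¹ • W c)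
        (by rw [norm_smul, norm_inv, norm_norm, inv_mul_cancel₀ hn0.ne']) hx
      refine le_trans (le_of_eq ?_) h
      congr 1
      ext g
      simp only [hB, Set.mem_ofPred_eq, real_inner_smul_left]
      rw [mul_left_comm, inv_mul_eq_div, lt_div_iff₀ hn0, mul_right_comm]
  refine (measure_mono hsub).trans ((measure_biUnion_finset_le _ _).trans ?_)
  calc _ ≤ ∑ c ∈ I', ENNReal.ofReal (gtail x) := Finset.sum_le_sum fun c _ => hBle c
    _ = ENNReal.ofReal (I'.card * gtail x) := by
        rw [Finset.sum_const, ← ENNReal.ofReal_nsmul, nsmul_eq_mul]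
    _ ≤ _ := by
        refine ENNReal.ofReal_le_ofReal ?_
        -- Counting by a generating function: every admissible `c` has weight `θ^{-N} ∏ θ^{|c j|} ≥
        -- 1`, and the sum of the weights factorises over the coordinates into factors at most `1 +
        -- 4 θ`.
        have hcard : (I'.card : ℝ) ≤ (θ ^ N)⁻¹ * Real.exp (4 * θ * p) := by
          calc (I'.card : ℝ) = ∑ c ∈ I', (1 : ℝ) := by simp
            _ ≤ ∑ c ∈ I', (θ ^ N)⁻¹ * ∏ j, θ ^ (c j).natAbs := by
                refine Finset.sum_le_sum fun c hc => ?_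
                have hc' := (Finset.mem_filter.1 hc).2
                rw [Finset.prod_pow_eq_pow_sum, inv_mul_eq_div, le_div_iff₀ (by positivity), one_mul]
                exact pow_le_pow_of_le_one hθ0.le (by linarith) hc'
            _ ≤ ∑ c ∈ I, (θ ^ N)⁻¹ * ∏ j, θ ^ (c j).natAbs :=
                Finset.sum_le_sum_of_subset_of_nonneg (Finset.filter_subset _ _)
                  fun c _ _ => by positivity
            _ = (θ ^ N)⁻¹ * ∏ _j : Fin p, ∑ c ∈ Finset.Icc (-(N : ℤ)) N, θ ^ c.natAbs := by
                rw [← Finset.mul_sum, hI, Finset.prod_univ_sum]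
            _ ≤ (θ ^ N)⁻¹ * ∏ _j : Fin p, Real.exp (4 * θ) := by
                refine mul_le_mul_of_nonneg_left (Finset.prod_le_prod (fun j _ => ?_) fun j _ => ?_)
                  (by positivity)
                · exact Finset.sum_nonneg fun c _ => by positivity
                · refine (sum_Icc_pow_natAbs_le hθ0.le hθ N).trans ?_
                  have := Real.add_one_le_exp (4 * θ)
                  have := pow_nonneg hθ0.le (N + 1)
                  linarith
            _ = _ := by
                rw [Finset.prod_const, Finset.card_univ, Fintype.card_fin, ← Real.exp_nat_mul,
                  mul_comm (p : ℝ)]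
        have := mul_le_mul_of_nonneg_right hcard (gtail_nonneg x)
        linarith

/-- The surplus `5/9 - 1/2 = 1/18` in the exponent absorbs the factor of order `t` in Mills' bound
once `t ≥ 15`. -/
lemma exp_neg_le_gtail {t : ℝ} (ht : 15 ≤ t) : Real.exp (-(5 / 9 * t ^ 2)) ≤ gtail t := by
  have h := mul_gpdf_le t
  have hs := sqrt_two_pi_bounds
  have h1 : Real.exp (-t ^ 2 / 2) = √(2 * Real.pi) * gpdf t := by
    rw [gpdf_eq, ← mul_assoc, mul_inv_cancel₀ (by positivity), one_mul]
  have h2 : 26 / 5 * t ≤ Real.exp (t ^ 2 / 18) := by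
    have := Real.quadratic_le_exp_of_nonneg (x := t ^ 2 / 18) (by positivity)
    have h3 : 3375 * t ≤ t ^ 3 * t := by
      have : (15 : ℝ) ^ 3 ≤ t ^ 3 := by gcongr
      nlinarith
    nlinarith [sq_nonneg t]
  have h3 : Real.exp (-t ^ 2 / 2) = Real.exp (-(5 / 9 * t ^ 2)) * Real.exp (t ^ 2 / 18) := by
    rw [← Real.exp_add]; congr 1; ring
  set q := Real.exp (-(5 / 9 * t ^ 2)) with hq
  have hq0 : 0 < q := Real.exp_pos _
  have hg := gpdf_pos t
  have h4 : q * (26 / 5 * t) ≤ 2507 / 1000 * gpdf t := by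
    calc q * (26 / 5 * t) ≤ q * Real.exp (t ^ 2 / 18) := mul_le_mul_of_nonneg_left h2 hq0.le
      _ = √(2 * Real.pi) * gpdf t := by rw [← h3, h1]
      _ ≤ _ := mul_le_mul_of_nonneg_right hs.2.le hg.le
  have h5 : (t ^ 2 + 1) * q ≤ (t ^ 2 + 1) * gtail t := by
    refine le_trans ?_ h
    have h6 : t * (q * (26 / 5 * t)) ≤ t * (2507 / 1000 * gpdf t) :=
      mul_le_mul_of_nonneg_left h4 (by linarith)
    nlinarith [mul_pos hq0 (by nlinarith : (0 : ℝ) < t ^ 2 - 1)]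
  exact le_of_mul_le_mul_left h5 (by positivity)


section numerics
variable {p : ℕ} {k e t : ℝ}

/-- Raising the level by the factor `1 + η` gains `exp (-η t²) ≤ 1/16` over the union bound `2 p
gtail t = 2 k`. -/
lemma mul_gtail_one_add_le (hp : 0 < p) (hke : k ≤ e) (hk : 0 < k) (ht : 0 < t)
    (hgt : gtail t = k / p) {η : ℝ} (hη : 0 ≤ η) (hexp : Real.exp (-(η * t ^ 2)) ≤ 1 / 16) :
    2 * p * gtail ((1 + η) * t) ≤ e / 8 := by
  have hp' : (0 : ℝ) < p := by exact_mod_cast hp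
  have h1 := gtail_add_le t (η * t) (by positivity)
  have h2 : Real.exp (-(t * (η * t)) - (η * t) ^ 2 / 2) ≤ 1 / 16 := by
    refine le_trans (Real.exp_le_exp.2 ?_) hexp
    nlinarith [sq_nonneg (η * t)]
  have h3 := mul_le_mul_of_nonneg_right h2 (gtail_nonneg t)
  have h4 : p * gtail t = k := by rw [hgt]; field_simp
  rw [show (1 + η) * t = t + η * t by ring]
  have := mul_le_mul_of_nonneg_left (h1.trans h3) hp'.le
  linarith

lemma exp_neg_mul_le (hp : 0 < p) (ht : 15 ≤ t) (hke : k ≤ e) (hgt : gtail t = k / p) :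
    p * Real.exp (-(5 / 9 * t ^ 2)) ≤ e := by
  have hp' : (0 : ℝ) < p := by exact_mod_cast hp
  have h := mul_le_mul_of_nonneg_left (exp_neg_le_gtail ht) hp'.le
  have h4 : p * gtail t = k := by rw [hgt]; field_simp
  linarith

/-- For a small set `K` the level may even be lowered to `0.99 t`: the exponents `1/10` and `0.99² /
2` add up to more than `5/9`, and for `t ≥ 15` the surplus exceeds `7`, where `exp (-7) ≤ 1/8`. -/
lemma card_mul_gtail_le (hp : 0 < p) (ht : 15 ≤ t) (hke : k ≤ e) (hgt : gtail t = k / p)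
    {K : Finset (Fin p)} (hK : (K.card : ℝ) ≤ p * Real.exp (-(t ^ 2 / 10))) :
    2 * K.card * gtail (99 / 100 * t) ≤ e / 8 := by
  have h0 := exp_neg_mul_le hp ht hke hgt
  have h1 := gtail_le_exp (99 / 100 * t) (by positivity)
  have hp' : (0 : ℝ) < p := by exact_mod_cast hp
  have h2 : Real.exp (-(t ^ 2 / 10)) * Real.exp (-((99 / 100 * t) ^ 2) / 2) ≤
      Real.exp (-(5 / 9 * t ^ 2)) * (1 / 8) := by
    have h8 : Real.exp (-7) ≤ 1 / 8 := by
      rw [Real.exp_neg, one_div]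
      have := Real.add_one_le_exp (7 : ℝ)
      gcongr; linarith
    rw [← Real.exp_add]
    refine le_trans ?_ (mul_le_mul_of_nonneg_left h8 (Real.exp_nonneg _))
    rw [← Real.exp_add, Real.exp_le_exp]
    nlinarith
  calc 2 * K.card * gtail (99 / 100 * t)
      ≤ 2 * (p * Real.exp (-(t ^ 2 / 10))) * (Real.exp (-((99 / 100 * t) ^ 2) / 2) / 2) := by
        gcongr
        exact gtail_nonneg _
    _ = p * (Real.exp (-(t ^ 2 / 10)) * Real.exp (-((99 / 100 * t) ^ 2) / 2)) := by ring
    _ ≤ p * (Real.exp (-(5 / 9 * t ^ 2)) * (1 / 8)) := by gcongr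
    _ ≤ _ := by linarith

/-- For a large set `K`, `N = 80 |K|` and `θ = exp (-t² / 10)`. The tail at `√N t / 2` contributes
the exponent `-10 |K| t²`, the count contributes `8 |K| t²`, and `4 θ p ≤ 4 |K|` by the size of `K`.
The balance `-2 |K| t² + 4 |K|` is far below `-(5/9) t² - 7`. -/
lemma int_comb_bound_le (hp : 0 < p) (ht : 15 ≤ t) (hke : k ≤ e) (hgt : gtail t = k / p)
    {K : Finset (Fin p)} (hK : p * Real.exp (-(t ^ 2 / 10)) < K.card) :
    gtail (√((80 * K.card : ℕ) : ℝ) * (t / 2)) * (Real.exp (-(t ^ 2 / 10)) ^ (80 * K.card))⁻¹ *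
      Real.exp (4 * Real.exp (-(t ^ 2 / 10)) * p) ≤ e / 8 := by
  have h0 := exp_neg_mul_le hp ht hke hgt
  have hp' : (1 : ℝ) ≤ p := by exact_mod_cast hp
  have hKpos : (0 : ℝ) < K.card := lt_of_le_of_lt (by positivity) hK
  have hK1 : (1 : ℝ) ≤ K.card := by exact_mod_cast (by exact_mod_cast hKpos : 0 < K.card)
  have h1 := gtail_le_exp (√((80 * K.card : ℕ) : ℝ) * (t / 2)) (by positivity)
  have e1 : (√((80 * K.card : ℕ) : ℝ) * (t / 2)) ^ 2 = 20 * K.card * t ^ 2 := by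
    rw [mul_pow, Real.sq_sqrt (by positivity)]; push_cast; ring
  rw [e1] at h1
  have e2 : (Real.exp (-(t ^ 2 / 10)) ^ (80 * K.card))⁻¹ = Real.exp (8 * K.card * t ^ 2) := by
    rw [← Real.exp_nat_mul, ← Real.exp_neg]; congr 1; push_cast; ring
  rw [e2]
  have h3 : Real.exp (4 * Real.exp (-(t ^ 2 / 10)) * p) ≤ Real.exp (4 * K.card) := by
    rw [Real.exp_le_exp]; nlinarith
  have h8 : Real.exp (-7) ≤ 1 / 8 := by
    rw [Real.exp_neg, one_div]
    have := Real.add_one_le_exp (7 : ℝ)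
    gcongr; linarith
  have ht2 : 225 ≤ t ^ 2 := by nlinarith
  calc _ ≤ Real.exp (-(20 * K.card * t ^ 2) / 2) / 2 * Real.exp (8 * K.card * t ^ 2) *
        Real.exp (4 * K.card) := by gcongr
    _ = Real.exp (-(2 * K.card * t ^ 2) + 4 * K.card) / 2 := by
        rw [div_mul_eq_mul_div, div_mul_eq_mul_div, ← Real.exp_add, ← Real.exp_add]
        congr 2; ring
    _ ≤ Real.exp (-(5 / 9 * t ^ 2) + -7) := by
        have : Real.exp (-(2 * K.card * t ^ 2) + 4 * K.card) ≤ Real.exp (-(5 / 9 * t ^ 2) + -7) := by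
          rw [Real.exp_le_exp]
          nlinarith [mul_le_mul_of_nonneg_right hK1 (by linarith : 0 ≤ 2 * t ^ 2 - 4)]
        have := Real.exp_pos (-(2 * K.card * t ^ 2) + 4 * K.card)
        linarith
    _ ≤ p * (Real.exp (-(5 / 9 * t ^ 2)) * (1 / 8)) := by
        rw [Real.exp_add]
        have h9 := mul_le_mul_of_nonneg_left h8 (Real.exp_nonneg (-(5 / 9 * t ^ 2)))
        have := Real.exp_pos (-(5 / 9 * t ^ 2))
        nlinarith
    _ ≤ _ := by linarith

end numerics

section greedy
variable {E : Type*} [NormedAddCommGroup E] [InnerProductSpace ℝ E] {p : ℕ}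

lemma inner_lin_left (a : Fin p → E) (b : Fin p → ℝ) (v : E) :
    inner ℝ (lin a b) v = ∑ j, b j * inner ℝ (a j) v := by
  simp [lin, sum_inner, real_inner_smul_left]

lemma lin_add (a : Fin p → E) (b c : Fin p → ℝ) : lin a (b + c) = lin a b + lin a c := by
  simp [lin, add_smul, Finset.sum_add_distrib]

lemma lin_sub (a : Fin p → E) (b c : Fin p → ℝ) : lin a (b - c) = lin a b - lin a c := by
  simp [lin, sub_smul, Finset.sum_sub_distrib]

lemma lin_smul (a : Fin p → E) (r : ℝ) (b : Fin p → ℝ) : lin a (r • b) = r • lin a b := by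
  simp [lin, Finset.smul_sum, mul_smul]

lemma lin_single (a : Fin p → E) (j : Fin p) (r : ℝ) : lin a (Pi.single j r) = r • a j := by
  rw [lin, Finset.sum_eq_single j]
  · simp
  · intro i _ hi; simp [Pi.single_eq_of_ne hi]
  · simp

/-- Greedy decomposition: if a unit vector has small correlation with all the integer combinations
of at most `N` columns, then its correlations with the columns are small after the removal of a
short vector. -/
lemma inner_le_of_int_comb {a : Fin p → E} (ha : ∀ j, ‖a j‖ = 1) {e : E} (he : ‖e‖ = 1) {L : ℝ}
    (hL : 0 < L) {N : ℕ} (hN : 80 ≤ N)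
    (h : ∀ c : Fin p → ℤ, ∑ j, (c j).natAbs ≤ N →
      inner ℝ (lin a (fun j => (c j : ℝ))) e ≤ √N * (L / 2) * ‖lin a (fun j => (c j : ℝ))‖)
    (u : Fin p → ℝ) :
    inner ℝ (lin a u) e ≤ 11 / 20 * L * l1 u + L * √N * ‖lin a u‖ := by
  classical
  set W : (Fin p → ℤ) → E := fun c => lin a (fun j => (c j : ℝ)) with hW
  set I : Finset (Fin p → ℤ) := (Fintype.piFinset fun _ => Finset.Icc (-(N : ℤ)) N).filter
    fun c => ∑ j, (c j).natAbs ≤ N with hI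
  have hmem : ∀ c : Fin p → ℤ, ∑ j, (c j).natAbs ≤ N → c ∈ I := by
    intro c hc
    simp only [hI, Finset.mem_filter, Fintype.mem_piFinset, Finset.mem_Icc]
    refine ⟨fun j => ?_, hc⟩
    have : (c j).natAbs ≤ ∑ j, (c j).natAbs :=
      Finset.single_le_sum (f := fun j => (c j).natAbs) (fun _ _ => Nat.zero_le _) (Finset.mem_univ j)
    omega
  -- Penalised least squares over the integer combinations with step `L / 2`. The penalty weight
  -- `3/10` is large enough to keep the minimiser away from the boundary of the admissible set, and
  -- with the term `1/4` of one step it gives the constant `11/20 = 1/4 + 3/10`.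
  set G : (Fin p → ℤ) → ℝ := fun c =>
    ‖e - (L / 2) • W c‖ ^ 2 + 3 / 10 * L ^ 2 * ((∑ j, (c j).natAbs : ℕ) : ℝ) with hG
  have h0mem : (0 : Fin p → ℤ) ∈ I := hmem 0 (by simp)
  obtain ⟨c, hcI, hcmin⟩ := I.exists_min_image G ⟨0, h0mem⟩
  have hcN : ∑ j, (c j).natAbs ≤ N := (Finset.mem_filter.1 hcI).2
  set s : ℝ := ((∑ j, (c j).natAbs : ℕ) : ℝ) with hs
  set r := √(N : ℝ) with hr
  have hr2 : r ^ 2 = N := Real.sq_sqrt (Nat.cast_nonneg N)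
  have hr0 : 0 ≤ r := Real.sqrt_nonneg _
  have hs0 : 0 ≤ s := Nat.cast_nonneg _
  have hexpand : ‖e - (L / 2) • W c‖ ^ 2 = 1 - L * inner ℝ (W c) e + L ^ 2 / 4 * ‖W c‖ ^ 2 := by
    rw [norm_sub_sq_real, real_inner_smul_right, norm_smul, he, real_inner_comm (W c) e,
      Real.norm_of_nonneg (by positivity)]
    ring
  have hG0 : G c ≤ 1 := by
    refine (hcmin 0 h0mem).trans (le_of_eq ?_)
    have : W 0 = 0 := by simp [hW, lin]
    simp [hG, this, he]
  -- Comparison of the minimiser with `c = 0`, using the assumed bound on the correlation of `W c`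
  -- with `e`.
  have hbase : ‖W c‖ ^ 2 / 4 + 3 / 10 * s ≤ r / 2 * ‖W c‖ := by
    have h1 := h c hcN
    simp only [hG] at hG0
    rw [hexpand] at hG0
    have h2 := mul_le_mul_of_nonneg_left h1 hL.le
    have : L ^ 2 * (‖W c‖ ^ 2 / 4 + 3 / 10 * s) ≤ L ^ 2 * (r / 2 * ‖W c‖) := by
      nlinarith
    exact le_of_mul_le_mul_left this (by positivity)
  have hWr : ‖W c‖ ≤ 2 * r := by
    by_contra hcon
    rw [not_le] at hcon
    nlinarith [norm_nonneg (W c)]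
  -- The right side of `hbase` minus `‖W c‖² / 4` is at most `N / 4`, so `s ≤ 5 N / 6`. Hence all
  -- neighbours of the minimiser are admissible.
  have hsN : s + 1 ≤ N := by
    have hN' : (80 : ℝ) ≤ N := by exact_mod_cast hN
    nlinarith [sq_nonneg (‖W c‖ / 2 - r / 2)]
  set e₁ := e - (L / 2) • W c with he₁
  -- Adding one column with coefficient `±1` cannot decrease `G`; the change of the square is `-L d
  -- ⟪a j, e₁⟫ + L² / 4` and the penalty grows by at most `3 L² / 10`.
  have hmove : ∀ (j : Fin p) (d : ℤ), d.natAbs = 1 → d * inner ℝ (a j) e₁ ≤ 11 / 20 * L := by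
    intro j d hd
    set c' : Fin p → ℤ := c + Pi.single j d with hc'
    have hle : ∑ i, (c' i).natAbs ≤ ∑ i, (c i).natAbs + 1 := by
      calc ∑ i, (c' i).natAbs ≤ ∑ i, ((c i).natAbs + (Pi.single (M := fun _ => ℤ) j d i).natAbs) :=
            Finset.sum_le_sum fun i _ => Int.natAbs_add_le _ _
        _ = ∑ i, (c i).natAbs + 1 := by
            rw [Finset.sum_add_distrib]
            congr 1
            rw [Finset.sum_eq_single j]
            · simpa using hd
            · intro i _ hi; simp [Pi.single_eq_of_ne hi]
            · simp
    have hle' : ((∑ i, (c' i).natAbs : ℕ) : ℝ) ≤ s + 1 := by rw [hs]; exact_mod_cast hle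
    have hc'I : c' ∈ I := hmem c' (by
      have : ((∑ i, (c' i).natAbs : ℕ) : ℝ) ≤ N := hle'.trans hsN
      exact_mod_cast this)
    have hmin := hcmin c' hc'I
    have hWc' : W c' = W c + (d : ℝ) • a j := by
      simp only [hW]
      have : (fun i => ((c' i : ℤ) : ℝ)) = (fun i => (c i : ℝ)) + Pi.single j (d : ℝ) := by
        ext i
        rcases eq_or_ne i j with rfl | hi
        · simp [hc']
        · simp [hc', Pi.single_eq_of_ne hi]
      rw [this, lin_add, lin_single]
    have hd2 : (d : ℝ) ^ 2 = 1 := by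
      rcases Int.natAbs_eq d with h | h <;> rw [h, hd] <;> simp
    have hn : ‖e - (L / 2) • W c'‖ ^ 2 = ‖e₁‖ ^ 2 - L * (d * inner ℝ (a j) e₁) + L ^ 2 / 4 := by
      have : e - (L / 2) • W c' = e₁ - (L / 2 * d) • a j := by
        rw [hWc', he₁]; module
      rw [this, norm_sub_sq_real, real_inner_smul_right, norm_smul, ha j, mul_one,
        Real.norm_eq_abs, sq_abs, real_inner_comm (a j) e₁]
      linear_combination (L ^ 2 / 4) * hd2
    simp only [hG] at hmin
    rw [hn, ← he₁, ← hs] at hmin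
    have h3 := mul_le_mul_of_nonneg_left hle' (by positivity : 0 ≤ 3 / 10 * L ^ 2)
    have : L * (d * inner ℝ (a j) e₁) ≤ L * (11 / 20 * L) := by nlinarith
    exact le_of_mul_le_mul_left this hL
  have hcorr : ∀ j, |inner ℝ (a j) e₁| ≤ 11 / 20 * L := by
    intro j
    have h1 := hmove j 1 rfl
    have h2 := hmove j (-1) rfl
    push_cast at h1 h2
    rw [abs_le]; constructor <;> linarith
  have hsplit : e = e₁ + (L / 2) • W c := by rw [he₁]; abel
  have h1 : inner ℝ (lin a u) e₁ ≤ 11 / 20 * L * l1 u := by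
    rw [inner_lin_left, l1, l1On, Finset.mul_sum]
    refine Finset.sum_le_sum fun j _ => ?_
    refine (le_abs_self _).trans ?_
    rw [abs_mul, mul_comm]
    exact mul_le_mul_of_nonneg_right (hcorr j) (abs_nonneg _)
  have h2 : inner ℝ (lin a u) ((L / 2) • W c) ≤ L * r * ‖lin a u‖ := by
    refine (real_inner_le_norm _ _).trans ?_
    rw [norm_smul, Real.norm_of_nonneg (by positivity)]
    have := mul_le_mul_of_nonneg_left hWr (by positivity : 0 ≤ ‖lin a u‖ * (L / 2))
    linarith
  have h3 : inner ℝ (lin a u) e = inner ℝ (lin a u) e₁ + inner ℝ (lin a u) ((L / 2) • W c) := by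
    rw [← inner_add_right, ← hsplit]
  linarith

end greedy

end ScaledLasso
end

/-! ### Normalised columns and transfer to the linear model -/

noncomputable section
namespace ScaledLasso

instance {n p : ℕ} : BorelSpace (Matrix (Fin n) (Fin p) ℝ) :=
  inferInstanceAs (BorelSpace (Fin n → Fin p → ℝ))

/-- The columns of the design, divided by `√n`. -/
def colE {n p : ℕ} (X : Matrix (Fin n) (Fin p) ℝ) (j : Fin p) : EuclideanSpace ℝ (Fin n) :=
  WithLp.toLp 2 fun i => X i j / √(n : ℝ)

section cols
variable {n p : ℕ}

lemma continuous_colE (j : Fin p) :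
    Continuous fun X : Matrix (Fin n) (Fin p) ℝ => colE X j := by
  unfold colE
  refine (PiLp.continuous_toLp 2 _).comp (continuous_pi fun i => ?_)
  exact (continuous_id.matrix_elem i j).div_const _

lemma lin_colE (X : Matrix (Fin n) (Fin p) ℝ) (b : Fin p → ℝ) :
    lin (colE X) b = (√(n : ℝ))⁻¹ • WithLp.toLp 2 (X.mulVec b) := by
  ext i
  simp only [lin, colE, PiLp.smul_apply, WithLp.ofLp_sum, Finset.sum_apply, WithLp.ofLp_smul,
    Pi.smul_apply, smul_eq_mul, Matrix.mulVec, dotProduct, Finset.mul_sum]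
  exact Finset.sum_congr rfl fun j _ => by ring

lemma norm_lin_colE (X : Matrix (Fin n) (Fin p) ℝ) (b : Fin p → ℝ) :
    ‖lin (colE X) b‖ = l2 (X.mulVec b) / √(n : ℝ) := by
  rw [lin_colE, norm_smul, norm_inv, Real.norm_of_nonneg (Real.sqrt_nonneg _), l2,
    inv_mul_eq_div]

lemma norm_colE (X : Matrix (Fin n) (Fin p) ℝ) (j : Fin p) :
    ‖colE X j‖ = l2 (fun i => X i j) / √(n : ℝ) := by
  have h := norm_lin_colE X (Pi.single j 1)
  rw [lin_single, one_smul] at h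
  rw [h, Matrix.mulVec_single_one]
  rfl

lemma norm_colE_eq_one (hn : 0 < n) {X : Matrix (Fin n) (Fin p) ℝ} {j : Fin p}
    (h : l2 (fun i => X i j) ^ 2 = n) : ‖colE X j‖ = 1 := by
  have hn' : (0 : ℝ) < n := by exact_mod_cast hn
  have h0 : 0 ≤ l2 (fun i => X i j) := norm_nonneg _
  rw [norm_colE, ← h, Real.sqrt_sq h0, div_self]
  intro h1
  rw [h1] at h
  norm_num at h
  linarith

end cols

section integration
variable {n p : ℕ}

lemma pi_gaussianReal_eq_map (m : Fin n → ℝ) (σ : ℝ) :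
    Measure.pi (fun i => gaussianReal (m i) (Real.toNNReal (σ ^ 2))) =
      (stdGaussian (EuclideanSpace ℝ (Fin n))).map (fun g i => m i + σ * g i) := by
  have h1 : ∀ i, gaussianReal (m i) (Real.toNNReal (σ ^ 2)) =
      (gaussianReal 0 1).map (fun x => m i + σ * x) := by
    intro i
    have : (fun x : ℝ => m i + σ * x) = (fun x => m i + x) ∘ fun x => σ * x := rfl
    rw [this, ← Measure.map_map (by fun_prop) (by fun_prop), gaussianReal_map_const_mul,
      gaussianReal_map_const_add]
    congr 1
    · ring
    · ext; simp [Real.coe_toNNReal _ (sq_nonneg σ)]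
  simp_rw [h1]
  rw [← Measure.pi_map_pi (fun i => by fun_prop), ← map_pi_eq_stdGaussian,
    Measure.map_map (by fun_prop) (by fun_prop)]
  rfl

/-- Transfer of a bound for Gaussian noise and fixed design to the linear model. -/
lemma IsModel.measure_noise_le {Ω : Type*} [MeasurableSpace Ω] {μ : Measure Ω}
    [IsProbabilityMeasure μ] {d : Data Ω n p} {σ lam : ℝ} (hm : IsModel μ d σ lam)
    {Bad : Set (Matrix (Fin n) (Fin p) ℝ × EuclideanSpace ℝ (Fin n))} (hBad : MeasurableSet Bad)
    {C : Set (Matrix (Fin n) (Fin p) ℝ)} (hC : MeasurableSet C)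
    (hscale : ∀ X w (r : ℝ), 0 < r → (X, r • w) ∈ Bad → (X, w) ∈ Bad) {η : ENNReal}
    (h : ∀ X ∈ C, stdGaussian (EuclideanSpace ℝ (Fin n)) {g | (X, g) ∈ Bad} ≤ η) :
    μ {ω | d.X ω ∈ C ∧
      (d.X ω, WithLp.toLp 2 (d.Y ω - (d.X ω).mulVec (d.γ ω))) ∈ Bad} ≤ η := by
  set Q := (Matrix (Fin n) (Fin p) ℝ × (Fin p → ℝ)) × (Fin n → ℝ) with hQ
  have hXij : ∀ i j, Measurable fun q : Q => q.1.1 i j := fun i j =>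
    (measurable_pi_apply j).comp ((measurable_pi_apply i).comp
      (measurable_fst.comp measurable_fst))
  have hres : Measurable fun q : Q => q.2 - q.1.1.mulVec q.1.2 := by
    refine measurable_pi_lambda _ fun i => ?_
    simp only [Pi.sub_apply, Matrix.mulVec, dotProduct]
    refine Measurable.sub ((measurable_pi_apply i).comp measurable_snd)
      (Finset.measurable_sum _ fun j _ => (hXij i j).mul
        ((measurable_pi_apply j).comp (measurable_snd.comp measurable_fst)))
  set S : Set Q := {q | q.1.1 ∈ C ∧
    (q.1.1, (WithLp.toLp 2 (q.2 - q.1.1.mulVec q.1.2) : EuclideanSpace ℝ (Fin n))) ∈ Bad} with hS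
  have hSm : MeasurableSet S := by
    refine MeasurableSet.inter ((measurable_fst.comp measurable_fst) hC) ?_
    refine ((measurable_fst.comp measurable_fst).prodMk ?_) hBad
    exact (by fun_prop : Measurable (WithLp.toLp 2 : (Fin n → ℝ) → EuclideanSpace ℝ (Fin n))).comp hres
  have hZ : Measurable fun ω => (d.X ω, d.γ ω) := hm.measurable_X.prodMk hm.measurable_γ
  have hpre : {ω | d.X ω ∈ C ∧
      (d.X ω, WithLp.toLp 2 (d.Y ω - (d.X ω).mulVec (d.γ ω))) ∈ Bad} =
      (fun ω => ((d.X ω, d.γ ω), d.Y ω)) ⁻¹' S := rfl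
  rw [hpre, ← Measure.map_apply (hZ.prodMk hm.measurable_Y) hSm,
    ← compProd_map_condDistrib hm.measurable_Y.aemeasurable, Measure.compProd_apply hSm]
  have : IsProbabilityMeasure (μ.map fun ω => (d.X ω, d.γ ω)) :=
    Measure.isProbabilityMeasure_map hZ.aemeasurable
  calc _ ≤ ∫⁻ _, η ∂(μ.map fun ω => (d.X ω, d.γ ω)) := by
        refine lintegral_mono_ae ?_
        filter_upwards [hm.law] with a ha
        rw [ha, pi_gaussianReal_eq_map,
          Measure.map_apply (by fun_prop) (measurable_prodMk_left hSm)]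
        by_cases haC : a.1 ∈ C
        · refine le_trans (measure_mono fun g hg => ?_) (h a.1 haC)
          simp only [hS, Set.mem_preimage, Set.mem_ofPred_eq] at hg ⊢
          -- Conditionally on `(X, γ)` the noise is `σ g` with `g` standard Gaussian. The invariance
          -- of the bad event under scaling removes `σ`.
          refine hscale a.1 g σ hm.σ_pos ?_
          convert hg.2 using 2
          ext i
          simp
        · have : (fun (g : EuclideanSpace ℝ (Fin n)) i => a.1.mulVec a.2 i + σ * g i) ⁻¹'
              (Prod.mk a ⁻¹' S) = ∅ := by
            ext g
            simp only [hS, Set.mem_preimage, Set.mem_empty_iff_false, iff_false]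
            exact fun h => haC h.1
          rw [this, measure_empty]
          exact zero_le
    _ = η := by simp

end integration

end ScaledLasso
end

/-! ### Deterministic analysis of the square-root lasso -/

noncomputable section
namespace ScaledLasso

section l1norm
variable {p : ℕ}

lemma l1On_nonneg (K : Finset (Fin p)) (u : Fin p → ℝ) : 0 ≤ l1On K u :=
  Finset.sum_nonneg fun _ _ => abs_nonneg _

lemma l1_nonneg (u : Fin p → ℝ) : 0 ≤ l1 u := l1On_nonneg _ u

lemma l1_eq_add (K : Finset (Fin p)) (u : Fin p → ℝ) : l1 u = l1On K u + l1On Kᶜ u :=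
  (Finset.sum_add_sum_compl K _).symm

lemma l1On_add_le (K : Finset (Fin p)) (u v : Fin p → ℝ) :
    l1On K (u + v) ≤ l1On K u + l1On K v := by
  unfold l1On
  rw [← Finset.sum_add_distrib]
  exact Finset.sum_le_sum fun j _ => abs_add_le _ _

lemma l1_add_le (u v : Fin p → ℝ) : l1 (u + v) ≤ l1 u + l1 v := l1On_add_le _ u v

lemma l1On_smul (K : Finset (Fin p)) (c : ℝ) (u : Fin p → ℝ) :
    l1On K (c • u) = |c| * l1On K u := by
  simp [l1On, abs_mul, Finset.mul_sum]

lemma l1_smul (c : ℝ) (u : Fin p → ℝ) : l1 (c • u) = |c| * l1 u := l1On_smul _ c u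

lemma l1On_le_add (K : Finset (Fin p)) (γ h : Fin p → ℝ) :
    l1On K h ≤ l1On K (γ + h) + l1On K γ := by
  unfold l1On
  rw [← Finset.sum_add_distrib]
  refine Finset.sum_le_sum fun j _ => ?_
  have := abs_sub (γ j + h j) (γ j)
  simpa using this

lemma l1On_le_add' (K : Finset (Fin p)) (γ h : Fin p → ℝ) :
    l1On K γ ≤ l1On K (γ + h) + l1On K h := by
  rw [add_comm γ h]; exact l1On_le_add K h γ

/-- The increase of the penalty is at least the off-target part of the error minus the rest. -/
lemma l1_sub_le_l1_add_sub (K : Finset (Fin p)) (γ h : Fin p → ℝ) :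
    l1On Kᶜ h - l1On K h - 2 * l1On Kᶜ γ ≤ l1 (γ + h) - l1 γ := by
  have h1 := l1On_le_add Kᶜ γ h
  have h2 := l1On_le_add' K γ h
  rw [l1_eq_add K (γ + h), l1_eq_add K γ]
  linarith

lemma l1_eq_zero {u : Fin p → ℝ} (h : l1 u ≤ 0) : u = 0 := by
  have h0 : ∑ k, |u k| = 0 := le_antisymm h (l1_nonneg u)
  rw [Finset.sum_eq_zero_iff_of_nonneg fun _ _ => abs_nonneg _] at h0
  ext j
  simpa using h0 j (Finset.mem_univ j)

lemma l1On_eq_of_supp_subset {S : Finset (Fin p)} {u : Fin p → ℝ} (h : supp u ⊆ S) :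
    l1On S u = l1 u ∧ l1On Sᶜ u = 0 := by
  have h0 : l1On Sᶜ u = 0 := Finset.sum_eq_zero fun j hj => by
    rw [Finset.mem_compl] at hj
    have : j ∉ supp u := fun h' => hj (h h')
    simpa [supp] using this
  exact ⟨by rw [l1_eq_add S u, h0, add_zero], h0⟩

lemma supp_smul {c : ℝ} (hc : c ≠ 0) (u : Fin p → ℝ) : supp (c • u) = supp u := by
  ext j; simp [supp, hc]

end l1norm

section deterministic
variable {E : Type*} [NormedAddCommGroup E] [InnerProductSpace ℝ E] {p : ℕ}

/-- The minimisation property of the square-root lasso `γ + h` in normalised form: the columns and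
the oracle residual `r` have norm one. -/
structure SqrtLasso (a : Fin p → E) (r : E) (γ h : Fin p → ℝ) (lam : ℝ) : Prop where
  norm_col : ∀ j, ‖a j‖ = 1
  norm_res : ‖r‖ = 1
  lam_pos : 0 < lam
  min_le : ∀ b, ‖r - lin a h‖ + lam * l1 (γ + h) ≤ ‖r - lin a b‖ + lam * l1 (γ + b)

variable {a : Fin p → E} {r : E} {γ h : Fin p → ℝ} {lam Z : ℝ}

lemma abs_inner_lin_le (hZ : ∀ j, |inner ℝ (a j) r| ≤ Z) (u : Fin p → ℝ) :
    |inner ℝ (lin a u) r| ≤ Z * l1 u := by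
  rw [inner_lin_left, l1, l1On, Finset.mul_sum]
  refine (Finset.abs_sum_le_sum_abs _ _).trans (Finset.sum_le_sum fun j _ => ?_)
  rw [abs_mul, mul_comm]
  exact mul_le_mul_of_nonneg_right (hZ j) (abs_nonneg _)

lemma norm_lin_le_l1 (ha : ∀ j, ‖a j‖ = 1) (u : Fin p → ℝ) : ‖lin a u‖ ≤ l1 u := by
  refine (norm_sum_le _ _).trans (le_of_eq ?_)
  exact Finset.sum_congr rfl fun j _ => by rw [norm_smul, ha, mul_one, Real.norm_eq_abs]

namespace SqrtLasso
variable (H : SqrtLasso a r γ h lam)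
include H

lemma norm_res_sq : ‖r - lin a h‖ ^ 2 = 1 - 2 * inner ℝ (lin a h) r + ‖lin a h‖ ^ 2 := by
  rw [norm_sub_sq_real, H.norm_res, real_inner_comm]; ring

/-- Projection of the residual on the unit vector `r`. This linear lower bound of the loss is what
makes the basic inequality free of any noise level. -/
lemma one_sub_inner_le : 1 - inner ℝ (lin a h) r ≤ ‖r - lin a h‖ := by
  have h1 : inner ℝ (r - lin a h) r ≤ ‖r - lin a h‖ * ‖r‖ := real_inner_le_norm _ _
  rw [inner_sub_left, real_inner_self_eq_norm_sq, H.norm_res] at h1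
  linarith

lemma norm_res_add_le : ‖r - lin a h‖ + lam * (l1 (γ + h) - l1 γ) ≤ 1 := by
  have h1 := H.min_le 0
  simp only [add_zero] at h1
  have h2 : lin a (0 : Fin p → ℝ) = 0 := by simp [lin]
  rw [h2, sub_zero, H.norm_res] at h1
  linarith

/-- The basic inequality. -/
lemma basic : lam * (l1 (γ + h) - l1 γ) ≤ inner ℝ (lin a h) r := by
  have h1 := H.norm_res_add_le
  have h2 := H.one_sub_inner_le
  linarith

lemma basic_on (K : Finset (Fin p)) :
    lam * (l1On Kᶜ h - l1On K h - 2 * l1On Kᶜ γ) ≤ inner ℝ (lin a h) r :=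
  (mul_le_mul_of_nonneg_left (l1_sub_le_l1_add_sub K γ h) H.lam_pos.le).trans H.basic

lemma norm_res_le : ‖r - lin a h‖ ≤ 1 + lam * l1 h := by
  have h1 := H.norm_res_add_le
  have h2 : l1 γ ≤ l1 (γ + h) + l1 h := l1On_le_add' _ γ h
  have := mul_le_mul_of_nonneg_left h2 H.lam_pos.le
  linarith

/-- Squaring `norm_res_le` and expanding the residual: the prediction error is controlled by the
`ℓ₁` error. Combined with a compatibility inequality in the other direction, this closes to an `ℓ₁`
bound. -/
lemma norm_lin_sq_le (hZ : ∀ j, |inner ℝ (a j) r| ≤ Z) :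
    ‖lin a h‖ ^ 2 ≤ 2 * (lam + Z) * l1 h + lam ^ 2 * l1 h ^ 2 := by
  have h1 := H.norm_res_sq
  have h2 : ‖r - lin a h‖ ^ 2 ≤ (1 + lam * l1 h) ^ 2 :=
    pow_le_pow_left₀ (norm_nonneg _) H.norm_res_le 2
  have h3 := le_of_abs_le (abs_inner_lin_le hZ h)
  nlinarith

/-- Prediction and noise level bounds from an `ℓ₁` bound. -/
lemma bounds_of_l1_le {Z' B D q l : ℝ} (hZ : ∀ j, |inner ℝ (a j) r| ≤ Z' * lam) (hZ' : 0 ≤ Z')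
    (hB : lam ≤ B * l) (hD : 0 ≤ D) (hq : 0 ≤ q) (hl : 0 ≤ l)
    (hh : l1 h ≤ D * q * l) (hsmall : B * D * (q * l ^ 2) ≤ 1) :
    ‖lin a h‖ ^ 2 ≤ (3 + 2 * Z') * D * (q * lam * l) ∧
    ‖lin a h‖ ^ 2 ≤ (3 + 2 * Z') * (B * D) * (q * l ^ 2) ∧
    |‖r - lin a h‖ - 1| ≤ (1 + Z') * (B * D) * (q * l ^ 2) := by
  have hlam := H.lam_pos
  have hn := l1_nonneg h
  have hDql : 0 ≤ D * q * l := by positivity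
  have h1 : lam * l1 h ≤ B * D * (q * l ^ 2) := by
    calc lam * l1 h ≤ (B * l) * (D * q * l) := mul_le_mul hB hh hn (hlam.le.trans hB)
      _ = _ := by ring
  have h0 : 0 ≤ lam * l1 h := by positivity
  have h2 := H.norm_lin_sq_le hZ
  have h3 : ‖lin a h‖ ^ 2 ≤ (3 + 2 * Z') * (lam * l1 h) := by nlinarith
  refine ⟨h3.trans ?_, h3.trans ?_, ?_⟩
  · calc (3 + 2 * Z') * (lam * l1 h) ≤ (3 + 2 * Z') * (lam * (D * q * l)) := by gcongr
      _ = _ := by ring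
  · calc (3 + 2 * Z') * (lam * l1 h) ≤ (3 + 2 * Z') * (B * D * (q * l ^ 2)) := by gcongr
      _ = _ := by ring
  · have h4 := H.norm_res_le
    have h5 := H.one_sub_inner_le
    have h6 := le_of_abs_le (abs_inner_lin_le hZ h)
    have h7 : 0 ≤ Z' * (lam * l1 h) := by positivity
    have h8 : Z' * (lam * l1 h) ≤ Z' * (B * D * (q * l ^ 2)) := by gcongr
    rw [abs_le]
    constructor <;> nlinarith

/-- An `ℓ₁` bound from a quadratic bound. -/
lemma l1_le_of_sq_le {G F : ℝ} (hZ : ∀ j, |inner ℝ (a j) r| ≤ Z) (hZ0 : 0 ≤ Z) (hG : 0 ≤ G)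
    (hF : 0 ≤ F) (hh : l1 h ^ 2 ≤ G * ‖lin a h‖ ^ 2 + F ^ 2) (hsmall : G * lam ^ 2 ≤ 1 / 2) :
    l1 h ≤ 8 * G * (lam + Z) + 2 * F := by
  have hlam := H.lam_pos
  have hn := l1_nonneg h
  have h1 : l1 h ^ 2 ≤ G * (2 * (lam + Z) * l1 h + lam ^ 2 * l1 h ^ 2) + F ^ 2 :=
    hh.trans (by gcongr; exact H.norm_lin_sq_le hZ)
  have h2 : G * lam ^ 2 * l1 h ^ 2 ≤ 1 / 2 * l1 h ^ 2 := by gcongr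
  -- The quadratic term on the right has coefficient `G lam² ≤ 1/2` and is absorbed on the left.
  have h3 : l1 h ^ 2 ≤ 4 * G * (lam + Z) * l1 h + 2 * F ^ 2 := by nlinarith
  have h4 : 0 ≤ G * (lam + Z) := by positivity
  by_contra hcon
  push Not at hcon
  nlinarith

end SqrtLasso
end deterministic
end ScaledLasso
end

/-! ### The `ℓ₁` bound under control of the total excess -/

noncomputable section
namespace ScaledLasso

section
variable {E : Type*} [NormedAddCommGroup E] [InnerProductSpace ℝ E] {p : ℕ}

/-- `T` collects the `m` largest values of `f` on `S`, or all of `S` if it has fewer elements; in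
that case the last clause is vacuous. -/
lemma exists_top_subset (f : Fin p → ℝ) (S : Finset (Fin p)) (m : ℕ) :
    ∃ T ⊆ S, T.card ≤ m ∧ ∀ j ∈ S, j ∉ T → T.card = m ∧ ∀ i ∈ T, f j ≤ f i := by
  classical
  induction m with
  | zero => exact ⟨∅, by simp, by simp, by simp⟩
  | succ m ih =>
    obtain ⟨T, hTS, hTm, hT⟩ := ih
    rcases (S \ T).eq_empty_or_nonempty with h0 | h0
    · refine ⟨T, hTS, by omega, fun j hj hjT => ?_⟩
      have : j ∈ S \ T := by simp [hj, hjT]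
      simp [h0] at this
    · obtain ⟨i, hi, hmax⟩ := Finset.exists_max_image (S \ T) f h0
      rw [Finset.mem_sdiff] at hi
      refine ⟨insert i T, Finset.insert_subset hi.1 hTS, ?_, fun j hj hjT => ?_⟩
      · rw [Finset.card_insert_of_notMem hi.2]; omega
      · rw [Finset.mem_insert, not_or] at hjT
        refine ⟨by rw [Finset.card_insert_of_notMem hi.2, (hT j hj hjT.2).1], fun l hl => ?_⟩
        rcases Finset.mem_insert.1 hl with rfl | hl
        · exact hmax j (by simp [hj, hjT.2])
        · exact (hT j hj hjT.2).2 l hl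

/-- The compatibility inequality on the cone `C(α, J)`. -/
def Compat (a : Fin p → E) (α : ℝ) (J : Finset (Fin p)) (C : ℝ) : Prop :=
  ∀ u ∈ cone α J, l1On J u ^ 2 ≤ C * J.card * ‖lin a u‖ ^ 2

variable {a : Fin p → E} {r : E} {γ h : Fin p → ℝ} {lam Z : ℝ}

/-- The noise term, off a set that contains the largest coefficients. -/
lemma inner_lin_le_of_sum_excess_le {J T : Finset (Fin p)} {m : ℕ} {x w y : ℝ} (hm0 : (0 : ℝ) < m)
    (hZ : ∀ j, |inner ℝ (a j) r| ≤ Z) (htop : ∀ j ∈ Jᶜ, |h j| ≤ l1On T h / m)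
    (hsum : ∑ j, excess x (inner ℝ (a j) r) ≤ w * m * y) :
    inner ℝ (lin a h) r ≤ Z * l1On J h + x * l1On Jᶜ h + w * y * l1On T h := by
  classical
  have hTn := l1On_nonneg T h
  rw [inner_lin_left, ← Finset.sum_add_sum_compl J]
  have e1 : ∑ j ∈ J, h j * inner ℝ (a j) r ≤ Z * l1On J h := by
    rw [l1On, Finset.mul_sum]
    refine Finset.sum_le_sum fun j _ => (le_abs_self _).trans ?_
    rw [abs_mul, mul_comm]
    exact mul_le_mul_of_nonneg_right (hZ j) (abs_nonneg _)
  have e2 : ∑ j ∈ Jᶜ, h j * inner ℝ (a j) r ≤ x * l1On Jᶜ h +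
      l1On T h / m * ∑ j ∈ Jᶜ, excess (x) (inner ℝ (a j) r) := by
    rw [l1On, Finset.mul_sum, Finset.mul_sum, ← Finset.sum_add_distrib]
    refine Finset.sum_le_sum fun j hj => (le_abs_self _).trans ?_
    rw [abs_mul]
    have k1 := sub_le_excess (x) (inner ℝ (a j) r)
    have k2 := excess_nonneg (x) (inner ℝ (a j) r)
    have k3 := mul_le_mul_of_nonneg_right (htop j hj) k2
    have k4 := abs_nonneg (h j)
    nlinarith
  have e3 : ∑ j ∈ Jᶜ, excess (x) (inner ℝ (a j) r) ≤ w * m * y :=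
    (Finset.sum_le_sum_of_subset_of_nonneg (Finset.subset_univ _)
      fun _ _ _ => excess_nonneg _ _).trans hsum
  have e4 : l1On T h / m * ∑ j ∈ Jᶜ, excess (x) (inner ℝ (a j) r) ≤
      w * y * l1On T h := by
    calc _ ≤ l1On T h / m * (w * m * y) := by gcongr
      _ = _ := by field_simp
  linarith

namespace SqrtLasso
variable (H : SqrtLasso a r γ h lam)
include H

/-- In the cone `‖h‖₁ ≤ (1 + α) ‖h_J‖₁`, so compatibility bounds `‖h‖₁²` by the prediction error, as
`l1_le_of_sq_le` requires. -/
lemma l1_le_of_mem_cone {α C s : ℝ} {J : Finset (Fin p)} (hZ : ∀ j, |inner ℝ (a j) r| ≤ Z)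
    (hZ0 : 0 ≤ Z) (hα : 0 ≤ α) (hC : 0 ≤ C) (hcompat : Compat a α J C) (hJ : (J.card : ℝ) ≤ s)
    (hh : h ∈ cone α J) (hsmall : (1 + α) ^ 2 * C * s * lam ^ 2 ≤ 1 / 2) :
    l1 h ≤ 8 * ((1 + α) ^ 2 * C * s) * (lam + Z) := by
  have hs : 0 ≤ s := (Nat.cast_nonneg _).trans hJ
  have h1 := hcompat h hh
  have h2 : l1On Jᶜ h ≤ α * l1On J h := hh
  have h3 := l1On_nonneg J h
  have h4 : l1 h ≤ (1 + α) * l1On J h := by rw [l1_eq_add J]; linarith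
  have h5 : l1 h ^ 2 ≤ (1 + α) ^ 2 * C * s * ‖lin a h‖ ^ 2 + 0 ^ 2 := by
    calc l1 h ^ 2 ≤ ((1 + α) * l1On J h) ^ 2 := pow_le_pow_left₀ (l1_nonneg h) h4 2
      _ = (1 + α) ^ 2 * l1On J h ^ 2 := by ring
      _ ≤ (1 + α) ^ 2 * (C * J.card * ‖lin a h‖ ^ 2) := by gcongr
      _ ≤ (1 + α) ^ 2 * (C * s * ‖lin a h‖ ^ 2) := by gcongr
      _ = _ := by ring
  have := H.l1_le_of_sq_le hZ hZ0 (by positivity) le_rfl h5 hsmall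
  linarith

/-- The `ℓ₁` bound under control of the total excess of the noise over the penalty level. -/
lemma l1_le_of_sum_excess_le {α C s θ ε w l₀ : ℝ} {m : ℕ} {K : Finset (Fin p)}
    (hZ : ∀ j, |inner ℝ (a j) r| ≤ Z) (hZ0 : 0 ≤ Z) (hα : 1 ≤ α) (hC : 0 ≤ C) (hm : 1 ≤ m)
    (hcompat : ∀ J : Finset (Fin p), (J \ K).card ≤ m → Compat a α J C)
    (hs : (K.card : ℝ) + m ≤ s) (hθ : 0 ≤ θ) (hθε : θ < ε)
    (hlam : (1 + ε) * l₀ ≤ lam)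
    (hsum : ∑ j, excess ((1 + θ) * l₀) (inner ℝ (a j) r) ≤ w * m * l₀)
    (h1 : lam + Z ≤ 99 / 100 * α * (lam - (1 + θ) * l₀))
    (h2 : Z - lam + w * l₀ ≤ 99 / 100 * α * (lam - (1 + θ) * l₀))
    (hsmall : (1 + α) ^ 2 * C * s * lam ^ 2 ≤ 1 / 2) :
    l1 h ≤ 8 * ((1 + α) ^ 2 * C * s) * (lam + Z) + 400 * ((1 + ε) / (ε - θ)) * l1On Kᶜ γ := by
  classical
  have hs0 : 0 ≤ s := le_trans (by positivity) hs
  have hlam0 := H.lam_pos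
  have hg := l1On_nonneg Kᶜ γ
  have hε : 0 < ε - θ := by linarith
  obtain ⟨T, hTS, hTm, hT⟩ := exists_top_subset (fun j => |h j|) Kᶜ m
  have hm0 : (0 : ℝ) < m := by exact_mod_cast hm
  have hdisj : Disjoint K T := by
    rw [Finset.disjoint_left]; intro j hj hjT
    exact (Finset.mem_compl.1 (hTS hjT)) hj
  -- `K` is enlarged by the `m` largest coordinates of `h` outside it. Beyond `J` each coordinate is
  -- at most the average over `T`, so a total excess of `w m l₀` is charged to `l1On T h` with
  -- coefficient `w l₀`.
  set J := K ∪ T with hJ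
  have hJK : (J \ K).card ≤ m := by
    refine (Finset.card_le_card ?_).trans hTm
    intro j hj
    simp only [hJ, Finset.mem_sdiff, Finset.mem_union] at hj
    tauto
  have hJs : (J.card : ℝ) ≤ s := by
    rw [hJ, Finset.card_union_of_disjoint hdisj]
    push_cast
    have : (T.card : ℝ) ≤ m := by exact_mod_cast hTm
    linarith
  have hJ1 : l1On J h = l1On K h + l1On T h := Finset.sum_union hdisj
  have hJ2 : l1On Kᶜ h = l1On T h + l1On Jᶜ h := by
    have e1 := l1_eq_add K h
    have e2 := l1_eq_add J h
    linarith
  have hTn := l1On_nonneg T h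
  have hKn := l1On_nonneg K h
  have hJn := l1On_nonneg J h
  have hJcn := l1On_nonneg Jᶜ h
  have htop : ∀ j ∈ Jᶜ, |h j| ≤ l1On T h / m := by
    intro j hj
    simp only [hJ, Finset.mem_compl, Finset.mem_union, not_or] at hj
    obtain ⟨hc, hle⟩ := hT j (Finset.mem_compl.2 hj.1) hj.2
    rw [le_div_iff₀ hm0, mul_comm, ← hc, ← nsmul_eq_mul]
    exact Finset.card_nsmul_le_sum _ _ _ hle
  have hzh := inner_lin_le_of_sum_excess_le hm0 hZ htop hsum
  have hbas := H.basic_on K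
  have hε1 : 0 < 1 + ε := by linarith
  have hmain : (lam - (1 + θ) * l₀) * l1On Jᶜ h ≤
      99 / 100 * α * (lam - (1 + θ) * l₀) * l1On J h + 2 * lam * l1On Kᶜ γ := by
    have m1 := mul_le_mul_of_nonneg_right h1 hKn
    have m2 := mul_le_mul_of_nonneg_right h2 hTn
    rw [hJ2] at hbas
    rw [hJ1] at hzh ⊢
    linarith
  obtain ⟨c, hc⟩ : ∃ c, c = lam - (1 + θ) * l₀ := ⟨_, rfl⟩
  rw [← hc] at hmain h1 h2
  have hcpos : lam * (ε - θ) ≤ (1 + ε) * c := by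
    have : (1 + θ) * ((1 + ε) * l₀) ≤ (1 + θ) * lam := by gcongr
    rw [hc]; linarith
  have hc0 : 0 < c := by
    have : 0 < lam * (ε - θ) := by positivity
    by_contra hcon
    push Not at hcon
    nlinarith
  set D := 2 * ((1 + ε) / (ε - θ)) * l1On Kᶜ γ with hD
  have hD0 : 0 ≤ D := by positivity
  have hlc : lam ≤ (1 + ε) / (ε - θ) * c := by
    rw [div_mul_eq_mul_div, le_div_iff₀ hε]; exact hcpos
  have hmain2 : l1On Jᶜ h ≤ 99 / 100 * α * l1On J h + D := by
    have : c * l1On Jᶜ h ≤ c * (99 / 100 * α * l1On J h + D) := by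
      have : lam * l1On Kᶜ γ ≤ (1 + ε) / (ε - θ) * c * l1On Kᶜ γ := by gcongr
      rw [hD]
      linarith
    exact le_of_mul_le_mul_left this hc0
  have hbig : 0 ≤ 8 * ((1 + α) ^ 2 * C * s) * (lam + Z) := by positivity
  have hD2 : 400 * ((1 + ε) / (ε - θ)) * l1On Kᶜ γ = 200 * D := by rw [hD]; ring
  rw [hD2]
  by_cases hcone : h ∈ cone α J
  · have := H.l1_le_of_mem_cone hZ hZ0 (by linarith) hC (hcompat J hJK) hJs hcone hsmall
    linarith
  · have h3 : α * l1On J h < l1On Jᶜ h := not_le.1 hcone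
    have h4 : l1On J h ≤ α * l1On J h := le_mul_of_one_le_left hJn hα
    rw [l1_eq_add J]
    linarith

end SqrtLasso
end
end ScaledLasso
end

/-! ### The `ℓ₁` bound for the larger penalty level -/

noncomputable section
namespace ScaledLasso

section
variable {E : Type*} [NormedAddCommGroup E] [InnerProductSpace ℝ E] {p : ℕ}
variable {a : Fin p → E} {r : E} {γ h : Fin p → ℝ} {lam Z : ℝ}

/-- A vector close to the cone can be shrunk into it. -/
lemma exists_mem_cone (ha : ∀ j, ‖a j‖ = 1) {α D : ℝ} {K : Finset (Fin p)} (hα : 0 ≤ α)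
    (hD : 0 ≤ D) (hh : l1On Kᶜ h ≤ α * l1On K h + D) :
    ∃ u ∈ cone α K, l1On K u = l1On K h ∧ ‖lin a u‖ ≤ ‖lin a h‖ + D := by
  classical
  by_cases hcone : h ∈ cone α K
  · exact ⟨h, hcone, rfl, by linarith⟩
  have h3 : α * l1On K h < l1On Kᶜ h := not_le.1 hcone
  have hK := l1On_nonneg K h
  have hpos : 0 < l1On Kᶜ h := lt_of_le_of_lt (by positivity) h3
  set τ := α * l1On K h / l1On Kᶜ h with hτ
  have hτ0 : 0 ≤ τ := by positivity
  have hτ1 : τ ≤ 1 := (div_le_one hpos).2 h3.le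
  have hτm : τ * l1On Kᶜ h = α * l1On K h := div_mul_cancel₀ _ hpos.ne'
  set u : Fin p → ℝ := fun j => if j ∈ K then h j else τ * h j with hu
  have e1 : l1On K u = l1On K h := Finset.sum_congr rfl fun j hj => by simp [hu, hj]
  have e2 : l1On Kᶜ u = τ * l1On Kᶜ h := by
    rw [l1On, l1On, Finset.mul_sum]
    refine Finset.sum_congr rfl fun j hj => ?_
    rw [Finset.mem_compl] at hj
    simp [hu, hj, abs_mul, abs_of_nonneg hτ0]
  refine ⟨u, ?_, e1, ?_⟩
  · show l1On Kᶜ u ≤ α * l1On K u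
    rw [e1, e2, hτm]
  · have e3 : l1 (u - h) = (1 - τ) * l1On Kᶜ h := by
      rw [l1_eq_add K]
      have f1 : l1On K (u - h) = 0 := Finset.sum_eq_zero fun j hj => by simp [hu, hj]
      have f2 : l1On Kᶜ (u - h) = (1 - τ) * l1On Kᶜ h := by
        rw [l1On, l1On, Finset.mul_sum]
        refine Finset.sum_congr rfl fun j hj => ?_
        rw [Finset.mem_compl] at hj
        have : (u - h) j = -((1 - τ) * h j) := by simp [hu, hj]; ring
        rw [this, abs_neg, abs_mul, abs_of_nonneg (sub_nonneg.2 hτ1)]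
      rw [f1, f2, zero_add]
    have e4 : lin a u = lin a h + lin a (u - h) := by rw [lin_sub]; abel
    rw [e4]
    refine (norm_add_le _ _).trans ?_
    have := norm_lin_le_l1 ha (u - h)
    rw [e3] at this
    linarith

namespace SqrtLasso
variable (H : SqrtLasso a r γ h lam)
include H

/-- The `ℓ₁` bound when the penalty dominates the noise and the target set is bounded. -/
lemma l1_le_of_card_le {α C s ε l₀ P₀ : ℝ} {K : Finset (Fin p)}
    (hZ : ∀ j, |inner ℝ (a j) r| ≤ l₀) (hl₀ : 0 < l₀) (hC : 0 ≤ C) (hε : 0 < ε)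
    (hα : α = 1 + 2 / ε) (hcompat : Compat a α K C) (hs : (K.card : ℝ) ≤ s)
    (hP : (K.card : ℝ) ≤ P₀) (hlam : (1 + ε) * l₀ ≤ lam)
    (hsmall : 2 * ((1 + α) ^ 2 * C * s) * lam ^ 2 ≤ 1 / 2) :
    l1 h ≤ 16 * ((1 + α) ^ 2 * C * s) * (lam + l₀) +
      8 * (((1 + α) * √(C * P₀) + 1) * ((1 + ε) / ε)) * l1On Kᶜ γ := by
  have hg := l1On_nonneg Kᶜ γ
  have hα0 : 0 ≤ α := by rw [hα]; positivity
  have hs0 : 0 ≤ s := (Nat.cast_nonneg _).trans hs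
  have hP0 : 0 ≤ P₀ := (Nat.cast_nonneg _).trans hP
  have hb := H.basic_on K
  have hz := le_of_abs_le (abs_inner_lin_le hZ h)
  rw [l1_eq_add K] at hz
  set D := 2 * ((1 + ε) / ε) * l1On Kᶜ γ with hD
  have hD0 : 0 ≤ D := by positivity
  have hKn := l1On_nonneg K h
  have hcl : 0 < lam - l₀ := by nlinarith
  -- `α = 1 + 2 / ε` is exactly `(lam + l₀) / (lam - l₀)` at `lam = (1 + ε) l₀`, so no room is left
  -- and `h` may miss the cone because of `D`.
  have h1 : (lam + l₀) ≤ α * (lam - l₀) := by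
    have : α * ε = ε + 2 := by rw [hα]; field_simp
    have h2 : (lam + l₀) * ε ≤ α * ε * (lam - l₀) := by rw [this]; nlinarith
    nlinarith
  have h2 : lam ≤ (1 + ε) / ε * (lam - l₀) := by
    rw [div_mul_eq_mul_div, le_div_iff₀ hε]; nlinarith
  have hnear : l1On Kᶜ h ≤ α * l1On K h + D := by
    have m1 := mul_le_mul_of_nonneg_right h1 hKn
    have m2 := mul_le_mul_of_nonneg_right h2 hg
    have : (lam - l₀) * l1On Kᶜ h ≤ (lam - l₀) * (α * l1On K h + D) := by
      rw [hD]; linarith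
    exact le_of_mul_le_mul_left this hcl
  -- Shrinking into the cone changes the prediction norm by at most `D`, which compatibility
  -- multiplies by `√(C |K|)`. This would spoil the rate for a large `K`; here `|K| ≤ P₀`.
  obtain ⟨u, huc, hu1, hu2⟩ := exists_mem_cone H.norm_col hα0 hD0 hnear
  have hcu := hcompat u huc
  rw [hu1] at hcu
  set N := ‖lin a h‖ with hN
  have hN0 : 0 ≤ N := norm_nonneg _
  set q := √(C * K.card) with hq
  have hq0 : 0 ≤ q := Real.sqrt_nonneg _
  have hq2 : q ^ 2 = C * K.card := Real.sq_sqrt (by positivity)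
  have hKle : l1On K h ≤ q * (N + D) := by
    refine le_of_sq_le_sq ?_ (by positivity)
    rw [mul_pow, hq2]
    refine hcu.trans ?_
    gcongr
  have hqP : q ≤ √(C * P₀) := Real.sqrt_le_sqrt (by gcongr)
  set M := (1 + α) * √(C * P₀) + 1 with hM
  have hM0 : 0 ≤ M := by positivity
  have hl1 : l1 h ≤ (1 + α) * q * N + M * D := by
    have e1 : (1 + α) * l1On K h ≤ (1 + α) * (q * (N + D)) := by gcongr
    have e2 : (1 + α) * q * D ≤ (1 + α) * √(C * P₀) * D := by gcongr
    rw [l1_eq_add K, hM]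
    linarith
  have hsq : l1 h ^ 2 ≤ 2 * ((1 + α) ^ 2 * C * s) * N ^ 2 + (2 * M * D) ^ 2 := by
    calc l1 h ^ 2 ≤ ((1 + α) * q * N + M * D) ^ 2 := pow_le_pow_left₀ (l1_nonneg h) hl1 2
      _ ≤ 2 * ((1 + α) * q * N) ^ 2 + 2 * (M * D) ^ 2 := add_sq_le.trans (by linarith)
      _ = 2 * ((1 + α) ^ 2 * q ^ 2) * N ^ 2 + 2 * (M * D) ^ 2 := by ring
      _ ≤ 2 * ((1 + α) ^ 2 * (C * s)) * N ^ 2 + (2 * M * D) ^ 2 := by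
        rw [hq2]
        have : 0 ≤ (M * D) ^ 2 := sq_nonneg _
        have e : 2 * ((1 + α) ^ 2 * (C * K.card)) * N ^ 2 ≤
            2 * ((1 + α) ^ 2 * (C * s)) * N ^ 2 := by gcongr
        linarith
      _ = _ := by ring
  have := H.l1_le_of_sq_le hZ hl₀.le (by positivity) (by positivity) hsq hsmall
  rw [hD] at this
  linarith

/-- The `ℓ₁` bound off the cone when the noise on the target set is smaller than elsewhere. -/
lemma l1_le_of_noise_on_le {α ε l₀ : ℝ} {K : Finset (Fin p)} (hε : 0 < ε)
    (hα : α = 1 + 2 / ε)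
    (hZ : ∀ j, |inner ℝ (a j) r| ≤ (1 + ε / (200 * (2 + ε))) * l₀)
    (hK : ∀ j ∈ K, |inner ℝ (a j) r| ≤ 99 / 100 * l₀) (hlam : (1 + ε) * l₀ ≤ lam)
    (hh : h ∉ cone α K) :
    l1 h ≤ 800 * ((1 + ε) * (2 + ε) / ε) * l1On Kᶜ γ := by
  have hg := l1On_nonneg Kᶜ γ
  have hb := H.basic_on K
  have h3 : α * l1On K h < l1On Kᶜ h := not_le.1 hh
  have hKn := l1On_nonneg K h
  have hlam0 := H.lam_pos
  have hz : inner ℝ (lin a h) r ≤ 99 / 100 * l₀ * l1On K h +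
      (1 + ε / (200 * (2 + ε))) * l₀ * l1On Kᶜ h := by
    rw [inner_lin_left, ← Finset.sum_add_sum_compl K, l1On, l1On, Finset.mul_sum, Finset.mul_sum]
    refine add_le_add (Finset.sum_le_sum fun j hj => ?_) (Finset.sum_le_sum fun j _ => ?_) <;>
    · refine (le_abs_self _).trans ?_
      rw [abs_mul, mul_comm]
      first
      | exact mul_le_mul_of_nonneg_right (hK j hj) (abs_nonneg _)
      | exact mul_le_mul_of_nonneg_right (hZ j) (abs_nonneg _)
  obtain ⟨y, hy⟩ : ∃ y, y = lam / (1 + ε) := ⟨_, rfl⟩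
  have hy1 : lam = (1 + ε) * y := by rw [hy]; field_simp
  have hy0 : 0 < y := by rw [hy]; positivity
  have hyl : l₀ ≤ y := by rw [hy, le_div_iff₀ (by positivity)]; linarith
  obtain ⟨v, hv⟩ : ∃ v, v = ε / (2 + ε) := ⟨_, rfl⟩
  have hv1 : v * (2 + ε) = ε := by rw [hv]; field_simp
  have hv0 : 0 < v := by rw [hv]; positivity
  have hηv : ε / (200 * (2 + ε)) = v / 200 := by rw [hv]; field_simp
  have hKv : l1On K h ≤ v * l1On Kᶜ h := by
    have hαv : α * v = 1 := by rw [hα, hv]; field_simp; ring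
    have := mul_le_mul_of_nonneg_left h3.le hv0.le
    calc l1On K h = v * (α * l1On K h) := by rw [← mul_assoc, mul_comm v α, hαv, one_mul]
      _ ≤ _ := this
  rw [hηv] at hz
  have hKcn := l1On_nonneg Kᶜ h
  have hz2 : inner ℝ (lin a h) r ≤ 99 / 100 * y * l1On K h + (1 + v / 200) * y * l1On Kᶜ h := by
    refine hz.trans ?_
    gcongr
  -- With `v = 1 / α` this identity expresses the exact balance of the cone argument. The smaller
  -- noise on `K` gains `v / 100`, the larger noise elsewhere costs `v / 200`, and `v / 200`
  -- remains.
  have hv2 : (1 + ε) * (1 - v) = 1 + v := by linear_combination (-1 : ℝ) * hv1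
  rw [hy1] at hb
  have h5 : y * (v / 200 * l1On Kᶜ h) ≤ y * (2 * (1 + ε) * l1On Kᶜ γ) := by
    have e1 : (1 + ε + 99 / 100) * l1On K h ≤ (1 + ε + 99 / 100) * (v * l1On Kᶜ h) := by gcongr
    have e2 : y * ((1 + ε + 99 / 100) * l1On K h) ≤
      y * ((1 + ε + 99 / 100) * (v * l1On Kᶜ h)) := by gcongr
    have e3 : (1 + ε) - (1 + ε + 99 / 100) * v - (1 + v / 200) = v / 200 := by
      linear_combination hv2
    have e4 : y * l1On Kᶜ h * ((1 + ε) - (1 + ε + 99 / 100) * v - (1 + v / 200)) =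
      y * l1On Kᶜ h * (v / 200) := by rw [e3]
    linarith
  have h6 : v * l1On Kᶜ h ≤ 400 * (1 + ε) * l1On Kᶜ γ := by
    have := le_of_mul_le_mul_left h5 hy0
    linarith
  have h7 : l1 h ≤ 2 * l1On Kᶜ h := by
    have : v ≤ 1 := by rw [hv, div_le_one (by positivity)]; linarith
    rw [l1_eq_add K]
    nlinarith
  have h8 : l1On Kᶜ h ≤ 400 * (1 + ε) * l1On Kᶜ γ / v := by
    rw [le_div_iff₀ hv0]; linarith
  have h9 : 400 * (1 + ε) * l1On Kᶜ γ / v = 400 * ((1 + ε) * (2 + ε) / ε) * l1On Kᶜ γ := by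
    rw [hv]; field_simp
  linarith

/-- The `ℓ₁` bound off the cone when the noise, up to a short vector, is smaller than the
penalty level. -/
lemma l1_le_of_greedy {α s ε l₀ : ℝ} {K : Finset (Fin p)} (hε : 0 < ε)
    (hα : α = 1 + 2 / ε) (hZ : ∀ j, |inner ℝ (a j) r| ≤ Z) (hZ0 : 0 ≤ Z)
    (hs : (K.card : ℝ) ≤ s) (hlam : (1 + ε) * l₀ ≤ lam)
    (hcomb : inner ℝ (lin a h) r ≤ 11 / 20 * l₀ * l1 h + l₀ * √((80 * K.card : ℕ) : ℝ) * ‖lin a h‖)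
    (hh : h ∉ cone α K) (hsmall : 800 * s * lam ^ 2 ≤ 1 / 2) :
    l1 h ≤ 6400 * s * (lam + Z) + 32 * (1 + ε) * l1On Kᶜ γ := by
  have hg := l1On_nonneg Kᶜ γ
  have hs0 : 0 ≤ s := (Nat.cast_nonneg _).trans hs
  have hb := H.basic_on K
  have h3 : α * l1On K h < l1On Kᶜ h := not_le.1 hh
  have hKn := l1On_nonneg K h
  have hlam0 := H.lam_pos
  have hn := l1_nonneg h
  obtain ⟨y, hy⟩ : ∃ y, y = lam / (1 + ε) := ⟨_, rfl⟩
  have hy1 : lam = (1 + ε) * y := by rw [hy]; field_simp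
  have hy0 : 0 < y := by rw [hy]; positivity
  have hyl : l₀ ≤ y := by rw [hy, le_div_iff₀ (by positivity)]; linarith
  -- Off the cone the penalty difference dominates the full norm: the basic inequality bounds `y
  -- ‖h‖₁` with `y = lam / (1 + ε) ≥ l₀`. Against it stands noise `(11/20) y ‖h‖₁`, and `9/20` of it
  -- is left over.
  have h4 : l1 h ≤ (1 + ε) * (l1On Kᶜ h - l1On K h) := by
    have : ε * α = ε + 2 := by rw [hα]; field_simp
    have h5 := mul_le_mul_of_nonneg_left h3.le hε.le
    rw [← mul_assoc, this] at h5
    rw [l1_eq_add K]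
    linarith
  obtain ⟨W, hW⟩ : ∃ W, W = √((80 * K.card : ℕ) : ℝ) * ‖lin a h‖ := ⟨_, rfl⟩
  have hW0 : 0 ≤ W := by rw [hW]; exact mul_nonneg (Real.sqrt_nonneg _) (norm_nonneg _)
  have h5 : y * (l1 h) - 2 * lam * l1On Kᶜ γ ≤ 11 / 20 * (y * l1 h) + y * W := by
    have e1 : l₀ * l1 h ≤ y * l1 h := by gcongr
    have e2 : l₀ * W ≤ y * W := by gcongr
    have e3 : y * l1 h ≤ y * ((1 + ε) * (l1On Kᶜ h - l1On K h)) := by gcongr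
    have e4 : inner ℝ (lin a h) r ≤ 11 / 20 * (l₀ * l1 h) + l₀ * W := by rw [hW]; linarith
    rw [hy1] at hb ⊢
    linarith
  have h6 : l1 h ≤ W * (20 / 9) + 40 / 9 * (1 + ε) * l1On Kᶜ γ := by
    have : y * l1 h ≤ y * (W * (20 / 9) + 40 / 9 * (1 + ε) * l1On Kᶜ γ) := by
      rw [hy1] at h5; linarith
    exact le_of_mul_le_mul_left this hy0
  have hWsq : W ^ 2 ≤ 80 * s * ‖lin a h‖ ^ 2 := by
    rw [hW, mul_pow, Real.sq_sqrt (Nat.cast_nonneg _)]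
    push_cast
    gcongr
  have hsq : l1 h ^ 2 ≤ 800 * s * ‖lin a h‖ ^ 2 + (16 * (1 + ε) * l1On Kᶜ γ) ^ 2 := by
    have h7 : l1 h ^ 2 ≤ (W * (20 / 9) + 40 / 9 * (1 + ε) * l1On Kᶜ γ) ^ 2 :=
      pow_le_pow_left₀ hn h6 2
    have h8 := add_sq_le (a := W * (20 / 9)) (b := 40 / 9 * (1 + ε) * l1On Kᶜ γ)
    have h9 : 0 ≤ ((1 + ε) * l1On Kᶜ γ) ^ 2 := sq_nonneg _
    have h10 : 0 ≤ W ^ 2 := sq_nonneg _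
    nlinarith
  have := H.l1_le_of_sq_le hZ hZ0 (by positivity) (by positivity) hsq hsmall
  linarith

end SqrtLasso
end
end ScaledLasso
end

/-! ### First order conditions, elimination of `σ`, and part (i) -/

noncomputable section
namespace ScaledLasso

section kkt
variable {E : Type*} [NormedAddCommGroup E] [InnerProductSpace ℝ E] {p : ℕ}
variable {a : Fin p → E} {y : E} {b : Fin p → ℝ} {lam : ℝ}

/-- First order conditions for the square-root lasso. -/
lemma inner_residual_eq (hmin : ∀ b', ‖y - lin a b‖ + lam * l1 b ≤ ‖y - lin a b'‖ + lam * l1 b')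
    (hres : y - lin a b ≠ 0) {u : Fin p → ℝ} (hu : supp u ⊆ supp b) :
    inner ℝ (lin a u) (y - lin a b) =
      ‖y - lin a b‖ * (lam * ∑ j, (SignType.sign (b j) : ℝ) * u j) := by
  have hpos : 0 < ‖y - lin a b‖ := norm_pos_iff.2 hres
  have h1 : HasDerivAt (fun t : ℝ => (y - lin a b) - t • lin a u) (-lin a u) 0 := by
    have : HasDerivAt (fun t : ℝ => t • lin a u) ((1 : ℝ) • lin a u) 0 :=
      (hasDerivAt_id (0 : ℝ)).smul_const _
    simpa using this.const_sub (y - lin a b)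
  have h2 : HasDerivAt (fun t : ℝ => ‖(y - lin a b) - t • lin a u‖)
      (-(inner ℝ (lin a u) (y - lin a b)) / ‖y - lin a b‖) 0 := by
    have h3 := h1.norm_sq.sqrt (by simpa using hres)
    refine (h3.congr_deriv ?_).congr_of_eventuallyEq (Filter.Eventually.of_forall fun t => ?_)
    · simp only [zero_smul, sub_zero, inner_neg_right, Real.sqrt_sq (norm_nonneg _)]
      rw [real_inner_comm]
      field_simp
    · exact (Real.sqrt_sq (norm_nonneg _)).symm
  -- The `ℓ₁` norm is differentiable along `u` because `u` vanishes wherever `b` does.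
  have h4 : HasDerivAt (fun t : ℝ => l1 (b + t • u))
      (∑ j, (SignType.sign (b j) : ℝ) * u j) 0 := by
    unfold l1 l1On
    refine HasDerivAt.fun_sum fun j _ => ?_
    by_cases hb : b j = 0
    · have huj : u j = 0 := by
        by_contra hne
        have : j ∈ supp b := hu (by simp [supp, hne])
        simp [supp, hb] at this
      simpa [hb, huj] using hasDerivAt_const (0 : ℝ) (0 : ℝ)
    · have h5 : HasDerivAt (fun t : ℝ => b j + t * u j) (u j) 0 := by
        simpa using ((hasDerivAt_id (0 : ℝ)).mul_const (u j)).const_add (b j)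
      have h6 : HasDerivAt (fun x : ℝ => |x|) (SignType.sign (b j) : ℝ) (b j + 0 * u j) := by
        simpa using hasDerivAt_abs hb
      exact h6.comp (0 : ℝ) h5
  have h7 := h2.add (h4.const_mul lam)
  have h8 : IsLocalMin ((fun t : ℝ => ‖(y - lin a b) - t • lin a u‖) +
      fun t : ℝ => lam * l1 (b + t • u)) 0 := by
    refine Filter.Eventually.of_forall fun t => ?_
    have := hmin (b + t • u)
    rw [lin_add, lin_smul, ← sub_sub] at this
    simpa using this
  have h9 := h8.hasDerivAt_eq_zero h7
  field_simp at h9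
  linarith

lemma abs_sum_sign_mul_le (b u : Fin p → ℝ) :
    |∑ j, (SignType.sign (b j) : ℝ) * u j| ≤ l1 u := by
  refine (Finset.abs_sum_le_sum_abs _ _).trans (Finset.sum_le_sum fun j _ => ?_)
  rw [abs_mul]
  refine mul_le_of_le_one_left (abs_nonneg _) ?_
  rcases lt_trichotomy (b j) 0 with h | h | h <;> simp [h]

lemma abs_inner_residual_le
    (hmin : ∀ b', ‖y - lin a b‖ + lam * l1 b ≤ ‖y - lin a b'‖ + lam * l1 b')
    (hlam : 0 ≤ lam) {u : Fin p → ℝ} (hu : supp u ⊆ supp b) :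
    |inner ℝ (lin a u) (y - lin a b)| ≤ ‖y - lin a b‖ * lam * l1 u := by
  by_cases hres : y - lin a b = 0
  · simp [hres]
  rw [inner_residual_eq hmin hres hu, abs_mul, abs_mul, abs_of_nonneg (norm_nonneg _),
    abs_of_nonneg hlam, mul_assoc]
  have := abs_sum_sign_mul_le b u
  gcongr

/-- The equality case for selected columns; the bound for the size of the selected model rests on
it. -/
lemma abs_inner_col_residual
    (hmin : ∀ b', ‖y - lin a b‖ + lam * l1 b ≤ ‖y - lin a b'‖ + lam * l1 b')
    (hlam : 0 ≤ lam) {j : Fin p} (hj : j ∈ supp b) :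
    |inner ℝ (a j) (y - lin a b)| = ‖y - lin a b‖ * lam := by
  by_cases hres : y - lin a b = 0
  · simp [hres]
  have h := inner_residual_eq (u := Pi.single j 1) hmin hres (by
    intro i hi
    by_cases h : i = j
    · rwa [h]
    · simp [supp, h] at hi)
  rw [lin_single, one_smul] at h
  rw [h, Finset.sum_eq_single j (fun i _ hi => by simp [hi]) (by simp)]
  have hbj : b j ≠ 0 := by simpa [supp] using hj
  have : |(SignType.sign (b j) : ℝ)| = 1 := by
    rcases lt_or_gt_of_ne hbj with h | h <;> simp [h]
  simp [abs_mul, this, abs_of_nonneg hlam]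

lemma supp_subset_iff {S : Finset (Fin p)} {u : Fin p → ℝ} : supp u ⊆ S ↔ ∀ j ∉ S, u j = 0 := by
  simp only [supp, Finset.subset_iff, Finset.mem_filter, Finset.mem_univ, true_and]
  exact forall_congr' fun j => not_imp_comm

lemma supp_sub_subset {S : Finset (Fin p)} {u v : Fin p → ℝ} (hu : supp u ⊆ S)
    (hv : supp v ⊆ S) : supp (u - v) ⊆ S :=
  supp_subset_iff.2 fun j hj => by
    simp [supp_subset_iff.1 hu j hj, supp_subset_iff.1 hv j hj]

/-- Comparison of the square-root lasso with the least squares fit in the selected model. -/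
lemma lse_compare {c : Fin p → ℝ}
    (hmin : ∀ b', ‖y - lin a b‖ + lam * l1 b ≤ ‖y - lin a b'‖ + lam * l1 b')
    (hlam : 0 ≤ lam) (hc : supp c ⊆ supp b)
    (hls : ∀ b', supp b' ⊆ supp b → ‖y - lin a c‖ ≤ ‖y - lin a b'‖) :
    ‖y - lin a b‖ ^ 2 - ‖y - lin a c‖ ^ 2 = ‖lin a (c - b)‖ ^ 2 ∧
    ‖lin a (c - b)‖ ^ 2 ≤ ‖y - lin a b‖ * lam * l1 (c - b) := by
  have hcb : supp (c - b) ⊆ supp b := supp_sub_subset hc subset_rfl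
  have horth : inner ℝ (lin a (c - b)) (y - lin a c) = 0 := by
    set v := lin a (c - b) with hv
    have key : ∀ t : ℝ, 0 ≤ -2 * t * inner ℝ v (y - lin a c) + t ^ 2 * ‖v‖ ^ 2 := by
      intro t
      have h1 := hls (c + t • (c - b)) (supp_subset_iff.2 fun j hj => by
        simp [supp_subset_iff.1 hc j hj, supp_subset_iff.1 hcb j hj])
      rw [lin_add, lin_smul, ← sub_sub, ← hv] at h1
      have h2 := pow_le_pow_left₀ (norm_nonneg _) h1 2
      rw [norm_sub_sq_real (y - lin a c), real_inner_smul_right, norm_smul, mul_pow,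
        Real.norm_eq_abs, sq_abs, real_inner_comm v] at h2
      linarith
    by_contra hne
    have hq : 0 ≤ ‖v‖ ^ 2 := sq_nonneg _
    -- The quadratic is minimal at the inner product divided by `‖v‖²`; the added `1` avoids the
    -- case `v = 0` and still gives a negative value.
    have h1 := key (inner ℝ v (y - lin a c) / (‖v‖ ^ 2 + 1))
    set i := inner ℝ v (y - lin a c) with hi
    have h2 : 0 < i ^ 2 := by positivity
    have h3 : -2 * (i / (‖v‖ ^ 2 + 1)) * i + (i / (‖v‖ ^ 2 + 1)) ^ 2 * ‖v‖ ^ 2 =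
      -(i ^ 2 * (‖v‖ ^ 2 + 2) / (‖v‖ ^ 2 + 1) ^ 2) := by field_simp; ring
    rw [h3] at h1
    have : 0 < i ^ 2 * (‖v‖ ^ 2 + 2) / (‖v‖ ^ 2 + 1) ^ 2 := by positivity
    linarith
  have hdec : y - lin a b = (y - lin a c) + lin a (c - b) := by rw [lin_sub]; abel
  constructor
  · rw [hdec, norm_add_sq_real, real_inner_comm, horth]; ring
  · have h1 := abs_inner_residual_le hmin hlam hcb
    have h2 : inner ℝ (lin a (c - b)) (y - lin a b) = ‖lin a (c - b)‖ ^ 2 := by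
      rw [hdec, inner_add_right, horth, real_inner_self_eq_norm_sq, zero_add]
    rw [← h2]
    exact le_of_abs_le h1

end kkt

section profile
variable {n p : ℕ} {X : Matrix (Fin n) (Fin p) ℝ} {Y : Fin n → ℝ} {lam : ℝ}

/-- The response, divided by `√n`. -/
def respE (Y : Fin n → ℝ) : EuclideanSpace ℝ (Fin n) := (√(n : ℝ))⁻¹ • WithLp.toLp 2 Y

lemma respE_sub_lin (X : Matrix (Fin n) (Fin p) ℝ) (Y : Fin n → ℝ) (b : Fin p → ℝ) :
    respE Y - lin (colE X) b = (√(n : ℝ))⁻¹ • WithLp.toLp 2 (Y - X.mulVec b) := by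
  rw [lin_colE, respE, ← smul_sub]; rfl

lemma norm_respE_sub_lin (X : Matrix (Fin n) (Fin p) ℝ) (Y : Fin n → ℝ) (b : Fin p → ℝ) :
    ‖respE Y - lin (colE X) b‖ = l2 (Y - X.mulVec b) / √(n : ℝ) := by
  rw [respE_sub_lin, norm_smul, norm_inv, Real.norm_of_nonneg (Real.sqrt_nonneg _), l2,
    inv_mul_eq_div]

lemma scaledLoss_of_pos (hn : 0 < n) (b : Fin p → ℝ) {σ : ℝ} (hσ : 0 < σ) :
    scaledLoss X Y b σ =
      ENNReal.ofReal (‖respE Y - lin (colE X) b‖ ^ 2 / (2 * σ) + σ / 2) := by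
  have hn' : (0 : ℝ) < n := by exact_mod_cast hn
  rw [scaledLoss, ← ENNReal.ofReal_div_of_pos (by positivity),
    ← ENNReal.ofReal_add (by positivity) (by positivity), norm_respE_sub_lin, div_pow,
    Real.sq_sqrt hn'.le]
  congr 2
  field_simp

lemma scaledLoss_zero (hn : 0 < n) (b : Fin p → ℝ) :
    scaledLoss X Y b 0 = if ‖respE Y - lin (colE X) b‖ = 0 then 0 else ⊤ := by
  have hn' : (0 : ℝ) < n := by exact_mod_cast hn
  have hs := Real.sqrt_pos.2 hn'
  have h0 : 0 ≤ l2 (Y - X.mulVec b) := norm_nonneg _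
  rw [scaledLoss, norm_respE_sub_lin]
  split_ifs with h
  · have : l2 (Y - X.mulVec b) = 0 := by simpa [hs.ne'] using h
    simp [this]
  · have h1 : l2 (Y - X.mulVec b) ≠ 0 := fun h2 => h (by rw [h2, zero_div])
    have : ENNReal.ofReal (l2 (Y - X.mulVec b) ^ 2) ≠ 0 := by
      rw [Ne, ENNReal.ofReal_eq_zero, not_le]; positivity
    simp [ENNReal.div_zero this]

lemma scaledLoss_norm (hn : 0 < n) (b : Fin p → ℝ) :
    scaledLoss X Y b ‖respE Y - lin (colE X) b‖ =
      ENNReal.ofReal ‖respE Y - lin (colE X) b‖ := by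
  rcases (norm_nonneg (respE Y - lin (colE X) b)).eq_or_lt with h | h
  · rw [← h, scaledLoss_zero hn]; simp [← h]
  · rw [scaledLoss_of_pos hn b h]
    congr 1
    field_simp
    ring

/-- With `x` the residual norm, the loss exceeds `x` by `(x - σ)² / (2 σ)`. At `σ = 0` the loss is
finite only for a vanishing residual, which again gives equality. -/
lemma eq_norm_of_scaledLoss_le (hn : 0 < n) (b : Fin p → ℝ) {σ : ℝ} (hσ : 0 ≤ σ)
    (h : scaledLoss X Y b σ ≤ ENNReal.ofReal ‖respE Y - lin (colE X) b‖) :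
    σ = ‖respE Y - lin (colE X) b‖ := by
  rcases hσ.eq_or_lt with h0 | h0
  · rw [← h0, scaledLoss_zero hn] at h
    split_ifs at h with h1
    · rw [h1, h0]
    · simp at h
  · rw [scaledLoss_of_pos hn b h0] at h
    have hx : 0 ≤ ‖respE Y - lin (colE X) b‖ := norm_nonneg _
    rw [ENNReal.ofReal_le_ofReal_iff hx] at h
    set x := ‖respE Y - lin (colE X) b‖
    have : x ^ 2 / (2 * σ) + σ / 2 - x = (x - σ) ^ 2 / (2 * σ) := by field_simp; ring
    have h2 : (x - σ) ^ 2 / (2 * σ) ≤ 0 := by linarith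
    have h3 : (x - σ) ^ 2 ≤ 0 := by
      rw [div_le_iff₀ (by positivity)] at h2; linarith
    have h4 : x - σ = 0 := by nlinarith
    linarith

/-- For fixed `b` the optimal noise level is the residual norm, which is also the optimal loss. What
is left is the square-root lasso. -/
lemma IsScaledLasso.profile (hn : 0 < n) (hlam : 0 ≤ lam) {γhat : Fin p → ℝ} {σhat : ℝ}
    (h : IsScaledLasso X Y lam γhat σhat) :
    σhat = ‖respE Y - lin (colE X) γhat‖ ∧
    ∀ b, ‖respE Y - lin (colE X) γhat‖ + lam * l1 γhat ≤
      ‖respE Y - lin (colE X) b‖ + lam * l1 b := by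
  have hσ : σhat = ‖respE Y - lin (colE X) γhat‖ := by
    refine eq_norm_of_scaledLoss_le hn _ h.1 ?_
    have h1 := h.2 γhat _ (norm_nonneg (respE Y - lin (colE X) γhat))
    rw [scaledLoss_norm hn] at h1
    exact ENNReal.le_of_add_le_add_right ENNReal.ofReal_ne_top h1
  refine ⟨hσ, fun b => ?_⟩
  have h1 := h.2 b _ (norm_nonneg (respE Y - lin (colE X) b))
  rw [hσ, scaledLoss_norm hn, scaledLoss_norm hn,
    ← ENNReal.ofReal_add (norm_nonneg _) (mul_nonneg hlam (l1_nonneg _)),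
    ← ENNReal.ofReal_add (norm_nonneg _) (mul_nonneg hlam (l1_nonneg _))] at h1
  exact (ENNReal.ofReal_le_ofReal_iff
    (add_nonneg (norm_nonneg _) (mul_nonneg hlam (l1_nonneg _)))).1 h1

lemma IsLSE.profile (hn : 0 < n) {S : Finset (Fin p)} {γlse : Fin p → ℝ} {σlse : ℝ}
    (h : IsLSE X Y S γlse σlse) :
    σlse = ‖respE Y - lin (colE X) γlse‖ ∧
    ∀ b, supp b ⊆ S → ‖respE Y - lin (colE X) γlse‖ ≤ ‖respE Y - lin (colE X) b‖ := by
  have hσ : σlse = ‖respE Y - lin (colE X) γlse‖ := by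
    refine eq_norm_of_scaledLoss_le hn _ h.2.1 ?_
    have h1 := h.2.2 γlse _ h.1 (norm_nonneg (respE Y - lin (colE X) γlse))
    rwa [scaledLoss_norm hn] at h1
  refine ⟨hσ, fun b hb => ?_⟩
  have h1 := h.2.2 b _ hb (norm_nonneg (respE Y - lin (colE X) b))
  rw [hσ, scaledLoss_norm hn, scaledLoss_norm hn] at h1
  exact (ENNReal.ofReal_le_ofReal_iff (norm_nonneg _)).1 h1

lemma l1On_pos_of_mem_cone {α : ℝ} {J : Finset (Fin p)} {u : Fin p → ℝ} (hu : u ∈ cone α J)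
    (h0 : u ≠ 0) : 0 < l1On J u := by
  refine (l1On_nonneg J u).lt_of_ne' fun h => h0 (l1_eq_zero ?_)
  have h1 : l1On Jᶜ u ≤ α * l1On J u := hu
  rw [l1_eq_add J, h]
  rw [h, mul_zero] at h1
  linarith

lemma phiComp_le {α : ℝ} {J : Finset (Fin p)} {u : Fin p → ℝ} (hu : u ∈ cone α J)
    (h0 : u ≠ 0) :
    phiComp α J X ≤ ENNReal.ofReal (√(J.card : ℝ) * ‖lin (colE X) u‖ / l1On J u) := by
  refine (iInf_le _ ⟨u, hu, h0⟩).trans (le_of_eq ?_)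
  rw [norm_lin_colE, mul_div_assoc', div_div]

/-- A finite bound for the inverse square excludes a vanishing quotient, since its inverse would be
infinite; the remaining case is a rearrangement in real numbers. -/
lemma compat_of_phiComp {α C : ℝ} {J : Finset (Fin p)} (hC : 0 ≤ C)
    (h : (phiComp α J X ^ 2)⁻¹ ≤ ENNReal.ofReal C) : Compat (colE X) α J C := by
  intro u hu
  by_cases h0 : u = 0
  · simp [h0, l1On, lin]
  have hp := l1On_pos_of_mem_cone hu h0
  have h1 := phiComp_le (X := X) hu h0
  set q := √(J.card : ℝ) * ‖lin (colE X) u‖ / l1On J u with hq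
  have hq0 : 0 ≤ q := by positivity
  have h2 : (ENNReal.ofReal (q ^ 2))⁻¹ ≤ ENNReal.ofReal C := by
    refine le_trans ?_ h
    rw [ENNReal.inv_le_inv, ENNReal.ofReal_pow hq0]
    exact pow_le_pow_left₀ zero_le h1 2
  have hq1 : 0 < q ^ 2 := by
    rcases (sq_nonneg q).eq_or_lt with h3 | h3
    · rw [← h3] at h2; simp at h2
    · exact h3
  rw [← ENNReal.ofReal_inv_of_pos hq1, ENNReal.ofReal_le_ofReal_iff hC] at h2
  have h3 : 1 ≤ C * q ^ 2 := by
    rwa [inv_le_iff_one_le_mul₀ hq1] at h2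
  rw [hq, div_pow, mul_pow, Real.sq_sqrt (Nat.cast_nonneg _), mul_div_assoc',
    le_div_iff₀ (by positivity)] at h3
  linarith

/-- The comparison of the scaled lasso and the least squares fit in the selected model, for an
arbitrary design. -/
lemma lasso_lse_compare (hn : 0 < n) (hlam : 0 < lam) {γhat γlse : Fin p → ℝ} {σhat σlse : ℝ}
    (h : IsScaledLasso X Y lam γhat σhat) (hσ : 0 < σhat)
    (hl : IsLSE X Y (supp γhat) γlse σlse) :
    σhat ^ 2 - σlse ^ 2 = l2 (X.mulVec (γlse - γhat)) ^ 2 / n ∧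
    ENNReal.ofReal (l2 (X.mulVec (γlse - γhat)) ^ 2 / n) ≤
      ENNReal.ofReal ((σhat * lam) ^ 2 * (supp γhat).card) / phiComp 0 (supp γhat) X ^ 2 ∧
    ENNReal.ofReal (l1 (γlse - γhat)) ≤
      ENNReal.ofReal (σhat * lam * (supp γhat).card) / phiComp 0 (supp γhat) X ^ 2 := by
  have hn' : (0 : ℝ) < n := by exact_mod_cast hn
  obtain ⟨hσ', hmin⟩ := h.profile hn hlam.le
  obtain ⟨hσl, hls⟩ := hl.profile hn
  obtain ⟨e1, e2⟩ := lse_compare hmin hlam.le hl.1 hls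
  rw [← hσ', ← hσl] at e1
  rw [← hσ'] at e2
  have e3 : l2 (X.mulVec (γlse - γhat)) ^ 2 / n = ‖lin (colE X) (γlse - γhat)‖ ^ 2 := by
    rw [norm_lin_colE, div_pow, Real.sq_sqrt hn'.le]
  rw [e3]
  refine ⟨e1, ?_⟩
  set u := γlse - γhat with hu
  by_cases h0 : u = 0
  · simp [h0, lin, l1, l1On]
  have hsub : supp u ⊆ supp γhat := supp_sub_subset hl.1 subset_rfl
  obtain ⟨f1, f2⟩ := l1On_eq_of_supp_subset hsub
  have hcone : u ∈ cone 0 (supp γhat) := by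
    show l1On (supp γhat)ᶜ u ≤ 0 * l1On (supp γhat) u
    rw [f2, zero_mul]
  have hp := l1On_pos_of_mem_cone hcone h0
  have hphi := phiComp_le (X := X) hcone h0
  rw [f1] at hp hphi
  have hcard : (0 : ℝ) < (supp γhat).card := by
    have : (supp γhat).Nonempty := by
      rw [Finset.nonempty_iff_ne_empty]
      intro he
      rw [he, Finset.subset_empty] at hsub
      rw [← f1, he] at hp
      simp [l1On] at hp
    exact_mod_cast this.card_pos
  set q := √((supp γhat).card : ℝ) * ‖lin (colE X) u‖ / l1 u with hq
  have hq0 : 0 ≤ q := by positivity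
  have hq2 : q ^ 2 = (supp γhat).card * ‖lin (colE X) u‖ ^ 2 / l1 u ^ 2 := by
    rw [hq, div_pow, mul_pow, Real.sq_sqrt hcard.le]
  have hphi2 : phiComp 0 (supp γhat) X ^ 2 ≤ ENNReal.ofReal (q ^ 2) := by
    rw [ENNReal.ofReal_pow hq0]
    exact pow_le_pow_left₀ zero_le hphi 2
  set N := ‖lin (colE X) u‖ ^ 2 with hN
  have hN0 : 0 ≤ N := sq_nonneg _
  -- The compatibility constant is bounded by the quotient `q` of the actual difference `u`. Both
  -- claims then follow from `‖X u‖² / n ≤ σhat lam ‖u‖₁`: applied twice for the prediction error,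
  -- once for the `ℓ₁` error.
  have key : ∀ x y : ℝ, 0 ≤ x → 0 < y → x * q ^ 2 ≤ y →
      ENNReal.ofReal x ≤ ENNReal.ofReal y / phiComp 0 (supp γhat) X ^ 2 := by
    intro x y hx hy hxy
    rw [ENNReal.le_div_iff_mul_le (Or.inr (by simpa using hy)) (Or.inr ENNReal.ofReal_ne_top)]
    calc ENNReal.ofReal x * phiComp 0 (supp γhat) X ^ 2 ≤
        ENNReal.ofReal x * ENNReal.ofReal (q ^ 2) := by gcongr
      _ = ENNReal.ofReal (x * q ^ 2) := (ENNReal.ofReal_mul hx).symm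
      _ ≤ _ := ENNReal.ofReal_le_ofReal hxy
  constructor
  · refine key _ _ hN0 (by positivity) ?_
    rw [hq2, mul_div_assoc', div_le_iff₀ (by positivity)]
    have : N * N ≤ (σhat * lam * l1 u) * (σhat * lam * l1 u) :=
      mul_le_mul e2 e2 hN0 (by positivity)
    nlinarith
  · refine key _ _ hp.le (by positivity) ?_
    rw [hq2, mul_div_assoc', div_le_iff₀ (by positivity)]
    have := mul_le_mul_of_nonneg_left e2 (mul_nonneg hp.le hcard.le)
    linarith

end profile
end ScaledLasso
end

/-! ### Error bounds, size of the selected model, and least squares after selection -/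

noncomputable section
namespace ScaledLasso

section
variable {E : Type*} [NormedAddCommGroup E] [InnerProductSpace ℝ E] {p : ℕ}
variable {a : Fin p → E} {r : E} {γ h : Fin p → ℝ} {lam Z : ℝ}

/-- The error bounds for a normalised error `v` and noise level ratio `τ`: here `q` is the
complexity and `l` the rate. -/
def ErrLe (a : Fin p → E) (v : Fin p → ℝ) (τ C q l : ℝ) : Prop :=
  ‖lin a v‖ ^ 2 ≤ C * (q * l ^ 2) ∧ l1 v ≤ C * (q * l) ∧ |τ - 1| ≤ C * (q * l ^ 2)

namespace SqrtLasso
variable (H : SqrtLasso a r γ h lam)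
include H

lemma min_le_shift (b : Fin p → ℝ) :
    ‖(r + lin a γ) - lin a (γ + h)‖ + lam * l1 (γ + h) ≤ ‖(r + lin a γ) - lin a b‖ + lam * l1 b := by
  have h1 := H.min_le (b - γ)
  rw [add_sub_cancel, lin_sub] at h1
  rw [lin_add]
  have e1 : r + lin a γ - (lin a γ + lin a h) = r - lin a h := by abel
  have e2 : r + lin a γ - lin a b = r - (lin a b - lin a γ) := by abel
  rwa [e1, e2]

lemma abs_inner_col_residual {j : Fin p} (hj : j ∈ supp (γ + h)) :
    |inner ℝ (a j) (r - lin a h)| = ‖r - lin a h‖ * lam := by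
  have h1 := ScaledLasso.abs_inner_col_residual H.min_le_shift H.lam_pos.le hj
  have e1 : r + lin a γ - lin a (γ + h) = r - lin a h := by rw [lin_add]; abel
  rwa [e1] at h1

lemma errLe_of_l1_le {Z' B D q l C : ℝ} (hZ : ∀ j, |inner ℝ (a j) r| ≤ Z' * lam) (hZ' : 0 ≤ Z')
    (hB0 : 0 ≤ B) (hB : lam ≤ B * l) (hD : 0 ≤ D) (hq : 0 ≤ q) (hl : 0 ≤ l)
    (hh : l1 h ≤ D * q * l) (hC1 : D ≤ C) (hC2 : (3 + 2 * Z') * (B * D) ≤ C)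
    (hsmall : C * (q * l ^ 2) ≤ 1) :
    ErrLe a h ‖r - lin a h‖ C q l ∧ ‖lin a h‖ ^ 2 ≤ (3 + 2 * Z') * D * (q * lam * l) ∧
      ‖lin a h‖ ^ 2 ≤ (3 + 2 * Z') * (B * D) * (q * l ^ 2) := by
  have hql : 0 ≤ q * l ^ 2 := by positivity
  have hBD : 0 ≤ B * D := by positivity
  have hs : B * D * (q * l ^ 2) ≤ 1 := by
    refine le_trans ?_ hsmall
    gcongr
    nlinarith
  obtain ⟨h1, h2, h3⟩ := H.bounds_of_l1_le hZ hZ' hB hD hq hl hh hs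
  refine ⟨⟨h2.trans (by gcongr), ?_, h3.trans ?_⟩, h1, h2⟩
  · calc l1 h ≤ D * q * l := hh
      _ = D * (q * l) := by ring
      _ ≤ _ := by gcongr
  · gcongr
    nlinarith

/-- Selected variables with small noise are few. -/
lemma card_filter_mul_sq_le {T : Finset (Fin p)} (hT : T ⊆ supp (γ + h)) {m : ℕ}
    (hTm : T.card ≤ m) {C x y : ℝ} (hS : SparseBound a m C) (hy : 0 ≤ y)
    (hxy : x + y ≤ ‖r - lin a h‖ * lam) :
    ((T.filter fun j => ¬ x < |inner ℝ (a j) r|).card : ℝ) * y ^ 2 ≤ C * ‖lin a h‖ ^ 2 := by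
  refine le_trans ?_ (hS (lin a h) (T.filter fun j => ¬ x < |inner ℝ (a j) r|)
    ((Finset.card_filter_le _ _).trans hTm))
  rw [← nsmul_eq_mul]
  refine Finset.card_nsmul_le_sum _ _ _ fun j hj => ?_
  rw [Finset.mem_filter, not_lt] at hj
  have h1 := H.abs_inner_col_residual (hT hj.1)
  rw [inner_sub_right] at h1
  have h2 := abs_sub (inner ℝ (a j) r) (inner ℝ (a j) (lin a h))
  -- A selected column has correlation at least `x + y` with the residual, of which the noise
  -- supplies at most `x`.
  have h3 : y ≤ |inner ℝ (a j) (lin a h)| := by linarith [hj.2]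
  rw [← sq_abs (inner ℝ (a j) (lin a h))]
  exact pow_le_pow_left₀ hy h3 2

/-- The dimension bound. -/
lemma card_supp_lt {m : ℕ} (hm : 0 < m) {C C₀ x q l ε ε₂ ε₃ l₀ : ℝ} (hC : 0 ≤ C)
    (hS : SparseBound a m C) (hl₀ : 0 < l₀) (hε : -1 < ε) (h23 : ε₂ < ε₃)
    (hlam : (1 + ε) * l₀ ≤ lam) (hx : x = (1 + (ε₂ + ε₃) / 2) * l₀)
    (hσ : (1 + ε₃) / (1 + ε) ≤ ‖r - lin a h‖)
    (hbad : ((Finset.univ.filter fun j => x < |inner ℝ (a j) r|).card : ℝ) ≤ m / 2)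
    (hN : 9 * ‖lin a h‖ ^ 2 ≤ C₀ * (q * l ^ 2))
    (hsize : C * (C₀ * (q * l ^ 2)) ≤ m * (ε₃ - ε₂) ^ 2 * l₀ ^ 2) :
    (supp (γ + h)).card < m := by
  by_contra hcon
  push Not at hcon
  obtain ⟨T, hT, hTm⟩ := Finset.exists_subset_card_eq hcon
  have hm0 : (0 : ℝ) < m := by exact_mod_cast hm
  have hε' : 0 < 1 + ε := by linarith
  have h4 : (1 + ε₃) * l₀ ≤ ‖r - lin a h‖ * lam := by
    calc (1 + ε₃) * l₀ = (1 + ε₃) / (1 + ε) * ((1 + ε) * l₀) := by field_simp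
      _ ≤ ‖r - lin a h‖ * lam := by
        refine mul_le_mul hσ hlam (by positivity) (norm_nonneg _)
  have h5 := H.card_filter_mul_sq_le hT hTm.le (x := x) (y := (ε₃ - ε₂) / 2 * l₀) hS
    (by have : 0 < ε₃ - ε₂ := by linarith
        positivity) (by rw [hx]; linarith)
  have h6 : (m : ℝ) / 2 ≤ ((T.filter fun j => ¬ x < |inner ℝ (a j) r|).card : ℝ) := by
    have h7 := Finset.card_filter_add_card_filter_not (s := T) (fun j => x < |inner ℝ (a j) r|)
    have h8 : (T.filter fun j => x < |inner ℝ (a j) r|).card ≤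
        (Finset.univ.filter fun j => x < |inner ℝ (a j) r|).card :=
      Finset.card_le_card (Finset.filter_subset_filter _ (Finset.subset_univ _))
    have h9 : ((T.filter fun j => x < |inner ℝ (a j) r|).card : ℝ) +
        (T.filter fun j => ¬ x < |inner ℝ (a j) r|).card = m := by
      rw [← hTm]; exact_mod_cast h7
    have h10 : ((T.filter fun j => x < |inner ℝ (a j) r|).card : ℝ) ≤
        (Finset.univ.filter fun j => x < |inner ℝ (a j) r|).card := by exact_mod_cast h8
    linarith
  -- At least half of `m` selected columns need `(ε₃ - ε₂) l₀ / 2` from the fit, which sums to `m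
  -- (ε₃ - ε₂)² l₀² / 8`. The factor `9 > 8` in `hN` gives the contradiction.
  have h7 : (m : ℝ) / 2 * ((ε₃ - ε₂) / 2 * l₀) ^ 2 ≤ C * ‖lin a h‖ ^ 2 :=
    (mul_le_mul_of_nonneg_right h6 (sq_nonneg _)).trans h5
  have h8 : C * (9 * ‖lin a h‖ ^ 2) ≤ C * (C₀ * (q * l ^ 2)) :=
    mul_le_mul_of_nonneg_left hN hC
  have h9 : 0 < m * (ε₃ - ε₂) ^ 2 * l₀ ^ 2 := by
    have : 0 < ε₃ - ε₂ := by linarith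
    positivity
  nlinarith

/-- The size of the selected model in terms of the penalty level. -/
lemma card_supp_mul_le {m : ℕ} {C Q Qb x q l ε ε₂ ε₃ l₀ : ℝ} (hC : 0 ≤ C)
    (hS : SparseBound a m C) (hm : (supp (γ + h)).card ≤ m)
    (hε : -1 < ε) (h23 : ε₂ < ε₃) (h2 : -2 ≤ ε₂ + ε₃)
    (hlam : (1 + ε) * l₀ ≤ lam) (hx : x = (1 + (ε₂ + ε₃) / 2) * l₀)
    (hσ : (1 + ε₃) / (1 + ε) ≤ ‖r - lin a h‖)
    (hbad : ((Finset.univ.filter fun j => x < |inner ℝ (a j) r|).card : ℝ) * lam ≤ Qb * (q * l))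
    (hN : ‖lin a h‖ ^ 2 ≤ Q * (q * lam * l)) :
    ((supp (γ + h)).card : ℝ) * lam ≤
      (C * Q / ((ε₃ - ε₂) / (2 * (1 + ε))) ^ 2 + Qb) * (q * l) := by
  have hε' : 0 < 1 + ε := by linarith
  have hlam0 := H.lam_pos
  set c := (ε₃ - ε₂) / (2 * (1 + ε)) with hc
  have hc0 : 0 < c := by
    have : 0 < ε₃ - ε₂ := by linarith
    positivity
  have h4 : x + c * lam ≤ ‖r - lin a h‖ * lam := by
    have e1 : (1 + (ε₂ + ε₃) / 2) * l₀ ≤ (1 + (ε₂ + ε₃) / 2) / (1 + ε) * lam := by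
      calc (1 + (ε₂ + ε₃) / 2) * l₀ = (1 + (ε₂ + ε₃) / 2) / (1 + ε) * ((1 + ε) * l₀) := by
            field_simp
        _ ≤ _ := by
          have : 0 ≤ 1 + (ε₂ + ε₃) / 2 := by linarith
          gcongr
    have e2 : (1 + (ε₂ + ε₃) / 2) / (1 + ε) * lam + c * lam = (1 + ε₃) / (1 + ε) * lam := by
      rw [hc]; field_simp; ring
    have e3 := mul_le_mul_of_nonneg_right hσ hlam0.le
    rw [hx]; linarith
  have h5 := H.card_filter_mul_sq_le subset_rfl hm (x := x) (y := c * lam) hS (by positivity) h4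
  set G := (((supp (γ + h)).filter fun j => ¬ x < |inner ℝ (a j) r|).card : ℝ) with hG
  have h6 : G * lam ≤ C * Q / c ^ 2 * (q * l) := by
    have h7 : C * ‖lin a h‖ ^ 2 ≤ C * (Q * (q * lam * l)) := by gcongr
    have h8 : lam * (G * lam * c ^ 2) ≤ lam * (C * Q * (q * l)) := by linarith
    have h9 := le_of_mul_le_mul_left h8 hlam0
    rw [div_mul_eq_mul_div, le_div_iff₀ (by positivity)]
    exact h9
  have h7 : ((supp (γ + h)).card : ℝ) ≤
      ((Finset.univ.filter fun j => x < |inner ℝ (a j) r|).card : ℝ) + G := by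
    rw [hG]
    norm_cast
    rw [← Finset.card_filter_add_card_filter_not (s := supp (γ + h))
      (fun j => x < |inner ℝ (a j) r|)]
    exact Nat.add_le_add_right
      (Finset.card_le_card (Finset.filter_subset_filter _ (Finset.subset_univ _))) _
  have h8 := mul_le_mul_of_nonneg_right h7 hlam0.le
  linarith

/-- A nonempty selection forces the penalty level to be small. -/
lemma lam_le_of_mem_supp (hσ : 0 < ‖r - lin a h‖) {j : Fin p} (hj : j ∈ supp (γ + h))
    (hZ : ∀ j, |inner ℝ (a j) r| ≤ Z) : lam - Z ≤ 2 * l1 h := by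
  have h1 := H.abs_inner_col_residual hj
  have h2 : lam ≤ 1 := by
    have h3 := abs_real_inner_le_norm (a j) (r - lin a h)
    rw [h1, H.norm_col, one_mul] at h3
    exact (mul_le_iff_le_one_right hσ).1 h3
  rw [inner_sub_right] at h1
  have h4 := abs_sub (inner ℝ (a j) r) (inner ℝ (a j) (lin a h))
  have h5 : |inner ℝ (a j) (lin a h)| ≤ l1 h := by
    refine (abs_real_inner_le_norm _ _).trans ?_
    rw [H.norm_col, one_mul]
    exact norm_lin_le_l1 H.norm_col h
  have h6 := H.one_sub_inner_le
  have h7 : inner ℝ (lin a h) r ≤ l1 h := by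
    refine (le_abs_self _).trans ((abs_real_inner_le_norm _ _).trans ?_)
    rw [H.norm_res, mul_one]
    exact norm_lin_le_l1 H.norm_col h
  have h8 := hZ j
  have hn := l1_nonneg h
  have h9 : (1 - l1 h) * lam ≤ ‖r - lin a h‖ * lam :=
    mul_le_mul_of_nonneg_right (by linarith) H.lam_pos.le
  have h10 : lam * l1 h ≤ 1 * l1 h := by gcongr
  linarith

/-- Error bounds for the least squares fit in the selected model. -/
lemma errLe_lse {u : Fin p → ℝ} {τ B C Q C₀ C' q l : ℝ} (hu : supp u ⊆ supp (γ + h))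
    (hτ0 : 0 ≤ τ) (hτ : ‖r - lin a h‖ ^ 2 - τ ^ 2 = ‖lin a u‖ ^ 2)
    (hau : ‖lin a u‖ ^ 2 ≤ ‖r - lin a h‖ * lam * l1 u) (hC : 0 ≤ C)
    (hcompat : Compat a 0 (supp (γ + h)) C) (hB : lam ≤ B * l) (hq : 0 ≤ q) (hl : 0 ≤ l)
    (hB0 : 0 ≤ B) (hQ : 0 ≤ Q)
    (hcard : ((supp (γ + h)).card : ℝ) * lam ≤ Q * (q * l))
    (herr : ErrLe a h ‖r - lin a h‖ C₀ q l) (hsmall : C₀ * (q * l ^ 2) ≤ 1 / 2)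
    (hC' : C' = 2 * C₀ + 5 * (C * Q) * (1 + B)) :
    ErrLe a (h + u) τ C' q l := by
  obtain ⟨e1, e2, e3⟩ := herr
  have hσ := abs_le.1 (e3.trans hsmall)
  set σ := ‖r - lin a h‖ with hσdef
  obtain ⟨f1, f2⟩ := l1On_eq_of_supp_subset hu
  have hcomp := hcompat u (by
    show l1On (supp (γ + h))ᶜ u ≤ 0 * l1On (supp (γ + h)) u
    rw [f2, zero_mul])
  rw [f1] at hcomp
  have hun := l1_nonneg u
  have hlam := H.lam_pos
  set k := ((supp (γ + h)).card : ℝ) with hk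
  have hk0 : 0 ≤ k := Nat.cast_nonneg _
  have hCk : 0 ≤ C * k := by positivity
  have hql : 0 ≤ q * l := by positivity
  have h1 : l1 u ≤ 3 / 2 * (C * Q) * (q * l) := by
    rcases hun.eq_or_lt with h0 | h0
    · rw [← h0]; positivity
    -- Compatibility and the first order bound on `‖lin a u‖²` leave one factor `l1 u` to cancel.
    -- Only the product `k * lam` occurs, and it is bounded even where `k` alone is not of order
    -- `q`.
    · have g1 : l1 u * l1 u ≤ (C * k * (σ * lam)) * l1 u := by
        have := mul_le_mul_of_nonneg_left hau hCk
        nlinarith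
      have g2 := le_of_mul_le_mul_right g1 h0
      calc l1 u ≤ C * k * (σ * lam) := g2
        _ = σ * (C * (k * lam)) := by ring
        _ ≤ 3 / 2 * (C * (Q * (q * l))) := by
          have : σ ≤ 3 / 2 := by linarith [hσ.2]
          gcongr
        _ = _ := by ring
  have h2 : ‖lin a u‖ ^ 2 ≤ 9 / 4 * (C * Q) * B * (q * l ^ 2) := by
    calc ‖lin a u‖ ^ 2 ≤ σ * lam * l1 u := hau
      _ ≤ 3 / 2 * (B * l) * (3 / 2 * (C * Q) * (q * l)) := by
        have : σ ≤ 3 / 2 := by linarith [hσ.2]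
        have : 0 ≤ σ := norm_nonneg _
        gcongr
      _ = _ := by ring
  have hql2 : 0 ≤ q * l ^ 2 := by positivity
  have hCQ : 0 ≤ C * Q := by positivity
  have hCQB : 0 ≤ C * Q * B := by positivity
  have hexp : ∀ x, C' * x = 2 * (C₀ * x) + 5 * (C * Q * x) + 5 * (C * Q * B * x) := by
    intro x; rw [hC']; ring
  have m1 := mul_nonneg hCQ hql2
  have m2 := mul_nonneg hCQB hql2
  refine ⟨?_, ?_, ?_⟩
  · have g1 : ‖lin a h + lin a u‖ ^ 2 ≤ 2 * (‖lin a h‖ ^ 2 + ‖lin a u‖ ^ 2) :=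
      (pow_le_pow_left₀ (norm_nonneg _) (norm_add_le _ _) 2).trans add_sq_le
    rw [lin_add, hexp]
    linarith
  · have g1 := l1_add_le h u
    have m3 := mul_nonneg hCQ hql
    have m4 := mul_nonneg hCQB hql
    have m5 := l1_nonneg h
    rw [hexp]
    linarith
  · have g0 : 0 ≤ C₀ * (q * l ^ 2) := (abs_nonneg _).trans e3
    -- `σ² - τ²` is known and `σ ≥ 1/2`, so `1 ≤ 2 (σ + τ)`.
    have g1 : |τ - σ| ≤ 2 * ‖lin a u‖ ^ 2 := by
      have hστ : τ ≤ σ := by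
        refine le_of_sq_le_sq ?_ (norm_nonneg _)
        linarith [sq_nonneg ‖lin a u‖]
      rw [abs_sub_comm, abs_of_nonneg (by linarith), ← hτ]
      have : 1 * (σ - τ) ≤ (2 * (σ + τ)) * (σ - τ) :=
        mul_le_mul_of_nonneg_right (by linarith [hσ.1]) (by linarith)
      linarith
    have g2 : |τ - 1| ≤ |τ - σ| + |σ - 1| := abs_sub_le _ _ _
    rw [hexp]
    linarith

end SqrtLasso
end
end ScaledLasso
end

/-! ### The explicit constants -/

noncomputable section
namespace ScaledLasso

section
variable {E : Type*} [NormedAddCommGroup E] [InnerProductSpace ℝ E] {p : ℕ}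
variable {a : Fin p → E} {r : E} {γ h : Fin p → ℝ} {lam Z : ℝ}

/-- The `ℓ₁` constant for the smaller penalty levels. -/
def smallPenaltyL1Const (B α ε θ C₂ : ℝ) : ℝ :=
  8 * (1 + α) ^ 2 * C₂ * α * B + 800 * ((1 + ε) / (ε - θ))

/-- The constant for the smaller penalty levels. -/
def smallPenaltyConst (B α ε θ C₂ : ℝ) : ℝ :=
  smallPenaltyL1Const B α ε θ C₂ + 9 * ((3 + 2 * α) * (B * smallPenaltyL1Const B α ε θ C₂)) +
    2 * ((1 + α) ^ 2 * C₂ * B ^ 2) + 16 * B ^ 2 + 1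

/-- The constant in the bound for the selected model size for the smaller penalty levels. -/
def smallPenaltySizeConst (B α ε θ C₂ C₃ ε₂ ε₃ : ℝ) : ℝ :=
  C₃ * ((3 + 2 * α) * smallPenaltyL1Const B α ε θ C₂) / ((ε₃ - ε₂) / (2 * (1 + ε))) ^ 2 +
    8 * (1 + ε) / (ε₃ - ε₂) * B

lemma smallPenaltyL1Const_nonneg {B α ε θ C₂ : ℝ} (hB : 0 ≤ B) (hα : 0 ≤ α) (hε : 0 ≤ ε)
    (hθ : θ < ε) (hC : 0 ≤ C₂) : 0 ≤ smallPenaltyL1Const B α ε θ C₂ := by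
  have : 0 < ε - θ := by linarith
  unfold smallPenaltyL1Const
  positivity

lemma smallPenaltyConst_pos {B α ε θ C₂ : ℝ} (hB : 0 ≤ B) (hα : 0 ≤ α) (hε : 0 ≤ ε)
    (hθ : θ < ε) (hC : 0 ≤ C₂) : 0 < smallPenaltyConst B α ε θ C₂ := by
  have := smallPenaltyL1Const_nonneg hB hα hε hθ hC
  unfold smallPenaltyConst
  positivity

namespace SqrtLasso
variable (H : SqrtLasso a r γ h lam)
include H

/-- The summands of `smallPenaltyConst` serve in turn the `ℓ₁` bound, the prediction bound with the
factor nine needed for the dimension, the absorption in `l1_le_of_sq_le`, and, with `16 B²`, the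
count of large noise coordinates. -/
lemma errLe_of_sum_excess_le {α B C₂ s l θ ε w l₀ : ℝ} {m : ℕ} {K : Finset (Fin p)}
    (hB0 : 0 ≤ B) (hZ : ∀ j, |inner ℝ (a j) r| ≤ Z) (hZ0 : 0 ≤ Z) (hα : 1 ≤ α) (hC : 0 ≤ C₂)
    (hm : 1 ≤ m) (hcompat : ∀ J : Finset (Fin p), (J \ K).card ≤ m → Compat a α J C₂)
    (hs : (K.card : ℝ) + m ≤ s) (hθ : 0 ≤ θ) (hθε : θ < ε) (hl₀ : 0 < l₀)
    (hlam : (1 + ε) * l₀ ≤ lam) (hB : lam ≤ B * l) (hl : 0 ≤ l)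
    (hsum : ∑ j, excess ((1 + θ) * l₀) (inner ℝ (a j) r) ≤ w * m * l₀)
    (h1 : lam + Z ≤ 99 / 100 * α * (lam - (1 + θ) * l₀))
    (h2 : Z - lam + w * l₀ ≤ 99 / 100 * α * (lam - (1 + θ) * l₀))
    (hg : l1On Kᶜ γ ≤ 2 * (s * l))
    (hsmall : smallPenaltyConst B α ε θ C₂ * (s * l ^ 2) ≤ 1 / 2) :
    ErrLe a h ‖r - lin a h‖ (smallPenaltyConst B α ε θ C₂) s l ∧
    ‖lin a h‖ ^ 2 ≤ (3 + 2 * α) * smallPenaltyL1Const B α ε θ C₂ * (s * lam * l) ∧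
    9 * ‖lin a h‖ ^ 2 ≤ smallPenaltyConst B α ε θ C₂ * (s * l ^ 2) := by
  have hs0 : 0 ≤ s := le_trans (by positivity) hs
  have hε0 : 0 ≤ ε := by linarith
  have hD0 := smallPenaltyL1Const_nonneg hB0 (by linarith : 0 ≤ α) hε0 hθε hC
  have hlam0 := H.lam_pos
  obtain ⟨D, hD⟩ : ∃ D, D = smallPenaltyL1Const B α ε θ C₂ := ⟨_, rfl⟩
  obtain ⟨C, hC'⟩ : ∃ C, C = smallPenaltyConst B α ε θ C₂ := ⟨_, rfl⟩
  have hCeq : C = D + 9 * ((3 + 2 * α) * (B * D)) + 2 * ((1 + α) ^ 2 * C₂ * B ^ 2) +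
      16 * B ^ 2 + 1 := by rw [hC', hD]; rfl
  rw [← hD] at hD0 ⊢
  rw [← hC'] at hsmall ⊢
  have t1 : 0 ≤ (3 + 2 * α) * (B * D) := by positivity
  have t2 : 0 ≤ (1 + α) ^ 2 * C₂ * B ^ 2 := by positivity
  have t3 : 0 ≤ B ^ 2 := by positivity
  have hsl : 0 ≤ s * l ^ 2 := by positivity
  have hlZ : lam + Z ≤ α * lam := by
    have : 0 ≤ (1 + θ) * l₀ := by positivity
    have : 0 ≤ α * ((1 + θ) * l₀) := by positivity
    have : 0 ≤ α * lam := by positivity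
    linarith
  have hsm : (1 + α) ^ 2 * C₂ * s * lam ^ 2 ≤ 1 / 2 := by
    calc (1 + α) ^ 2 * C₂ * s * lam ^ 2 ≤ (1 + α) ^ 2 * C₂ * s * (B * l) ^ 2 := by gcongr
      _ = (1 + α) ^ 2 * C₂ * B ^ 2 * (s * l ^ 2) := by ring
      _ ≤ C * (s * l ^ 2) := by gcongr; linarith
      _ ≤ _ := hsmall
  have hl1 : l1 h ≤ D * s * l := by
    have e1 := H.l1_le_of_sum_excess_le hZ hZ0 hα hC hm hcompat hs hθ hθε hlam hsum h1 h2 hsm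
    have e2 : 8 * ((1 + α) ^ 2 * C₂ * s) * (lam + Z) ≤
        8 * ((1 + α) ^ 2 * C₂ * s) * (α * (B * l)) := by
      gcongr
      exact hlZ.trans (by gcongr)
    have e3 : 400 * ((1 + ε) / (ε - θ)) * l1On Kᶜ γ ≤
        400 * ((1 + ε) / (ε - θ)) * (2 * (s * l)) := by
      have : 0 < ε - θ := by linarith
      gcongr
    rw [hD, smallPenaltyL1Const]
    linarith
  have hZ' : ∀ j, |inner ℝ (a j) r| ≤ α * lam := fun j => (hZ j).trans (by linarith)
  obtain ⟨f1, f2, f3⟩ := H.errLe_of_l1_le hZ' (by linarith) hB0 hB hD0 hs0 hl hl1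
    (C := C) (by linarith) (by linarith) (by linarith)
  refine ⟨f1, f2, ?_⟩
  calc 9 * ‖lin a h‖ ^ 2 ≤ 9 * ((3 + 2 * α) * (B * D) * (s * l ^ 2)) := by gcongr
    _ = 9 * ((3 + 2 * α) * (B * D)) * (s * l ^ 2) := by ring
    _ ≤ C * (s * l ^ 2) := by gcongr; linarith

/-- The total excess also counts: a coordinate above `x = (1 + (ε₂ + ε₃) / 2) l₀` contributes at
least `(ε₃ - ε₂) l₀ / 2` to the excess over `(1 + θ) l₀`, so there are at most of order `s` of them.
-/
lemma card_supp_of_sum_excess_le {α B C₂ C₃ s l θ ε ε₂ ε₃ w l₀ : ℝ} {m m' : ℕ}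
    (hB0 : 0 ≤ B) (hα : 0 ≤ α) (hC : 0 ≤ C₂) (hm : 1 ≤ m') (hs : (m : ℝ) ≤ s) (hθ : 0 ≤ θ)
    (hθ2 : θ ≤ ε₂) (h23 : ε₂ < ε₃) (h3ε : ε₃ < ε) (hl₀ : 0 < l₀) (hl : 0 < l)
    (hlam : (1 + ε) * l₀ ≤ lam) (hB : lam ≤ B * l)
    (hsum : ∑ j, excess ((1 + θ) * l₀) (inner ℝ (a j) r) ≤ w * m * l₀)
    (hw : w ≤ 4 * (1 + ε)) (hC₃ : 1 ≤ C₃) (hS : SparseBound a m' C₃)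
    (herr : ErrLe a h ‖r - lin a h‖ (smallPenaltyConst B α ε θ C₂) s l)
    (hN1 : ‖lin a h‖ ^ 2 ≤ (3 + 2 * α) * smallPenaltyL1Const B α ε θ C₂ * (s * lam * l))
    (hN2 : 9 * ‖lin a h‖ ^ 2 ≤ smallPenaltyConst B α ε θ C₂ * (s * l ^ 2))
    (hnoise : smallPenaltyConst B α ε θ C₂ * (s * l ^ 2) ≤ (ε - ε₃) / (1 + ε))
    (hsize : C₃ * (smallPenaltyConst B α ε θ C₂ * (s * l ^ 2)) ≤ m' * (ε₃ - ε₂) ^ 2 * l₀ ^ 2) :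
    (supp (γ + h)).card < m' ∧
    ((supp (γ + h)).card : ℝ) * lam ≤
      smallPenaltySizeConst B α ε θ C₂ C₃ ε₂ ε₃ * (s * l) := by
  have hs0 : 0 ≤ s := le_trans (by positivity) hs
  have hε0 : 0 ≤ ε := by linarith
  have hd : 0 < ε₃ - ε₂ := by linarith
  have hlam0 := H.lam_pos
  have hD0 := smallPenaltyL1Const_nonneg hB0 hα hε0 (by linarith : θ < ε) hC
  have hσ : (1 + ε₃) / (1 + ε) ≤ ‖r - lin a h‖ := by
    have e1 := (abs_le.1 (herr.2.2.trans hnoise)).1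
    have e2 : (1 + ε₃) / (1 + ε) = 1 - (ε - ε₃) / (1 + ε) := by
      have : 1 + ε ≠ 0 := by linarith
      field_simp; ring
    linarith
  set x := (1 + (ε₂ + ε₃) / 2) * l₀ with hx
  have hcount : ((Finset.univ.filter fun j => x < |inner ℝ (a j) r|).card : ℝ) *
      ((ε₃ - ε₂) / 2 * l₀) ≤ 4 * (1 + ε) * s * l₀ := by
    rw [← nsmul_eq_mul]
    have e1 : ∑ j ∈ Finset.univ.filter fun j => x < |inner ℝ (a j) r|,
        excess ((1 + θ) * l₀) (inner ℝ (a j) r) ≤ w * m * l₀ :=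
      (Finset.sum_le_sum_of_subset_of_nonneg (Finset.filter_subset _ _)
        fun _ _ _ => excess_nonneg _ _).trans hsum
    have e2 : w * m * l₀ ≤ 4 * (1 + ε) * s * l₀ := by
      have : w * m ≤ 4 * (1 + ε) * m := by gcongr
      have : 4 * (1 + ε) * (m : ℝ) ≤ 4 * (1 + ε) * s := by gcongr
      gcongr
    refine (Finset.card_nsmul_le_sum _ _ _ fun j hj => ?_).trans (e1.trans e2)
    rw [Finset.mem_filter] at hj
    have e3 := sub_le_excess ((1 + θ) * l₀) (inner ℝ (a j) r)
    have e4 : θ * l₀ ≤ ε₂ * l₀ := by gcongr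
    rw [hx] at hj
    linarith [hj.2]
  set N := ((Finset.univ.filter fun j => x < |inner ℝ (a j) r|).card : ℝ) with hN
  have hcount2 : N ≤ 8 * (1 + ε) / (ε₃ - ε₂) * s := by
    have e1 : l₀ * (N * (ε₃ - ε₂)) ≤ l₀ * (8 * (1 + ε) * s) := by linarith
    have e2 := le_of_mul_le_mul_left e1 hl₀
    rw [div_mul_eq_mul_div, le_div_iff₀ hd]
    exact e2
  have hlt : (supp (γ + h)).card < m' := by
    -- The large noise coordinates must be at most `m' / 2`. The summand `16 B²` of the constant
    -- turns the size constraint into `16 (1 + ε)² s ≤ m' (ε₃ - ε₂)²`, and `ε₃ - ε₂ ≤ 1 + ε`.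
    refine H.card_supp_lt hm (by linarith) hS hl₀ (by linarith) h23 hlam hx hσ ?_ hN2 hsize
    have e1 : 16 * B ^ 2 ≤ smallPenaltyConst B α ε θ C₂ := by
      unfold smallPenaltyConst
      have : 0 ≤ (3 + 2 * α) * (B * smallPenaltyL1Const B α ε θ C₂) := by positivity
      have : 0 ≤ (1 + α) ^ 2 * C₂ * B ^ 2 := by positivity
      linarith
    have e2 : 16 * B ^ 2 * (s * l ^ 2) ≤ m' * (ε₃ - ε₂) ^ 2 * l₀ ^ 2 := by
      have k1 : 16 * B ^ 2 * (s * l ^ 2) ≤ smallPenaltyConst B α ε θ C₂ * (s * l ^ 2) := by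
        gcongr
      have k2 : 1 * (smallPenaltyConst B α ε θ C₂ * (s * l ^ 2)) ≤
        C₃ * (smallPenaltyConst B α ε θ C₂ * (s * l ^ 2)) := by
        refine mul_le_mul_of_nonneg_right hC₃ (le_trans (by positivity) k1)
      linarith
    have e3 : ((1 + ε) * l₀) ^ 2 ≤ (B * l) ^ 2 := by
      have := hlam.trans hB
      gcongr
    have hBl : 0 < (B * l) ^ 2 := by
      have : 0 < B * l := hlam0.trans_le hB
      positivity
    have e4 : (B * l) ^ 2 * (16 * (1 + ε) ^ 2 * s) ≤
        (B * l) ^ 2 * (m' * (ε₃ - ε₂) ^ 2) := by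
      have k1 : (m' * (ε₃ - ε₂) ^ 2) * ((1 + ε) * l₀) ^ 2 ≤
        (m' * (ε₃ - ε₂) ^ 2) * (B * l) ^ 2 := by gcongr
      have k2 := mul_le_mul_of_nonneg_left e2 (sq_nonneg (1 + ε))
      linarith
    have e5 := le_of_mul_le_mul_left e4 hBl
    refine hcount2.trans ?_
    rw [div_mul_eq_mul_div, div_le_iff₀ hd]
    have e6 : (m' : ℝ) * (ε₃ - ε₂) ^ 2 ≤ m' * ((ε₃ - ε₂) * (1 + ε)) := by
      rw [sq]
      gcongr
      linarith
    have e7 : (1 + ε) * (16 * (1 + ε) * s) ≤ (1 + ε) * (m' * (ε₃ - ε₂)) := by linarith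
    have e8 := le_of_mul_le_mul_left e7 (by linarith)
    linarith
  refine ⟨hlt, H.card_supp_mul_le (by linarith) hS hlt.le (by linarith) h23 (by linarith) hlam hx
    hσ ?_ hN1⟩
  calc N * lam ≤ 8 * (1 + ε) / (ε₃ - ε₂) * s * (B * l) := by
        gcongr
    _ = _ := by ring

end SqrtLasso

/-- The `ℓ₁` constant for the larger penalty level; `P₀` bounds the dimension when the normal
quantile is small. -/
def largePenaltyL1Const (B ε C₂ P₀ : ℝ) : ℝ :=
  32 * ((1 + (1 + 2 / ε)) ^ 2 * C₂) * B +
    16 * (((1 + (1 + 2 / ε)) * √(C₂ * P₀) + 1) * ((1 + ε) / ε)) +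
    1600 * ((1 + ε) * (2 + ε) / ε) + 12800 * B + 64 * (1 + ε)

/-- The ratio of the penalty level to the rate, when some variable is selected. -/
def largePenaltyRatio (B ε C₂ P₀ : ℝ) : ℝ := 4 * (1 + ε) / ε * largePenaltyL1Const B ε C₂ P₀

/-- The constant for the larger penalty level. -/
def largePenaltyConst (B ε C₂ P₀ : ℝ) : ℝ :=
  largePenaltyL1Const B ε C₂ P₀ + 45 * (B * largePenaltyL1Const B ε C₂ P₀) +
    2 * ((1 + (1 + 2 / ε)) ^ 2 * C₂ * B ^ 2) + 800 * B ^ 2 +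
    (P₀ + 33) * (largePenaltyRatio B ε C₂ P₀ * B) + 1

/-- The constant in the bound for the selected model size for the larger penalty level. -/
def largePenaltySizeConst (B ε C₂ P₀ C₃ ε₂ ε₃ : ℝ) : ℝ :=
  C₃ * (5 * largePenaltyL1Const B ε C₂ P₀) / ((ε₃ - ε₂) / (2 * (1 + ε))) ^ 2 +
    (P₀ + 16) * largePenaltyRatio B ε C₂ P₀

lemma largePenaltyL1Const_pos {B ε C₂ P₀ : ℝ} (hB : 0 ≤ B) (hε : 0 < ε) (hC : 0 ≤ C₂) :
    0 < largePenaltyL1Const B ε C₂ P₀ := by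
  unfold largePenaltyL1Const; positivity

lemma largePenaltyRatio_pos {B ε C₂ P₀ : ℝ} (hB : 0 ≤ B) (hε : 0 < ε) (hC : 0 ≤ C₂) :
    0 < largePenaltyRatio B ε C₂ P₀ := by
  have := largePenaltyL1Const_pos (P₀ := P₀) hB hε hC
  unfold largePenaltyRatio; positivity

lemma largePenaltyConst_pos {B ε C₂ P₀ : ℝ} (hB : 0 ≤ B) (hε : 0 < ε) (hC : 0 ≤ C₂)
    (hP : 0 ≤ P₀) : 0 < largePenaltyConst B ε C₂ P₀ := by
  have := largePenaltyL1Const_pos (P₀ := P₀) hB hε hC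
  have := largePenaltyRatio_pos (P₀ := P₀) hB hε hC
  unfold largePenaltyConst; positivity

/-- Control of the noise for the larger penalty level: bounded dimension, or a slight excess over
the level `l₀` which is compensated on the target set or by the greedy decomposition. -/
def LargePenaltyNoise (a : Fin p → E) (r : E) (h : Fin p → ℝ) (K : Finset (Fin p))
    (ε l₀ P₀ : ℝ) : Prop :=
  ((p : ℝ) ≤ P₀ ∧ ∀ j, |inner ℝ (a j) r| ≤ l₀) ∨
  ((∀ j, |inner ℝ (a j) r| ≤ (1 + ε / (200 * (2 + ε))) * l₀) ∧
    ((∀ j ∈ K, |inner ℝ (a j) r| ≤ 99 / 100 * l₀) ∨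
      inner ℝ (lin a h) r ≤
        11 / 20 * l₀ * l1 h + l₀ * √((80 * K.card : ℕ) : ℝ) * ‖lin a h‖))

lemma LargePenaltyNoise.abs_inner_le {K : Finset (Fin p)} {ε l₀ P₀ : ℝ}
    (hn : LargePenaltyNoise a r h K ε l₀ P₀) (hε : 0 < ε) (hl₀ : 0 ≤ l₀) (j : Fin p) :
    |inner ℝ (a j) r| ≤ (1 + ε / (200 * (2 + ε))) * l₀ := by
  rcases hn with h1 | h1
  · refine (h1.2 j).trans (le_mul_of_one_le_left hl₀ ?_)
    have : 0 ≤ ε / (200 * (2 + ε)) := by positivity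
    linarith
  · exact h1.1 j

lemma slack_le {ε : ℝ} (hε : 0 < ε) : ε / (200 * (2 + ε)) ≤ ε / 400 := by
  gcongr; linarith

namespace SqrtLasso
variable (H : SqrtLasso a r γ h lam)
include H

/-- There are four regimes: bounded dimension; `h` in the cone; `h` off the cone with smaller noise
on `K`; `h` off the cone with the greedy decomposition. `largePenaltyL1Const` adds up their
constants. -/
lemma errLe_of_largePenaltyNoise {B C₂ s l ε l₀ P₀ : ℝ} {K : Finset (Fin p)}
    (hB0 : 0 ≤ B) (hC : 0 ≤ C₂) (hP0 : 0 ≤ P₀) (hcompat : Compat a (1 + 2 / ε) K C₂)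
    (hs : (K.card : ℝ) ≤ s) (hε : 0 < ε) (hl₀ : 0 < l₀)
    (hlam : (1 + ε) * l₀ ≤ lam) (hB : lam ≤ B * l) (hl : 0 ≤ l)
    (hnoise : LargePenaltyNoise a r h K ε l₀ P₀) (hg : l1On Kᶜ γ ≤ 2 * (s * l))
    (hsmall : largePenaltyConst B ε C₂ P₀ * (s * l ^ 2) ≤ 1 / 2) :
    l1 h ≤ largePenaltyL1Const B ε C₂ P₀ * s * l ∧
    ErrLe a h ‖r - lin a h‖ (largePenaltyConst B ε C₂ P₀) s l ∧
    ‖lin a h‖ ^ 2 ≤ 5 * largePenaltyL1Const B ε C₂ P₀ * (s * lam * l) ∧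
    9 * ‖lin a h‖ ^ 2 ≤ largePenaltyConst B ε C₂ P₀ * (s * l ^ 2) := by
  have hs0 : 0 ≤ s := (Nat.cast_nonneg _).trans hs
  have hlam0 := H.lam_pos
  have hD0 := (largePenaltyL1Const_pos (P₀ := P₀) hB0 hε hC).le
  have hR0 := (largePenaltyRatio_pos (P₀ := P₀) hB0 hε hC).le
  have hg0 := l1On_nonneg Kᶜ γ
  obtain ⟨D, hD⟩ : ∃ D, D = largePenaltyL1Const B ε C₂ P₀ := ⟨_, rfl⟩
  obtain ⟨R, hR⟩ : ∃ R, R = largePenaltyRatio B ε C₂ P₀ := ⟨_, rfl⟩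
  obtain ⟨C, hC'⟩ : ∃ C, C = largePenaltyConst B ε C₂ P₀ := ⟨_, rfl⟩
  obtain ⟨α, hα⟩ : ∃ α, α = 1 + 2 / ε := ⟨_, rfl⟩
  have hCeq : C = D + 45 * (B * D) + 2 * ((1 + α) ^ 2 * C₂ * B ^ 2) + 800 * B ^ 2 +
      (P₀ + 33) * (R * B) + 1 := by rw [hC', hD, hR, hα]; rfl
  have hDeq : D = 32 * ((1 + α) ^ 2 * C₂) * B +
    16 * (((1 + α) * √(C₂ * P₀) + 1) * ((1 + ε) / ε)) +
    1600 * ((1 + ε) * (2 + ε) / ε) + 12800 * B + 64 * (1 + ε) := by rw [hD, hα]; rfl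
  rw [← hD] at hD0 ⊢
  rw [← hR] at hR0
  rw [← hC'] at hsmall ⊢
  rw [← hα] at hcompat
  have hα0 : 0 ≤ α := by rw [hα]; positivity
  have t1 : 0 ≤ B * D := by positivity
  have t2 : 0 ≤ (1 + α) ^ 2 * C₂ * B ^ 2 := by positivity
  have t3 : 0 ≤ B ^ 2 := by positivity
  have t4 : 0 ≤ (P₀ + 33) * (R * B) := by positivity
  have hsl : 0 ≤ s * l ^ 2 := by positivity
  have hZle : (1 + ε / (200 * (2 + ε))) * l₀ ≤ lam := by
    refine le_trans ?_ hlam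
    gcongr
    have := slack_le hε
    linarith
  have hl₀lam : l₀ ≤ lam := by nlinarith
  have hsm : ∀ G, 0 ≤ G → G * B ^ 2 ≤ C → G * s * lam ^ 2 ≤ 1 / 2 := by
    intro G hG hGC
    calc G * s * lam ^ 2 ≤ G * s * (B * l) ^ 2 := by gcongr
      _ = G * B ^ 2 * (s * l ^ 2) := by ring
      _ ≤ C * (s * l ^ 2) := by gcongr
      _ ≤ _ := hsmall
  have hsm1 := hsm (2 * ((1 + α) ^ 2 * C₂)) (by positivity) (by linarith)
  have hsm2 := hsm 800 (by positivity) (by linarith)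
  have hsl1 : 0 ≤ s * l := by positivity
  have u1 : 0 ≤ (1 + α) ^ 2 * C₂ * B * (s * l) := by positivity
  have u2 : 0 ≤ ((1 + α) * √(C₂ * P₀) + 1) * ((1 + ε) / ε) * (s * l) := by positivity
  have u3 : 0 ≤ (1 + ε) * (2 + ε) / ε * (s * l) := by positivity
  have u4 : 0 ≤ B * (s * l) := by positivity
  have u5 : 0 ≤ (1 + ε) * (s * l) := by positivity
  have hl1 : l1 h ≤ D * s * l := by
    have hexp : D * s * l = 32 * ((1 + α) ^ 2 * C₂ * B * (s * l)) +
      16 * (((1 + α) * √(C₂ * P₀) + 1) * ((1 + ε) / ε) * (s * l)) +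
      1600 * ((1 + ε) * (2 + ε) / ε * (s * l)) + 12800 * (B * (s * l)) +
      64 * ((1 + ε) * (s * l)) := by rw [hDeq]; ring
    rw [hexp]
    rcases hnoise with ⟨hp, hZ⟩ | ⟨hZ, hn⟩
    · have e1 := H.l1_le_of_card_le hZ hl₀ hC hε hα hcompat hs
        (P₀ := P₀) (le_trans (by exact_mod_cast (Finset.card_le_univ K).trans_eq (by simp)) hp) hlam
        (by linarith)
      have e2 : 16 * ((1 + α) ^ 2 * C₂ * s) * (lam + l₀) ≤
          16 * ((1 + α) ^ 2 * C₂ * s) * (B * l + B * l) := by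
        gcongr; linarith
      have e3 : 8 * (((1 + α) * √(C₂ * P₀) + 1) * ((1 + ε) / ε)) * l1On Kᶜ γ ≤
        8 * (((1 + α) * √(C₂ * P₀) + 1) * ((1 + ε) / ε)) * (2 * (s * l)) := by gcongr
      linarith
    · have hZ0 : 0 ≤ (1 + ε / (200 * (2 + ε))) * l₀ := by positivity
      by_cases hcone : h ∈ cone α K
      · have e1 := H.l1_le_of_mem_cone hZ hZ0 hα0 hC hcompat hs hcone (by
          have : 0 ≤ (1 + α) ^ 2 * C₂ * s * lam ^ 2 := by positivity
          linarith)
        have e2 : 8 * ((1 + α) ^ 2 * C₂ * s) * (lam + (1 + ε / (200 * (2 + ε))) * l₀) ≤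
          8 * ((1 + α) ^ 2 * C₂ * s) * (B * l + B * l) :=
          mul_le_mul_of_nonneg_left (by linarith) (by positivity)
        linarith
      · rcases hn with hn | hn
        · have e1 := H.l1_le_of_noise_on_le hε hα hZ hn hlam hcone
          have e2 : 800 * ((1 + ε) * (2 + ε) / ε) * l1On Kᶜ γ ≤
            800 * ((1 + ε) * (2 + ε) / ε) * (2 * (s * l)) := by gcongr
          linarith
        · have e1 := H.l1_le_of_greedy hε hα hZ hZ0 hs hlam hn hcone hsm2
          have e2 : 6400 * s * (lam + (1 + ε / (200 * (2 + ε))) * l₀) ≤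
            6400 * s * (B * l + B * l) :=
            mul_le_mul_of_nonneg_left (by linarith) (by positivity)
          have e3 : 32 * (1 + ε) * l1On Kᶜ γ ≤ 32 * (1 + ε) * (2 * (s * l)) := by gcongr
          linarith
  have hZ' : ∀ j, |inner ℝ (a j) r| ≤ 1 * lam := fun j => by
    rw [one_mul]
    exact (hnoise.abs_inner_le hε hl₀.le j).trans hZle
  obtain ⟨f1, f2, f3⟩ := H.errLe_of_l1_le hZ' zero_le_one hB0 hB hD0 hs0 hl hl1
    (C := C) (by linarith) (by linarith) (by linarith)
  refine ⟨hl1, f1, by linarith, ?_⟩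
  calc 9 * ‖lin a h‖ ^ 2 ≤ 9 * ((3 + 2 * 1) * (B * D) * (s * l ^ 2)) := by gcongr
    _ = 45 * (B * D) * (s * l ^ 2) := by ring
    _ ≤ C * (s * l ^ 2) := by gcongr; linarith

/-- The total excess is not available here. Instead, an empty selection is trivial, and a nonempty
one forces the penalty level to be at most a constant times the `ℓ₁` rate. The size constraint then
forces `m ≥ P₀ + 33`, which exceeds `p` if `p ≤ P₀` and is more than twice `16` otherwise. -/
lemma card_supp_of_largePenaltyNoise {B C₂ C₃ s l ε ε₂ ε₃ l₀ P₀ : ℝ} {m : ℕ} {K : Finset (Fin p)}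
    (hB0 : 0 ≤ B) (hC : 0 ≤ C₂) (hP0 : 0 ≤ P₀) (hs : 0 ≤ s) (hε : 0 < ε) (h2 : 0 ≤ ε₂)
    (h23 : ε₂ < ε₃) (h3ε : ε₃ < ε) (hm : 1 ≤ m) (hl₀ : 0 < l₀) (hl : 0 < l)
    (hlam : (1 + ε) * l₀ ≤ lam) (hB : lam ≤ B * l) (hC₃ : 1 ≤ C₃)
    (hnoise : LargePenaltyNoise a r h K ε l₀ P₀)
    (halt : (p : ℝ) ≤ P₀ ∨ SparseBound a m C₃ ∧
      (Finset.univ.filter fun j => l₀ < |inner ℝ (a j) r|).card < 16)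
    (hl1 : l1 h ≤ largePenaltyL1Const B ε C₂ P₀ * s * l)
    (herr : ErrLe a h ‖r - lin a h‖ (largePenaltyConst B ε C₂ P₀) s l)
    (hN1 : ‖lin a h‖ ^ 2 ≤ 5 * largePenaltyL1Const B ε C₂ P₀ * (s * lam * l))
    (hN2 : 9 * ‖lin a h‖ ^ 2 ≤ largePenaltyConst B ε C₂ P₀ * (s * l ^ 2))
    (hsmall : largePenaltyConst B ε C₂ P₀ * (s * l ^ 2) ≤ (ε - ε₃) / (1 + ε))
    (hsize : C₃ * (largePenaltyConst B ε C₂ P₀ * (s * l ^ 2)) ≤ m * (ε₃ - ε₂) ^ 2 * l₀ ^ 2) :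
    (supp (γ + h)).card < m ∧
    ((supp (γ + h)).card : ℝ) * lam ≤ largePenaltySizeConst B ε C₂ P₀ C₃ ε₂ ε₃ * (s * l) := by
  have hd : 0 < ε₃ - ε₂ := by linarith
  have hlam0 := H.lam_pos
  have hD0 := (largePenaltyL1Const_pos (P₀ := P₀) hB0 hε hC).le
  have hR0 := (largePenaltyRatio_pos (P₀ := P₀) hB0 hε hC).le
  obtain ⟨R, hR⟩ : ∃ R, R = largePenaltyRatio B ε C₂ P₀ := ⟨_, rfl⟩
  obtain ⟨C, hC'⟩ : ∃ C, C = largePenaltyConst B ε C₂ P₀ := ⟨_, rfl⟩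
  rw [largePenaltySizeConst, ← hR]
  rw [← hR] at hR0
  have hQ0 : 0 ≤ C₃ * (5 * largePenaltyL1Const B ε C₂ P₀) / ((ε₃ - ε₂) / (2 * (1 + ε))) ^ 2 := by
    positivity
  have hsl : 0 ≤ s * l := by positivity
  rcases (supp (γ + h)).eq_empty_or_nonempty with hemp | ⟨j, hj⟩
  · rw [hemp]
    simp only [Finset.card_empty, CharP.cast_eq_zero, zero_mul]
    exact ⟨hm, by positivity⟩
  have hσ : (1 + ε₃) / (1 + ε) ≤ ‖r - lin a h‖ := by
    have e1 := (abs_le.1 (herr.2.2.trans hsmall)).1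
    have e2 : (1 + ε₃) / (1 + ε) = 1 - (ε - ε₃) / (1 + ε) := by
      have : 1 + ε ≠ 0 := by linarith
      field_simp; ring
    linarith
  have hσ0 : 0 < ‖r - lin a h‖ := lt_of_lt_of_le (div_pos (by linarith) (by linarith)) hσ
  -- The noise stays below `lam` by a fraction of order `ε / (1 + ε)`, so the gap `lam - Z ≤ 2 ‖h‖₁`
  -- bounds `lam` itself.
  have hlamR : lam ≤ R * (s * l) := by
    have e1 := H.lam_le_of_mem_supp hσ0 hj (hnoise.abs_inner_le hε hl₀.le)
    have e2 := slack_le hε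
    have e3 : ε / 2 * lam ≤ (1 + ε) * (lam - (1 + ε / (200 * (2 + ε))) * l₀) := by
      have k1 : (1 + ε / (200 * (2 + ε))) * ((1 + ε) * l₀) ≤
        (1 + ε / 400) * lam := by gcongr
      have k2 : 0 ≤ ε * lam := by positivity
      linarith
    have e4 : ε / 2 * lam ≤ (1 + ε) * (2 * (largePenaltyL1Const B ε C₂ P₀ * s * l)) := by
      refine e3.trans ?_
      gcongr
      linarith
    rw [hR, largePenaltyRatio, div_mul_eq_mul_div, div_mul_eq_mul_div, le_div_iff₀ hε]
    linarith
  have hmlarge : P₀ + 33 ≤ m := by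
    have e1 : (P₀ + 33) * (R * B) ≤ C := by
      have : 0 ≤ (1 + (1 + 2 / ε)) ^ 2 * C₂ * B ^ 2 := by positivity
      have : 0 ≤ B * largePenaltyL1Const B ε C₂ P₀ := by positivity
      rw [hC', largePenaltyConst, ← hR]
      have : 0 ≤ B ^ 2 := by positivity
      linarith
    have hC0 : 0 ≤ C := le_trans (by positivity) e1
    rw [← hC'] at hsize
    have e2 : C * (s * l ^ 2) ≤ C₃ * (C * (s * l ^ 2)) := le_mul_of_one_le_left (by positivity) hC₃
    have e3 : (m : ℝ) * (ε₃ - ε₂) ^ 2 * l₀ ^ 2 ≤ m * (R * (s * l) * (B * l)) := by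
      calc (m : ℝ) * (ε₃ - ε₂) ^ 2 * l₀ ^ 2 ≤ m * (1 + ε) ^ 2 * l₀ ^ 2 := by
            gcongr; linarith
        _ = m * (((1 + ε) * l₀) * ((1 + ε) * l₀)) := by ring
        _ ≤ m * (lam * lam) := by gcongr
        _ ≤ m * (R * (s * l) * (B * l)) := by gcongr
    have hpos : 0 < R * (s * l) * (B * l) :=
      mul_pos (hlam0.trans_le hlamR) (hlam0.trans_le hB)
    have e4 : (P₀ + 33) * (R * (s * l) * (B * l)) ≤ m * (R * (s * l) * (B * l)) := by
      calc (P₀ + 33) * (R * (s * l) * (B * l)) = (P₀ + 33) * (R * B) * (s * l ^ 2) := by ring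
        _ ≤ C * (s * l ^ 2) := by gcongr
        _ ≤ _ := e2.trans (hsize.trans e3)
    exact le_of_mul_le_mul_right e4 hpos
  rcases halt with hp | ⟨hS, hcount⟩
  · have hcard : ((supp (γ + h)).card : ℝ) ≤ P₀ :=
      le_trans (by exact_mod_cast (Finset.card_le_univ _).trans_eq (by simp)) hp
    refine ⟨?_, ?_⟩
    · have : ((supp (γ + h)).card : ℝ) < m := by linarith
      exact_mod_cast this
    · calc ((supp (γ + h)).card : ℝ) * lam ≤ P₀ * (R * (s * l)) := by gcongr
        _ = 0 + P₀ * R * (s * l) := by ring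
        _ ≤ _ := by
          rw [add_mul]
          have : 0 ≤ 16 * R * (s * l) := by positivity
          have := mul_nonneg hQ0 hsl
          linarith
  · obtain ⟨x, hx⟩ : ∃ x, x = (1 + (ε₂ + ε₃) / 2) * l₀ := ⟨_, rfl⟩
    have hbad : ((Finset.univ.filter fun j => x < |inner ℝ (a j) r|).card : ℝ) ≤ 16 := by
      have e1 : l₀ ≤ x := by rw [hx]; exact le_mul_of_one_le_left hl₀.le (by linarith)
      have e2 : (Finset.univ.filter fun j => x < |inner ℝ (a j) r|).card ≤ 16 := by
        refine (Finset.card_le_card fun j hj => ?_).trans hcount.le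
        rw [Finset.mem_filter] at hj ⊢
        exact ⟨hj.1, e1.trans_lt hj.2⟩
      exact_mod_cast e2
    have hlt := H.card_supp_lt hm (by linarith) hS hl₀ (by linarith) h23 hlam hx hσ
      (by linarith) hN2 hsize
    refine ⟨hlt, H.card_supp_mul_le (by linarith) hS hlt.le (by linarith) h23 (by linarith) hlam
      hx hσ ?_ hN1⟩
    calc _ ≤ 16 * (R * (s * l)) := by gcongr
      _ ≤ (P₀ + 16) * R * (s * l) := by
        have : 0 ≤ P₀ * R * (s * l) := by positivity
        linarith

end SqrtLasso
end
end ScaledLasso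
end

/-! ### Noise events in the linear model -/

noncomputable section
namespace ScaledLasso

section holds
variable {Ω : Type*} [MeasurableSpace Ω] {μ : Measure Ω}

/-- Subadditivity holds for arbitrary sets, so no measurability is asked of the events; the
estimators in them need not be measurable. -/
lemma HoldsWP.and {A B : Ω → Prop} {x y : ℝ} (hA : HoldsWP μ A x) (hB : HoldsWP μ B y)
    (hx : 0 ≤ x) (hy : 0 ≤ y) : HoldsWP μ (fun ω => A ω ∧ B ω) (x + y) := by
  unfold HoldsWP at *
  rw [ENNReal.ofReal_add hx hy]
  refine (measure_mono fun ω hω => ?_).trans ((measure_union_le _ _).trans (add_le_add hA hB))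
  rw [Set.mem_union, Set.mem_ofPred_eq, Set.mem_ofPred_eq]
  rw [Set.mem_ofPred_eq] at hω
  tauto

lemma HoldsWP.mono {A B : Ω → Prop} {x y : ℝ} (hA : HoldsWP μ A x) (hAB : ∀ ω, A ω → B ω)
    (hxy : x ≤ y) : HoldsWP μ B y :=
  (measure_mono (Set.compl_subset_compl.2 hAB)).trans (hA.trans (ENNReal.ofReal_le_ofReal hxy))

lemma holdsWP_of_ae {A : Ω → Prop} (h : ∀ᵐ ω ∂μ, A ω) (x : ℝ) : HoldsWP μ A x := by
  have : μ {ω | ¬ A ω} = 0 := h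
  rw [HoldsWP, this]
  exact zero_le

lemma holdsWP_of_one_le [IsProbabilityMeasure μ] (A : Ω → Prop) {x : ℝ} (hx : 1 ≤ x) :
    HoldsWP μ A x :=
  prob_le_one.trans (by rw [← ENNReal.ofReal_one]; exact ENNReal.ofReal_le_ofReal hx)

lemma HoldsWP.exists [IsProbabilityMeasure μ] {A : Ω → Prop} {x : ℝ} (hA : HoldsWP μ A x)
    (hx : x < 1) : ∃ ω, A ω := by
  by_contra hcon
  push Not at hcon
  have : {ω | ¬ A ω} = Set.univ := Set.eq_univ_of_forall hcon
  rw [HoldsWP, this, measure_univ, ENNReal.one_le_ofReal] at hA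
  linarith

end holds

section noise
variable {n p : ℕ} {Ω : Type*} [MeasurableSpace Ω] {μ : Measure Ω} [IsProbabilityMeasure μ]
  {d : Data Ω n p} {σ lam : ℝ}

/-- The noise vector `Y - X γ`. -/
def Data.noise (d : Data Ω n p) (ω : Ω) : EuclideanSpace ℝ (Fin n) :=
  WithLp.toLp 2 (d.Y ω - (d.X ω).mulVec (d.γ ω))

lemma continuous_inner_colE (j : Fin p) :
    Continuous fun q : Matrix (Fin n) (Fin p) ℝ × EuclideanSpace ℝ (Fin n) =>
      inner ℝ (colE q.1 j) q.2 :=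
  ((continuous_colE j).comp continuous_fst).inner continuous_snd

lemma continuous_lin_colE (c : Fin p → ℝ) :
    Continuous fun X : Matrix (Fin n) (Fin p) ℝ => lin (colE X) c := by
  unfold lin
  exact continuous_finsetSum _ fun j _ => (continuous_const_smul (c j)).comp (continuous_colE j)

lemma IsModel.ae_norm_colE (hm : IsModel μ d σ lam) (hn : 0 < n) :
    ∀ᵐ ω ∂μ, ∀ j, ‖colE (d.X ω) j‖ = 1 := by
  filter_upwards [hm.standardized] with ω h j
  exact norm_colE_eq_one hn (h j)

lemma measurableSet_norm_colE :
    MeasurableSet {X : Matrix (Fin n) (Fin p) ℝ | ∀ j, ‖colE X j‖ = 1} := by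
  refine IsClosed.measurableSet ?_
  rw [Set.ofPred_forall]
  exact isClosed_iInter fun j => isClosed_eq (continuous_colE j).norm continuous_const

lemma measurableSet_sparseBound (m : ℕ) (C : ℝ) :
    MeasurableSet {X : Matrix (Fin n) (Fin p) ℝ | SparseBound (colE X) m C} := by
  refine IsClosed.measurableSet ?_
  unfold SparseBound
  simp only [Set.ofPred_forall]
  refine isClosed_iInter fun v => isClosed_iInter fun T => isClosed_iInter fun _ => ?_
  refine isClosed_le (continuous_finsetSum _ fun j _ => ?_) continuous_const
  exact ((continuous_colE j).inner continuous_const).pow 2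

/-- Transfer of a noise event from fixed standardised designs to the model. -/
lemma IsModel.holdsWP_noise (hm : IsModel μ d σ lam) (hn : 0 < n)
    {D : Matrix (Fin n) (Fin p) ℝ → Prop} (hD : MeasurableSet {X | D X})
    {Bad : Matrix (Fin n) (Fin p) ℝ → EuclideanSpace ℝ (Fin n) → Prop}
    (hBad : MeasurableSet {q : Matrix (Fin n) (Fin p) ℝ × EuclideanSpace ℝ (Fin n) | Bad q.1 q.2})
    (hscale : ∀ X w (r : ℝ), 0 < r → Bad X (r • w) → Bad X w) {η : ℝ}
    (h : ∀ X, (∀ j, ‖colE X j‖ = 1) → D X →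
      stdGaussian (EuclideanSpace ℝ (Fin n)) {g | Bad X g} ≤ ENNReal.ofReal η) :
    HoldsWP μ (fun ω => D (d.X ω) → ¬ Bad (d.X ω) (d.noise ω)) η := by
  have h1 := hm.measure_noise_le hBad (measurableSet_norm_colE.inter hD) hscale
    (η := ENNReal.ofReal η) (fun X hX => h X hX.1 hX.2)
  unfold HoldsWP
  refine le_trans (measure_mono_ae ?_) h1
  filter_upwards [hm.ae_norm_colE hn] with ω hω hbad
  change ¬ (D (d.X ω) → ¬ Bad (d.X ω) (d.noise ω)) at hbad
  rw [Classical.not_imp, not_not] at hbad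
  exact ⟨⟨hω, hbad.1⟩, hbad.2⟩

lemma IsModel.ae_noise_ne_zero (hm : IsModel μ d σ lam) (hn : 0 < n) :
    ∀ᵐ ω ∂μ, d.noise ω ≠ 0 := by
  have : Nonempty (Fin n) := ⟨⟨0, hn⟩⟩
  have h1 := hm.holdsWP_noise hn (D := fun _ => True) (Bad := fun _ w => w = 0) (η := 0)
    (by simp) (measurableSet_eq_fun measurable_snd measurable_const)
    (fun X w r hr h => (smul_eq_zero.1 h).resolve_left hr.ne') (fun X _ _ => by
      have : {g : EuclideanSpace ℝ (Fin n) | g = 0} = {0} := rfl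
      rw [this, stdGaussian_eq_withDensity]
      refine le_of_eq_of_le ?_ zero_le
      rw [withDensity_apply _ (measurableSet_singleton _)]
      simp)
  have h2 : μ {ω | ¬ (True → ¬ d.noise ω = 0)} = 0 := by
    simpa [HoldsWP] using h1
  have h3 : ∀ᵐ ω ∂μ, True → ¬ d.noise ω = 0 := h2
  filter_upwards [h3] with ω h using h trivial

lemma IsModel.holdsWP_sup (hm : IsModel μ d σ lam) (hn : 2 ≤ n) (T : Finset (Fin p)) {x : ℝ}
    (hx : 0 ≤ x) :
    HoldsWP μ (fun ω => ∀ j ∈ T,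
      |√(n - 3 / 2 : ℝ) * inner ℝ (colE (d.X ω) j) (d.noise ω)| ≤ x * ‖d.noise ω‖)
      (2 * T.card * gtail x) := by
  refine (hm.holdsWP_noise (by omega) (D := fun _ => True)
    (Bad := fun X w => ∃ j ∈ T, x * ‖w‖ < |√(n - 3 / 2 : ℝ) * inner ℝ (colE X j) w|)
    (by simp) ?_ ?_ (fun X hX _ => measure_sphere_sup_le hn hX T hx)).mono ?_ le_rfl
  · have : {q : Matrix (Fin n) (Fin p) ℝ × EuclideanSpace ℝ (Fin n) |
        ∃ j ∈ T, x * ‖q.2‖ < |√(n - 3 / 2 : ℝ) * inner ℝ (colE q.1 j) q.2|} =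
        ⋃ j ∈ T, {q | x * ‖q.2‖ < |√(n - 3 / 2 : ℝ) * inner ℝ (colE q.1 j) q.2|} := by
      ext q; simp
    rw [this]
    refine Finset.measurableSet_biUnion _ fun j _ => (isOpen_lt (by fun_prop) ?_).measurableSet
    exact (continuous_const.mul (continuous_inner_colE j)).abs
  · rintro X w r hr ⟨j, hj, h⟩
    refine ⟨j, hj, ?_⟩
    rw [norm_smul, real_inner_smul_right, Real.norm_of_nonneg hr.le, mul_left_comm,
      mul_left_comm _ r, abs_mul, abs_of_pos hr] at h
    exact lt_of_mul_lt_mul_left h hr.le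
  · intro ω h j hj
    by_contra hcon
    exact h trivial ⟨j, hj, not_le.1 hcon⟩

lemma excess_mul {c : ℝ} (hc : 0 ≤ c) (a x : ℝ) : excess (c * a) (c * x) = c * excess a x := by
  unfold excess
  rw [abs_mul, abs_of_nonneg hc, ← mul_sub, mul_max_of_nonneg _ _ hc, mul_zero]

lemma IsModel.holdsWP_sumExcess (hm : IsModel μ d σ lam) (hn : 2 ≤ n)
    {D : Matrix (Fin n) (Fin p) ℝ → Prop} (hD : MeasurableSet {X | D X}) {a w η : ℝ}
    (h : ∀ X, (∀ j, ‖colE X j‖ = 1) → D X →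
      (stdGaussian (EuclideanSpace ℝ (Fin n))).real {g | w < sumExcess (colE X) a g} ≤ η) :
    HoldsWP μ (fun ω => D (d.X ω) → ∑ j, excess (a * ‖d.noise ω‖)
        (√(n - 3 / 2 : ℝ) * inner ℝ (colE (d.X ω) j) (d.noise ω)) ≤ w * ‖d.noise ω‖)
      (2 * η) := by
  have : Nonempty (Fin n) := ⟨⟨0, by omega⟩⟩
  refine (hm.holdsWP_noise (by omega) (D := D)
    (Bad := fun X v => w * ‖v‖ < ∑ j, excess (a * ‖v‖) (√(n - 3 / 2 : ℝ) * inner ℝ (colE X j) v))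
    hD ?_ ?_ (fun X hX hDX => measure_sphere_sumExcess_le ?_ (h X hX hDX))).mono ?_ le_rfl
  · refine (isOpen_lt (by fun_prop) (continuous_finsetSum _ fun j _ => ?_)).measurableSet
    unfold excess
    have := continuous_inner_colE (n := n) j
    fun_prop
  · intro X v r hr h
    rw [norm_smul, Real.norm_of_nonneg hr.le, mul_left_comm] at h
    have : ∀ j, excess (a * (r * ‖v‖)) (√(n - 3 / 2 : ℝ) * inner ℝ (colE X j) (r • v)) =
        r * excess (a * ‖v‖) (√(n - 3 / 2 : ℝ) * inner ℝ (colE X j) v) := by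
      intro j
      rw [real_inner_smul_right, ← excess_mul hr.le]
      congr 1 <;> ring
    simp_rw [this, ← Finset.mul_sum] at h
    exact lt_of_mul_lt_mul_left h hr.le
  · rw [finrank_euclideanSpace_fin]; linarith
  · exact fun ω h hDω => not_lt.1 (h hDω)

lemma IsModel.holdsWP_card (hm : IsModel μ d σ lam) (hn : 2 ≤ n) {x : ℝ} (hx : 0 ≤ x) {N : ℕ}
    (hN : 0 < N) :
    HoldsWP μ (fun ω => (Finset.univ.filter fun j => x * ‖d.noise ω‖ <
      |√(n - 3 / 2 : ℝ) * inner ℝ (colE (d.X ω) j) (d.noise ω)|).card < N)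
      (2 * p * gtail x / N) := by
  classical
  refine (hm.holdsWP_noise (by omega) (D := fun _ => True)
    (Bad := fun X w => N ≤ (Finset.univ.filter fun j => x * ‖w‖ <
      |√(n - 3 / 2 : ℝ) * inner ℝ (colE X j) w|).card)
    (by simp) ?_ ?_ (fun X hX _ => ?_)).mono ?_ le_rfl
  · have : {q : Matrix (Fin n) (Fin p) ℝ × EuclideanSpace ℝ (Fin n) |
        N ≤ (Finset.univ.filter fun j => x * ‖q.2‖ <
          |√(n - 3 / 2 : ℝ) * inner ℝ (colE q.1 j) q.2|).card} =
        ⋃ T ∈ Finset.univ.filter (fun T : Finset (Fin p) => N ≤ T.card), ⋂ j ∈ T,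
          {q | x * ‖q.2‖ < |√(n - 3 / 2 : ℝ) * inner ℝ (colE q.1 j) q.2|} := by
      ext q
      simp only [Set.mem_ofPred_eq, Set.mem_iUnion, Set.mem_iInter, Finset.mem_filter,
        Finset.mem_univ, true_and, exists_prop]
      constructor
      · intro h
        exact ⟨_, h, fun j hj => (Finset.mem_filter.1 hj).2⟩
      · rintro ⟨T, hT, h⟩
        exact hT.trans (Finset.card_le_card fun j hj => by simpa using h j hj)
    rw [this]
    refine Finset.measurableSet_biUnion _ fun T _ => Finset.measurableSet_biInter _ fun j _ =>
      (isOpen_lt (by fun_prop) ?_).measurableSet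
    exact (continuous_const.mul (continuous_inner_colE j)).abs
  · intro X w r hr h
    refine h.trans (Finset.card_le_card fun j hj => ?_)
    rw [Finset.mem_filter] at hj ⊢
    refine ⟨hj.1, ?_⟩
    have h := hj.2
    rw [norm_smul, real_inner_smul_right, Real.norm_of_nonneg hr.le, mul_left_comm,
      mul_left_comm _ r, abs_mul, abs_of_pos hr] at h
    exact lt_of_mul_lt_mul_left h hr.le
  · convert measure_sphere_card_le hn hX hx N hN
  · intro ω h
    have := not_le.1 (h trivial)
    convert this

lemma IsModel.holdsWP_int_comb (hm : IsModel μ d σ lam) (hn : 2 ≤ n) {θ x : ℝ} (hθ0 : 0 < θ)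
    (hθ : θ ≤ 1 / 2) (hx : 0 ≤ x) (N : ℕ) :
    HoldsWP μ (fun ω => ∀ c : Fin p → ℤ, ∑ j, (c j).natAbs ≤ N →
      √(n - 3 / 2 : ℝ) * inner ℝ (lin (colE (d.X ω)) fun j => (c j : ℝ)) (d.noise ω) ≤
        x * ‖lin (colE (d.X ω)) fun j => (c j : ℝ)‖ * ‖d.noise ω‖)
      (gtail x * (θ ^ N)⁻¹ * Real.exp (4 * θ * p)) := by
  refine (hm.holdsWP_noise (by omega) (D := fun _ => True)
    (Bad := fun X w => ∃ c : Fin p → ℤ, ∑ j, (c j).natAbs ≤ N ∧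
      x * ‖lin (colE X) fun j => (c j : ℝ)‖ * ‖w‖ <
        √(n - 3 / 2 : ℝ) * inner ℝ (lin (colE X) fun j => (c j : ℝ)) w)
    (by simp) ?_ ?_ (fun X _ _ => measure_sphere_int_comb_le hn _ hθ0 hθ hx N)).mono ?_ le_rfl
  · simp only [Set.ofPred_exists]
    refine MeasurableSet.iUnion fun c => ?_
    refine MeasurableSet.inter (MeasurableSet.const _)
      (s₂ := {q : Matrix (Fin n) (Fin p) ℝ × EuclideanSpace ℝ (Fin n) |
        x * ‖lin (colE q.1) fun j => (c j : ℝ)‖ * ‖q.2‖ <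
          √(n - 3 / 2 : ℝ) * inner ℝ (lin (colE q.1) fun j => (c j : ℝ)) q.2})
      (isOpen_lt ?_ ?_).measurableSet
    · exact (continuous_const.mul ((continuous_lin_colE _).comp continuous_fst).norm).mul
        continuous_snd.norm
    · exact continuous_const.mul (((continuous_lin_colE _).comp continuous_fst).inner
        continuous_snd)
  · rintro X w r hr ⟨c, hc, h⟩
    refine ⟨c, hc, ?_⟩
    rw [norm_smul, real_inner_smul_right, Real.norm_of_nonneg hr.le, mul_left_comm,
      mul_left_comm _ r] at h
    exact lt_of_mul_lt_mul_left h hr.le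
  · intro ω h c hc
    by_contra hcon
    exact h trivial ⟨c, hc, not_le.1 hcon⟩

end noise

end ScaledLasso
end

/-! ### Probabilities of the noise events, sparse eigenvalues, normalisation -/

noncomputable section
namespace ScaledLasso

section noise
variable {n p : ℕ} {Ω : Type*} [MeasurableSpace Ω] {μ : Measure Ω} [IsProbabilityMeasure μ]
  {d : Data Ω n p} {σ lam : ℝ}

/-- The noise event for the smaller penalty levels. -/
lemma IsModel.holdsWP_small_penalty (hm : IsModel μ d σ lam) (hn : 2 ≤ n) (hp : 3 ≤ p) {m : ℕ}
    (hm1 : 1 ≤ m) {C : ℝ} (hC0 : 0 < C) {k e t t₁ A₀ θ : ℝ} (he0 : 0 < e) (he : e < 1 / 6)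
    (ht : 0 < t) (hgt : gtail t = k / p) (hgt₁ : gtail t₁ = e / p)
    (hA₀ : A₀ = 4 * (k / m) / (t ^ 4 + 2 * t ^ 2))
    (hθ : A₀ + (t₁ + (√(2 * Real.pi))⁻¹) / t * √(C / m) ≤ θ) :
    HoldsWP μ (fun ω => SparseBound (colE (d.X ω)) m C →
      (∀ j, |√(n - 3 / 2 : ℝ) * inner ℝ (colE (d.X ω) j) (d.noise ω)| ≤
        6 / 5 * t₁ * ‖d.noise ω‖) ∧
      ∑ j, excess ((1 + θ) * t * ‖d.noise ω‖)
        (√(n - 3 / 2 : ℝ) * inner ℝ (colE (d.X ω) j) (d.noise ω)) ≤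
        (13 / 5 + 2 * A₀ + θ / 4) * m * t * ‖d.noise ω‖) (3 * e) := by
  have : Nonempty (Fin n) := ⟨⟨0, by omega⟩⟩
  have hp' : (3 : ℝ) ≤ p := by exact_mod_cast hp
  have ht₁ : 13 / 10 < t₁ := lt_of_gtail_le hgt₁.le (by
    rw [div_lt_iff₀ (by linarith)]; linarith)
  have h1 := hm.holdsWP_sup hn Finset.univ (x := 6 / 5 * t₁) (by linarith)
  have h2 := hm.holdsWP_sumExcess hn (measurableSet_sparseBound m C)
    (a := (1 + θ) * t) (fun X hX hS => measureReal_sumExcess_gt_le hp hm1 hX hC0 hS he0 he ht hgt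
      hgt₁ hA₀ hθ)
  -- The level `6/5 * t₁` instead of `t₁` lowers the union bound from `2 e` to `5/3 * e`. Together
  -- with twice `2/3 * e` for the total excess this makes `3 e`.
  have h3 : 2 * ((Finset.univ : Finset (Fin p)).card : ℝ) * gtail (6 / 5 * t₁) ≤ 5 / 3 * e := by
    have k1 := gtail_add_le t₁ (t₁ / 5) (by linarith)
    have k2 : Real.exp (-(t₁ * (t₁ / 5)) - (t₁ / 5) ^ 2 / 2) ≤ 5 / 6 := by
      have k3 : 1 / 5 ≤ t₁ * (t₁ / 5) + (t₁ / 5) ^ 2 / 2 := by nlinarith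
      have k4 := Real.add_one_le_exp (t₁ * (t₁ / 5) + (t₁ / 5) ^ 2 / 2)
      rw [show -(t₁ * (t₁ / 5)) - (t₁ / 5) ^ 2 / 2 = -(t₁ * (t₁ / 5) + (t₁ / 5) ^ 2 / 2) by ring,
        Real.exp_neg]
      calc _ ≤ (6 / 5 : ℝ)⁻¹ := by gcongr; linarith
        _ = 5 / 6 := by norm_num
    rw [show t₁ + t₁ / 5 = 6 / 5 * t₁ by ring] at k1
    have k5 : gtail (6 / 5 * t₁) ≤ 5 / 6 * (e / p) := by
      rw [hgt₁] at k1
      refine k1.trans ?_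
      gcongr
    rw [Finset.card_univ, Fintype.card_fin]
    calc 2 * (p : ℝ) * gtail (6 / 5 * t₁) ≤ 2 * (p : ℝ) * (5 / 6 * (e / p)) := by gcongr
      _ = 5 / 3 * e := by field_simp; ring
  have h4 := h1.and h2 (mul_nonneg (by positivity) (gtail_nonneg _)) (by positivity)
  exact h4.mono (fun ω h hS => ⟨fun j => h.1 j (Finset.mem_univ j), h.2 hS⟩) (by linarith)

/-- The noise event for the larger penalty level and a small normal quantile. -/
lemma IsModel.holdsWP_large_penalty (hm : IsModel μ d σ lam) (hn : 2 ≤ n) (hp : 0 < p)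
    {k t : ℝ} (ht : 0 < t) (hgt : gtail t = k / p) :
    HoldsWP μ (fun ω => ∀ j, |√(n - 3 / 2 : ℝ) * inner ℝ (colE (d.X ω) j) (d.noise ω)| ≤
      t * ‖d.noise ω‖) (2 * k) := by
  have hp' : (0 : ℝ) < p := by exact_mod_cast hp
  refine (hm.holdsWP_sup hn Finset.univ ht.le).mono (fun ω h j => h j (Finset.mem_univ j)) ?_
  rw [Finset.card_univ, Fintype.card_fin, hgt]
  exact le_of_eq (by field_simp)

/-- The noise event for the larger penalty level and a large normal quantile. -/
lemma IsModel.holdsWP_large_penalty_large (hm : IsModel μ d σ lam) (hn : 2 ≤ n) (hp : 0 < p)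
    {k e t η : ℝ} (hk : 0 < k) (hke : k ≤ e) (ht : 15 ≤ t) (hgt : gtail t = k / p) (hη : 0 ≤ η)
    (hexp : Real.exp (-(η * t ^ 2)) ≤ 1 / 16) (K : Finset (Fin p)) :
    HoldsWP μ (fun ω =>
      (∀ j, |√(n - 3 / 2 : ℝ) * inner ℝ (colE (d.X ω) j) (d.noise ω)| ≤
        (1 + η) * t * ‖d.noise ω‖) ∧
      (Finset.univ.filter fun j => t * ‖d.noise ω‖ <
        |√(n - 3 / 2 : ℝ) * inner ℝ (colE (d.X ω) j) (d.noise ω)|).card < 16 ∧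
      ((∀ j ∈ K, |√(n - 3 / 2 : ℝ) * inner ℝ (colE (d.X ω) j) (d.noise ω)| ≤
        99 / 100 * t * ‖d.noise ω‖) ∨
      (0 < K.card ∧ ∀ c : Fin p → ℤ, ∑ j, (c j).natAbs ≤ 80 * K.card →
        √(n - 3 / 2 : ℝ) * inner ℝ (lin (colE (d.X ω)) fun j => (c j : ℝ)) (d.noise ω) ≤
          √((80 * K.card : ℕ) : ℝ) * (t / 2) * ‖lin (colE (d.X ω)) fun j => (c j : ℝ)‖ *
            ‖d.noise ω‖))) e := by
  have hp' : (0 : ℝ) < p := by exact_mod_cast hp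
  have ht0 : 0 < t := by linarith
  have h1 : HoldsWP μ (fun ω =>
      ∀ j, |√(n - 3 / 2 : ℝ) * inner ℝ (colE (d.X ω) j) (d.noise ω)| ≤
        (1 + η) * t * ‖d.noise ω‖) (e / 8) := by
    refine (hm.holdsWP_sup hn Finset.univ (x := (1 + η) * t) (by positivity)).mono
      (fun ω h j => h j (Finset.mem_univ j)) ?_
    rw [Finset.card_univ, Fintype.card_fin]
    exact mul_gtail_one_add_le hp hke hk ht0 hgt hη hexp
  have h2 := hm.holdsWP_card hn ht0.le (N := 16) (by norm_num)
  have h2' : 2 * (p : ℝ) * gtail t / (16 : ℕ) ≤ e / 8 := by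
    rw [hgt]
    have : 2 * (p : ℝ) * (k / p) = 2 * k := by field_simp
    rw [this]; push_cast; linarith
  have h2 := h2.mono (fun _ h => h) h2'
  have he : 0 < e := hk.trans_le hke
  have h3 : HoldsWP μ (fun ω =>
      (∀ j ∈ K, |√(n - 3 / 2 : ℝ) * inner ℝ (colE (d.X ω) j) (d.noise ω)| ≤
        99 / 100 * t * ‖d.noise ω‖) ∨
      (0 < K.card ∧ ∀ c : Fin p → ℤ, ∑ j, (c j).natAbs ≤ 80 * K.card →
        √(n - 3 / 2 : ℝ) * inner ℝ (lin (colE (d.X ω)) fun j => (c j : ℝ)) (d.noise ω) ≤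
          √((80 * K.card : ℕ) : ℝ) * (t / 2) * ‖lin (colE (d.X ω)) fun j => (c j : ℝ)‖ *
            ‖d.noise ω‖)) (e / 8) := by
    -- `K` is deterministic, so its size decides between the union bound over `K` and the one over
    -- integer combinations.
    rcases le_or_gt (K.card : ℝ) (p * Real.exp (-(t ^ 2 / 10))) with hK | hK
    · exact (hm.holdsWP_sup hn K (x := 99 / 100 * t) (by positivity)).mono
        (fun ω h => Or.inl h) (card_mul_gtail_le hp ht hke hgt hK)
    · have hK0 : 0 < K.card := by
        have : (0 : ℝ) < K.card := lt_of_le_of_lt (by positivity) hK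
        exact_mod_cast this
      have hθ : Real.exp (-(t ^ 2 / 10)) ≤ 1 / 2 := by
        rw [Real.exp_neg, one_div]
        have := Real.add_one_le_exp (t ^ 2 / 10)
        gcongr
        nlinarith
      exact (hm.holdsWP_int_comb hn (Real.exp_pos _) hθ
        (x := √((80 * K.card : ℕ) : ℝ) * (t / 2))
        (mul_nonneg (Real.sqrt_nonneg _) (by linarith)) (80 * K.card)).mono
        (fun ω h => Or.inr ⟨hK0, h⟩) (int_comb_bound_le hp ht hke hgt hK)
  exact (h1.and (h2.and h3 (by positivity) (by positivity)) (by positivity) (by positivity)).mono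
    (fun _ h => h) (by linarith)

end noise

section sparse
variable {n p : ℕ} {X : Matrix (Fin n) (Fin p) ℝ}

lemma SparseBound.mono {E : Type*} [NormedAddCommGroup E] [InnerProductSpace ℝ E] {a : Fin p → E}
    {m m' : ℕ} {C : ℝ} (h : SparseBound a m' C) (hm : m ≤ m') : SparseBound a m C :=
  fun v T hT => h v T (hT.trans hm)

lemma SparseBound.one_le {E : Type*} [NormedAddCommGroup E] [InnerProductSpace ℝ E] {a : Fin p → E}
    {m : ℕ} {C : ℝ} (h : SparseBound a m C) (hm : 1 ≤ m) (ha : ∀ j, ‖a j‖ = 1) (hp : 0 < p) :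
    1 ≤ C := by
  have := h (a ⟨0, hp⟩) {⟨0, hp⟩} (by simpa using hm)
  simpa [ha] using this

lemma l2_sq (u : Fin p → ℝ) : l2 u ^ 2 = ∑ j, u j ^ 2 := by
  rw [l2, EuclideanSpace.real_norm_sq_eq]

/-- Duality: the norm of `u ↦ X u` on vectors supported in `T` equals that of its adjoint. The test
vector is the vector of correlations with `v`, restricted to `T`. -/
lemma sparseBound_of_kappaStar {m : ℕ} {C : ℝ} (hn : 0 < n) (hC : 0 ≤ C)
    (h : kappaStar m X ≤ ENNReal.ofReal C) : SparseBound (colE X) m C := by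
  classical
  have hn' : (0 : ℝ) < n := by exact_mod_cast hn
  have key : ∀ u : Fin p → ℝ, (supp u).card ≤ m → ‖lin (colE X) u‖ ^ 2 ≤ C * l2 u ^ 2 := by
    intro u hu
    have hl : 0 ≤ l2 u := norm_nonneg _
    rcases hl.eq_or_lt with h0 | h0
    · have : u = 0 := by
        have h1 : (WithLp.toLp 2 u : EuclideanSpace ℝ (Fin p)) = 0 := norm_eq_zero.1 h0.symm
        simpa using h1
      simp [this, lin, l2]
    · have h1 : l2 ((l2 u)⁻¹ • u) = 1 := by
        have : l2 ((l2 u)⁻¹ • u) = ‖(l2 u)⁻¹‖ * l2 u := by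
          rw [l2, WithLp.toLp_smul, norm_smul]; rfl
        rw [this, norm_inv, Real.norm_of_nonneg hl, inv_mul_cancel₀ h0.ne']
      have h2 : (supp ((l2 u)⁻¹ • u)).card ≤ m := by
        rwa [supp_smul (inv_ne_zero h0.ne')]
      have h3 := (le_iSup (fun u : {u : Fin p → ℝ // l2 u = 1 ∧ (supp u).card ≤ m} =>
        ENNReal.ofReal (l2 (X.mulVec u.1) ^ 2 / n)) ⟨_, h1, h2⟩).trans h
      rw [ENNReal.ofReal_le_ofReal_iff hC] at h3
      have h4 : l2 (X.mulVec ((l2 u)⁻¹ • u)) ^ 2 / n = ‖lin (colE X) ((l2 u)⁻¹ • u)‖ ^ 2 := by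
        rw [norm_lin_colE, div_pow, Real.sq_sqrt hn'.le]
      rw [h4, lin_smul, norm_smul, norm_inv, Real.norm_of_nonneg hl, mul_pow, inv_pow,
        inv_mul_le_iff₀ (by positivity)] at h3
      linarith
  intro v T hT
  set u : Fin p → ℝ := fun j => if j ∈ T then inner ℝ (colE X j) v else 0 with hu
  have hsupp : supp u ⊆ T := supp_subset_iff.2 fun j hj => by simp [hu, hj]
  have h1 := key u ((Finset.card_le_card hsupp).trans hT)
  have h2 : l2 u ^ 2 = ∑ j ∈ T, inner ℝ (colE X j) v ^ 2 := by
    rw [l2_sq]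
    simp [hu, ite_pow]
  have h3 : inner ℝ (lin (colE X) u) v = ∑ j ∈ T, inner ℝ (colE X j) v ^ 2 := by
    rw [inner_lin_left]
    simp [hu, sq]
  rw [h2] at h1
  set S := ∑ j ∈ T, inner ℝ (colE X j) v ^ 2 with hS
  have hS0 : 0 ≤ S := Finset.sum_nonneg fun _ _ => sq_nonneg _
  have h4 : S ≤ ‖lin (colE X) u‖ * ‖v‖ := by rw [← h3]; exact real_inner_le_norm _ _
  rcases hS0.eq_or_lt with h5 | h5
  · rw [← h5]; positivity
  · have h6 : S * S ≤ (C * ‖v‖ ^ 2) * S := by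
      calc S * S ≤ (‖lin (colE X) u‖ * ‖v‖) * (‖lin (colE X) u‖ * ‖v‖) :=
            mul_le_mul h4 h4 hS0 (by positivity)
        _ = ‖lin (colE X) u‖ ^ 2 * ‖v‖ ^ 2 := by ring
        _ ≤ C * S * ‖v‖ ^ 2 := by gcongr
        _ = _ := by ring
    exact le_of_mul_le_mul_right h6 h5

end sparse

section normalise
variable {n p : ℕ} {Ω : Type*} {d : Data Ω n p} {ω : Ω} {lam : ℝ}

/-- The residual at the target, normalised to norm one. -/
def Data.resE (d : Data Ω n p) (ω : Ω) : EuclideanSpace ℝ (Fin n) :=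
  (d.σora ω)⁻¹ • (respE (d.Y ω) - lin (colE (d.X ω)) (d.γtar ω))

/-- The normalised noise. -/
def Data.noiseE (d : Data Ω n p) (ω : Ω) : EuclideanSpace ℝ (Fin n) :=
  (d.σora ω)⁻¹ • (respE (d.Y ω) - lin (colE (d.X ω)) (d.γ ω))

lemma Data.σora_eq (d : Data Ω n p) (ω : Ω) :
    d.σora ω = ‖respE (d.Y ω) - lin (colE (d.X ω)) (d.γtar ω)‖ :=
  (norm_respE_sub_lin _ _ _).symm

lemma Data.noiseE_eq (d : Data Ω n p) (ω : Ω) :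
    d.noiseE ω = ((d.σora ω)⁻¹ * (√(n : ℝ))⁻¹) • d.noise ω := by
  rw [Data.noiseE, respE_sub_lin, smul_smul]; rfl

lemma Data.norm_resE (hσ : 0 < d.σora ω) : ‖d.resE ω‖ = 1 := by
  rw [Data.resE, norm_smul, ← d.σora_eq, norm_inv, Real.norm_of_nonneg hσ.le,
    inv_mul_cancel₀ hσ.ne']

lemma sqrtLasso_of_isScaledLasso (hn : 0 < n) (hlam : 0 < lam)
    (hcol : ∀ j, ‖colE (d.X ω) j‖ = 1) (hσ : 0 < d.σora ω)
    (h : IsScaledLasso (d.X ω) (d.Y ω) lam (d.γhat ω) (d.σhat ω)) :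
    SqrtLasso (colE (d.X ω)) (d.resE ω) ((d.σora ω)⁻¹ • d.γtar ω)
      ((d.σora ω)⁻¹ • (d.γhat ω - d.γtar ω)) lam ∧
    d.σhat ω / d.σora ω =
      ‖d.resE ω - lin (colE (d.X ω)) ((d.σora ω)⁻¹ • (d.γhat ω - d.γtar ω))‖ := by
  obtain ⟨h1, h2⟩ := h.profile hn hlam.le
  set c := d.σora ω with hc
  have hci : 0 ≤ c⁻¹ := by positivity
  have hres : ∀ b : Fin p → ℝ, ‖d.resE ω - lin (colE (d.X ω)) (c⁻¹ • (b - d.γtar ω))‖ =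
      c⁻¹ * ‖respE (d.Y ω) - lin (colE (d.X ω)) b‖ := by
    intro b
    rw [Data.resE, ← hc, lin_smul, ← smul_sub, norm_smul, Real.norm_of_nonneg hci, lin_sub]
    congr 2
    abel
  have hadd : ∀ b : Fin p → ℝ, c⁻¹ • d.γtar ω + c⁻¹ • (b - d.γtar ω) = c⁻¹ • b := by
    intro b; rw [← smul_add, add_sub_cancel]
  refine ⟨⟨hcol, Data.norm_resE hσ, hlam, fun b => ?_⟩, ?_⟩
  · have e1 : b = c⁻¹ • ((d.γtar ω + c • b) - d.γtar ω) := by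
      rw [add_sub_cancel_left, smul_smul, inv_mul_cancel₀ hσ.ne', one_smul]
    rw [e1, hadd, hadd, hres, hres, l1_smul, l1_smul, abs_of_nonneg hci]
    have := mul_le_mul_of_nonneg_left (h2 (d.γtar ω + c • b)) hci
    linarith
  · rw [hres, ← h1, div_eq_inv_mul]

lemma lse_compare_normalised (hn : 0 < n) (hlam : 0 < lam) (hσ : 0 < d.σora ω)
    (h : IsScaledLasso (d.X ω) (d.Y ω) lam (d.γhat ω) (d.σhat ω))
    (hl : IsLSE (d.X ω) (d.Y ω) (supp (d.γhat ω)) (d.γlse ω) (d.σlse ω)) :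
    supp ((d.σora ω)⁻¹ • (d.γlse ω - d.γhat ω)) ⊆ supp (d.γhat ω) ∧ 0 ≤ d.σlse ω / d.σora ω ∧
    (d.σhat ω / d.σora ω) ^ 2 - (d.σlse ω / d.σora ω) ^ 2 =
      ‖lin (colE (d.X ω)) ((d.σora ω)⁻¹ • (d.γlse ω - d.γhat ω))‖ ^ 2 ∧
    ‖lin (colE (d.X ω)) ((d.σora ω)⁻¹ • (d.γlse ω - d.γhat ω))‖ ^ 2 ≤
      d.σhat ω / d.σora ω * lam * l1 ((d.σora ω)⁻¹ • (d.γlse ω - d.γhat ω)) := by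
  obtain ⟨h1, h2⟩ := h.profile hn hlam.le
  obtain ⟨h3, h4⟩ := hl.profile hn
  obtain ⟨e1, e2⟩ := lse_compare h2 hlam.le hl.1 h4
  rw [← h1, ← h3] at e1
  rw [← h1] at e2
  set c := d.σora ω with hc
  have hci : 0 ≤ c⁻¹ := by positivity
  refine ⟨?_, div_nonneg hl.2.1 hσ.le, ?_, ?_⟩
  · rw [supp_smul (inv_ne_zero hσ.ne')]
    exact supp_sub_subset hl.1 subset_rfl
  · rw [lin_smul, norm_smul, Real.norm_of_nonneg hci, mul_pow, ← e1]
    field_simp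
  · rw [lin_smul, norm_smul, Real.norm_of_nonneg hci, mul_pow, l1_smul, abs_of_nonneg hci]
    have := mul_le_mul_of_nonneg_left e2 (sq_nonneg c⁻¹)
    refine this.trans (le_of_eq ?_)
    field_simp

end normalise
end ScaledLasso
end

/-! ### Noise control for the smaller penalty levels; parameters in normalised form -/

noncomputable section
namespace ScaledLasso

section smallnoise
variable {E : Type*} [NormedAddCommGroup E] [InnerProductSpace ℝ E] {p : ℕ}
variable {a : Fin p → E} {r r' : E}

/-- Control of the noise for the smaller penalty levels: a bound for the largest coordinate and for
the total excess over the level `(1 + θ) l₀`. -/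
def SmallPenaltyNoise (a : Fin p → E) (r : E) (α ε θ l₀ lam : ℝ) (m : ℕ) : Prop :=
  ∃ Z w : ℝ, 0 ≤ Z ∧ w ≤ 4 * (1 + ε) ∧ (∀ j, |inner ℝ (a j) r| ≤ Z) ∧
    ∑ j, excess ((1 + θ) * l₀) (inner ℝ (a j) r) ≤ w * m * l₀ ∧
    lam + Z ≤ 99 / 100 * α * (lam - (1 + θ) * l₀) ∧
    Z - lam + w * l₀ ≤ 99 / 100 * α * (lam - (1 + θ) * l₀)

/-- At `lam = (1 + ε) l₀` the gap on the right is `(ε - θ) l₀` and the claim is the condition on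
`α`. A larger `lam` increases the left side at rate one and the right side at rate `99/100 * α ≥ 1`.
-/
lemma le_mul_penalty_gap {α ε θ l₀ lam f R : ℝ} (hl₀ : 0 ≤ l₀) (hθ : 0 ≤ θ) (hθε : θ < ε)
    (hlam : (1 + ε) * l₀ ≤ lam) (hf : 1 ≤ f) (hR : 0 ≤ R)
    (hα : f * (ε - θ)⁻¹ * (1 + ε + R) ≤ 99 / 100 * α) :
    f * (1 + ε + R) * l₀ + (lam - (1 + ε) * l₀) ≤ 99 / 100 * α * (lam - (1 + θ) * l₀) := by
  have hd : 0 < ε - θ := by linarith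
  have h1 : f * (1 + ε + R) ≤ 99 / 100 * α * (ε - θ) := by
    calc f * (1 + ε + R) = f * (ε - θ)⁻¹ * (1 + ε + R) * (ε - θ) := by field_simp
      _ ≤ _ := by gcongr
  have h2 : 1 ≤ 99 / 100 * α := by
    have : (ε - θ) * 1 ≤ (ε - θ) * (99 / 100 * α) := by nlinarith
    exact le_of_mul_le_mul_left this hd
  have h3 := mul_le_mul_of_nonneg_right h1 hl₀
  have h4 := mul_le_mul_of_nonneg_right h2 (sub_nonneg.2 hlam)
  linarith

lemma one_le_of_factor_le {α ε θ f R : ℝ} (hθ : 0 ≤ θ) (hθε : θ < ε) (hf : 1 ≤ f) (hR : 0 ≤ R)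
    (hα : f * (ε - θ)⁻¹ * (1 + ε + R) ≤ α) : 1 ≤ α := by
  refine le_trans ?_ hα
  have hd : 0 < ε - θ := by linarith
  rw [mul_assoc, inv_mul_eq_div]
  have : 1 ≤ (1 + ε + R) / (ε - θ) := by rw [one_le_div hd]; linarith
  nlinarith

/-- The factor `√2` in the condition on `α` exceeds the `6/5` of the supremum bound; `99/100 * √2 ≥
7/5` leaves enough for the weight of the total excess as well. -/
lemma smallPenaltyNoise_of_unbiased {α ε θ l₀ lam R A₀ : ℝ} {m : ℕ} (hl₀ : 0 ≤ l₀) (hA₀ : A₀ ≤ θ)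
    (hθ : 0 ≤ θ) (hθε : θ < ε) (hlam : (1 + ε) * l₀ ≤ lam) (hR : 1 ≤ R)
    (hα : √2 * (ε - θ)⁻¹ * (1 + ε + R) ≤ α)
    (hsup : ∀ j, |inner ℝ (a j) r| ≤ 6 / 5 * (R * l₀))
    (hsum : ∑ j, excess ((1 + θ) * l₀) (inner ℝ (a j) r) ≤ (13 / 5 + 2 * A₀ + θ / 4) * m * l₀) :
    SmallPenaltyNoise a r α ε θ l₀ lam m := by
  have hd : 0 < ε - θ := by linarith
  have hα' : (7 / 5 : ℝ) * (ε - θ)⁻¹ * (1 + ε + R) ≤ 99 / 100 * α := by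
    have h3 : 0 ≤ (ε - θ)⁻¹ * (1 + ε + R) :=
      mul_nonneg (inv_nonneg.2 hd.le) (by linarith)
    have h4 : (7 / 5 : ℝ) ≤ 99 / 100 * √2 := by
      have : (14142 / 10000 : ℝ) ≤ √2 := Real.le_sqrt_of_sq_le (by norm_num)
      linarith
    have h5 := mul_le_mul_of_nonneg_right h4 h3
    linarith
  have hgap := le_mul_penalty_gap hl₀ hθ hθε hlam (by norm_num) (by linarith) hα'
  have hε0 : 0 ≤ ε * l₀ := mul_nonneg (by linarith) hl₀
  have hRl : l₀ ≤ R * l₀ := le_mul_of_one_le_left hl₀ hR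
  have hA : A₀ * l₀ ≤ ε * l₀ := by gcongr; linarith
  have hT : θ * l₀ ≤ ε * l₀ := by gcongr
  exact ⟨6 / 5 * (R * l₀), 13 / 5 + 2 * A₀ + θ / 4, by positivity, by linarith, hsup, hsum,
    by linarith, by linarith⟩

/-- The noise direction `r'` and the target residual `r` differ by at most `ρ = δ l₀ / 2`. All
correlations move by at most `ρ`, and `‖r'‖ ≤ 1 + ρ`; the passage from `ε₁` to `θ` and the factor
`2` in the condition on `α` pay for both. -/
lemma smallPenaltyNoise_of_biased {α ε ε₁ θ l₀ lam R A₀ δ : ℝ} {m : ℕ} (ha : ∀ j, ‖a j‖ = 1)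
    (hr : ‖r‖ = 1) (hl₀ : 0 ≤ l₀) (hA₀0 : 0 ≤ A₀) (hA₀ : A₀ ≤ ε₁)
    (hθε : θ < ε) (hlam : (1 + ε) * l₀ ≤ lam) (hR : 1 ≤ R) (hRl : R * l₀ ≤ 1)
    (hα : 2 * (ε - θ)⁻¹ * (1 + ε + R) ≤ α) (hδ0 : 0 ≤ δ) (hδ1 : δ ≤ √2 - 1) (hδ2 : δ ≤ θ - ε₁)
    (hrr : ‖r - r'‖ ≤ δ * l₀ / 2)
    (hsup : ∀ j, |inner ℝ (a j) r'| ≤ 6 / 5 * (R * l₀) * ‖r'‖)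
    (hsum : ∑ j, excess ((1 + ε₁) * l₀ * ‖r'‖) (inner ℝ (a j) r') ≤
      (13 / 5 + 2 * A₀ + ε₁ / 4) * m * l₀ * ‖r'‖) :
    SmallPenaltyNoise a r α ε θ l₀ lam m := by
  have hε₁ : 0 ≤ ε₁ := hA₀0.trans hA₀
  have hθ : 0 ≤ θ := by linarith
  have hd : 0 < ε - θ := by linarith
  have hα' : (198 / 100 : ℝ) * (ε - θ)⁻¹ * (1 + ε + R) ≤ 99 / 100 * α := by linarith
  have hgap := le_mul_penalty_gap hl₀ hθ hθε hlam (by norm_num) (by linarith) hα'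
  have hδ3 : δ ≤ 415 / 1000 := by
    have : √2 ≤ 1415 / 1000 := Real.sqrt_le_iff.2 ⟨by norm_num, by norm_num⟩
    linarith
  have hRl' : l₀ ≤ R * l₀ := le_mul_of_one_le_left hl₀ hR
  obtain ⟨ρ, hρ⟩ : ∃ ρ, ρ = δ * l₀ / 2 := ⟨_, rfl⟩
  rw [← hρ] at hrr
  have hδl : δ * l₀ ≤ 415 / 1000 * l₀ := by gcongr
  have hρ0 : 0 ≤ ρ := by rw [hρ]; positivity
  have hρ1 : ρ ≤ 21 / 100 := by linarith
  have hr' : ‖r'‖ ≤ 1 + ρ := by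
    have := norm_sub_norm_le r' r
    rw [norm_sub_rev] at this
    linarith
  have hdiff : ∀ j, |inner ℝ (a j) (r - r')| ≤ ρ := fun j => by
    refine (abs_real_inner_le_norm _ _).trans ?_
    rw [ha, one_mul]; exact hrr
  have hsplit : ∀ j, inner ℝ (a j) r = inner ℝ (a j) r' + inner ℝ (a j) (r - r') := fun j => by
    rw [← inner_add_right]; congr 1; abel
  have hε0 : 0 ≤ ε * l₀ := mul_nonneg (by linarith) hl₀
  have hA : A₀ * l₀ ≤ ε * l₀ := by gcongr; linarith
  have hT : ε₁ * l₀ ≤ ε * l₀ := by gcongr; linarith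
  -- As `R l₀ ≤ 1`, the supremum grows by at most `11/5 * ρ = 11/10 * δ l₀ ≤ 46/100 * l₀`. The
  -- factor `121/100` bounds `‖r'‖`, because `ρ ≤ 21/100`.
  refine ⟨6 / 5 * (R * l₀) + 46 / 100 * l₀, 121 / 100 * (13 / 5 + 2 * A₀ + ε₁ / 4),
    by positivity, by linarith, fun j => ?_, ?_, by linarith, by linarith⟩
  · have h1 := abs_add_le (inner ℝ (a j) r') (inner ℝ (a j) (r - r'))
    rw [← hsplit] at h1
    have h2 : 6 / 5 * (R * l₀) * ‖r'‖ ≤ 6 / 5 * (R * l₀) * (1 + ρ) := by gcongr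
    have h3 : R * l₀ * ρ ≤ 1 * ρ := by gcongr
    linarith [hsup j, hdiff j]
  · have hw0 : 0 ≤ (13 / 5 + 2 * A₀ + ε₁ / 4) * m * l₀ := by positivity
    -- Correlations of unit vectors never exceed one, so a level above one has no excess. Below one,
    -- the rise of the level is at most `2 ρ = δ l₀ ≤ (θ - ε₁) l₀`.
    rcases le_or_gt 1 ((1 + θ) * l₀) with h1 | h1
    · have h0 : ∀ j, excess ((1 + θ) * l₀) (inner ℝ (a j) r) = 0 := fun j => by
        refine max_eq_right ?_
        have := abs_real_inner_le_norm (a j) r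
        rw [ha, hr, mul_one] at this
        linarith
      simp_rw [h0, Finset.sum_const_zero]
      linarith
    · have hthr : (1 + ε₁) * l₀ * ‖r'‖ + ρ ≤ (1 + θ) * l₀ := by
        have k1 : (1 + ε₁) * l₀ * ‖r'‖ ≤ (1 + ε₁) * l₀ * (1 + ρ) := by gcongr
        have k2 : (1 + ε₁) * l₀ ≤ 1 := by
          refine le_trans ?_ h1.le
          gcongr
          linarith
        have k3 : (1 + ε₁) * l₀ * ρ ≤ 1 * ρ := by gcongr
        have k4 : δ * l₀ ≤ (θ - ε₁) * l₀ := by gcongr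
        linarith
      calc ∑ j, excess ((1 + θ) * l₀) (inner ℝ (a j) r) ≤
          ∑ j, excess ((1 + ε₁) * l₀ * ‖r'‖) (inner ℝ (a j) r') := by
            refine Finset.sum_le_sum fun j _ => (excess_anti hthr _).trans ?_
            rw [hsplit j]
            refine (excess_add_le _ _ _ _).trans ?_
            have : excess ρ (inner ℝ (a j) (r - r')) = 0 :=
              max_eq_right (by linarith [hdiff j])
            rw [this, add_zero]
        _ ≤ _ := hsum
        _ ≤ (13 / 5 + 2 * A₀ + ε₁ / 4) * m * l₀ * (121 / 100) := by
            gcongr; linarith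
        _ = _ := by ring

end smallnoise

section params
variable {P : Params} {B ε : ℝ}

/-- The rate `√(δ log p / n)`. -/
def Params.rate (P : Params) : ℝ := √(P.δ * Real.log P.p / P.n)

/-- The normal quantile `L₁(k/p)`. -/
def Params.quant (P : Params) : ℝ := L 1 (P.k / P.p)

/-- The basic penalty level `L_{n-3/2}(k/p)`. -/
def Params.level (P : Params) : ℝ := L (P.n - 3 / 2) (P.k / P.p)

namespace Common
variable (hc : Common P B ε)

lemma _root_.ScaledLasso.Params.level_eq (P : Params) : P.level = P.quant / √((P.n : ℝ) - 3 / 2) := L_eq _ _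

include hc

lemma n_pos : (0 : ℝ) < P.n := by have := hc.two_le_n; positivity
lemma p_pos : (0 : ℝ) < P.p := by have := hc.two_le_p; positivity

lemma two_le_n_real : (2 : ℝ) ≤ P.n := by exact_mod_cast hc.two_le_n

lemma ratio_pos : 0 < P.k / P.p := div_pos hc.k_pos hc.p_pos

lemma quant_pos : 0 < P.quant := L_one_pos hc.ratio_pos hc.k_lt

lemma gtail_quant : gtail P.quant = P.k / P.p :=
  gtail_L_one hc.ratio_pos (by linarith [hc.k_lt])

lemma sqrt_pos : 0 < √((P.n : ℝ) - 3 / 2) := Real.sqrt_pos.2 (by linarith [hc.two_le_n_real])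

lemma level_pos : 0 < P.level := by
  rw [P.level_eq]; exact div_pos hc.quant_pos hc.sqrt_pos

lemma lam_pos (hε : 0 < ε) : 0 < P.lam := by
  have h1 : (1 + ε) * P.level ≤ P.lam := hc.lam_ge
  have := hc.level_pos
  have : 0 < (1 + ε) * P.level := by positivity
  linarith

lemma log_pos : 0 < Real.log P.p := by
  refine Real.log_pos ?_
  have := hc.two_le_p
  exact_mod_cast (by omega : 1 < P.p)

lemma rate_sq : P.rate ^ 2 = P.δ * Real.log P.p / P.n := by
  have h1 := hc.log_pos
  have h2 := hc.n_pos
  have h3 := hc.one_le_δ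
  rw [Params.rate, Real.sq_sqrt (by positivity)]

lemma rate_pos : 0 < P.rate := by
  have h1 := hc.log_pos
  have h2 := hc.n_pos
  have h3 := hc.one_le_δ
  exact Real.sqrt_pos.2 (by positivity)

lemma complexity_eq : P.s * P.rate ^ 2 = P.δ * P.s * Real.log P.p / P.n := by
  rw [hc.rate_sq]; ring

lemma complexity_le {C : ℝ} (hC : 0 ≤ C) (h : C * P.c₀ ≤ 1 / 2) :
    C * (P.s * P.rate ^ 2) ≤ 1 / 2 := by
  rw [hc.complexity_eq]
  exact (mul_le_mul_of_nonneg_left hc.rate hC).trans h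

/-- The size constraint is stated with `L₁`; dividing by `n` and using `n - 3/2 ≤ n` gives it for
`L_{n-3/2}`. -/
lemma size_le {C₀ ε₂ ε₃ C₃ : ℝ} (hz : SizeConstraints P C₀ ε ε₂ ε₃ C₃) (h23 : ε₂ < ε₃)
    (hC₃ : 0 < C₃) :
    C₀ * (P.s * P.rate ^ 2) ≤ (ε - ε₃) / (1 + ε) ∧
    C₃ * (C₀ * (P.s * P.rate ^ 2)) ≤ P.s₃ * (ε₃ - ε₂) ^ 2 * P.level ^ 2 := by
  have hn := hc.n_pos
  have ht := hc.quant_pos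
  have hd : 0 < ε₃ - ε₂ := by linarith
  have hν : (0 : ℝ) < P.n - 3 / 2 := by linarith [hc.two_le_n_real]
  constructor
  · have := hz.noise
    rw [hc.complexity_eq]
    refine le_trans (le_of_eq ?_) this
    ring
  · have h1 := hz.size
    change _ / ((ε₃ - ε₂) ^ 2 * P.quant ^ 2) ≤ _ at h1
    rw [div_le_div_iff₀ (by positivity) hC₃] at h1
    rw [hc.complexity_eq, P.level_eq, div_pow, Real.sq_sqrt hν.le]
    calc C₃ * (C₀ * (P.δ * P.s * Real.log P.p / P.n)) =
        C₀ * P.s * P.δ * Real.log P.p * C₃ / P.n := by ring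
      _ ≤ P.s₃ * ((ε₃ - ε₂) ^ 2 * P.quant ^ 2) / P.n := by gcongr
      _ ≤ P.s₃ * ((ε₃ - ε₂) ^ 2 * P.quant ^ 2) / (P.n - 3 / 2) := by
        gcongr; linarith
      _ = _ := by ring

end Common

lemma one_le_expN (n : ℕ) : 1 ≤ expN n := Real.one_le_exp (by positivity)

end params

section bounds
variable {P : Params} {B ε : ℝ} {Ω : Type*} {d : Data Ω P.n P.p}

/-- The normalised error bounds at `ω` for an estimator. -/
def ErrAt (P : Params) (d : Data Ω P.n P.p) (γest : Ω → Fin P.p → ℝ) (σest : Ω → ℝ) (C : ℝ)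
    (ω : Ω) : Prop :=
  0 < d.σora ω ∧ ErrLe (colE (d.X ω)) ((d.σora ω)⁻¹ • (γest ω - d.γtar ω))
    (σest ω / d.σora ω) C P.s P.rate

lemma errorBounds_of_errAt [MeasurableSpace Ω] {μ : Measure Ω} (hc : Common P B ε) {γest : Ω → Fin P.p → ℝ} {σest : Ω → ℝ} {C : ℝ}
    (hC : 0 ≤ C) (hC0 : C * P.c₀ ≤ 1 / 2)
    (h : HoldsWP μ (ErrAt P d γest σest C) ((P.p : ℝ) ^ (1 - P.δ) * P.e₀)) :
    ErrorBounds μ P d γest σest C := by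
  have hn := hc.n_pos
  have hrs := hc.rate_sq
  have hsm := hc.complexity_le hC hC0
  have e0 : C * P.s * P.δ * Real.log P.p / P.n = C * (P.s * P.rate ^ 2) := by rw [hrs]; ring
  refine ⟨h.mono (fun ω hω => ?_) le_rfl, h.mono (fun ω hω => ?_) le_rfl,
    h.mono (fun ω hω => ?_) le_rfl⟩
  · obtain ⟨hσ, h1, h2, h3⟩ := hω
    rw [lin_smul, norm_smul, norm_inv, Real.norm_of_nonneg hσ.le, norm_lin_colE, mul_pow, inv_pow,
      div_pow, Real.sq_sqrt hn.le, inv_mul_le_iff₀ (by positivity), div_le_iff₀ hn, hrs] at h1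
    refine h1.trans (le_of_eq ?_)
    field_simp
  · obtain ⟨hσ, h1, h2, h3⟩ := hω
    rw [l1_smul, abs_inv, abs_of_pos hσ, inv_mul_le_iff₀ hσ] at h2
    refine h2.trans (le_of_eq ?_)
    rw [Params.rate]; ring
  · obtain ⟨hσ, h1, h2, h3⟩ := hω
    rw [e0]
    exact ⟨h3, hsm⟩

/-- Each summand of the capped size is nonnegative, so each is at most `s₁`; and `√(2 log p / n) ≤ 2
√(δ log p / n)` as `δ ≥ 1`. -/
lemma cond₁_normalised (hc : Common P B ε) {ω : Ω} (h : Cond₁ P d ω) (hs : P.s₁ ≤ P.s) :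
    (P.K.card : ℝ) ≤ P.s₁ ∧ 0 ≤ P.s ∧
      l1On P.Kᶜ ((d.σora ω)⁻¹ • d.γtar ω) ≤ 2 * (P.s * P.rate) := by
  have hn := hc.n_pos
  have hlog := hc.log_pos
  have hδ := hc.one_le_δ
  have hr := hc.rate_pos
  unfold Cond₁ at h
  rw [← Finset.sum_div] at h
  have h1 : ∑ j ∈ P.Kᶜ, |d.γtar ω j / d.σora ω| = l1On P.Kᶜ ((d.σora ω)⁻¹ • d.γtar ω) := by
    unfold l1On
    refine Finset.sum_congr rfl fun j _ => ?_
    simp [div_eq_inv_mul]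
  rw [h1] at h
  set g := l1On P.Kᶜ ((d.σora ω)⁻¹ • d.γtar ω) with hg
  have hg0 : 0 ≤ g := l1On_nonneg _ _
  set q := √(2 / P.n * Real.log P.p) with hq
  have hq0 : 0 < q := Real.sqrt_pos.2 (by positivity)
  have h2 : 0 ≤ g / q := by positivity
  have h3 : (0 : ℝ) ≤ P.K.card := Nat.cast_nonneg _
  have h4 : g / q ≤ P.s := by linarith
  have hs0 : 0 ≤ P.s := by linarith
  refine ⟨by linarith, hs0, ?_⟩
  rw [div_le_iff₀ hq0] at h4
  have h5 : q ≤ 2 * P.rate := by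
    refine Real.sqrt_le_iff.2 ⟨by positivity, ?_⟩
    rw [mul_pow, hc.rate_sq]
    have e1 : 2 / (P.n : ℝ) * Real.log P.p = 2 * (Real.log P.p / P.n) := by ring
    have e2 : 2 ^ 2 * (P.δ * Real.log P.p / P.n) = 4 * P.δ * (Real.log P.p / P.n) := by ring
    rw [e1, e2]
    gcongr
    linarith
  calc g ≤ P.s * q := h4
    _ ≤ P.s * (2 * P.rate) := by gcongr
    _ = _ := by ring

/-- The normalised noise is a positive multiple of the noise. With `√(n - 3/2)` taken out of the
factor, the scale invariant noise events translate into multiples of the penalty level. -/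
lemma Common.exists_noise_scale (hc : Common P B ε) {ω : Ω} (hσ : 0 < d.σora ω) :
    ∃ κ : ℝ, 0 < κ ∧
      (∀ v, inner ℝ v (d.noiseE ω) = κ * (√((P.n : ℝ) - 3 / 2) * inner ℝ v (d.noise ω))) ∧
      ‖d.noiseE ω‖ = κ * √((P.n : ℝ) - 3 / 2) * ‖d.noise ω‖ := by
  have hn := hc.n_pos
  have hs := hc.sqrt_pos
  have hk : 0 ≤ (d.σora ω)⁻¹ * (√(P.n : ℝ))⁻¹ := by positivity
  refine ⟨(d.σora ω)⁻¹ * (√(P.n : ℝ))⁻¹ / √((P.n : ℝ) - 3 / 2), by positivity, fun v => ?_, ?_⟩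
  · rw [d.noiseE_eq, real_inner_smul_right]
    generalize √((P.n : ℝ) - 3 / 2) = q at hs ⊢
    field_simp
  · rw [d.noiseE_eq, norm_smul, Real.norm_of_nonneg hk]
    generalize √((P.n : ℝ) - 3 / 2) = q at hs ⊢
    field_simp

lemma Common.abs_inner_noiseE_le (hc : Common P B ε) {ω : Ω} (hσ : 0 < d.σora ω) {x : ℝ}
    {v : EuclideanSpace ℝ (Fin P.n)}
    (h : |√((P.n : ℝ) - 3 / 2) * inner ℝ v (d.noise ω)| ≤ x * ‖d.noise ω‖) :
    |inner ℝ v (d.noiseE ω)| ≤ x / √((P.n : ℝ) - 3 / 2) * ‖d.noiseE ω‖ := by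
  obtain ⟨κ, hκ, h1, h2⟩ := hc.exists_noise_scale hσ
  have hs := hc.sqrt_pos
  rw [h1, h2, abs_mul, abs_of_pos hκ]
  calc _ ≤ κ * (x * ‖d.noise ω‖) := by gcongr
    _ = _ := by
      generalize √((P.n : ℝ) - 3 / 2) = q at hs ⊢
      field_simp

lemma Common.inner_noiseE_le (hc : Common P B ε) {ω : Ω} (hσ : 0 < d.σora ω) {x : ℝ}
    {v : EuclideanSpace ℝ (Fin P.n)}
    (h : √((P.n : ℝ) - 3 / 2) * inner ℝ v (d.noise ω) ≤ x * ‖d.noise ω‖) :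
    inner ℝ v (d.noiseE ω) ≤ x / √((P.n : ℝ) - 3 / 2) * ‖d.noiseE ω‖ := by
  obtain ⟨κ, hκ, h1, h2⟩ := hc.exists_noise_scale hσ
  have hs := hc.sqrt_pos
  rw [h1, h2]
  calc _ ≤ κ * (x * ‖d.noise ω‖) := by gcongr
    _ = _ := by
      generalize √((P.n : ℝ) - 3 / 2) = q at hs ⊢
      field_simp

lemma Common.lt_abs_inner_noise (hc : Common P B ε) {ω : Ω} (hσ : 0 < d.σora ω) {x : ℝ}
    {v : EuclideanSpace ℝ (Fin P.n)}
    (h : x / √((P.n : ℝ) - 3 / 2) * ‖d.noiseE ω‖ < |inner ℝ v (d.noiseE ω)|) :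
    x * ‖d.noise ω‖ < |√((P.n : ℝ) - 3 / 2) * inner ℝ v (d.noise ω)| := by
  by_contra hcon
  exact not_lt.2 (hc.abs_inner_noiseE_le hσ (not_lt.1 hcon)) h

lemma Common.sum_excess_noiseE_le (hc : Common P B ε) {ω : Ω} (hσ : 0 < d.σora ω) {x w : ℝ}
    {a : Fin P.p → EuclideanSpace ℝ (Fin P.n)}
    (h : ∑ j, excess (x * ‖d.noise ω‖) (√((P.n : ℝ) - 3 / 2) * inner ℝ (a j) (d.noise ω)) ≤
      w * ‖d.noise ω‖) :
    ∑ j, excess (x / √((P.n : ℝ) - 3 / 2) * ‖d.noiseE ω‖) (inner ℝ (a j) (d.noiseE ω)) ≤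
      w / √((P.n : ℝ) - 3 / 2) * ‖d.noiseE ω‖ := by
  obtain ⟨κ, hκ, h1, h2⟩ := hc.exists_noise_scale hσ
  have hs := hc.sqrt_pos
  have e1 : ∀ y, y / √((P.n : ℝ) - 3 / 2) * ‖d.noiseE ω‖ = κ * (y * ‖d.noise ω‖) := by
    intro y
    rw [h2]
    generalize √((P.n : ℝ) - 3 / 2) = q at hs ⊢
    field_simp
  simp_rw [e1, h1, excess_mul hκ.le, ← Finset.mul_sum]
  gcongr

end bounds
end ScaledLasso
end

/-! ### Conclusions at a single outcome -/

noncomputable section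
namespace ScaledLasso

section pointwise
variable {P : Params} {B ε : ℝ} {Ω : Type*} {d : Data Ω P.n P.p} {ω : Ω}

lemma smul_add_smul_sub (c : ℝ) {p : ℕ} (u v : Fin p → ℝ) : c • u + c • (v - u) = c • v := by
  rw [← smul_add, add_sub_cancel]

/-- The facts at `ω` that do not depend on the noise. -/
structure RegularAt (P : Params) (d : Data Ω P.n P.p) (ω : Ω) : Prop where
  σora_pos : 0 < d.σora ω
  norm_col : ∀ j, ‖colE (d.X ω) j‖ = 1
  lasso : IsScaledLasso (d.X ω) (d.Y ω) P.lam (d.γhat ω) (d.σhat ω)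
  lse : IsLSE (d.X ω) (d.Y ω) (supp (d.γhat ω)) (d.γlse ω) (d.σlse ω)

namespace RegularAt
variable (hr : RegularAt P d ω) (hc : Common P B ε)
include hr

lemma supp_eq : supp ((d.σora ω)⁻¹ • d.γtar ω + (d.σora ω)⁻¹ • (d.γhat ω - d.γtar ω)) =
    supp (d.γhat ω) := by
  rw [smul_add_smul_sub, supp_smul (inv_ne_zero hr.σora_pos.ne')]

include hc

lemma sqrtLasso (hε : 0 < ε) :
    SqrtLasso (colE (d.X ω)) (d.resE ω) ((d.σora ω)⁻¹ • d.γtar ω)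
      ((d.σora ω)⁻¹ • (d.γhat ω - d.γtar ω)) P.lam ∧
    d.σhat ω / d.σora ω =
      ‖d.resE ω - lin (colE (d.X ω)) ((d.σora ω)⁻¹ • (d.γhat ω - d.γtar ω))‖ :=
  sqrtLasso_of_isScaledLasso (by have := hc.two_le_n; omega) (hc.lam_pos hε) hr.norm_col
    hr.σora_pos hr.lasso

lemma errAt_lse (hε : 0 < ε) (hB0 : 0 ≤ B) {C C₂ Q : ℝ} (hs : 0 ≤ P.s) (hC₂ : 0 ≤ C₂) (hQ : 0 ≤ Q)
    (herr : ErrAt P d d.γhat d.σhat C ω) (hsmall : C * (P.s * P.rate ^ 2) ≤ 1 / 2)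
    (hcard : (supp (d.γhat ω)).card < P.s₃)
    (hcard' : ((supp (d.γhat ω)).card : ℝ) * P.lam ≤ Q * (P.s * P.rate))
    (hadd : Cond₂Add P C₂ d ω) :
    ErrAt P d d.γlse d.σlse (2 * C + 5 * (C₂ * Q) * (1 + B)) ω := by
  obtain ⟨H, hσ⟩ := hr.sqrtLasso hc hε
  have hn : 0 < P.n := by have := hc.two_le_n; omega
  obtain ⟨e1, e2, e3, e4⟩ := lse_compare_normalised hn (hc.lam_pos hε) hr.σora_pos hr.lasso hr.lse
  have hcomp : Compat (colE (d.X ω)) 0 (supp (d.γhat ω)) C₂ := by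
    refine compat_of_phiComp hC₂ (hadd _ ?_)
    have : ((supp (d.γhat ω)).card : ℝ) < P.s₃ := by exact_mod_cast hcard
    linarith
  have h1 := herr.2
  rw [hσ] at h1 e3 e4
  rw [← hr.supp_eq] at e1 hcomp hcard'
  have := H.errLe_lse e1 e2 e3 e4 hC₂ hcomp hc.lam_le hs hc.rate_pos.le hB0 hQ hcard' h1 hsmall rfl
  rw [← smul_add, add_comm (d.γhat ω - d.γtar ω), sub_add_sub_cancel] at this
  exact ⟨hr.σora_pos, this⟩

/-- The scaled lasso for the smaller penalty levels. -/
lemma errAt_small_penalty {α θ C₂ : ℝ} (hB0 : 0 ≤ B) (hα : 1 ≤ α) (hC₂ : 0 ≤ C₂)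
    (hs : P.s₁ + P.s₂ ≤ P.s) (hs₂ : 1 ≤ P.s₂) (hθ : 0 ≤ θ) (hθε : θ < ε)
    (hc₀ : smallPenaltyConst B α ε θ C₂ * P.c₀ ≤ 1 / 2) (h1 : Cond₁ P d ω)
    (h2 : Cond₂ P α C₂ d ω)
    (hnoise : SmallPenaltyNoise (colE (d.X ω)) (d.resE ω) α ε θ P.level P.lam P.s₂) :
    ErrAt P d d.γhat d.σhat (smallPenaltyConst B α ε θ C₂) ω ∧
    ∀ {C₃ ε₂ ε₃ : ℝ}, θ ≤ ε₂ → ε₂ < ε₃ → ε₃ < ε → P.s₂ ≤ P.s₃ →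
      SizeConstraints P (smallPenaltyConst B α ε θ C₂) ε ε₂ ε₃ C₃ →
      SparseBound (colE (d.X ω)) P.s₃ C₃ → 1 ≤ C₃ →
      (supp (d.γhat ω)).card < P.s₃ ∧ 0 ≤ P.s ∧
      (Cond₂Add P C₂ d ω → ErrAt P d d.γlse d.σlse (2 * smallPenaltyConst B α ε θ C₂ +
        5 * (C₂ * smallPenaltySizeConst B α ε θ C₂ C₃ ε₂ ε₃) * (1 + B)) ω) := by
  have hε : 0 < ε := by linarith
  obtain ⟨H, hσ⟩ := hr.sqrtLasso hc hε
  obtain ⟨Z, w, hZ0, hw, hZ, hsum, n1, n2⟩ := hnoise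
  have hC0 := smallPenaltyConst_pos hB0 (by linarith : 0 ≤ α) hε.le hθε hC₂
  have hD0 := smallPenaltyL1Const_nonneg hB0 (by linarith : 0 ≤ α) hε.le hθε hC₂
  have hs₂' : (1 : ℝ) ≤ P.s₂ := by exact_mod_cast hs₂
  obtain ⟨k1, k2, k3⟩ := cond₁_normalised hc h1 (by linarith)
  have hsm := hc.complexity_le hC0.le hc₀
  obtain ⟨f1, f2, f3⟩ := H.errLe_of_sum_excess_le hB0 hZ hZ0 hα hC₂ hs₂
    (fun J hJ => compat_of_phiComp hC₂ (h2 J hJ)) (by linarith) hθ hθε hc.level_pos hc.lam_ge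
    hc.lam_le hc.rate_pos.le hsum n1 n2 k3 hsm
  have hErr : ErrAt P d d.γhat d.σhat (smallPenaltyConst B α ε θ C₂) ω :=
    ⟨hr.σora_pos, by rw [hσ]; exact f1⟩
  refine ⟨hErr, ?_⟩
  intro C₃ ε₂ ε₃ hθ2 h23 h3ε hs₂₃ hsize hS hC₃
  obtain ⟨g1, g2⟩ := hc.size_le hsize h23 (by linarith)
  obtain ⟨m1, m2⟩ := H.card_supp_of_sum_excess_le hB0 (by linarith) hC₂ (hs₂.trans hs₂₃)
    (m := P.s₂) (by linarith [(Nat.cast_nonneg _ : (0 : ℝ) ≤ P.K.card)]) hθ hθ2 h23 h3ε hc.level_pos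
    hc.rate_pos hc.lam_ge hc.lam_le hsum hw hC₃ hS f1 f2 f3 g1 g2
  rw [hr.supp_eq] at m1 m2
  refine ⟨m1, k2, fun hadd => hr.errAt_lse hc hε hB0 k2 hC₂ ?_ hErr hsm m1 m2 hadd⟩
  unfold smallPenaltySizeConst
  have : 0 < ε₃ - ε₂ := by linarith
  positivity

/-- The scaled lasso for the larger penalty level. -/
lemma errAt_large_penalty {C₂ P₀ : ℝ} (hB0 : 0 ≤ B) (hε : 0 < ε) (hC₂ : 0 ≤ C₂) (hP₀ : 0 ≤ P₀)
    (hs : P.s₁ ≤ P.s) (hc₀ : largePenaltyConst B ε C₂ P₀ * P.c₀ ≤ 1 / 2) (h1 : Cond₁ P d ω)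
    (h2 : Cond₂ P (1 + 2 / ε) C₂ d ω)
    (hnoise : LargePenaltyNoise (colE (d.X ω)) (d.resE ω)
      ((d.σora ω)⁻¹ • (d.γhat ω - d.γtar ω)) P.K ε P.level P₀) :
    ErrAt P d d.γhat d.σhat (largePenaltyConst B ε C₂ P₀) ω ∧
    ∀ {C₃ ε₂ ε₃ : ℝ}, 0 ≤ ε₂ → ε₂ < ε₃ → ε₃ < ε → 1 ≤ P.s₃ →
      SizeConstraints P (largePenaltyConst B ε C₂ P₀) ε ε₂ ε₃ C₃ → 1 ≤ C₃ →
      ((P.p : ℝ) ≤ P₀ ∨ SparseBound (colE (d.X ω)) P.s₃ C₃ ∧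
        (Finset.univ.filter fun j =>
          P.level < |inner ℝ (colE (d.X ω) j) (d.resE ω)|).card < 16) →
      (supp (d.γhat ω)).card < P.s₃ ∧ 0 ≤ P.s ∧
      (Cond₂Add P C₂ d ω → ErrAt P d d.γlse d.σlse (2 * largePenaltyConst B ε C₂ P₀ +
        5 * (C₂ * largePenaltySizeConst B ε C₂ P₀ C₃ ε₂ ε₃) * (1 + B)) ω) := by
  obtain ⟨H, hσ⟩ := hr.sqrtLasso hc hε
  have hC0 := largePenaltyConst_pos hB0 hε hC₂ hP₀
  obtain ⟨k1, k2, k3⟩ := cond₁_normalised hc h1 hs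
  have hsm := hc.complexity_le hC0.le hc₀
  obtain ⟨f0, f1, f2, f3⟩ := H.errLe_of_largePenaltyNoise hB0 hC₂ hP₀
    (compat_of_phiComp hC₂ (h2 P.K (by simp))) (k1.trans hs) hε hc.level_pos hc.lam_ge hc.lam_le
    hc.rate_pos.le hnoise k3 hsm
  have hErr : ErrAt P d d.γhat d.σhat (largePenaltyConst B ε C₂ P₀) ω :=
    ⟨hr.σora_pos, by rw [hσ]; exact f1⟩
  refine ⟨hErr, ?_⟩
  intro C₃ ε₂ ε₃ hε₂ h23 h3ε hs₃ hsize hC₃ halt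
  obtain ⟨g1, g2⟩ := hc.size_le hsize h23 (by linarith)
  obtain ⟨m1, m2⟩ := H.card_supp_of_largePenaltyNoise hB0 hC₂ hP₀ k2 hε hε₂ h23 h3ε hs₃
    hc.level_pos hc.rate_pos hc.lam_ge hc.lam_le hC₃ hnoise halt f0 f1 f2 f3 g1 g2
  rw [hr.supp_eq] at m1 m2
  refine ⟨m1, k2, fun hadd => hr.errAt_lse hc hε hB0 k2 hC₂ ?_ hErr hsm m1 m2 hadd⟩
  have := largePenaltyL1Const_pos (P₀ := P₀) hB0 hε hC₂
  have := largePenaltyRatio_pos (P₀ := P₀) hB0 hε hC₂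
  unfold largePenaltySizeConst
  positivity

end RegularAt
end pointwise
end ScaledLasso
end

/-! ### Case 1: large penalty level -/

noncomputable section
namespace ScaledLasso

section residuals
variable {P : Params} {B ε : ℝ} {Ω : Type*} {d : Data Ω P.n P.p}

lemma Data.norm_noise {n p : ℕ} {d : Data Ω n p} (ω : Ω) :
    ‖respE (d.Y ω) - lin (colE (d.X ω)) (d.γ ω)‖ = (√(n : ℝ))⁻¹ * ‖d.noise ω‖ := by
  rw [respE_sub_lin, norm_smul, norm_inv, Real.norm_of_nonneg (Real.sqrt_nonneg _)]; rfl

lemma noiseE_eq_resE (htar : ∀ ω, d.γtar ω = d.γ ω) (ω : Ω) : d.noiseE ω = d.resE ω := by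
  rw [Data.noiseE, Data.resE, htar]

lemma SparseBound.of_cond₃ (hc : Common P B ε) {C₃ : ℝ} (hC₃ : 0 ≤ C₃) {ω : Ω}
    (h : Cond₃ P C₃ d ω) : SparseBound (colE (d.X ω)) P.s₃ C₃ :=
  sparseBound_of_kappaStar (by have := hc.two_le_n; omega) hC₃ h

end residuals

section events
variable {P : Params} {B ε : ℝ} {Ω : Type*} [MeasurableSpace Ω] {μ : Measure Ω}
  [IsProbabilityMeasure μ] {d : Data Ω P.n P.p} {σ : ℝ}

lemma IsModel.ae_regularAt (hm : IsModel μ d σ P.lam) (hc : Common P B ε)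
    (htar : ∀ ω, d.γtar ω = d.γ ω) : ∀ᵐ ω ∂μ, RegularAt P d ω := by
  have hn : 0 < P.n := by have := hc.two_le_n; omega
  have hn' := hc.n_pos
  filter_upwards [hm.ae_norm_colE hn, hm.ae_noise_ne_zero hn, hm.lasso, hm.lse] with ω h1 h2 h3 h4
  refine ⟨?_, h1, h3, h4⟩
  have : 0 < ‖d.noise ω‖ := norm_pos_iff.2 h2
  rw [d.σora_eq, htar, Data.norm_noise]
  positivity

/-- As `e₁ < 1` the eigenvalue condition holds at some outcome with unit columns, and a single such
column gives `C₃ ≥ 1`. -/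
lemma IsModel.one_le_of_cond₃ (hm : IsModel μ d σ P.lam) (hc : Common P B ε) {C₃ : ℝ}
    (hC₃ : 0 ≤ C₃) (hs₃ : 1 ≤ P.s₃) (h : HoldsWP μ (Cond₃ P C₃ d) P.e₁) : 1 ≤ C₃ := by
  have hn : 0 < P.n := by have := hc.two_le_n; omega
  obtain ⟨ω, h1, h2⟩ := ((holdsWP_of_ae (hm.ae_norm_colE hn) 0).and h le_rfl hc.e₁_pos.le).exists
    (by linarith [hc.e₁_lt])
  exact (SparseBound.of_cond₃ hc hC₃ h2).one_le hs₃ h1 (by have := hc.two_le_p; omega)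

/-- The threshold for the normal quantile. -/
def quantThreshold (ε : ℝ) : ℝ := 15 + 3 / (ε / (200 * (2 + ε)))

/-- The bound for the dimension when the normal quantile is below the threshold. -/
def dimThreshold (ε : ℝ) : ℝ := (gtail (quantThreshold ε))⁻¹

/-- The number of large noise coordinates is bounded. -/
def FewLarge (P : Params) (d : Data Ω P.n P.p) (ω : Ω) : Prop :=
  (Finset.univ.filter fun j => P.level < |inner ℝ (colE (d.X ω) j) (d.resE ω)|).card < 16

/-- The noise event at `ω` for the larger penalty level. -/
def LargeNoiseAt (P : Params) (d : Data Ω P.n P.p) (ε : ℝ) (ω : Ω) : Prop :=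
  LargePenaltyNoise (colE (d.X ω)) (d.resE ω) ((d.σora ω)⁻¹ • (d.γhat ω - d.γtar ω)) P.K ε
    P.level (dimThreshold ε)

/-- A quantile below the threshold bounds `p`, since `gtail` of the quantile is `k / p ≤ 1 / p`. The
two alternatives have different costs on purpose: `4 e₁` is available and `Cond₁`, `Cond₂` use two
of them. The eigenvalue condition is needed for selection only in the second alternative, where the
noise costs just `e₁`. -/
lemma IsModel.holdsWP_largeNoiseAt (hm : IsModel μ d σ P.lam) (hc : Common P B ε)
    (htar : ∀ ω, d.γtar ω = d.γ ω) (hε : 0 < ε) (hk : P.k ≤ P.e₁) :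
    ((P.p : ℝ) ≤ dimThreshold ε ∧ HoldsWP μ (LargeNoiseAt P d ε) (2 * P.e₁)) ∨
    HoldsWP μ (fun ω => LargeNoiseAt P d ε ω ∧ FewLarge P d ω) P.e₁ := by
  have hp : 0 < P.p := by have := hc.two_le_p; omega
  have hp' := hc.p_pos
  have hreg := holdsWP_of_ae (hm.ae_regularAt hc htar) 0
  have hη : 0 < ε / (200 * (2 + ε)) := by positivity
  have hnorm : ∀ ω, RegularAt P d ω → ‖d.noiseE ω‖ = 1 := fun ω h => by
    rw [noiseE_eq_resE htar, Data.norm_resE h.σora_pos]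
  rcases lt_or_ge P.quant (quantThreshold ε) with ht | ht
  · left
    constructor
    · have h1 := strictAnti_gtail ht
      rw [hc.gtail_quant] at h1
      have h2 : gtail (quantThreshold ε) ≤ (P.p : ℝ)⁻¹ := by
        refine h1.le.trans ?_
        rw [div_eq_mul_inv]
        have := hc.e₁_lt
        exact mul_le_of_le_one_left (by positivity) (by linarith)
      rw [dimThreshold]
      exact (le_inv_comm₀ hp' (gtail_pos _)).2 h2
    · have h1 := hm.holdsWP_large_penalty hc.two_le_n hp hc.quant_pos hc.gtail_quant
      refine (hreg.and h1 le_rfl (by linarith [hc.k_pos])).mono (fun ω h => Or.inl ⟨?_, ?_⟩)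
        (by linarith)
      · have h1 := strictAnti_gtail ht
        rw [hc.gtail_quant] at h1
        have h2 : gtail (quantThreshold ε) ≤ (P.p : ℝ)⁻¹ := by
          refine h1.le.trans ?_
          rw [div_eq_mul_inv]
          have := hc.e₁_lt
          exact mul_le_of_le_one_left (by positivity) (by linarith)
        rw [dimThreshold]
        exact (le_inv_comm₀ hp' (gtail_pos _)).2 h2
      · intro j
        have h2 := hc.abs_inner_noiseE_le h.1.σora_pos (h.2 j)
        rw [hnorm ω h.1, mul_one, ← P.level_eq, noiseE_eq_resE htar] at h2
        exact h2
  · right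
    have ht15 : 15 ≤ P.quant := by
      refine le_trans ?_ ht
      rw [quantThreshold]
      have : 0 < 3 / (ε / (200 * (2 + ε))) := by positivity
      linarith
    have hexp : Real.exp (-(ε / (200 * (2 + ε)) * P.quant ^ 2)) ≤ 1 / 16 := by
      -- The two summands of the threshold give `η t ≥ 3` and `t ≥ 15`, where `η` is the slack.
      have h1 : 45 ≤ ε / (200 * (2 + ε)) * P.quant ^ 2 := by
        have h2 : 3 / (ε / (200 * (2 + ε))) ≤ P.quant := by
          rw [quantThreshold] at ht; linarith
        rw [div_le_iff₀ hη] at h2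
        nlinarith
      rw [Real.exp_neg, one_div]
      have := Real.add_one_le_exp (ε / (200 * (2 + ε)) * P.quant ^ 2)
      gcongr
      linarith
    have h1 := hm.holdsWP_large_penalty_large hc.two_le_n hp hc.k_pos hk ht15 hc.gtail_quant hη.le
      hexp P.K
    refine (hreg.and h1 le_rfl hc.e₁_pos.le).mono (fun ω h => ?_) (by linarith)
    obtain ⟨hr, n1, n2, n3⟩ := h
    have hno := hnorm ω hr
    have hlev : ∀ x, x * P.quant / √((P.n : ℝ) - 3 / 2) = x * P.level := fun x => by
      rw [P.level_eq]; ring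
    refine ⟨Or.inr ⟨fun j => ?_, ?_⟩, ?_⟩
    · have h2 := hc.abs_inner_noiseE_le hr.σora_pos (n1 j)
      rwa [hno, mul_one, hlev, noiseE_eq_resE htar] at h2
    · rcases n3 with n3 | ⟨hK, n3⟩
      · left
        intro j hj
        have h2 := hc.abs_inner_noiseE_le hr.σora_pos (n3 j hj)
        rwa [hno, mul_one, hlev, noiseE_eq_resE htar] at h2
      · right
        refine inner_le_of_int_comb hr.norm_col (Data.norm_resE hr.σora_pos) hc.level_pos
          (by omega) (fun c hcN => ?_) _
        have h2 := hc.inner_noiseE_le hr.σora_pos (n3 c hcN)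
        rw [hno, mul_one, noiseE_eq_resE htar] at h2
        refine h2.trans (le_of_eq ?_)
        rw [P.level_eq]
        ring
    · refine lt_of_le_of_lt (Finset.card_le_card fun j hj => ?_) n2
      rw [Finset.mem_filter] at hj ⊢
      refine ⟨hj.1, hc.lt_abs_inner_noise hr.σora_pos ?_⟩
      rw [hno, mul_one, ← P.level_eq, noiseE_eq_resE htar]
      exact hj.2

end events

section firstCase
variable {P : Params} {B ε C₂ : ℝ} {Ω : Type*} [MeasurableSpace Ω] {μ : Measure Ω}
  [IsProbabilityMeasure μ] {d : Data Ω P.n P.p} {σ : ℝ}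

lemma dimThreshold_nonneg (ε : ℝ) : 0 ≤ dimThreshold ε := inv_nonneg.2 (gtail_nonneg _)

lemma caseI_errorBounds (hm : IsModel μ d σ P.lam) (htar : ∀ ω, d.γtar ω = d.γ ω)
    (hB : 0 < B) (hε : 0 < ε) (hC₂ : 0 < C₂) (hc : Common P B ε) (hI : CaseI P)
    (hc₀ : largePenaltyConst B ε C₂ (dimThreshold ε) * P.c₀ ≤ 1 / 2)
    (h1 : HoldsWP μ (Cond₁ P d) P.e₁) (h2 : HoldsWP μ (Cond₂ P (1 + 2 / ε) C₂ d) P.e₁) :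
    ErrorBounds μ P d d.γhat d.σhat (largePenaltyConst B ε C₂ (dimThreshold ε)) := by
  have hP := dimThreshold_nonneg ε
  have he := hc.e₁_pos
  refine errorBounds_of_errAt hc (largePenaltyConst_pos hB.le hε hC₂.le hP).le hc₀ ?_
  have h3 : HoldsWP μ (LargeNoiseAt P d ε) (2 * P.e₁) := by
    rcases hm.holdsWP_largeNoiseAt hc htar hε hI.k_le with h | h
    · exact h.2
    · exact h.mono (fun ω h => h.1) (by linarith)
  refine ((holdsWP_of_ae (hm.ae_regularAt hc htar) 0).and (h1.and (h2.and h3 he.le (by linarith))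
    he.le (by linarith)) le_rfl (by linarith)).mono (fun ω h => ?_) (by linarith [hI.level])
  exact (h.1.errAt_large_penalty hc hB.le hε hC₂.le hP hI.s_ge hc₀ h.2.1 h.2.2.1 h.2.2.2).1

/-- The constant for the least squares fit after the scaled lasso with the larger penalty level. -/
def largePenaltyLSEConst (B ε C₂ P₀ C₃ ε₂ ε₃ : ℝ) : ℝ :=
  2 * largePenaltyConst B ε C₂ P₀ +
    5 * (C₂ * largePenaltySizeConst B ε C₂ P₀ C₃ ε₂ ε₃) * (1 + B)

lemma largePenaltyLSEConst_pos {P₀ C₃ ε₂ ε₃ : ℝ} (hB : 0 ≤ B) (hε : 0 < ε) (hC₂ : 0 ≤ C₂)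
    (hP₀ : 0 ≤ P₀) (hC₃ : 0 ≤ C₃) (h23 : ε₂ < ε₃) :
    0 < largePenaltyLSEConst B ε C₂ P₀ C₃ ε₂ ε₃ := by
  have := largePenaltyConst_pos hB hε hC₂ hP₀
  have := largePenaltyL1Const_pos (P₀ := P₀) hB hε hC₂
  have := largePenaltyRatio_pos (P₀ := P₀) hB hε hC₂
  have : 0 < ε₃ - ε₂ := by linarith
  unfold largePenaltyLSEConst largePenaltySizeConst
  positivity

lemma caseI_selection {C₃ ε₂ ε₃ : ℝ} (hm : IsModel μ d σ P.lam)
    (htar : ∀ ω, d.γtar ω = d.γ ω) (hB : 0 < B) (hε : 0 < ε) (hC₂ : 0 < C₂) (hC₃ : 0 < C₃)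
    (hε₂ : 0 ≤ ε₂) (h23 : ε₂ < ε₃) (h3ε : ε₃ < ε) (hc : Common P B ε) (hI : CaseI P)
    (hs₃ : 1 ≤ P.s₃) (hc₀ : largePenaltyConst B ε C₂ (dimThreshold ε) * P.c₀ ≤ 1 / 2)
    (hsize : SizeConstraints P (largePenaltyConst B ε C₂ (dimThreshold ε)) ε ε₂ ε₃ C₃)
    (h1 : HoldsWP μ (Cond₁ P d) P.e₁) (h3 : HoldsWP μ (Cond₃ P C₃ d) P.e₁)
    {A : Ω → Prop} (hA : ∀ ω, A ω → Cond₂ P (1 + 2 / ε) C₂ d ω) (h2 : HoldsWP μ A P.e₁) :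
    HoldsWP μ (fun ω => A ω ∧ ((supp (d.γhat ω)).card : ℝ) < P.s₃ + P.s ∧
      (Cond₂Add P C₂ d ω → ErrAt P d d.γlse d.σlse
        (largePenaltyLSEConst B ε C₂ (dimThreshold ε) C₃ ε₂ ε₃) ω))
      ((P.p : ℝ) ^ (1 - P.δ) * P.e₀) := by
  have hP := dimThreshold_nonneg ε
  have he := hc.e₁_pos
  have hC₃1 := hm.one_le_of_cond₃ hc hC₃.le hs₃ h3
  have h4 : HoldsWP μ (fun ω => LargeNoiseAt P d ε ω ∧ ((P.p : ℝ) ≤ dimThreshold ε ∨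
      SparseBound (colE (d.X ω)) P.s₃ C₃ ∧ FewLarge P d ω)) (2 * P.e₁) := by
    rcases hm.holdsWP_largeNoiseAt hc htar hε hI.k_le with h | h
    · exact h.2.mono (fun ω h' => ⟨h', Or.inl h.1⟩) le_rfl
    · exact (h.and h3 he.le he.le).mono
        (fun ω h' => ⟨h'.1.1, Or.inr ⟨SparseBound.of_cond₃ hc hC₃.le h'.2, h'.1.2⟩⟩) (by linarith)
  refine ((holdsWP_of_ae (hm.ae_regularAt hc htar) 0).and (h1.and (h2.and h4 he.le (by linarith))
    he.le (by linarith)) le_rfl (by linarith)).mono (fun ω h => ?_) (by linarith [hI.level])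
  obtain ⟨hr, g1, g2, g3, g4⟩ := h
  obtain ⟨k1, k2, k3⟩ := (hr.errAt_large_penalty hc hB.le hε hC₂.le hP hI.s_ge hc₀ g1 (hA ω g2) g3).2
    hε₂ h23 h3ε hs₃ hsize hC₃1 g4
  refine ⟨g2, ?_, k3⟩
  have : ((supp (d.γhat ω)).card : ℝ) < P.s₃ := by exact_mod_cast k1
  linarith

end firstCase
end ScaledLasso
end

/-! ### Cases 2 and 3: smaller penalty levels -/

noncomputable section
namespace ScaledLasso

section quantiles
variable {P : Params} {B ε : ℝ}

/-- The ratio of the two normal quantiles. -/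
def Params.quantRatio (P : Params) : ℝ := L 1 (P.e₁ / P.p) / P.quant

/-- The part of the lower bound for `ε₁` that does not involve the sparse eigenvalue. -/
def Params.excessRatio (P : Params) : ℝ := 4 * (P.k / P.s₂) / (P.quant ^ 4 + 2 * P.quant ^ 2)

namespace Common
variable (hc : Common P B ε)
include hc

lemma three_le_p (hk : 1 ≤ P.k) : 3 ≤ P.p := by
  have h1 := hc.k_lt
  rw [div_lt_iff₀ hc.p_pos] at h1
  have : (2 : ℝ) < P.p := by linarith
  exact_mod_cast this

lemma one_le_quantRatio (hk : 1 ≤ P.k) : 1 ≤ P.quantRatio := by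
  have hp := hc.p_pos
  rw [Params.quantRatio, one_le_div hc.quant_pos]
  refine L_one_antitone (div_pos hc.e₁_pos hp) ?_ (by linarith [hc.k_lt])
  have := hc.e₁_lt
  gcongr
  linarith

lemma quantRatio_mul_level : P.quantRatio * P.level = L 1 (P.e₁ / P.p) / √((P.n : ℝ) - 3 / 2) := by
  have := hc.quant_pos
  rw [Params.quantRatio, P.level_eq]
  field_simp

lemma quantRatio_mul_level_le : P.quantRatio * P.level ≤ 1 := by
  rw [hc.quantRatio_mul_level, ← L_eq]
  exact hc.lamStar

lemma excessRatio_nonneg : 0 ≤ P.excessRatio := by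
  have := hc.quant_pos
  have := hc.k_pos
  unfold Params.excessRatio
  positivity

/-- The factor `expN` is at least one and enters `eps₁Bound` monotonically; the noise estimates do
without it. -/
lemma excessRatio_add_le {C₃ : ℝ} : P.excessRatio +
    (L 1 (P.e₁ / P.p) + (√(2 * Real.pi))⁻¹) / P.quant * √(C₃ / P.s₂) ≤ eps₁Bound P C₃ := by
  have ht := hc.quant_pos
  have hk := hc.k_pos
  have hN := one_le_expN P.n
  have hpi : 0 < √(2 * Real.pi) := Real.sqrt_pos.2 (by positivity)
  have e1 : eps₁Bound P C₃ = expN P.n * P.excessRatio +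
      (L 1 (P.e₁ / P.p) + expN P.n * (√(2 * Real.pi))⁻¹) / P.quant * √(C₃ / P.s₂) := by
    unfold eps₁Bound Params.excessRatio Params.quant
    ring
  rw [e1]
  have h1 := hc.excessRatio_nonneg
  gcongr
  · exact le_mul_of_one_le_left h1 hN
  · exact le_mul_of_one_le_left (by positivity) hN

lemma excessRatio_le {C₃ : ℝ} (hk : 1 ≤ P.k) : P.excessRatio ≤ eps₁Bound P C₃ := by
  refine le_trans ?_ hc.excessRatio_add_le
  have ht := hc.quant_pos
  have h1 := hc.one_le_quantRatio hk
  rw [Params.quantRatio, one_le_div ht] at h1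
  have : 0 < L 1 (P.e₁ / P.p) := by linarith
  have : 0 ≤ (L 1 (P.e₁ / P.p) + (√(2 * Real.pi))⁻¹) / P.quant * √(C₃ / P.s₂) := by positivity
  linarith

end Common
end quantiles

section bias
variable {P : Params} {Ω : Type*} {d : Data Ω P.n P.p}

lemma norm_resE_sub_noiseE {ω : Ω} (hσ : 0 < d.σora ω) : ‖d.resE ω - d.noiseE ω‖ =
    (d.σora ω)⁻¹ * (l2 ((d.X ω).mulVec (d.γtar ω - d.γ ω)) / √(P.n : ℝ)) := by
  rw [Data.resE, Data.noiseE, ← smul_sub, sub_sub_sub_cancel_left, ← lin_sub, norm_smul, norm_inv,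
    Real.norm_of_nonneg hσ.le, norm_lin_colE, ← neg_sub, Matrix.mulVec_neg, l2, WithLp.toLp_neg,
    norm_neg, l2]

end bias

section events
variable {P : Params} {B ε : ℝ} {Ω : Type*} [MeasurableSpace Ω] {μ : Measure Ω}
  [IsProbabilityMeasure μ] {d : Data Ω P.n P.p} {σ : ℝ}

lemma IsModel.holdsWP_smallNoise (hm : IsModel μ d σ P.lam) (hc : Common P B ε) {C₃ ε₁ : ℝ}
    (hC₃ : 0 < C₃) (hk : 1 ≤ P.k) (hs₂ : 1 ≤ P.s₂) (he : P.e₁ < 1 / 6)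
    (hε₁ : eps₁Bound P C₃ ≤ ε₁) :
    HoldsWP μ (fun ω => SparseBound (colE (d.X ω)) P.s₂ C₃ → 0 < d.σora ω →
      (∀ j, |inner ℝ (colE (d.X ω) j) (d.noiseE ω)| ≤
        6 / 5 * (P.quantRatio * P.level) * ‖d.noiseE ω‖) ∧
      ∑ j, excess ((1 + ε₁) * P.level * ‖d.noiseE ω‖) (inner ℝ (colE (d.X ω) j) (d.noiseE ω)) ≤
        (13 / 5 + 2 * P.excessRatio + ε₁ / 4) * P.s₂ * P.level * ‖d.noiseE ω‖) (3 * P.e₁) := by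
  have hp := hc.p_pos
  have hp3 := hc.three_le_p hk
  have hep : P.e₁ / P.p < 1 := by
    rw [div_lt_one hp]
    have : (3 : ℝ) ≤ P.p := by exact_mod_cast hp3
    linarith
  refine (hm.holdsWP_small_penalty hc.two_le_n hp3 hs₂ hC₃ hc.e₁_pos he hc.quant_pos
    hc.gtail_quant (gtail_L_one (div_pos hc.e₁_pos hp) hep) rfl
    (hc.excessRatio_add_le.trans hε₁)).mono (fun ω h hS hσ => ?_) le_rfl
  obtain ⟨h1, h2⟩ := h hS
  constructor
  · intro j
    have := hc.abs_inner_noiseE_le hσ (h1 j)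
    rwa [mul_div_assoc, ← hc.quantRatio_mul_level] at this
  · have := hc.sum_excess_noiseE_le hσ h2
    rwa [mul_div_assoc, ← P.level_eq, mul_div_assoc, ← P.level_eq] at this

end events

section smallPenalty
variable {P : Params} {B ε θ α C₂ : ℝ} {Ω : Type*} {d : Data Ω P.n P.p}

/-- The event at `ω` on which the bounds for the smaller penalty levels hold. -/
def SmallPenaltyAt (P : Params) (d : Data Ω P.n P.p) (α ε θ C₃ : ℝ) (ω : Ω) : Prop :=
  RegularAt P d ω ∧ Cond₁ P d ω ∧ SparseBound (colE (d.X ω)) P.s₃ C₃ ∧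
    SmallPenaltyNoise (colE (d.X ω)) (d.resE ω) α ε θ P.level P.lam P.s₂

/-- The constant for the least squares fit after the scaled lasso with a smaller penalty level. -/
def smallPenaltyLSEConst (B α ε θ C₂ C₃ ε₂ ε₃ : ℝ) : ℝ :=
  2 * smallPenaltyConst B α ε θ C₂ +
    5 * (C₂ * smallPenaltySizeConst B α ε θ C₂ C₃ ε₂ ε₃) * (1 + B)

lemma smallPenaltyLSEConst_pos {C₃ ε₂ ε₃ : ℝ} (hB : 0 ≤ B) (hα : 1 ≤ α) (hθ : 0 ≤ θ) (hθε : θ < ε)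
    (hC₂ : 0 ≤ C₂) (hC₃ : 0 ≤ C₃) (h23 : ε₂ < ε₃) :
    0 < smallPenaltyLSEConst B α ε θ C₂ C₃ ε₂ ε₃ := by
  have h1 := smallPenaltyConst_pos hB (by linarith : 0 ≤ α) (by linarith) hθε hC₂
  have h2 := smallPenaltyL1Const_nonneg hB (by linarith : 0 ≤ α) (by linarith) hθε hC₂
  have : 0 < ε₃ - ε₂ := by linarith
  have : 0 < ε := by linarith
  unfold smallPenaltyLSEConst smallPenaltySizeConst
  positivity

lemma errorBounds_of_smallPenaltyAt [MeasurableSpace Ω] {μ : Measure Ω} {C₃ : ℝ} (hc : Common P B ε) (hB : 0 ≤ B) (hα : 1 ≤ α)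
    (hC₂ : 0 ≤ C₂) (hs : P.s₁ + P.s₂ ≤ P.s) (hs₂ : 1 ≤ P.s₂) (hθ : 0 ≤ θ) (hθε : θ < ε)
    (hc₀ : smallPenaltyConst B α ε θ C₂ * P.c₀ ≤ 1 / 2)
    (h : HoldsWP μ (fun ω => SmallPenaltyAt P d α ε θ C₃ ω ∧ Cond₂ P α C₂ d ω)
      ((P.p : ℝ) ^ (1 - P.δ) * P.e₀)) :
    ErrorBounds μ P d d.γhat d.σhat (smallPenaltyConst B α ε θ C₂) := by
  have hC0 := smallPenaltyConst_pos hB (by linarith : 0 ≤ α) (by linarith) hθε hC₂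
  refine errorBounds_of_errAt hc hC0.le hc₀ (h.mono (fun ω hω => ?_) le_rfl)
  obtain ⟨⟨g1, g2, -, g4⟩, g5⟩ := hω
  exact (g1.errAt_small_penalty hc hB hα hC₂ hs hs₂ hθ hθε hc₀ g2 g5 g4).1

lemma selection_of_smallPenaltyAt {C₃ ε₂ ε₃ : ℝ} (hc : Common P B ε) (hB : 0 ≤ B) (hα : 1 ≤ α)
    (hC₂ : 0 ≤ C₂) (hs : P.s₁ + P.s₂ ≤ P.s) (hs₂ : 1 ≤ P.s₂) (hs₃ : P.s₂ ≤ P.s₃) (hθ : 0 ≤ θ)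
    (hθ₂ : θ ≤ ε₂) (h23 : ε₂ < ε₃) (h3ε : ε₃ < ε) (hC₃ : 1 ≤ C₃)
    (hc₀ : smallPenaltyConst B α ε θ C₂ * P.c₀ ≤ 1 / 2)
    (hsize : SizeConstraints P (smallPenaltyConst B α ε θ C₂) ε ε₂ ε₃ C₃) {ω : Ω}
    (h : SmallPenaltyAt P d α ε θ C₃ ω) (h2 : Cond₂ P α C₂ d ω) :
    ((supp (d.γhat ω)).card : ℝ) < P.s₃ + P.s ∧
      (Cond₂Add P C₂ d ω →
        ErrAt P d d.γlse d.σlse (smallPenaltyLSEConst B α ε θ C₂ C₃ ε₂ ε₃) ω) := by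
  obtain ⟨g1, g2, g3, g4⟩ := h
  obtain ⟨k1, k2, k3⟩ := (g1.errAt_small_penalty hc hB hα hC₂ hs hs₂ hθ (by linarith) hc₀ g2 h2
    g4).2 hθ₂ h23 h3ε hs₃ hsize g3 hC₃
  refine ⟨?_, k3⟩
  have : ((supp (d.γhat ω)).card : ℝ) < P.s₃ := by exact_mod_cast k1
  linarith

lemma dimBound_and_errorBounds_of_smallPenaltyAt [MeasurableSpace Ω] {μ : Measure Ω}
    {C₃ ε₂ ε₃ : ℝ} (hc : Common P B ε) (hB : 0 ≤ B) (hα : 1 ≤ α) (hC₂ : 0 ≤ C₂) (hs : P.s₁ + P.s₂ ≤ P.s) (hs₂ : 1 ≤ P.s₂) (hs₃ : P.s₂ ≤ P.s₃)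
    (hθ : 0 ≤ θ) (hθ₂ : θ ≤ ε₂) (h23 : ε₂ < ε₃) (h3ε : ε₃ < ε) (hC₃ : 1 ≤ C₃)
    (hc₀ : smallPenaltyConst B α ε θ C₂ * P.c₀ ≤ 1 / 2)
    (hsize : SizeConstraints P (smallPenaltyConst B α ε θ C₂) ε ε₂ ε₃ C₃)
    (h2 : HoldsWP μ (Cond₂ P α C₂ d) P.e₁)
    (h : ∀ {A : Ω → Prop}, HoldsWP μ A P.e₁ →
      HoldsWP μ (fun ω => SmallPenaltyAt P d α ε θ C₃ ω ∧ A ω) ((P.p : ℝ) ^ (1 - P.δ) * P.e₀)) :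
    DimBound μ P d ∧
      (HoldsWP μ (fun ω => Cond₂ P α C₂ d ω ∧ Cond₂Add P C₂ d ω) P.e₁ →
        smallPenaltyLSEConst B α ε θ C₂ C₃ ε₂ ε₃ * P.c₀ ≤ 1 / 2 →
        ErrorBounds μ P d d.γlse d.σlse (smallPenaltyLSEConst B α ε θ C₂ C₃ ε₂ ε₃)) := by
  constructor
  · exact (h h2).mono (fun ω hω => (selection_of_smallPenaltyAt hc hB hα hC₂ hs hs₂ hs₃ hθ hθ₂ h23
      h3ε hC₃ hc₀ hsize hω.1 hω.2).1) le_rfl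
  · intro h2' hc₀'
    refine errorBounds_of_errAt hc (smallPenaltyLSEConst_pos hB hα hθ (by linarith) hC₂
      (by linarith) h23).le hc₀' ((h h2').mono (fun ω hω => ?_) le_rfl)
    exact (selection_of_smallPenaltyAt hc hB hα hC₂ hs hs₂ hs₃ hθ hθ₂ h23
      h3ε hC₃ hc₀ hsize hω.1 hω.2.1).2 hω.2.2

end smallPenalty

section secondCase
variable {P : Params} {B ε ε₁ α C₃ : ℝ} {Ω : Type*} [MeasurableSpace Ω] {μ : Measure Ω}
  [IsProbabilityMeasure μ] {d : Data Ω P.n P.p} {σ : ℝ}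

lemma CaseII.nonneg (h : CaseII P α ε ε₁ C₃) (hc : Common P B ε) : 0 ≤ ε₁ :=
  hc.excessRatio_nonneg.trans ((hc.excessRatio_le h.one_le_k).trans h.ε₁_ge)

lemma CaseII.one_le_α (h : CaseII P α ε ε₁ C₃) (hc : Common P B ε) : 1 ≤ α :=
  one_le_of_factor_le (h.nonneg hc) h.ε₁_lt (Real.one_le_sqrt.2 (by norm_num))
    (zero_le_one.trans (hc.one_le_quantRatio h.one_le_k)) h.α_ge

/-- Three conditions and the noise at `3 e₁` make `6 e₁`, within `(5 + expN) e₁`. The event `A` is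
kept general so that both the plain and the strengthened compatibility condition can be inserted. -/
lemma CaseII.holdsWP (h : CaseII P α ε ε₁ C₃) (hm : IsModel μ d σ P.lam)
    (htar : ∀ ω, d.γtar ω = d.γ ω) (hC₃ : 0 < C₃) (hc : Common P B ε)
    (h1 : HoldsWP μ (Cond₁ P d) P.e₁) (h3 : HoldsWP μ (Cond₃ P C₃ d) P.e₁) {A : Ω → Prop}
    (hA : HoldsWP μ A P.e₁) :
    HoldsWP μ (fun ω => SmallPenaltyAt P d α ε ε₁ C₃ ω ∧ A ω) ((P.p : ℝ) ^ (1 - P.δ) * P.e₀) := by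
  -- If the allowed probability reaches one there is nothing to prove; otherwise `6 e₁ < 1`, as the
  -- noise bound requires.
  rcases le_or_gt 1 ((P.p : ℝ) ^ (1 - P.δ) * P.e₀) with hη | hη
  · exact holdsWP_of_one_le _ hη
  have he := hc.e₁_pos
  have hbud : 6 * P.e₁ ≤ (P.p : ℝ) ^ (1 - P.δ) * P.e₀ := by
    refine le_trans ?_ h.level
    have := one_le_expN P.n
    gcongr
    linarith
  have hnoise := hm.holdsWP_smallNoise hc hC₃ h.one_le_k h.one_le_s₂ (by linarith) h.ε₁_ge
  refine ((holdsWP_of_ae (hm.ae_regularAt hc htar) 0).and (h1.and (h3.and (hA.and hnoise he.le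
    (by linarith)) he.le (by linarith)) he.le (by linarith)) le_rfl (by linarith)).mono
    (fun ω hω => ?_) (by linarith)
  obtain ⟨hr, g1, g3, g4, g5⟩ := hω
  have hS := SparseBound.of_cond₃ hc hC₃.le g3
  obtain ⟨n1, n2⟩ := g5 (hS.mono h.s₂_le) hr.σora_pos
  simp only [noiseE_eq_resE htar, Data.norm_resE hr.σora_pos, mul_one] at n1 n2
  exact ⟨⟨hr, g1, hS, smallPenaltyNoise_of_unbiased hc.level_pos.le
    ((hc.excessRatio_le h.one_le_k).trans h.ε₁_ge) (h.nonneg hc) h.ε₁_lt hc.lam_ge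
    (hc.one_le_quantRatio h.one_le_k) h.α_ge n1 n2⟩, g4⟩

end secondCase

section thirdCase
variable {P : Params} {B ε ε₁ ε₂ α C₃ C₄ : ℝ} {Ω : Type*} {d : Data Ω P.n P.p}

lemma CaseIII.nonneg (h : CaseIII P α ε ε₁ ε₂ C₃ C₄) (hc : Common P B ε) : 0 ≤ ε₂ :=
  (hc.excessRatio_nonneg.trans ((hc.excessRatio_le h.one_le_k).trans h.ε₁_ge)).trans h.ε₁_lt.le

lemma CaseIII.one_le_α (h : CaseIII P α ε ε₁ ε₂ C₃ C₄) (hc : Common P B ε) : 1 ≤ α :=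
  one_le_of_factor_le (h.nonneg hc) h.ε₂_lt one_le_two
    (zero_le_one.trans (hc.one_le_quantRatio h.one_le_k)) h.α_ge

lemma CaseIII.bias_pos (h : CaseIII P α ε ε₁ ε₂ C₃ C₄) : 0 < min (√2 - 1) (ε₂ - ε₁) := by
  refine lt_min ?_ (sub_pos.2 h.ε₁_lt)
  have : 1 < √2 := Real.lt_sqrt_of_sq_lt (by norm_num)
  linarith

lemma CaseIII.C₄_pos (h : CaseIII P α ε ε₁ ε₂ C₃ C₄) (hc : Common P B ε) : 0 < C₄ ∧
    2 * √(Real.log (P.p / P.e₁)) ≤ C₄ * min (√2 - 1) (ε₂ - ε₁) * P.quant := by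
  have ht := hc.quant_pos
  have hlog : 0 < Real.log (P.p / P.e₁) := by
    refine Real.log_pos ((one_lt_div hc.e₁_pos).2 (hc.e₁_lt.trans_le ?_))
    exact_mod_cast (by have := hc.two_le_p; omega : 1 ≤ P.p)
  have e : √(4 / L 1 (P.k / P.p) ^ 2 * Real.log (P.p / P.e₁)) =
      2 * √(Real.log (P.p / P.e₁)) / P.quant := by
    rw [Real.sqrt_mul (by positivity), show 4 / L 1 (P.k / P.p) ^ 2 = (2 / P.quant) ^ 2 by
      rw [Params.quant]; ring, Real.sqrt_sq (by positivity)]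
    ring
  have h1 := h.C₄_ge
  rw [e] at h1
  have hb := h.bias_pos
  refine ⟨lt_of_lt_of_le ?_ h1, ?_⟩
  · positivity
  · rwa [div_div, div_le_iff₀ (by positivity), mul_comm P.quant, ← mul_assoc] at h1

/-- If `σora` vanished, `Cond₄` with `C₄ > 0` would force a zero bias; the residual at the target
would then be the noise, which is nonzero. -/
lemma CaseIII.σora_pos (h : CaseIII P α ε ε₁ ε₂ C₃ C₄) (hc : Common P B ε) {ω : Ω}
    (hn : d.noise ω ≠ 0) (h4 : Cond₄ P C₄ d ω) : 0 < d.σora ω := by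
  have hσ : 0 ≤ d.σora ω := by rw [d.σora_eq]; exact norm_nonneg _
  refine hσ.lt_of_ne fun h0 => ?_
  unfold Cond₄ at h4
  rw [← h0, zero_mul] at h4
  have hl : l2 ((d.X ω).mulVec (d.γtar ω - d.γ ω)) = 0 := by
    refine le_antisymm ?_ (norm_nonneg _)
    exact nonpos_of_mul_nonpos_right h4 (h.C₄_pos hc).1
  have h2 : ‖lin (colE (d.X ω)) (d.γtar ω - d.γ ω)‖ = 0 := by rw [norm_lin_colE, hl, zero_div]
  rw [norm_eq_zero, lin_sub, sub_eq_zero] at h2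
  rw [d.σora_eq, h2, Data.norm_noise] at h0
  have := hc.n_pos
  have h3 : 0 < ‖d.noise ω‖ := norm_pos_iff.2 hn
  have : 0 < (√(P.n : ℝ))⁻¹ * ‖d.noise ω‖ := by positivity
  linarith

/-- The lower bound for `C₄` is designed for this: it turns `√(log (p / e₁))` in `Cond₄` into a
multiple of the normal quantile, and `1 / √n ≤ 1 / √(n - 3/2)` turns the quantile into the penalty
level. -/
lemma CaseIII.norm_resE_sub_noiseE_le (h : CaseIII P α ε ε₁ ε₂ C₃ C₄) (hc : Common P B ε) {ω : Ω}
    (hσ : 0 < d.σora ω) (h4 : Cond₄ P C₄ d ω) :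
    ‖d.resE ω - d.noiseE ω‖ ≤ min (√2 - 1) (ε₂ - ε₁) * P.level / 2 := by
  obtain ⟨hC₄, h5⟩ := h.C₄_pos hc
  have hb := h.bias_pos
  have ht := hc.quant_pos
  have hs := hc.sqrt_pos
  have h6 : l2 ((d.X ω).mulVec (d.γtar ω - d.γ ω)) ≤
      d.σora ω * (min (√2 - 1) (ε₂ - ε₁) * P.quant / 2) := by
    refine le_of_mul_le_mul_left ?_ hC₄
    have h7 := mul_le_mul_of_nonneg_left h5 hσ.le
    unfold Cond₄ at h4
    linarith
  rw [norm_resE_sub_noiseE hσ]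
  calc _ ≤ (d.σora ω)⁻¹ * (d.σora ω * (min (√2 - 1) (ε₂ - ε₁) * P.quant / 2) /
        √((P.n : ℝ) - 3 / 2)) := by
        gcongr
        linarith
    _ = _ := by
        rw [P.level_eq]
        generalize √((P.n : ℝ) - 3 / 2) = q at hs ⊢
        field_simp

lemma CaseIII.holdsWP [MeasurableSpace Ω] {μ : Measure Ω} [IsProbabilityMeasure μ] {σ : ℝ}
    (h : CaseIII P α ε ε₁ ε₂ C₃ C₄) (hm : IsModel μ d σ P.lam) (hC₃ : 0 < C₃)
    (hc : Common P B ε) (h1 : HoldsWP μ (Cond₁ P d) P.e₁) (h3 : HoldsWP μ (Cond₃ P C₃ d) P.e₁)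
    (h4 : HoldsWP μ (Cond₄ P C₄ d) P.e₁) {A : Ω → Prop} (hA : HoldsWP μ A P.e₁) :
    HoldsWP μ (fun ω => SmallPenaltyAt P d α ε ε₂ C₃ ω ∧ A ω) ((P.p : ℝ) ^ (1 - P.δ) * P.e₀) := by
  rcases le_or_gt 1 ((P.p : ℝ) ^ (1 - P.δ) * P.e₀) with hη | hη
  · exact holdsWP_of_one_le _ hη
  have he := hc.e₁_pos
  have hn : 0 < P.n := by have := hc.two_le_n; omega
  have hbud : 7 * P.e₁ ≤ (P.p : ℝ) ^ (1 - P.δ) * P.e₀ := by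
    refine le_trans ?_ h.level
    have := one_le_expN P.n
    gcongr
    linarith
  have hnoise := hm.holdsWP_smallNoise hc hC₃ h.one_le_k h.one_le_s₂ (by linarith) h.ε₁_ge
  have hae : ∀ᵐ ω ∂μ, Cond₄ P C₄ d ω → RegularAt P d ω := by
    filter_upwards [hm.ae_norm_colE hn, hm.ae_noise_ne_zero hn, hm.lasso, hm.lse]
      with ω k1 k2 k3 k4 k5
    exact ⟨h.σora_pos hc k2 k5, k1, k3, k4⟩
  refine ((holdsWP_of_ae hae 0).and (h1.and (h3.and (h4.and (hA.and hnoise he.le (by linarith))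
    he.le (by linarith)) he.le (by linarith)) he.le (by linarith)) le_rfl (by linarith)).mono
    (fun ω hω => ?_) (by linarith)
  obtain ⟨hr', g1, g3, g4, g5, g6⟩ := hω
  have hr := hr' g4
  have hS := SparseBound.of_cond₃ hc hC₃.le g3
  obtain ⟨n1, n2⟩ := g6 (hS.mono h.s₂_le) hr.σora_pos
  exact ⟨⟨hr, g1, hS, smallPenaltyNoise_of_biased hr.norm_col (Data.norm_resE hr.σora_pos)
    hc.level_pos.le hc.excessRatio_nonneg ((hc.excessRatio_le h.one_le_k).trans h.ε₁_ge) h.ε₂_lt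
    hc.lam_ge (hc.one_le_quantRatio h.one_le_k) hc.quantRatio_mul_level_le h.α_ge h.bias_pos.le
    (min_le_left _ _) (min_le_right _ _) (h.norm_resE_sub_noiseE_le hc hr.σora_pos g4) n1 n2⟩, g5⟩

end thirdCase
end ScaledLasso
end

/-! ### Assembly of the three cases -/

open ScaledLasso in
theorem theorem11 :
    -- (i) the deterministic comparison of the two estimators
    (∀ (n p : ℕ), 0 < n → ∀ (X : Matrix (Fin n) (Fin p) ℝ) (Y : Fin n → ℝ) (lam : ℝ), 0 < lam →
      ∀ (γhat γlse : Fin p → ℝ) (σhat σlse : ℝ),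
        IsScaledLasso X Y lam γhat σhat → 0 < σhat → IsLSE X Y (supp γhat) γlse σlse →
        σhat ^ 2 - σlse ^ 2 = l2 (X.mulVec (γlse - γhat)) ^ 2 / n ∧
        ENNReal.ofReal (l2 (X.mulVec (γlse - γhat)) ^ 2 / n) ≤
          ENNReal.ofReal ((σhat * lam) ^ 2 * (supp γhat).card) / phiComp 0 (supp γhat) X ^ 2 ∧
        ENNReal.ofReal (l1 (γlse - γhat)) ≤
          ENNReal.ofReal (σhat * lam * (supp γhat).card) / phiComp 0 (supp γhat) X ^ 2) ∧
    -- (ii), first case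
    (∀ B ε C₂ : ℝ, 0 < B → 0 < ε → 0 < C₂ → ∃ C₀ : ℝ, 0 < C₀ ∧
      (∀ (P : Params) (Ω : Type u) [MeasurableSpace Ω] (μ : Measure Ω) [IsProbabilityMeasure μ]
        (d : Data Ω P.n P.p) (σ : ℝ),
        IsModel μ d σ P.lam → (∀ ω, d.γtar ω = d.γ ω) →
        Common P B ε → CaseI P → C₀ * P.c₀ ≤ 1 / 2 →
        HoldsWP μ (Cond₁ P d) P.e₁ → HoldsWP μ (Cond₂ P (1 + 2 / ε) C₂ d) P.e₁ →
        ErrorBounds μ P d d.γhat d.σhat C₀) ∧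
      (∀ C₃ ε₂ ε₃ : ℝ, 0 < C₃ → 0 ≤ ε₂ → ε₂ < ε₃ → ε₃ < ε → ∃ C₀' : ℝ, 0 < C₀' ∧
        ∀ (P : Params) (Ω : Type u) [MeasurableSpace Ω] (μ : Measure Ω) [IsProbabilityMeasure μ]
          (d : Data Ω P.n P.p) (σ : ℝ),
          IsModel μ d σ P.lam → (∀ ω, d.γtar ω = d.γ ω) →
          Common P B ε → CaseI P → 1 ≤ P.s₃ → C₀ * P.c₀ ≤ 1 / 2 →
          SizeConstraints P C₀ ε ε₂ ε₃ C₃ →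
          HoldsWP μ (Cond₁ P d) P.e₁ → HoldsWP μ (Cond₂ P (1 + 2 / ε) C₂ d) P.e₁ →
          HoldsWP μ (Cond₃ P C₃ d) P.e₁ →
          DimBound μ P d ∧
          (HoldsWP μ (fun ω => Cond₂ P (1 + 2 / ε) C₂ d ω ∧ Cond₂Add P C₂ d ω) P.e₁ →
            C₀' * P.c₀ ≤ 1 / 2 → ErrorBounds μ P d d.γlse d.σlse C₀'))) ∧
    -- (ii), second case
    (∀ B α ε ε₁ C₂ : ℝ, 0 < B → 0 < ε → 0 < C₂ → ∃ C₀ : ℝ, 0 < C₀ ∧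
      (∀ (C₃ : ℝ) (P : Params) (Ω : Type u) [MeasurableSpace Ω] (μ : Measure Ω)
        [IsProbabilityMeasure μ] (d : Data Ω P.n P.p) (σ : ℝ),
        0 < C₃ → IsModel μ d σ P.lam → (∀ ω, d.γtar ω = d.γ ω) →
        Common P B ε → CaseII P α ε ε₁ C₃ → C₀ * P.c₀ ≤ 1 / 2 →
        HoldsWP μ (Cond₁ P d) P.e₁ → HoldsWP μ (Cond₂ P α C₂ d) P.e₁ →
        HoldsWP μ (Cond₃ P C₃ d) P.e₁ →
        ErrorBounds μ P d d.γhat d.σhat C₀) ∧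
      (∀ C₃ ε₂ ε₃ : ℝ, 0 < C₃ → ε₁ < ε₂ → ε₂ < ε₃ → ε₃ < ε → ∃ C₀' : ℝ, 0 < C₀' ∧
        ∀ (P : Params) (Ω : Type u) [MeasurableSpace Ω] (μ : Measure Ω) [IsProbabilityMeasure μ]
          (d : Data Ω P.n P.p) (σ : ℝ),
          IsModel μ d σ P.lam → (∀ ω, d.γtar ω = d.γ ω) →
          Common P B ε → CaseII P α ε ε₁ C₃ → C₀ * P.c₀ ≤ 1 / 2 →
          SizeConstraints P C₀ ε ε₂ ε₃ C₃ →
          HoldsWP μ (Cond₁ P d) P.e₁ → HoldsWP μ (Cond₂ P α C₂ d) P.e₁ →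
          HoldsWP μ (Cond₃ P C₃ d) P.e₁ →
          DimBound μ P d ∧
          (HoldsWP μ (fun ω => Cond₂ P α C₂ d ω ∧ Cond₂Add P C₂ d ω) P.e₁ →
            C₀' * P.c₀ ≤ 1 / 2 → ErrorBounds μ P d d.γlse d.σlse C₀'))) ∧
    -- (ii), third case
    (∀ B α ε ε₂ C₂ : ℝ, 0 < B → 0 < ε → 0 < C₂ → ∃ C₀ : ℝ, 0 < C₀ ∧
      (∀ (ε₁ C₃ C₄ : ℝ) (P : Params) (Ω : Type u) [MeasurableSpace Ω] (μ : Measure Ω)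
        [IsProbabilityMeasure μ] (d : Data Ω P.n P.p) (σ : ℝ),
        0 < C₃ → IsModel μ d σ P.lam →
        Common P B ε → CaseIII P α ε ε₁ ε₂ C₃ C₄ → C₀ * P.c₀ ≤ 1 / 2 →
        HoldsWP μ (Cond₁ P d) P.e₁ → HoldsWP μ (Cond₂ P α C₂ d) P.e₁ →
        HoldsWP μ (Cond₃ P C₃ d) P.e₁ → HoldsWP μ (Cond₄ P C₄ d) P.e₁ →
        ErrorBounds μ P d d.γhat d.σhat C₀) ∧
      (∀ C₃ ε₃ : ℝ, 0 < C₃ → ε₂ < ε₃ → ε₃ < ε → ∃ C₀' : ℝ, 0 < C₀' ∧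
        ∀ (ε₁ C₄ : ℝ) (P : Params) (Ω : Type u) [MeasurableSpace Ω] (μ : Measure Ω)
          [IsProbabilityMeasure μ] (d : Data Ω P.n P.p) (σ : ℝ),
          IsModel μ d σ P.lam →
          Common P B ε → CaseIII P α ε ε₁ ε₂ C₃ C₄ → C₀ * P.c₀ ≤ 1 / 2 →
          SizeConstraints P C₀ ε ε₂ ε₃ C₃ →
          HoldsWP μ (Cond₁ P d) P.e₁ → HoldsWP μ (Cond₂ P α C₂ d) P.e₁ →
          HoldsWP μ (Cond₃ P C₃ d) P.e₁ → HoldsWP μ (Cond₄ P C₄ d) P.e₁ →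
          DimBound μ P d ∧
          (HoldsWP μ (fun ω => Cond₂ P α C₂ d ω ∧ Cond₂Add P C₂ d ω) P.e₁ →
            C₀' * P.c₀ ≤ 1 / 2 → ErrorBounds μ P d d.γlse d.σlse C₀'))) := by
  refine ⟨fun n p hn X Y lam hlam γhat γlse σhat σlse h hσ hl =>
    lasso_lse_compare hn hlam h hσ hl, ?_, ?_, ?_⟩
  · intro B ε C₂ hB hε hC₂
    have hP := dimThreshold_nonneg ε
    refine ⟨largePenaltyConst B ε C₂ (dimThreshold ε), largePenaltyConst_pos hB.le hε hC₂.le hP,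
      ?_, ?_⟩
    · intro P Ω _ μ _ d σ hm htar hc hI hc₀ h1 h2
      exact caseI_errorBounds hm htar hB hε hC₂ hc hI hc₀ h1 h2
    · intro C₃ ε₂ ε₃ hC₃ hε₂ h23 h3ε
      have hpos := largePenaltyLSEConst_pos hB.le hε hC₂.le hP hC₃.le h23
      refine ⟨largePenaltyLSEConst B ε C₂ (dimThreshold ε) C₃ ε₂ ε₃, hpos, ?_⟩
      intro P Ω _ μ _ d σ hm htar hc hI hs₃ hc₀ hsize h1 h2 h3
      refine ⟨(caseI_selection hm htar hB hε hC₂ hC₃ hε₂ h23 h3ε hc hI hs₃ hc₀ hsize h1 h3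
        (fun ω h => h) h2).mono (fun ω h => h.2.1) le_rfl, fun h2' hc₀' => ?_⟩
      exact errorBounds_of_errAt hc hpos.le hc₀' ((caseI_selection hm htar hB hε hC₂ hC₃ hε₂ h23
        h3ε hc hI hs₃ hc₀ hsize h1 h3 (fun ω h => h.1) h2').mono (fun ω h => h.2.2 h.1.2) le_rfl)
  · intro B α ε ε₁ C₂ hB hε hC₂
    -- The constant must be chosen before the parameters that satisfy the case conditions are given.
    -- These conditions imply the three inequalities, so any constant does when the inequalities
    -- fail.
    by_cases hpar : 1 ≤ α ∧ 0 ≤ ε₁ ∧ ε₁ < ε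
    · obtain ⟨hα, hε₁, hlt⟩ := hpar
      refine ⟨smallPenaltyConst B α ε ε₁ C₂,
        smallPenaltyConst_pos hB.le (zero_le_one.trans hα) hε.le hlt hC₂.le, ?_, ?_⟩
      · intro C₃ P Ω _ μ _ d σ hC₃ hm htar hc hII hc₀ h1 h2 h3
        exact errorBounds_of_smallPenaltyAt hc hB.le hα hC₂.le hII.s_ge hII.one_le_s₂ hε₁ hlt hc₀
          (hII.holdsWP hm htar hC₃ hc h1 h3 h2)
      · intro C₃ ε₂ ε₃ hC₃ h12 h23 h3ε
        refine ⟨smallPenaltyLSEConst B α ε ε₁ C₂ C₃ ε₂ ε₃,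
          smallPenaltyLSEConst_pos hB.le hα hε₁ hlt hC₂.le hC₃.le h23, ?_⟩
        intro P Ω _ μ _ d σ hm htar hc hII hc₀ hsize h1 h2 h3
        exact dimBound_and_errorBounds_of_smallPenaltyAt hc hB.le hα hC₂.le hII.s_ge hII.one_le_s₂
          hII.s₂_le hε₁ h12.le h23 h3ε
          (hm.one_le_of_cond₃ hc hC₃.le (hII.one_le_s₂.trans hII.s₂_le) h3) hc₀ hsize h2
          (fun hA => hII.holdsWP hm htar hC₃ hc h1 h3 hA)
    · refine ⟨1, one_pos, ?_, ?_⟩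
      · intro C₃ P Ω _ μ _ d σ hC₃ hm htar hc hII
        exact absurd ⟨hII.one_le_α hc, hII.nonneg hc, hII.ε₁_lt⟩ hpar
      · intro C₃ ε₂ ε₃ hC₃ h12 h23 h3ε
        refine ⟨1, one_pos, ?_⟩
        intro P Ω _ μ _ d σ hm htar hc hII
        exact absurd ⟨hII.one_le_α hc, hII.nonneg hc, hII.ε₁_lt⟩ hpar
  · intro B α ε ε₂ C₂ hB hε hC₂
    -- Here `ε₂` takes the place of `ε₁` as the level of the total excess, so that the constants
    -- depend neither on `ε₁` nor on `C₄`.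
    by_cases hpar : 1 ≤ α ∧ 0 ≤ ε₂ ∧ ε₂ < ε
    · obtain ⟨hα, hε₂, hlt⟩ := hpar
      refine ⟨smallPenaltyConst B α ε ε₂ C₂,
        smallPenaltyConst_pos hB.le (zero_le_one.trans hα) hε.le hlt hC₂.le, ?_, ?_⟩
      · intro ε₁ C₃ C₄ P Ω _ μ _ d σ hC₃ hm hc hIII hc₀ h1 h2 h3 h4
        exact errorBounds_of_smallPenaltyAt hc hB.le hα hC₂.le hIII.s_ge hIII.one_le_s₂ hε₂ hlt hc₀
          (hIII.holdsWP hm hC₃ hc h1 h3 h4 h2)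
      · intro C₃ ε₃ hC₃ h23 h3ε
        refine ⟨smallPenaltyLSEConst B α ε ε₂ C₂ C₃ ε₂ ε₃,
          smallPenaltyLSEConst_pos hB.le hα hε₂ hlt hC₂.le hC₃.le h23, ?_⟩
        intro ε₁ C₄ P Ω _ μ _ d σ hm hc hIII hc₀ hsize h1 h2 h3 h4
        exact dimBound_and_errorBounds_of_smallPenaltyAt hc hB.le hα hC₂.le hIII.s_ge
          hIII.one_le_s₂ hIII.s₂_le hε₂ le_rfl h23 h3ε
          (hm.one_le_of_cond₃ hc hC₃.le (hIII.one_le_s₂.trans hIII.s₂_le) h3) hc₀ hsize h2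
          (fun hA => hIII.holdsWP hm hC₃ hc h1 h3 h4 hA)
    · refine ⟨1, one_pos, ?_, ?_⟩
      · intro ε₁ C₃ C₄ P Ω _ μ _ d σ hC₃ hm hc hIII
        exact absurd ⟨hIII.one_le_α hc, hIII.nonneg hc, hIII.ε₂_lt⟩ hpar
      · intro C₃ ε₃ hC₃ h23 h3ε
        refine ⟨1, one_pos, ?_⟩
        intro ε₁ C₄ P Ω _ μ _ d σ hm hc hIII
        exact absurd ⟨hIII.one_le_α hc, hIII.nonneg hc, hIII.ε₂_lt⟩ hpar
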